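/- Let $p\ge 2$ be an integer and $q=e^{i\pi/p}$; write $q^x=e^{i\pi x/p}$, $[n]=\frac{q^n-q^{-n}}{q-q^{-1}}$, $[m]!=[1][2]\cdots[m]$. All algebras are over $\mathbb{C}$. Let $B$ be the Hopf algebra generated by $e,k$ with relations $e^p=0$, $k^{4p}=1$, $kek^{-1}=qe$ and $\Delta(e)=1\otimes e+e\otimes k^2$, $\Delta(k)=k\otimes k$, $\epsilon(e)=0$, $\epsilon(k)=1$, $S(e)=-ek^{-2}$, $S(k)=k^{-1}$. Let $D(B)$ be its Drinfeld double: the Hopf algebra on the space $B^*\otimes B$ containing $B$ and $B^*$, where $\langle\beta\gamma,x\rangle=\sum\langle\beta,x'\rangle\langle\gamma,x''\rangle$, $\langle\Delta(\beta),x\otimes y\rangle=\langle\beta,yx\rangle$, $\langle 1,x\rangle=\epsilon(x)$, $\epsilon(\beta)=\langle\beta,1\rangle$, $\langle S(\beta),x\rangle=\langle\beta,S^{-1}(x)\rangle$, with cross relation $x\beta=\sum\beta(S^{-1}(x''')\,?\,x')\,x''$. Let $\kappa,\phi\in B^*$ be the functionals with $$\langle\kappa,e^mk^n\rangle=\delta_{m,0}\,q^{-n/2},\qquad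 \langle\phi,e^mk^n\rangle=\delta_{m,1}\frac{q^{-n}}{q-q^{-1}}\qquad(0\le m<p,\ 0\le n<4p).$$ Let $\bar D$ be the Hopf algebra generated by $e,\phi,k$ with relations $kek^{-1}=qe$, $k\phi k^{-1}=q^{-1}\phi$, $[e,\phi]=\frac{k^2-k^{-2}}{q-q^{-1}}$, $e^p=\phi^p=0$, $k^{4p}=1$ and $\Delta(e)=1\otimes e+e\otimes k^2$, $\Delta(\phi)=k^{-2}\otimes\phi+\phi\otimes 1$, $\Delta(k)=k\otimes k$, $\epsilon(e)=\epsilon(\phi)=0$, $\epsilon(k)=1$, $S(e)=-ek^{-2}$, $S(\phi)=-k^2\phi$, $S(k)=k^{-1}$. Let $\overline{U}_q s\ell(2)$ be the restricted quantum group: the Hopf algebra generated by $E,F,K$ with relations $KEK^{-1}=q^2E$, $KFK^{-1}=q^{-2}F$, $[E,F]=\frac{K-K^{-1}}{q-q^{-1}}$, $E^p=F^p=0$, $K^{2p}=1$ and $\Delta(E)=1\otimes E+E\otimes K$, $\Delta(F)=K^{-1}\otimes F+F\otimes 1$, $\Delta(K)=K\otimes K$, $\epsilon(E)=\epsilon(F)=0$,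 $\epsilon(K)=1$, $S(E)=-EK^{-1}$, $S(F)=-KF$, $S(K)=K^{-1}$. **Theorem.** 1. The element $\kappa k$ is central in $D(B)$, and there is a surjective Hopf algebra homomorphism $D(B)\to\bar D$ with $e\mapsto e$, $k\mapsto k$, $\phi\mapsto\phi$ whose kernel is the two-sided ideal generated by $\kappa k-1$. 2. $\bar D$ is quasitriangular with the universal $R$-matrix $$\bar R=\frac1{4p}\sum_{m=0}^{p-1}\sum_{n,j=0}^{4p-1}\frac{(q-q^{-1})^m}{[m]!}\,q^{m(m-1)/2+m(n-j)-nj/2}\,e^mk^n\otimes\phi^mk^j;$$ that is, $\bar R$ is invertible, $\Delta^{\mathrm{op}}(x)=\bar R\Delta(x)\bar R^{-1}$ for all $x\in\bar D$, $(\Delta\otimes\mathrm{id})(\bar R)=\bar R_{13}\bar R_{23}$, $(\mathrm{id}\otimes\Delta)(\bar R)=\bar R_{13}\bar R_{12}$. 3. $(\bar D,\bar R)$ is a ribbon Hopf algebra with the ribbon element $$v=\frac{1-i}{2\sqrt p}\sum_{m=0}^{p-1}\sum_{j=0}^{2p-1}\frac{(q-q^{-1})^m}{[m]!}\,q^{-\frac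 m2+mj+\frac12(j+p+1)^2}\,\phi^me^mk^{2j};$$ that is, $v$ is invertible and central, $v^2=uS(u)$, $S(v)=v$, $\epsilon(v)=1$, $\Delta(v)=M^{-1}(v\otimes v)$, where $M=\bar R_{21}\bar R_{12}$ and $u$ is the image of $\bar R_{21}$ under $a\otimes b\mapsto S(a)b$. 4. The assignment $E\mapsto e$, $F\mapsto\phi$, $K\mapsto k^2$ defines an injective Hopf algebra homomorphism $\overline{U}_q s\ell(2)\to\bar D$, and $\bar R_{21}\bar R_{12}$ is the image of the element of $\overline{U}_q s\ell(2)\otimes\overline{U}_q s\ell(2)$ $$\bar M=\frac1{2p}\sum_{m,n=0}^{p-1}\sum_{i,j=0}^{2p-1}\frac{(q-q^{-1})^{m+n}}{[m]!\,[n]!}\,q^{m(m-1)/2+n(n-1)/2}\,q^{-m^2-mj+2nj-2ni-ij+mi}\,F^mE^nK^j\otimes E^mF^nK^i.$$ Moreover $\bar M=\sum_I m_I\otimes n_I$ for two bases $(m_I)$ and $(n_I)$ of $\overline{U}_q s\ell(2)$. -/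

import Mathlib

open scoped TensorProduct

noncomputable section

namespace QDouble

/-! ### Auxiliary facts used to build the Hopf algebras below -/

/-- Gaussian binomial coefficients, by the Pascal recursion. -/
def gaussBinom (w : ℂ) : ℕ → ℕ → ℂ
  | _, 0 => 1
  | 0, _ + 1 => 0
  | n + 1, k + 1 => gaussBinom w n k + w ^ (k + 1) * gaussBinom w n (k + 1)

lemma gaussBinom_zero_right (w : ℂ) (n : ℕ) : gaussBinom w n 0 = 1 := by
  cases n <;> rfl

lemma gaussBinom_succ (w : ℂ) (n k : ℕ) :
    gaussBinom w (n + 1) (k + 1) =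
      gaussBinom w n k + w ^ (k + 1) * gaussBinom w n (k + 1) := rfl

lemma gaussBinom_lt (w : ℂ) (n : ℕ) : ∀ k, n < k → gaussBinom w n k = 0 := by
  induction n with
  | zero => intro k hk; cases k with
    | zero => omega
    | succ k => rfl
  | succ n ih => intro k hk; cases k with
    | zero => omega
    | succ k => rw [gaussBinom_succ, ih k (by omega), ih (k + 1) (by omega)]; simp

lemma gaussBinom_self (w : ℂ) (n : ℕ) : gaussBinom w n n = 1 := by
  induction n with
  | zero => rfl
  | succ n ih => rw [gaussBinom_succ, ih, gaussBinom_lt w n (n + 1) (by omega)]; simp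

lemma gaussBinom_absorb (w : ℂ) (n : ℕ) : ∀ k,
    (1 - w ^ (k + 1)) * gaussBinom w (n + 1) (k + 1) =
      (1 - w ^ (n + 1)) * gaussBinom w n k := by
  induction n with
  | zero =>
    intro k
    cases k with
    | zero => simp [gaussBinom]
    | succ k => simp [gaussBinom]
  | succ n ih =>
    intro k
    cases k with
    | zero =>
      have h := ih 0
      rw [gaussBinom_succ w (n + 1) 0]
      simp only [gaussBinom_zero_right] at h ⊢
      linear_combination w * h
    | succ k =>
      have h1 := ih (k + 1)
      have h2 := ih k
      have h3 := gaussBinom_succ w n k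
      rw [gaussBinom_succ w (n + 1) (k + 1)]
      linear_combination w ^ (k + 2) * h1 - w * (1 - w ^ (n + 1)) * h3 + w * h2

section qcomm

variable {R : Type*} [Ring R] [Algebra ℂ R]

lemma qcomm_pow {x y : R} {w : ℂ} (h : y * x = w • (x * y)) (k : ℕ) :
    y * x ^ k = w ^ k • (x ^ k * y) := by
  induction k with
  | zero => simp
  | succ k ih =>
    rw [pow_succ, ← mul_assoc, ih, smul_mul_assoc, mul_assoc, h, mul_smul_comm, smul_smul,
      mul_assoc, pow_succ]

lemma qcomm_pow_left {x y : R} {w : ℂ} (h : y * x = w • (x * y)) (k : ℕ) :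
    y ^ k * x = w ^ k • (x * y ^ k) := by
  induction k with
  | zero => simp
  | succ k ih =>
    rw [pow_succ, mul_assoc, h, mul_smul_comm, ← mul_assoc, ih, smul_mul_assoc, smul_smul,
      mul_assoc, pow_succ, mul_comm]

lemma q_binomial {x y : R} {w : ℂ} (h : y * x = w • (x * y)) (n : ℕ) :
    (x + y) ^ n = ∑ k ∈ Finset.range (n + 1), gaussBinom w n k • (x ^ k * y ^ (n - k)) := by
  induction n with
  | zero => simp [gaussBinom]
  | succ n ih =>
    rw [pow_succ', ih, add_mul, Finset.mul_sum, Finset.mul_sum, Finset.sum_range_succ' _ (n + 1)]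
    have h1 : ∀ k ∈ Finset.range (n + 1),
        x * gaussBinom w n k • (x ^ k * y ^ (n - k)) =
          gaussBinom w n k • (x ^ (k + 1) * y ^ (n - k)) := by
      intro k _
      rw [mul_smul_comm, ← mul_assoc, pow_succ']
    have h2 : ∀ k ∈ Finset.range (n + 1),
        y * gaussBinom w n k • (x ^ k * y ^ (n - k)) =
          (w ^ k * gaussBinom w n k) • (x ^ k * y ^ (n + 1 - k)) := by
      intro k hk
      have : n + 1 - k = (n - k) + 1 := by
        have := Finset.mem_range.1 hk
        omega
      rw [mul_smul_comm, ← mul_assoc, qcomm_pow h, smul_mul_assoc, smul_smul, mul_assoc, this,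
        pow_succ' y, mul_comm (w ^ k)]
    rw [Finset.sum_congr rfl h1, Finset.sum_congr rfl h2,
      Finset.sum_range_succ' (fun k => (w ^ k * gaussBinom w n k) • (x ^ k * y ^ (n + 1 - k))) n]
    have h3 : ∑ k ∈ Finset.range (n + 1),
        gaussBinom w (n + 1) (k + 1) • (x ^ (k + 1) * y ^ (n + 1 - (k + 1))) =
        ∑ k ∈ Finset.range (n + 1), gaussBinom w n k • (x ^ (k + 1) * y ^ (n - k)) +
        ∑ k ∈ Finset.range (n + 1), (w ^ (k + 1) * gaussBinom w n (k + 1)) •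
          (x ^ (k + 1) * y ^ (n - k)) := by
      rw [← Finset.sum_add_distrib]
      refine Finset.sum_congr rfl fun k _ => ?_
      rw [gaussBinom_succ, add_smul, Nat.succ_sub_succ]
    rw [h3, Finset.sum_range_succ (fun k => (w ^ (k + 1) * gaussBinom w n (k + 1)) •
          (x ^ (k + 1) * y ^ (n - k))) n, gaussBinom_lt w n (n + 1) (by omega)]
    simp only [Nat.add_sub_add_right, gaussBinom_zero_right, mul_zero, zero_smul, add_zero]
    simp only [pow_zero, one_mul, add_assoc]

lemma add_pow_of_primitive {x y : R} {w : ℂ} (h : y * x = w • (x * y)) {p : ℕ} (hp : p ≠ 0)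
    (hw : IsPrimitiveRoot w p) : (x + y) ^ p = x ^ p + y ^ p := by
  obtain ⟨m, rfl⟩ := Nat.exists_eq_succ_of_ne_zero hp
  rw [q_binomial h, Finset.sum_range_succ, Finset.sum_range_succ', Finset.sum_eq_zero]
  · simp [gaussBinom_self, gaussBinom_zero_right, add_comm]
  · intro k hk
    have hk := Finset.mem_range.1 hk
    have h1 := gaussBinom_absorb w m k
    have h2 : w ^ (m + 1) = 1 := hw.pow_eq_one
    have h3 : w ^ (k + 1) ≠ 1 := hw.pow_ne_one_of_pos_of_lt (by omega) (by simp; omega)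
    rw [h2, sub_self, zero_mul, mul_eq_zero] at h1
    rcases h1 with h1 | h1
    · exact absurd (sub_eq_zero.1 h1).symm h3
    · change gaussBinom w (m + 1) (k + 1) • _ = _
      rw [h1, zero_smul]

lemma mul_pow_eq_zero {x y : R} {w : ℂ} (h : y * x = w • (x * y)) {p : ℕ} (hx : x ^ p * y ^ p = 0) :
    (x * y) ^ p = 0 := by
  have : ∀ n, ∃ c : ℂ, (x * y) ^ n = c • (x ^ n * y ^ n) := by
    intro n
    induction n with
    | zero => exact ⟨1, by simp⟩
    | succ n ih =>
      obtain ⟨c, hc⟩ := ih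
      refine ⟨c * w ^ n, ?_⟩
      rw [pow_succ, hc, smul_mul_assoc, mul_assoc, ← mul_assoc (y ^ n), qcomm_pow_left h,
        smul_mul_assoc, mul_smul_comm, smul_smul, pow_succ x, pow_succ y]
      simp only [mul_assoc]
  obtain ⟨c, hc⟩ := this p
  rw [hc, hx, smul_zero]

lemma comul_pow_E {e L : R} {w : ℂ} (h : L * e = w • (e * L)) {p : ℕ} (hp : p ≠ 0)
    (hw : IsPrimitiveRoot w p) (he : e ^ p = 0) :
    ((1 : R) ⊗ₜ[ℂ] e + e ⊗ₜ[ℂ] L) ^ p = 0 := by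
  rw [add_pow_of_primitive (w := w) _ hp hw]
  · simp [Algebra.TensorProduct.tmul_pow, he]
  · simp [Algebra.TensorProduct.tmul_mul_tmul, h, TensorProduct.tmul_smul]

lemma comul_pow_F {f L : R} {w : ℂ} (h : f * L = w • (L * f)) {p : ℕ} (hp : p ≠ 0)
    (hw : IsPrimitiveRoot w p) (hf : f ^ p = 0) :
    (L ⊗ₜ[ℂ] f + f ⊗ₜ[ℂ] (1 : R)) ^ p = 0 := by
  rw [add_pow_of_primitive (w := w) _ hp hw]
  · simp [Algebra.TensorProduct.tmul_pow, hf]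
  · simp [Algebra.TensorProduct.tmul_mul_tmul, h, TensorProduct.smul_tmul']

lemma comul_EF {e f L L' : R} {c d : ℂ} (h1 : L * f = c • (f * L)) (h2 : L' * e = c • (e * L'))
    (h : e * f - f * e = d • (L - L')) :
    ((1 : R) ⊗ₜ[ℂ] e + e ⊗ₜ[ℂ] L) * (L' ⊗ₜ[ℂ] f + f ⊗ₜ[ℂ] (1 : R)) -
      (L' ⊗ₜ[ℂ] f + f ⊗ₜ[ℂ] (1 : R)) * ((1 : R) ⊗ₜ[ℂ] e + e ⊗ₜ[ℂ] L) =
      d • (L ⊗ₜ[ℂ] L - L' ⊗ₜ[ℂ] L') := by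
  simp only [add_mul, mul_add, Algebra.TensorProduct.tmul_mul_tmul, one_mul, mul_one, h1, h2,
    TensorProduct.tmul_smul, ← TensorProduct.smul_tmul']
  have e1 : e * f = f * e + d • (L - L') := by rw [← h]; abel
  rw [e1]
  simp only [TensorProduct.tmul_add, TensorProduct.add_tmul, TensorProduct.tmul_smul,
    TensorProduct.tmul_sub, TensorProduct.sub_tmul, ← TensorProduct.smul_tmul', smul_sub]
  abel

end qcomm

section antipode

variable {A : Type*} [Ring A] [Bialgebra ℂ A]

/-- The linear map underlying an anti-homomorphism. -/
def antiLin (S : A →ₐ[ℂ] Aᵐᵒᵖ) : A →ₗ[ℂ] A :=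
  (MulOpposite.opLinearEquiv ℂ).symm.toLinearMap ∘ₗ S.toLinearMap

lemma antiLin_apply (S : A →ₐ[ℂ] Aᵐᵒᵖ) (a : A) : antiLin S a = (S a).unop := rfl

lemma antiLin_mul (S : A →ₐ[ℂ] Aᵐᵒᵖ) (a b : A) :
    antiLin S (a * b) = antiLin S b * antiLin S a := by simp [antiLin_apply]

lemma antiLin_left_aux (S : A →ₐ[ℂ] Aᵐᵒᵖ) {t : A ⊗[ℂ] A} {c : ℂ}
    (ht : LinearMap.mul' ℂ A ((antiLin S).rTensor A t) = algebraMap ℂ A c) (u : A ⊗[ℂ] A) :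
    LinearMap.mul' ℂ A ((antiLin S).rTensor A (t * u)) =
      c • LinearMap.mul' ℂ A ((antiLin S).rTensor A u) := by
  induction u with
  | zero => simp
  | add u v hu hv => simp only [mul_add, map_add, hu, hv, smul_add]
  | tmul z w =>
    have : ∀ t : A ⊗[ℂ] A, LinearMap.mul' ℂ A ((antiLin S).rTensor A (t * z ⊗ₜ w)) =
        antiLin S z * LinearMap.mul' ℂ A ((antiLin S).rTensor A t) * w := by
      intro t
      induction t with
      | zero => simp
      | add u v hu hv => simp only [mul_add, add_mul, map_add, hu, hv]
      | tmul x y => simp [antiLin_mul, mul_assoc]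
    rw [this, ht]
    simp [Algebra.algebraMap_eq_smul_one]

lemma antiLin_right_aux (S : A →ₐ[ℂ] Aᵐᵒᵖ) {u : A ⊗[ℂ] A} {c : ℂ}
    (hu : LinearMap.mul' ℂ A ((antiLin S).lTensor A u) = algebraMap ℂ A c) (t : A ⊗[ℂ] A) :
    LinearMap.mul' ℂ A ((antiLin S).lTensor A (t * u)) =
      c • LinearMap.mul' ℂ A ((antiLin S).lTensor A t) := by
  induction t with
  | zero => simp
  | add u v hu hv => simp only [add_mul, map_add, hu, hv, smul_add]
  | tmul z w =>
    have : ∀ t : A ⊗[ℂ] A, LinearMap.mul' ℂ A ((antiLin S).lTensor A (z ⊗ₜ w * t)) =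
        z * LinearMap.mul' ℂ A ((antiLin S).lTensor A t) * antiLin S w := by
      intro t
      induction t with
      | zero => simp
      | add u v hu hv => simp only [mul_add, add_mul, map_add, hu, hv]
      | tmul x y => simp [antiLin_mul, mul_assoc]
    rw [this, hu]
    simp [Algebra.algebraMap_eq_smul_one]

/-- A bialgebra with an anti-homomorphism satisfying the antipode axioms on algebra generators is a
Hopf algebra. -/
@[reducible] def hopfOfGenerators (S : A →ₐ[ℂ] Aᵐᵒᵖ) (G : Set A) (hG : Algebra.adjoin ℂ G = ⊤)
    (hl : ∀ a ∈ G, LinearMap.mul' ℂ A ((antiLin S).rTensor A (Coalgebra.comul (R := ℂ) a)) =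
      algebraMap ℂ A (Coalgebra.counit (R := ℂ) a))
    (hr : ∀ a ∈ G, LinearMap.mul' ℂ A ((antiLin S).lTensor A (Coalgebra.comul (R := ℂ) a)) =
      algebraMap ℂ A (Coalgebra.counit (R := ℂ) a)) : HopfAlgebra ℂ A where
  antipode := antiLin S
  mul_antipode_rTensor_comul := by
    ext a
    have ha : a ∈ Algebra.adjoin ℂ G := hG ▸ Algebra.mem_top
    simp only [LinearMap.comp_apply, Algebra.linearMap_apply]
    induction ha using Algebra.adjoin_induction with
    | mem x hx => exact hl x hx
    | algebraMap r => simp [antiLin_apply, Algebra.TensorProduct.algebraMap_apply]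
    | add x y _ _ hx hy => simp only [map_add, hx, hy]
    | mul x y _ _ hx hy =>
      rw [Bialgebra.comul_mul, antiLin_left_aux S hx, hy, Bialgebra.counit_mul, map_mul,
        Algebra.smul_def]
  mul_antipode_lTensor_comul := by
    ext a
    have ha : a ∈ Algebra.adjoin ℂ G := hG ▸ Algebra.mem_top
    simp only [LinearMap.comp_apply, Algebra.linearMap_apply]
    induction ha using Algebra.adjoin_induction with
    | mem x hx => exact hr x hx
    | algebraMap r => simp [antiLin_apply, Algebra.TensorProduct.algebraMap_apply]
    | add x y _ _ hx hy => simp only [map_add, hx, hy]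
    | mul x y _ _ hx hy =>
      rw [Bialgebra.comul_mul, antiLin_right_aux S hy, hx, Bialgebra.counit_mul,
        mul_comm (Coalgebra.counit (R := ℂ) x), map_mul, Algebra.smul_def]

end antipode

/-- `qpow p x` is `q ^ x = exp (i π x / p)`, where `q = exp (i π / p)`. -/
def qpow (p : ℕ) (x : ℂ) : ℂ := Complex.exp (Real.pi * Complex.I * x / p)

lemma qpow_add (p : ℕ) (x y : ℂ) : qpow p (x + y) = qpow p x * qpow p y := by
  rw [qpow, qpow, qpow, ← Complex.exp_add]
  congr 1
  ring

lemma qpow_zero (p : ℕ) : qpow p 0 = 1 := by simp [qpow]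

lemma qpow_ne_zero (p : ℕ) (x : ℂ) : qpow p x ≠ 0 := Complex.exp_ne_zero _

lemma qpow_neg (p : ℕ) (x : ℂ) : qpow p (-x) = (qpow p x)⁻¹ := by
  refine eq_inv_of_mul_eq_one_left ?_
  rw [← qpow_add, neg_add_cancel, qpow_zero]

lemma qpow_pow (p : ℕ) (x : ℂ) (n : ℕ) : qpow p x ^ n = qpow p (n * x) := by
  rw [qpow, qpow, ← Complex.exp_nat_mul]
  congr 1
  ring

lemma qpow_four_mul (p : ℕ) [NeZero p] : qpow p (4 * p) = 1 := by
  have hp : (p : ℂ) ≠ 0 := Nat.cast_ne_zero.2 (NeZero.ne p)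
  rw [qpow, Complex.exp_eq_one_iff]
  exact ⟨2, by field_simp; norm_num⟩

lemma qpow_two_primitive (p : ℕ) [NeZero p] : IsPrimitiveRoot (qpow p 2) p := by
  have h := Complex.isPrimitiveRoot_exp p (NeZero.ne p)
  have e : qpow p 2 = Complex.exp (2 * Real.pi * Complex.I / p) := by
    rw [qpow]
    congr 1
    ring
  rwa [e]

section rels

variable {A : Type*} [Ring A] [Algebra ℂ A]

/-- The relations of the Borel part: `k e = q^a e k`, `e^p = 0`, `k^(2tp) = 1`. -/
structure BorelRel (p t : ℕ) (a : ℂ) (e k : A) : Prop where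
  ke : k * e = qpow p a • (e * k)
  e_pow : e ^ p = 0
  k_pow : k ^ (2 * t * p) = 1

/-- The relations satisfied by the images of the generators of the quantum `sl(2)` algebras below.
-/
structure Sl2Rel (p t : ℕ) (a : ℂ) (e f k : A) : Prop extends BorelRel p t a e k where
  kf : k * f = qpow p (-a) • (f * k)
  ef : e * f - f * e =
    (qpow p 1 - qpow p (-1))⁻¹ • (k ^ t - k ^ (2 * t * p - t))
  f_pow : f ^ p = 0

variable {p t : ℕ} {a : ℂ} {e f k : A}

lemma le_order [NeZero p] (t : ℕ) : t ≤ 2 * t * p := by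
  have : 1 ≤ p := NeZero.one_le
  nlinarith

lemma qpow_compl [NeZero p] (ha : (t : ℂ) * a = 2) :
    qpow p a ^ (2 * t * p - t) = qpow p (-2) := by
  have h : ((2 * t * p - t : ℕ) : ℂ) = 2 * t * p - t := by
    rw [Nat.cast_sub (le_order t)]
    push_cast
    ring
  have e1 : ((2 * t * p - t : ℕ) : ℂ) * a = 4 * p + -2 := by
    rw [h]
    linear_combination (2 * (p : ℂ) - 1) * ha
  rw [qpow_pow, e1, qpow_add, qpow_four_mul, one_mul]

lemma qpow_base (ha : (t : ℂ) * a = 2) : qpow p a ^ t = qpow p 2 := by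
  rw [qpow_pow, ha]

lemma qpow_base_neg (ha : (t : ℂ) * a = 2) : qpow p (-a) ^ t = qpow p (-2) := by
  rw [qpow_pow, mul_neg, ha]

lemma qpow_compl_neg [NeZero p] (ha : (t : ℂ) * a = 2) :
    qpow p (-a) ^ (2 * t * p - t) = qpow p 2 := by
  rw [qpow_neg, inv_pow, qpow_compl ha, qpow_neg, inv_inv]

/-- The Borel relations hold for the counits of the generators. -/
lemma BorelRel.counit (p t : ℕ) [NeZero p] (a : ℂ) : BorelRel p t a (0 : ℂ) (1 : ℂ) where
  ke := by simp
  e_pow := zero_pow (NeZero.ne p)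
  k_pow := one_pow _

namespace BorelRel

lemma kL (h : BorelRel p t a e k) [NeZero p] : k ^ t * k ^ (2 * t * p - t) = 1 := by
  rw [← pow_add, Nat.add_sub_cancel' (le_order t), h.k_pow]

lemma Lk (h : BorelRel p t a e k) [NeZero p] : k ^ (2 * t * p - t) * k ^ t = 1 := by
  rw [← pow_add, Nat.sub_add_cancel (le_order t), h.k_pow]

lemma kinv (h : BorelRel p t a e k) (hN : 2 * t * p ≠ 0) : k ^ (2 * t * p - 1) * k = 1 := by
  rw [← pow_succ, Nat.sub_add_cancel (by omega), h.k_pow]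

lemma kinv' (h : BorelRel p t a e k) (hN : 2 * t * p ≠ 0) : k * k ^ (2 * t * p - 1) = 1 := by
  rw [← pow_succ', Nat.sub_add_cancel (by omega), h.k_pow]

lemma kinv_pow (h : BorelRel p t a e k) (hN : 2 * t * p ≠ 0) (n : ℕ) : (k ^ (2 * t * p - 1)) ^ n * k ^ n = 1 := by
  have hc : Commute (k ^ (2 * t * p - 1)) k := Commute.pow_self k _
  rw [← hc.mul_pow, h.kinv hN, one_pow]

lemma kinv_pow_base (h : BorelRel p t a e k) [NeZero p] (hN : 2 * t * p ≠ 0) :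
    (k ^ (2 * t * p - 1)) ^ t = k ^ (2 * t * p - t) :=
  left_inv_eq_right_inv (h.kinv_pow hN t) h.kL

lemma kinv_pow_compl (h : BorelRel p t a e k) [NeZero p] (hN : 2 * t * p ≠ 0) :
    (k ^ (2 * t * p - 1)) ^ (2 * t * p - t) = k ^ t :=
  left_inv_eq_right_inv (h.kinv_pow hN _) h.Lk

lemma Le (h : BorelRel p t a e k) (ha : (t : ℂ) * a = 2) : k ^ t * e = qpow p 2 • (e * k ^ t) := by
  rw [qcomm_pow_left h.ke, qpow_base ha]

lemma Le' (h : BorelRel p t a e k) [NeZero p] (ha : (t : ℂ) * a = 2) :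
    k ^ (2 * t * p - t) * e = qpow p (-2) • (e * k ^ (2 * t * p - t)) := by
  rw [qcomm_pow_left h.ke, qpow_compl ha]

/-- The Borel relations hold for the coproducts of the generators. -/
lemma comul (h : BorelRel p t a e k) [NeZero p] (ha : (t : ℂ) * a = 2) :
    BorelRel p t a ((1 : A) ⊗ₜ[ℂ] e + e ⊗ₜ[ℂ] (k ^ t)) (k ⊗ₜ[ℂ] k) where
  ke := by
    simp only [mul_add, add_mul, Algebra.TensorProduct.tmul_mul_tmul, one_mul, mul_one, h.ke,
      TensorProduct.tmul_smul, ← TensorProduct.smul_tmul', smul_add]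
    rw [← pow_succ, ← pow_succ']
  e_pow := comul_pow_E (h.Le ha) (NeZero.ne p) (qpow_two_primitive p) h.e_pow
  k_pow := by
    rw [Algebra.TensorProduct.tmul_pow, h.k_pow, Algebra.TensorProduct.one_def]

/-- The Borel relations hold for the antipodes of the generators in the opposite algebra. -/
lemma antipode (h : BorelRel p t a e k) [NeZero p] (ha : (t : ℂ) * a = 2) (hN : 2 * t * p ≠ 0) :
    BorelRel p t a (MulOpposite.op (-(e * k ^ (2 * t * p - t))))
      (MulOpposite.op (k ^ (2 * t * p - 1))) where
  ke := by
    rw [← MulOpposite.op_mul, ← MulOpposite.op_mul, ← MulOpposite.op_smul]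
    congr 1
    have e1 : k ^ (2 * t * p - 1) * e * k = qpow p (-a) • e := by
      have h2 : e * k = qpow p (-a) • (k * e) := by
        rw [h.ke, smul_smul, ← qpow_add, neg_add_cancel, qpow_zero, one_smul]
      rw [mul_assoc, h2, mul_smul_comm, ← mul_assoc, h.kinv hN, one_mul]
    have e2 : k ^ (2 * t * p - 1) * e = qpow p (-a) • (e * k ^ (2 * t * p - 1)) := by
      rw [← smul_mul_assoc, ← e1, mul_assoc _ k, h.kinv' hN, mul_one]
    rw [mul_neg, ← mul_assoc, e2, smul_mul_assoc, smul_neg, smul_smul, ← qpow_add,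
      add_neg_cancel, qpow_zero, one_smul, neg_mul, mul_assoc e, mul_assoc e, ← pow_add, ← pow_add,
      add_comm]
  e_pow := by
    rw [← MulOpposite.op_pow, neg_pow, mul_pow_eq_zero (h.Le' ha) (by rw [h.e_pow, zero_mul]), mul_zero,
      MulOpposite.op_zero]
  k_pow := by
    rw [← MulOpposite.op_pow, ← pow_mul, mul_comm, pow_mul, h.k_pow, one_pow, MulOpposite.op_one]

end BorelRel

namespace Sl2Rel

lemma counit (p t : ℕ) [NeZero p] (a : ℂ) : Sl2Rel p t a (0 : ℂ) (0 : ℂ) (1 : ℂ) where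
  toBorelRel := BorelRel.counit p t a
  kf := by simp
  ef := by simp
  f_pow := zero_pow (NeZero.ne p)

lemma Lf (h : Sl2Rel p t a e f k) (ha : (t : ℂ) * a = 2) : k ^ t * f = qpow p (-2) • (f * k ^ t) := by
  rw [qcomm_pow_left h.kf, qpow_base_neg ha]

lemma fL (h : Sl2Rel p t a e f k) (ha : (t : ℂ) * a = 2) : f * k ^ t = qpow p 2 • (k ^ t * f) := by
  rw [h.Lf ha, smul_smul, ← qpow_add, add_neg_cancel, qpow_zero, one_smul]

lemma Lf' (h : Sl2Rel p t a e f k) [NeZero p] (ha : (t : ℂ) * a = 2) :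
    k ^ (2 * t * p - t) * f = qpow p 2 • (f * k ^ (2 * t * p - t)) := by
  rw [qcomm_pow_left h.kf, qpow_compl_neg ha]

lemma fL' (h : Sl2Rel p t a e f k) [NeZero p] (ha : (t : ℂ) * a = 2) :
    f * k ^ (2 * t * p - t) = qpow p (-2) • (k ^ (2 * t * p - t) * f) := by
  rw [h.Lf' ha, smul_smul, ← qpow_add, neg_add_cancel, qpow_zero, one_smul]

/-- The relations hold for the coproducts of the generators. -/
lemma comul (h : Sl2Rel p t a e f k) [NeZero p] (ha : (t : ℂ) * a = 2) :
    Sl2Rel p t a ((1 : A) ⊗ₜ[ℂ] e + e ⊗ₜ[ℂ] (k ^ t))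
      ((k ^ (2 * t * p - t)) ⊗ₜ[ℂ] f + f ⊗ₜ[ℂ] (1 : A)) (k ⊗ₜ[ℂ] k) where
  toBorelRel := h.toBorelRel.comul ha
  kf := by
    simp only [mul_add, add_mul, Algebra.TensorProduct.tmul_mul_tmul, one_mul, mul_one, h.kf,
      TensorProduct.tmul_smul, ← TensorProduct.smul_tmul', smul_add]
    rw [← pow_succ, ← pow_succ']
  ef := by
    rw [comul_EF (h.Lf ha) (h.Le' ha) h.ef, Algebra.TensorProduct.tmul_pow,
      Algebra.TensorProduct.tmul_pow]
  f_pow := by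
    have hp : IsPrimitiveRoot (qpow p (-2)) p := by
      rw [qpow_neg]
      exact (qpow_two_primitive p).inv
    exact comul_pow_F (h.fL' ha) (NeZero.ne p) hp h.f_pow

/-- The relations hold for the antipodes of the generators in the opposite algebra. -/
lemma antipode (h : Sl2Rel p t a e f k) [NeZero p] (ha : (t : ℂ) * a = 2) (hN : 2 * t * p ≠ 0) :
    Sl2Rel p t a (MulOpposite.op (-(e * k ^ (2 * t * p - t))))
      (MulOpposite.op (-(k ^ t * f))) (MulOpposite.op (k ^ (2 * t * p - 1))) where
  toBorelRel := h.toBorelRel.antipode ha hN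
  kf := by
    rw [← MulOpposite.op_mul, ← MulOpposite.op_mul, ← MulOpposite.op_smul]
    congr 1
    have e1 : k * f * k ^ (2 * t * p - 1) = qpow p (-a) • f := by
      rw [h.kf, smul_mul_assoc, mul_assoc, h.kinv' hN, mul_one]
    have e2 : f * k ^ (2 * t * p - 1) = qpow p (-a) • (k ^ (2 * t * p - 1) * f) := by
      rw [← mul_smul_comm, ← e1, ← mul_assoc, ← mul_assoc, h.kinv hN, one_mul]
    rw [neg_mul, mul_neg, mul_assoc, e2, mul_smul_comm, smul_neg, ← mul_assoc, ← mul_assoc,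
      ← pow_add, ← pow_add, add_comm]
  ef := by
    rw [← MulOpposite.op_mul, ← MulOpposite.op_mul, ← MulOpposite.op_pow, ← MulOpposite.op_pow,
      ← MulOpposite.op_sub, ← MulOpposite.op_sub, ← MulOpposite.op_smul,
      h.kinv_pow_base hN, h.kinv_pow_compl hN]
    congr 1
    have e1 : k ^ t * f * (e * k ^ (2 * t * p - t)) = f * e := by
      rw [← mul_assoc, h.Lf ha, smul_mul_assoc, smul_mul_assoc, mul_assoc f, h.Le ha,
        mul_smul_comm, smul_mul_assoc, smul_smul, ← qpow_add, neg_add_cancel, qpow_zero,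
        one_smul, ← mul_assoc, mul_assoc, h.kL, mul_one]
    have e2 : e * k ^ (2 * t * p - t) * (k ^ t * f) = e * f := by
      rw [← mul_assoc, mul_assoc e, h.Lk, mul_one]
    rw [neg_mul_neg, neg_mul_neg, e1, e2, ← neg_sub (e * f), h.ef, ← smul_neg, neg_sub]
  f_pow := by
    rw [← MulOpposite.op_pow, neg_pow, mul_pow_eq_zero (h.fL ha) (by rw [h.f_pow, mul_zero]), mul_zero,
      MulOpposite.op_zero]

end Sl2Rel

end rels

/-! ### The Hopf algebra `B` -/

/-- Generators of `B`. -/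
inductive BGen
  | E
  | K

/-- Generators of the two quantum `sl(2)` algebras. -/
inductive Gen
  | E
  | F
  | K

open FreeAlgebra in
/-- Defining relations of `B`: `E^p = 0`, `K^(4p) = 1`, `K E = q E K`. -/
inductive BPres (p : ℕ) : FreeAlgebra ℂ BGen → FreeAlgebra ℂ BGen → Prop
  | ke : BPres p (ι ℂ .K * ι ℂ .E) (qpow p 1 • (ι ℂ .E * ι ℂ .K))
  | e_pow : BPres p (ι ℂ .E ^ p) 0
  | k_pow : BPres p (ι ℂ .K ^ (4 * p)) 1

/-- The "short-screening" algebra `B`. -/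
def B (p : ℕ) : Type := RingQuot (BPres p)

namespace B

instance (p : ℕ) : Ring (B p) := inferInstanceAs (Ring (RingQuot (BPres p)))
instance (p : ℕ) : Algebra ℂ (B p) := inferInstanceAs (Algebra ℂ (RingQuot (BPres p)))

/-- The quotient map from the free algebra. -/
def mk (p : ℕ) : FreeAlgebra ℂ BGen →ₐ[ℂ] B p := RingQuot.mkAlgHom ℂ (BPres p)

/-- The generator `E` of `B`. -/
def E (p : ℕ) : B p := mk p (FreeAlgebra.ι ℂ .E)
/-- The generator `K` of `B`. -/
def K (p : ℕ) : B p := mk p (FreeAlgebra.ι ℂ .K)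

section

variable {p : ℕ} {A : Type*} [Ring A] [Algebra ℂ A]

lemma mk_rel {x y : FreeAlgebra ℂ BGen} (h : BPres p x y) : mk p x = mk p y :=
  RingQuot.mkAlgHom_rel ℂ h

lemma rel (p : ℕ) : BorelRel p 2 1 (E p) (K p) where
  ke := by simpa [E, K] using mk_rel (BPres.ke (p := p))
  e_pow := by simpa [E] using mk_rel (BPres.e_pow (p := p))
  k_pow := by simpa [K] using mk_rel (BPres.k_pow (p := p))

/-- The universal property of the presentation of `B`. -/
def lift {e k : A} (h : BorelRel p 2 1 e k) : B p →ₐ[ℂ] A :=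
  RingQuot.liftAlgHom ℂ ⟨FreeAlgebra.lift ℂ fun | .E => e | .K => k, by
    rintro _ _ (_ | _ | _)
    · simpa using h.ke
    · simpa using h.e_pow
    · simpa using h.k_pow⟩

@[simp] lemma lift_E {e k : A} (h : BorelRel p 2 1 e k) : lift h (E p) = e :=
  (RingQuot.liftAlgHom_mkAlgHom_apply ..).trans (FreeAlgebra.lift_ι_apply ..)

@[simp] lemma lift_K {e k : A} (h : BorelRel p 2 1 e k) : lift h (K p) = k :=
  (RingQuot.liftAlgHom_mkAlgHom_apply ..).trans (FreeAlgebra.lift_ι_apply ..)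

lemma hom_ext {f g : B p →ₐ[ℂ] A} (hE : f (E p) = g (E p)) (hK : f (K p) = g (K p)) : f = g := by
  apply RingQuot.ringQuot_ext'
  ext (_ | _)
  · exact hE
  · exact hK

end

lemma adjoin (p : ℕ) : Algebra.adjoin ℂ {E p, K p} = ⊤ := by
  set s := Algebra.adjoin ℂ {E p, K p}
  have h : BorelRel p 2 1 (⟨E p, Algebra.subset_adjoin (by simp)⟩ : s)
      (⟨K p, Algebra.subset_adjoin (by simp)⟩ : s) :=
    ⟨Subtype.ext (rel p).ke, Subtype.ext (rel p).e_pow, Subtype.ext (rel p).k_pow⟩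
  have e : s.val.comp (lift h) = AlgHom.id ℂ (B p) := hom_ext (by simp) (by simp)
  rw [eq_top_iff]
  intro x _
  have := DFunLike.congr_fun e x
  simp only [AlgHom.comp_apply, AlgHom.id_apply] at this
  rw [← this]
  exact (lift h x).2

variable {p : ℕ} [NeZero p]

/-- `Δ(E) = 1 ⊗ E + E ⊗ K^2` and `Δ(K) = K ⊗ K`. -/
def comulHom (p : ℕ) [NeZero p] : B p →ₐ[ℂ] B p ⊗[ℂ] B p :=
  lift (e := 1 ⊗ₜ[ℂ] E p + E p ⊗ₜ[ℂ] (K p ^ 2)) (k := K p ⊗ₜ[ℂ] K p)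
    ((rel p).comul (by norm_num))

/-- `ε(E) = 0` and `ε(K) = 1`. -/
def counitHom (p : ℕ) [NeZero p] : B p →ₐ[ℂ] ℂ :=
  lift (e := 0) (k := 1) (BorelRel.counit p 2 1)

/-- `S(E) = -E K^(-2)` and `S(K) = K^(-1)`, as an anti-homomorphism. -/
def antipodeHom (p : ℕ) [NeZero p] : B p →ₐ[ℂ] (B p)ᵐᵒᵖ :=
  lift (e := .op (-(E p * K p ^ (4 * p - 2)))) (k := .op (K p ^ (4 * p - 1)))
    ((rel p).antipode (by norm_num) (by simpa using NeZero.ne p))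

instance : Bialgebra ℂ (B p) :=
  Bialgebra.ofAlgHom (comulHom p) (counitHom p)
    (hom_ext
      (by simp [comulHom, Algebra.TensorProduct.one_def, TensorProduct.tmul_add, add_assoc,
            TensorProduct.add_tmul, Algebra.TensorProduct.tmul_pow])
      (by simp [comulHom]))
    (hom_ext (by simp [comulHom, counitHom]) (by simp [comulHom, counitHom]))
    (hom_ext (by simp [comulHom, counitHom]) (by simp [comulHom, counitHom]))

lemma comul_E : Coalgebra.comul (R := ℂ) (E p) = 1 ⊗ₜ[ℂ] E p + E p ⊗ₜ[ℂ] (K p ^ 2) := lift_E _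
lemma comul_K : Coalgebra.comul (R := ℂ) (K p) = K p ⊗ₜ[ℂ] K p := lift_K _
lemma counit_E : Coalgebra.counit (R := ℂ) (E p) = 0 := lift_E _
lemma counit_K : Coalgebra.counit (R := ℂ) (K p) = 1 := lift_K _

instance : HopfAlgebra ℂ (B p) :=
  hopfOfGenerators (antipodeHom p) {E p, K p} (adjoin p)
    (by
      have hN : 2 * 2 * p ≠ 0 := by simpa using NeZero.ne p
      have hL : K p ^ (4 * p - 2) * K p ^ 2 = 1 := (rel p).Lk
      rintro _ (rfl | rfl)
      · simp [comul_E, counit_E, antiLin_apply, antipodeHom, mul_assoc]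
        rw [hL, mul_one, add_neg_cancel]
      · simp [comul_K, counit_K, antiLin_apply, antipodeHom]
        exact (rel p).kinv hN)
    (by
      have hN : 2 * 2 * p ≠ 0 := by simpa using NeZero.ne p
      have hK : (K p ^ (4 * p - 1)) ^ 2 = K p ^ (4 * p - 2) := (rel p).kinv_pow_base hN
      rintro _ (rfl | rfl)
      · simp [comul_E, counit_E, antiLin_apply, antipodeHom]
        rw [hK, neg_add_cancel]
      · simp [comul_K, counit_K, antiLin_apply, antipodeHom]
        exact (rel p).kinv' hN)

lemma antipode_E : HopfAlgebra.antipode ℂ (E p) = -(E p * K p ^ (4 * p - 2)) :=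
  congrArg MulOpposite.unop (lift_E _)
lemma antipode_K : HopfAlgebra.antipode ℂ (K p) = K p ^ (4 * p - 1) :=
  congrArg MulOpposite.unop (lift_K _)

end B

/-! ### The Hopf algebra `DBar` -/

open FreeAlgebra in
/-- Defining relations of `DBar`:
`K E = q E K`, `K F = q⁻¹ F K`, `[E, F] = (K^2 - K^(-2)) / (q - q⁻¹)`, `E^p = F^p = 0`,
`K^(4p) = 1` (so `K^(-2)` is `K^(4p-2)`). -/
inductive DBarPres (p : ℕ) : FreeAlgebra ℂ Gen → FreeAlgebra ℂ Gen → Prop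
  | ke : DBarPres p (ι ℂ .K * ι ℂ .E) (qpow p 1 • (ι ℂ .E * ι ℂ .K))
  | kf : DBarPres p (ι ℂ .K * ι ℂ .F) (qpow p (-1) • (ι ℂ .F * ι ℂ .K))
  | ef : DBarPres p (ι ℂ .E * ι ℂ .F - ι ℂ .F * ι ℂ .E)
      ((qpow p 1 - qpow p (-1))⁻¹ • (ι ℂ .K ^ 2 - ι ℂ .K ^ (4 * p - 2)))
  | e_pow : DBarPres p (ι ℂ .E ^ p) 0
  | f_pow : DBarPres p (ι ℂ .F ^ p) 0
  | k_pow : DBarPres p (ι ℂ .K ^ (4 * p)) 1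

/-- The algebra `DBar` (the quotient of the Drinfeld double of `B`), presented by generators and
relations. -/
def DBar (p : ℕ) : Type := RingQuot (DBarPres p)

namespace DBar

instance (p : ℕ) : Ring (DBar p) := inferInstanceAs (Ring (RingQuot (DBarPres p)))
instance (p : ℕ) : Algebra ℂ (DBar p) := inferInstanceAs (Algebra ℂ (RingQuot (DBarPres p)))

/-- The quotient map from the free algebra. -/
def mk (p : ℕ) : FreeAlgebra ℂ Gen →ₐ[ℂ] DBar p := RingQuot.mkAlgHom ℂ (DBarPres p)

/-- The generator `E`. -/
def E (p : ℕ) : DBar p := mk p (FreeAlgebra.ι ℂ .E)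
/-- The generator `F`. -/
def F (p : ℕ) : DBar p := mk p (FreeAlgebra.ι ℂ .F)
/-- The generator `K`. -/
def K (p : ℕ) : DBar p := mk p (FreeAlgebra.ι ℂ .K)

section

variable {p : ℕ} {A : Type*} [Ring A] [Algebra ℂ A]

lemma mk_rel {x y : FreeAlgebra ℂ Gen} (h : DBarPres p x y) : mk p x = mk p y :=
  RingQuot.mkAlgHom_rel ℂ h

lemma rel (p : ℕ) : Sl2Rel p 2 1 (E p) (F p) (K p) where
  ke := by simpa [E, K] using mk_rel (DBarPres.ke (p := p))
  kf := by simpa [F, K] using mk_rel (DBarPres.kf (p := p))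
  ef := by simpa [E, F, K] using mk_rel (DBarPres.ef (p := p))
  e_pow := by simpa [E] using mk_rel (DBarPres.e_pow (p := p))
  f_pow := by simpa [F] using mk_rel (DBarPres.f_pow (p := p))
  k_pow := by simpa [K] using mk_rel (DBarPres.k_pow (p := p))

/-- The universal property of the presentation. -/
def lift {e f k : A} (h : Sl2Rel p 2 1 e f k) : DBar p →ₐ[ℂ] A :=
  RingQuot.liftAlgHom ℂ ⟨FreeAlgebra.lift ℂ fun | .E => e | .F => f | .K => k, by
    rintro _ _ (_ | _ | _ | _ | _ | _)
    · simpa using h.ke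
    · simpa using h.kf
    · simpa using h.ef
    · simpa using h.e_pow
    · simpa using h.f_pow
    · simpa using h.k_pow⟩

@[simp] lemma lift_E {e f k : A} (h : Sl2Rel p 2 1 e f k) : lift h (E p) = e :=
  (RingQuot.liftAlgHom_mkAlgHom_apply ..).trans (FreeAlgebra.lift_ι_apply ..)

@[simp] lemma lift_F {e f k : A} (h : Sl2Rel p 2 1 e f k) : lift h (F p) = f :=
  (RingQuot.liftAlgHom_mkAlgHom_apply ..).trans (FreeAlgebra.lift_ι_apply ..)

@[simp] lemma lift_K {e f k : A} (h : Sl2Rel p 2 1 e f k) : lift h (K p) = k :=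
  (RingQuot.liftAlgHom_mkAlgHom_apply ..).trans (FreeAlgebra.lift_ι_apply ..)

lemma hom_ext {φ ψ : DBar p →ₐ[ℂ] A} (hE : φ (E p) = ψ (E p)) (hF : φ (F p) = ψ (F p))
    (hK : φ (K p) = ψ (K p)) : φ = ψ := by
  apply RingQuot.ringQuot_ext'
  ext (_ | _ | _)
  · exact hE
  · exact hF
  · exact hK

end

lemma adjoin (p : ℕ) : Algebra.adjoin ℂ {E p, F p, K p} = ⊤ := by
  set s := Algebra.adjoin ℂ {E p, F p, K p}
  have h : Sl2Rel p 2 1 (⟨E p, Algebra.subset_adjoin (by simp)⟩ : s)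
      (⟨F p, Algebra.subset_adjoin (by simp)⟩ : s)
      (⟨K p, Algebra.subset_adjoin (by simp)⟩ : s) :=
    ⟨⟨Subtype.ext (rel p).ke, Subtype.ext (rel p).e_pow, Subtype.ext (rel p).k_pow⟩,
      Subtype.ext (rel p).kf, Subtype.ext (rel p).ef, Subtype.ext (rel p).f_pow⟩
  have e : s.val.comp (lift h) = AlgHom.id ℂ (DBar p) := hom_ext (by simp) (by simp) (by simp)
  rw [eq_top_iff]
  intro x _
  have := DFunLike.congr_fun e x
  simp only [AlgHom.comp_apply, AlgHom.id_apply] at this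
  rw [← this]
  exact (lift h x).2

variable {p : ℕ} [NeZero p]

/-- `Δ(E) = 1 ⊗ E + E ⊗ K^2`, `Δ(F) = K^(-2) ⊗ F + F ⊗ 1`, `Δ(K) = K ⊗ K`. -/
def comulHom (p : ℕ) [NeZero p] : DBar p →ₐ[ℂ] DBar p ⊗[ℂ] DBar p :=
  lift (e := 1 ⊗ₜ[ℂ] E p + E p ⊗ₜ[ℂ] (K p ^ 2))
    (f := (K p ^ (4 * p - 2)) ⊗ₜ[ℂ] F p + F p ⊗ₜ[ℂ] 1) (k := K p ⊗ₜ[ℂ] K p)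
    (by simpa using (rel p).comul (by norm_num))

/-- `ε(E) = ε(F) = 0` and `ε(K) = 1`. -/
def counitHom (p : ℕ) [NeZero p] : DBar p →ₐ[ℂ] ℂ :=
  lift (e := 0) (f := 0) (k := 1) (Sl2Rel.counit p 2 1)

/-- `S(E) = -E K^(-2)`, `S(F) = -K^2 F`, `S(K) = K^(-1)`, as an anti-homomorphism. -/
def antipodeHom (p : ℕ) [NeZero p] : DBar p →ₐ[ℂ] (DBar p)ᵐᵒᵖ :=
  lift (e := .op (-(E p * K p ^ (4 * p - 2)))) (f := .op (-((K p ^ 2) * F p)))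
    (k := .op (K p ^ (4 * p - 1)))
    (by simpa using (rel p).antipode (by norm_num) (by simpa using NeZero.ne p))

instance : Bialgebra ℂ (DBar p) :=
  Bialgebra.ofAlgHom (comulHom p) (counitHom p)
    (hom_ext
      (by simp [comulHom, Algebra.TensorProduct.one_def, TensorProduct.tmul_add, add_assoc,
            TensorProduct.add_tmul, Algebra.TensorProduct.tmul_pow])
      (by simp [comulHom, Algebra.TensorProduct.one_def, TensorProduct.tmul_add, add_assoc,
            TensorProduct.add_tmul, Algebra.TensorProduct.tmul_pow])
      (by simp [comulHom]))
    (hom_ext (by simp [comulHom, counitHom]) (by simp [comulHom, counitHom])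
      (by simp [comulHom, counitHom]))
    (hom_ext (by simp [comulHom, counitHom]) (by simp [comulHom, counitHom])
      (by simp [comulHom, counitHom]))

lemma comul_E : Coalgebra.comul (R := ℂ) (E p) = 1 ⊗ₜ[ℂ] E p + E p ⊗ₜ[ℂ] (K p ^ 2) :=
  lift_E _
lemma comul_F : Coalgebra.comul (R := ℂ) (F p) =
    (K p ^ (4 * p - 2)) ⊗ₜ[ℂ] F p + F p ⊗ₜ[ℂ] 1 := lift_F _
lemma comul_K : Coalgebra.comul (R := ℂ) (K p) = K p ⊗ₜ[ℂ] K p := lift_K _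
lemma counit_E : Coalgebra.counit (R := ℂ) (E p) = 0 := lift_E _
lemma counit_F : Coalgebra.counit (R := ℂ) (F p) = 0 := lift_F _
lemma counit_K : Coalgebra.counit (R := ℂ) (K p) = 1 := lift_K _

instance : HopfAlgebra ℂ (DBar p) :=
  hopfOfGenerators (antipodeHom p) {E p, F p, K p} (adjoin p)
    (by
      have hN : 2 * 2 * p ≠ 0 := by simpa using NeZero.ne p
      have hL : K p ^ (4 * p - 2) * (K p ^ 2) = 1 := by simpa using (rel p).Lk
      have hK : (K p ^ (4 * p - 1)) ^ (4 * p - 2) = (K p ^ 2) := by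
        simpa using (rel p).kinv_pow_compl hN
      rintro _ (rfl | rfl | rfl)
      · simp [comul_E, counit_E, antiLin_apply, antipodeHom, mul_assoc]
        rw [hL, mul_one, add_neg_cancel]
      · simp [comul_F, counit_F, antiLin_apply, antipodeHom]
        rw [hK, add_neg_cancel]
      · simp [comul_K, counit_K, antiLin_apply, antipodeHom]
        exact (rel p).kinv hN)
    (by
      have hN : 2 * 2 * p ≠ 0 := by simpa using NeZero.ne p
      have hL : K p ^ (4 * p - 2) * (K p ^ 2) = 1 := by simpa using (rel p).Lk
      have hK : (K p ^ (4 * p - 1)) ^ 2 = K p ^ (4 * p - 2) := by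
        simpa using (rel p).kinv_pow_base hN
      rintro _ (rfl | rfl | rfl)
      · simp [comul_E, counit_E, antiLin_apply, antipodeHom]
        rw [hK, neg_add_cancel]
      · simp [comul_F, counit_F, antiLin_apply, antipodeHom, ← mul_assoc]
        rw [hL, one_mul, neg_add_cancel]
      · simp [comul_K, counit_K, antiLin_apply, antipodeHom]
        exact (rel p).kinv' hN)

lemma antipode_E : HopfAlgebra.antipode ℂ (E p) = -(E p * K p ^ (4 * p - 2)) :=
  congrArg MulOpposite.unop (lift_E _)
lemma antipode_F : HopfAlgebra.antipode ℂ (F p) = -((K p ^ 2) * F p) :=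
  congrArg MulOpposite.unop (lift_F _)
lemma antipode_K : HopfAlgebra.antipode ℂ (K p) = K p ^ (4 * p - 1) :=
  congrArg MulOpposite.unop (lift_K _)

end DBar

/-! ### The restricted quantum group -/

open FreeAlgebra in
/-- Defining relations of the restricted quantum group:
`K E = q^2 E K`, `K F = q^(-2) F K`, `[E, F] = (K - K⁻¹) / (q - q⁻¹)`, `E^p = F^p = 0`,
`K^(2p) = 1` (so `K⁻¹` is `K^(2p-1)`). -/
inductive UqPres (p : ℕ) : FreeAlgebra ℂ Gen → FreeAlgebra ℂ Gen → Prop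
  | ke : UqPres p (ι ℂ .K * ι ℂ .E) (qpow p 2 • (ι ℂ .E * ι ℂ .K))
  | kf : UqPres p (ι ℂ .K * ι ℂ .F) (qpow p (-2) • (ι ℂ .F * ι ℂ .K))
  | ef : UqPres p (ι ℂ .E * ι ℂ .F - ι ℂ .F * ι ℂ .E)
      ((qpow p 1 - qpow p (-1))⁻¹ • (ι ℂ .K - ι ℂ .K ^ (2 * p - 1)))
  | e_pow : UqPres p (ι ℂ .E ^ p) 0
  | f_pow : UqPres p (ι ℂ .F ^ p) 0
  | k_pow : UqPres p (ι ℂ .K ^ (2 * p)) 1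

/-- The restricted quantum group `U_q sl(2)` at `q = exp (i π / p)`. -/
def Uq (p : ℕ) : Type := RingQuot (UqPres p)

namespace Uq

instance (p : ℕ) : Ring (Uq p) := inferInstanceAs (Ring (RingQuot (UqPres p)))
instance (p : ℕ) : Algebra ℂ (Uq p) := inferInstanceAs (Algebra ℂ (RingQuot (UqPres p)))

/-- The quotient map from the free algebra. -/
def mk (p : ℕ) : FreeAlgebra ℂ Gen →ₐ[ℂ] Uq p := RingQuot.mkAlgHom ℂ (UqPres p)

/-- The generator `E`. -/
def E (p : ℕ) : Uq p := mk p (FreeAlgebra.ι ℂ .E)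
/-- The generator `F`. -/
def F (p : ℕ) : Uq p := mk p (FreeAlgebra.ι ℂ .F)
/-- The generator `K`. -/
def K (p : ℕ) : Uq p := mk p (FreeAlgebra.ι ℂ .K)

section

variable {p : ℕ} {A : Type*} [Ring A] [Algebra ℂ A]

lemma mk_rel {x y : FreeAlgebra ℂ Gen} (h : UqPres p x y) : mk p x = mk p y :=
  RingQuot.mkAlgHom_rel ℂ h

lemma rel (p : ℕ) : Sl2Rel p 1 2 (E p) (F p) (K p) where
  ke := by simpa [E, K] using mk_rel (UqPres.ke (p := p))
  kf := by simpa [F, K] using mk_rel (UqPres.kf (p := p))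
  ef := by simpa [E, F, K] using mk_rel (UqPres.ef (p := p))
  e_pow := by simpa [E] using mk_rel (UqPres.e_pow (p := p))
  f_pow := by simpa [F] using mk_rel (UqPres.f_pow (p := p))
  k_pow := by simpa [K] using mk_rel (UqPres.k_pow (p := p))

/-- The universal property of the presentation. -/
def lift {e f k : A} (h : Sl2Rel p 1 2 e f k) : Uq p →ₐ[ℂ] A :=
  RingQuot.liftAlgHom ℂ ⟨FreeAlgebra.lift ℂ fun | .E => e | .F => f | .K => k, by
    rintro _ _ (_ | _ | _ | _ | _ | _)
    · simpa using h.ke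
    · simpa using h.kf
    · simpa using h.ef
    · simpa using h.e_pow
    · simpa using h.f_pow
    · simpa using h.k_pow⟩

@[simp] lemma lift_E {e f k : A} (h : Sl2Rel p 1 2 e f k) : lift h (E p) = e :=
  (RingQuot.liftAlgHom_mkAlgHom_apply ..).trans (FreeAlgebra.lift_ι_apply ..)

@[simp] lemma lift_F {e f k : A} (h : Sl2Rel p 1 2 e f k) : lift h (F p) = f :=
  (RingQuot.liftAlgHom_mkAlgHom_apply ..).trans (FreeAlgebra.lift_ι_apply ..)

@[simp] lemma lift_K {e f k : A} (h : Sl2Rel p 1 2 e f k) : lift h (K p) = k :=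
  (RingQuot.liftAlgHom_mkAlgHom_apply ..).trans (FreeAlgebra.lift_ι_apply ..)

lemma hom_ext {φ ψ : Uq p →ₐ[ℂ] A} (hE : φ (E p) = ψ (E p)) (hF : φ (F p) = ψ (F p))
    (hK : φ (K p) = ψ (K p)) : φ = ψ := by
  apply RingQuot.ringQuot_ext'
  ext (_ | _ | _)
  · exact hE
  · exact hF
  · exact hK

end

lemma adjoin (p : ℕ) : Algebra.adjoin ℂ {E p, F p, K p} = ⊤ := by
  set s := Algebra.adjoin ℂ {E p, F p, K p}
  have h : Sl2Rel p 1 2 (⟨E p, Algebra.subset_adjoin (by simp)⟩ : s)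
      (⟨F p, Algebra.subset_adjoin (by simp)⟩ : s)
      (⟨K p, Algebra.subset_adjoin (by simp)⟩ : s) :=
    ⟨⟨Subtype.ext (rel p).ke, Subtype.ext (rel p).e_pow, Subtype.ext (rel p).k_pow⟩,
      Subtype.ext (rel p).kf, Subtype.ext (rel p).ef, Subtype.ext (rel p).f_pow⟩
  have e : s.val.comp (lift h) = AlgHom.id ℂ (Uq p) := hom_ext (by simp) (by simp) (by simp)
  rw [eq_top_iff]
  intro x _
  have := DFunLike.congr_fun e x
  simp only [AlgHom.comp_apply, AlgHom.id_apply] at this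
  rw [← this]
  exact (lift h x).2

variable {p : ℕ} [NeZero p]

/-- `Δ(E) = 1 ⊗ E + E ⊗ K`, `Δ(F) = K⁻¹ ⊗ F + F ⊗ 1`, `Δ(K) = K ⊗ K`. -/
def comulHom (p : ℕ) [NeZero p] : Uq p →ₐ[ℂ] Uq p ⊗[ℂ] Uq p :=
  lift (e := 1 ⊗ₜ[ℂ] E p + E p ⊗ₜ[ℂ] K p)
    (f := (K p ^ (2 * p - 1)) ⊗ₜ[ℂ] F p + F p ⊗ₜ[ℂ] 1) (k := K p ⊗ₜ[ℂ] K p)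
    (by simpa using (rel p).comul (by norm_num))

/-- `ε(E) = ε(F) = 0` and `ε(K) = 1`. -/
def counitHom (p : ℕ) [NeZero p] : Uq p →ₐ[ℂ] ℂ :=
  lift (e := 0) (f := 0) (k := 1) (Sl2Rel.counit p 1 2)

/-- `S(E) = -E K⁻¹`, `S(F) = -K F`, `S(K) = K⁻¹`, as an anti-homomorphism. -/
def antipodeHom (p : ℕ) [NeZero p] : Uq p →ₐ[ℂ] (Uq p)ᵐᵒᵖ :=
  lift (e := .op (-(E p * K p ^ (2 * p - 1)))) (f := .op (-(K p * F p)))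
    (k := .op (K p ^ (2 * p - 1)))
    (by simpa using (rel p).antipode (by norm_num) (by simpa using NeZero.ne p))

instance : Bialgebra ℂ (Uq p) :=
  Bialgebra.ofAlgHom (comulHom p) (counitHom p)
    (hom_ext
      (by simp [comulHom, Algebra.TensorProduct.one_def, TensorProduct.tmul_add, add_assoc,
            TensorProduct.add_tmul])
      (by simp [comulHom, Algebra.TensorProduct.one_def, TensorProduct.tmul_add, add_assoc,
            TensorProduct.add_tmul, Algebra.TensorProduct.tmul_pow])
      (by simp [comulHom]))
    (hom_ext (by simp [comulHom, counitHom]) (by simp [comulHom, counitHom])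
      (by simp [comulHom, counitHom]))
    (hom_ext (by simp [comulHom, counitHom]) (by simp [comulHom, counitHom])
      (by simp [comulHom, counitHom]))

lemma comul_E : Coalgebra.comul (R := ℂ) (E p) = 1 ⊗ₜ[ℂ] E p + E p ⊗ₜ[ℂ] K p :=
  lift_E _
lemma comul_F : Coalgebra.comul (R := ℂ) (F p) =
    (K p ^ (2 * p - 1)) ⊗ₜ[ℂ] F p + F p ⊗ₜ[ℂ] 1 := lift_F _
lemma comul_K : Coalgebra.comul (R := ℂ) (K p) = K p ⊗ₜ[ℂ] K p := lift_K _
lemma counit_E : Coalgebra.counit (R := ℂ) (E p) = 0 := lift_E _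
lemma counit_F : Coalgebra.counit (R := ℂ) (F p) = 0 := lift_F _
lemma counit_K : Coalgebra.counit (R := ℂ) (K p) = 1 := lift_K _

instance : HopfAlgebra ℂ (Uq p) :=
  hopfOfGenerators (antipodeHom p) {E p, F p, K p} (adjoin p)
    (by
      have hN : 2 * 1 * p ≠ 0 := by simpa using NeZero.ne p
      have hL : K p ^ (2 * p - 1) * K p = 1 := by simpa using (rel p).Lk
      have hK : (K p ^ (2 * p - 1)) ^ (2 * p - 1) = K p := by
        simpa using (rel p).kinv_pow_compl hN
      rintro _ (rfl | rfl | rfl)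
      · simp [comul_E, counit_E, antiLin_apply, antipodeHom, mul_assoc]
        rw [hL, mul_one, add_neg_cancel]
      · simp [comul_F, counit_F, antiLin_apply, antipodeHom]
        rw [hK, add_neg_cancel]
      · simp [comul_K, counit_K, antiLin_apply, antipodeHom]
        exact (rel p).kinv hN)
    (by
      have hN : 2 * 1 * p ≠ 0 := by simpa using NeZero.ne p
      have hL : K p ^ (2 * p - 1) * K p = 1 := by simpa using (rel p).Lk
      rintro _ (rfl | rfl | rfl)
      · simp [comul_E, counit_E, antiLin_apply, antipodeHom]
      · simp [comul_F, counit_F, antiLin_apply, antipodeHom, ← mul_assoc]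
        rw [hL, one_mul, neg_add_cancel]
      · simp [comul_K, counit_K, antiLin_apply, antipodeHom]
        exact (rel p).kinv' hN)

lemma antipode_E : HopfAlgebra.antipode ℂ (E p) = -(E p * K p ^ (2 * p - 1)) :=
  congrArg MulOpposite.unop (lift_E _)
lemma antipode_F : HopfAlgebra.antipode ℂ (F p) = -(K p * F p) :=
  congrArg MulOpposite.unop (lift_F _)
lemma antipode_K : HopfAlgebra.antipode ℂ (K p) = K p ^ (2 * p - 1) :=
  congrArg MulOpposite.unop (lift_K _)

end Uq

/-! ### The Drinfeld double -/

section Double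

open WithConv

variable {H D : Type*} [Ring H] [HopfAlgebra ℂ H] [Ring D] [HopfAlgebra ℂ D]

/-- The inverse of the antipode (which exists for every finite-dimensional Hopf algebra). -/
def antipodeInv (H : Type*) [Ring H] [HopfAlgebra ℂ H] : H →ₗ[ℂ] H :=
  Ring.inverse (HopfAlgebra.antipode ℂ : Module.End ℂ H)

/-- `IsDrinfeldDouble i j` says that the Hopf algebra `D` is the Drinfeld double of the
finite-dimensional Hopf algebra `H`, where `i : H → D` and `j : H^* → D` are the canonical
inclusions. The underlying vector space is `H^* ⊗ H`, via `β ⊗ x ↦ j β * i x`; the product of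
`H^*` is the convolution product `⟨βγ, x⟩ = ∑ ⟨β, x'⟩ ⟨γ, x''⟩`, with unit `ε`; the coproduct,
counit and antipode of `H^*` are given by `⟨Δ β, x ⊗ y⟩ = ⟨β, y x⟩`, `ε(β) = ⟨β, 1⟩`,
`⟨S β, x⟩ = ⟨β, S⁻¹ x⟩`; and the cross relation is `x β = ∑ β(S⁻¹(x''') ? x') x''`. -/
structure IsDrinfeldDouble (i : H →ₐc[ℂ] D) (j : Module.Dual ℂ H →ₗ[ℂ] D) : Prop where
  finite : Module.Finite ℂ H
  bijective : Function.Bijective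
    (TensorProduct.lift ((LinearMap.mul ℂ D).compl₁₂ j (i : H →ₗ[ℂ] D)))
  map_one : j (Coalgebra.counit (R := ℂ) (A := H)) = 1
  map_mul : ∀ β γ : Module.Dual ℂ H, j (toConv β * toConv γ).ofConv = j β * j γ
  comul : ∀ (β : Module.Dual ℂ H) (t : Module.Dual ℂ H ⊗[ℂ] Module.Dual ℂ H),
    (∀ x y : H, TensorProduct.dualDistrib ℂ H H t (x ⊗ₜ[ℂ] y) = β (y * x)) →
    Coalgebra.comul (R := ℂ) (j β) = TensorProduct.map j j t
  counit : ∀ β : Module.Dual ℂ H, Coalgebra.counit (R := ℂ) (j β) = β 1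
  antipode : ∀ β : Module.Dual ℂ H, HopfAlgebra.antipode ℂ (j β) = j (β ∘ₗ antipodeInv H)
  cross : ∀ (x : H) (β : Module.Dual ℂ H) (s : Finset ℕ) (x₁ x₂ x₃ : ℕ → H),
    (Coalgebra.comul (R := ℂ) (A := H)).lTensor H (Coalgebra.comul (R := ℂ) x) =
      ∑ l ∈ s, x₁ l ⊗ₜ[ℂ] (x₂ l ⊗ₜ[ℂ] x₃ l) →
    i x * j β = ∑ l ∈ s,
      j (β ∘ₗ LinearMap.mulLeft ℂ (antipodeInv H (x₃ l)) ∘ₗ LinearMap.mulRight ℂ (x₁ l)) *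
        i (x₂ l)

end Double

/-! ### Quasitriangular and ribbon Hopf algebras -/

section Quasitriangular

variable {A : Type*} [Ring A] [HopfAlgebra ℂ A]

/-- `R ↦ R₁₂`. -/
def leg12 : A ⊗[ℂ] A →ₐ[ℂ] A ⊗[ℂ] (A ⊗[ℂ] A) :=
  Algebra.TensorProduct.map (AlgHom.id ℂ A) Algebra.TensorProduct.includeLeft

/-- `R ↦ R₁₃`. -/
def leg13 : A ⊗[ℂ] A →ₐ[ℂ] A ⊗[ℂ] (A ⊗[ℂ] A) :=
  Algebra.TensorProduct.map (AlgHom.id ℂ A) Algebra.TensorProduct.includeRight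

/-- `R ↦ R₂₃`. -/
def leg23 : A ⊗[ℂ] A →ₐ[ℂ] A ⊗[ℂ] (A ⊗[ℂ] A) := Algebra.TensorProduct.includeRight

/-- `R ↦ R₂₁`. -/
def flip21 : A ⊗[ℂ] A →ₐ[ℂ] A ⊗[ℂ] A := (Algebra.TensorProduct.comm ℂ A A).toAlgHom

/-- `R` is a universal `R`-matrix of the Hopf algebra `A`, so that `(A, R)` is quasitriangular:
`R` is invertible, `Δ^op(x) R = R Δ(x)`, `(Δ ⊗ id)(R) = R₁₃ R₂₃` and `(id ⊗ Δ)(R) = R₁₃ R₁₂`. -/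
structure IsUniversalRMatrix (R : A ⊗[ℂ] A) : Prop where
  isUnit : IsUnit R
  op_comul : ∀ x : A, flip21 (Coalgebra.comul (R := ℂ) x) * R = R * Coalgebra.comul (R := ℂ) x
  comul_id : TensorProduct.assoc ℂ A A A ((Coalgebra.comul (R := ℂ) (A := A)).rTensor A R) =
    leg13 R * leg23 R
  id_comul : (Coalgebra.comul (R := ℂ) (A := A)).lTensor A R = leg13 R * leg12 R

/-- The `M`-matrix `R₂₁ R₁₂`. -/
def mMatrix (R : A ⊗[ℂ] A) : A ⊗[ℂ] A := flip21 R * R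

/-- The canonical element `u`, the image of `R₂₁` under `a ⊗ b ↦ S(a) b`. -/
def canonicalElement (R : A ⊗[ℂ] A) : A :=
  LinearMap.mul' ℂ A ((HopfAlgebra.antipode ℂ).rTensor A (flip21 R))

/-- `v` is a ribbon element of the quasitriangular Hopf algebra `(A, R)`: it is invertible and
central, `v² = u S(u)`, `S(v) = v`, `ε(v) = 1` and `Δ(v) = M⁻¹ (v ⊗ v)`. -/
structure IsRibbonElement (R : A ⊗[ℂ] A) (v : A) : Prop where
  isUnit : IsUnit v
  central : v ∈ Subalgebra.center ℂ A
  sq : v ^ 2 = canonicalElement R * HopfAlgebra.antipode ℂ (canonicalElement R)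
  antipode : HopfAlgebra.antipode ℂ v = v
  counit : Coalgebra.counit (R := ℂ) v = 1
  comul : Coalgebra.comul (R := ℂ) v = Ring.inverse (mMatrix R) * (v ⊗ₜ[ℂ] v)

end Quasitriangular

/-! ### The explicit elements -/

/-- The `q`-integer `[n] = (q^n - q^(-n)) / (q - q⁻¹)`. -/
def qInt (p n : ℕ) : ℂ := (qpow p n - qpow p (-n)) / (qpow p 1 - qpow p (-1))

/-- The `q`-factorial `[m]! = [1] [2] ⋯ [m]`. -/
def qFactorial (p m : ℕ) : ℂ := ∏ n ∈ Finset.Icc 1 m, qInt p n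

/-- The explicit element of `DBar ⊗ DBar` claimed to be the universal `R`-matrix. -/
def Rbar (p : ℕ) : DBar p ⊗[ℂ] DBar p :=
  (1 / (4 * p) : ℂ) • ∑ m ∈ Finset.range p, ∑ n ∈ Finset.range (4 * p),
    ∑ j ∈ Finset.range (4 * p),
      ((qpow p 1 - qpow p (-1)) ^ m / qFactorial p m *
        qpow p ((m : ℂ) * (m - 1) / 2 + m * ((n : ℂ) - j) - (n : ℂ) * j / 2)) •
      ((DBar.E p ^ m * DBar.K p ^ n) ⊗ₜ[ℂ] (DBar.F p ^ m * DBar.K p ^ j))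

/-- The explicit element of `DBar` claimed to be the ribbon element. -/
def ribbonElement (p : ℕ) : DBar p :=
  ((1 - Complex.I) / (2 * (√(p : ℝ) : ℝ)) : ℂ) • ∑ m ∈ Finset.range p,
    ∑ j ∈ Finset.range (2 * p),
      ((qpow p 1 - qpow p (-1)) ^ m / qFactorial p m *
        qpow p (-(m : ℂ) / 2 + (m : ℂ) * j + ((j : ℂ) + p + 1) ^ 2 / 2)) •
      (DBar.F p ^ m * DBar.E p ^ m * DBar.K p ^ (2 * j))

/-- The explicit element of `U_q sl(2) ⊗ U_q sl(2)` claimed to be the `M`-matrix. -/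
def Mbar (p : ℕ) : Uq p ⊗[ℂ] Uq p :=
  (1 / (2 * p) : ℂ) • ∑ m ∈ Finset.range p, ∑ n ∈ Finset.range p,
    ∑ i ∈ Finset.range (2 * p), ∑ j ∈ Finset.range (2 * p),
      ((qpow p 1 - qpow p (-1)) ^ (m + n) / (qFactorial p m * qFactorial p n) *
        qpow p ((m : ℂ) * (m - 1) / 2 + (n : ℂ) * (n - 1) / 2) *
        qpow p (-(m : ℂ) ^ 2 - (m : ℂ) * j + 2 * (n : ℂ) * j - 2 * (n : ℂ) * i - (i : ℂ) * j +
          (m : ℂ) * i)) •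
      ((Uq.F p ^ m * Uq.E p ^ n * Uq.K p ^ j) ⊗ₜ[ℂ] (Uq.E p ^ m * Uq.F p ^ n * Uq.K p ^ i))

end QDouble

end

open QDouble

open scoped TensorProduct

noncomputable section

namespace QDouble

/-! ### Powers of q, q-integers and q-factorials. -/

section roots

variable (p : ℕ) [NeZero p]

/-! Everything is reduced to three tools: weight projectors of the torus, a truncated q-exponential,
and a highest weight module big enough to separate PBW monomials.

The double. Sending `E` to φ and `K` to κ defines an algebra map from `B` to its dual (`B.toDual`).
In the monomials e^n k^j the resulting pairing is diagonal in n and given by an explicit symmetric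
formula (`B.toDualLin_mon`), nondegenerate by Fourier inversion on the cyclic group of order 4p.
Symmetry turns multiplication of `B` into the coproduct of the dual, so the dual of `B` is `B` with
opposite coproduct. The double can therefore be presented by two copies of the Borel relations and
cross relations (`Double`). Its PBW theorem comes from acting on the module with basis F^m E^n v
over the group algebra of (ℤ/4p)²: each PBW monomial sends v to a nonzero scalar times a group
element times a basis vector (`Verma.coeffAt_monomial`). The cross relation is first put into the
form Σ x' β(x'' ?) = Σ β(? x') x'', which is multiplicative in x and hence checked on generators
(`Double.leftForm_comul`). Modulo κk - 1 the presentation becomes that of `DBar`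
(`Double.toDBar_eq_zero_iff`).

The R-matrix. It factors as a Cartan part times a q-exponential of e ⊗ φ (`DBar.Rbar_eq`).
Intertwining of coproducts is checked on generators; the hexagon identities follow from exp(x + y) =
exp(x) exp(y) for q^(-2)-commuting x, y (`qexp_add`), the truncation being harmless because e and φ
are nilpotent.

The ribbon element. For any quasitriangular Hopf algebra in which S reverses Δ, the canonical
element satisfies Δ(u) = M⁻¹(u ⊗ u), by Yang–Baxter. In `DBar` the element v = k^(-2p-2) u is
central, and k^(-2p-2) is group-like, so all ribbon axioms follow except ε(v) = 1, S(v) = v and the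
explicit formula. On each weight projector v is an explicit polynomial in the Casimir element
(`DBar.vElt_mul_idem`). The given formula yields the same polynomial once the sum over j is
evaluated as a quadratic Gauss sum, which explains the prefactor (`DBar.ribbonElement_mul_idem`).
Since S fixes the Casimir element and sends weight s to -s, S(v) = v means that the polynomials for
s and -s coincide (`ribPoly_neg`). The Gauss sum itself is obtained from the modular transformation
of theta series (`theta_reciprocity`).

The M-matrix. Its Cartan part is the square of that of R, in which only even powers of k occur;
hence M comes from the restricted quantum group (`DBar.map_Mbar`), embedded by the same PBW argument
over ℤ/4p. Grouping M by its first factors F^m E^n K^j, the second factors are nonzero multiples of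
Fourier transforms over ℤ/2p of the elements E^m F^n K^i, hence again a basis (`Uq.Mbar_eq_sum`). -/

lemma cast_ne : (p : ℂ) ≠ 0 := Nat.cast_ne_zero.2 (NeZero.ne p)

lemma qpow_two_p_int (n : ℤ) : qpow p (2 * p * n) = 1 := by
  have := cast_ne p
  rw [qpow, Complex.exp_eq_one_iff]
  exact ⟨n, by field_simp⟩

lemma qpow_eq_one_iff {s : ℤ} : qpow p s = 1 ↔ (2 * p : ℤ) ∣ s := by
  have hp := cast_ne p
  rw [qpow, Complex.exp_eq_one_iff]
  have h2 : (2 * Real.pi * Complex.I : ℂ) ≠ 0 := Complex.two_pi_I_ne_zero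
  constructor
  · rintro ⟨n, hn⟩
    refine ⟨n, ?_⟩
    have h : (2 * Real.pi * Complex.I : ℂ) * s = (2 * Real.pi * Complex.I : ℂ) * (2 * p * n) := by
      field_simp at hn
      rw [hn]; ring
    exact_mod_cast mul_left_cancel₀ h2 h
  · rintro ⟨n, rfl⟩
    exact ⟨n, by push_cast; field_simp⟩

lemma qpow_half_eq_one_iff {s : ℤ} : qpow p (s / 2) = 1 ↔ (4 * p : ℤ) ∣ s := by
  have hp := cast_ne p
  rw [qpow, Complex.exp_eq_one_iff]
  have h2 : (2 * Real.pi * Complex.I : ℂ) ≠ 0 := Complex.two_pi_I_ne_zero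
  constructor
  · rintro ⟨n, hn⟩
    refine ⟨n, ?_⟩
    have h : (2 * Real.pi * Complex.I : ℂ) * s = (2 * Real.pi * Complex.I : ℂ) * (4 * p * n) := by
      field_simp at hn
      rw [hn]; ring
    exact_mod_cast mul_left_cancel₀ h2 h
  · rintro ⟨n, rfl⟩
    exact ⟨n, by push_cast; field_simp; ring⟩

/-- `x - x⁻¹` for `x = q ^ n` does not vanish unless `p ∣ n`. -/
lemma qpow_sub_neg_ne_zero {n : ℤ} (h : ¬ (p : ℤ) ∣ n) : qpow p n - qpow p (-n) ≠ 0 := by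
  intro h0
  apply h
  have h1 : qpow p ((2 * n : ℤ) : ℂ) = 1 := by
    have : qpow p ((2 * n : ℤ) : ℂ) = qpow p n * qpow p n := by
      rw [← qpow_add]; congr 1; push_cast; ring
    rw [this]
    nth_rewrite 1 [sub_eq_zero.1 h0]
    rw [← qpow_add, neg_add_cancel, qpow_zero]
  obtain ⟨c, hc⟩ := (qpow_eq_one_iff p).1 h1
  exact ⟨c, by linarith⟩

lemma qdiff_ne_zero (hp : 2 ≤ p) : qpow p 1 - qpow p (-1) ≠ 0 := by
  have := qpow_sub_neg_ne_zero p (n := 1) (by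
    intro h
    have := Int.le_of_dvd one_pos h
    omega)
  simpa using this

lemma qInt_ne_zero (hp : 2 ≤ p) {m : ℕ} (h0 : 0 < m) (hm : m < p) : qInt p m ≠ 0 := by
  refine div_ne_zero ?_ (qdiff_ne_zero p hp)
  have := qpow_sub_neg_ne_zero p (n := m) (by
    intro h
    have := Int.le_of_dvd (by exact_mod_cast h0) h
    omega)
  simpa using this

omit [NeZero p] in
lemma qInt_zero : qInt p 0 = 0 := by simp [qInt]

lemma qInt_self : qInt p p = 0 := by
  rw [qInt, div_eq_zero_iff]
  left
  have h : qpow p p = qpow p (-p) * qpow p (2 * p * (1 : ℤ)) := by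
    rw [← qpow_add]; congr 1; push_cast; ring
  rw [h, qpow_two_p_int, mul_one, sub_self]

lemma qInt_mul (hp : 2 ≤ p) (m : ℕ) :
    qInt p m * (qpow p 1 - qpow p (-1)) = qpow p m - qpow p (-m) :=
  div_mul_cancel₀ _ (qdiff_ne_zero p hp)

omit [NeZero p] in
lemma qFactorial_zero : qFactorial p 0 = 1 := by simp [qFactorial]

omit [NeZero p] in
lemma qFactorial_succ (m : ℕ) : qFactorial p (m + 1) = qFactorial p m * qInt p (m + 1 : ℕ) :=
  Finset.prod_Icc_succ_top (by omega) _

lemma qFactorial_ne_zero (hp : 2 ≤ p) {m : ℕ} (hm : m < p) : qFactorial p m ≠ 0 := by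
  refine Finset.prod_ne_zero_iff.2 fun n hn => ?_
  have := Finset.mem_Icc.1 hn
  exact qInt_ne_zero p hp (by omega) (by omega)

end roots

/-! ### Sums over a period and orthogonality of characters. -/

section periodic

/-- Sums of periodic functions over a period are translation invariant. -/
lemma sum_range_shift {M : Type*} [AddCommMonoid M] {N : ℕ} {f : ℤ → M}
    (hf : ∀ n, f (n + N) = f n) (a : ℤ) :
    ∑ n ∈ Finset.range N, f (n + a) = ∑ n ∈ Finset.range N, f n := by
  have step : ∀ a : ℤ, ∑ n ∈ Finset.range N, f (n + (a + 1)) = ∑ n ∈ Finset.range N, f (n + a) := by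
    intro a
    have h := (Finset.sum_range_succ (fun n : ℕ => f (n + a)) N).symm.trans
      (Finset.sum_range_succ' (fun n : ℕ => f (n + a)) N)
    have e1 : f ((N : ℕ) + a) = f ((0 : ℕ) + a) := by
      rw [add_comm, hf, Nat.cast_zero, zero_add]
    have e2 : ∀ n ∈ Finset.range N, f (n + (a + 1)) = f ((n + 1 : ℕ) + a) := fun n _ => by
      push_cast; congr 1; ring
    rw [Finset.sum_congr rfl e2]
    cases N with
    | zero => simp
    | succ N =>
      rw [Finset.sum_range_succ, Finset.sum_range_succ' (fun n : ℕ => f (n + a)) N]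
      congr 1
  induction a using Int.induction_on with
  | zero => simp
  | succ n ih => rw [step, ih]
  | pred n ih => rw [← ih, ← step, sub_add_cancel]

lemma sum_range_neg {M : Type*} [AddCommMonoid M] {N : ℕ} {f : ℤ → M}
    (hf : ∀ n, f (n + N) = f n) :
    ∑ n ∈ Finset.range N, f (-n) = ∑ n ∈ Finset.range N, f n := by
  rw [← Finset.sum_range_reflect (fun n : ℕ => f (-n))]
  -- The reflection n ↦ N - 1 - n followed by negation is translation by -(N - 1), so negation
  -- invariance reduces to translation invariance.
  rw [← sum_range_shift (f := f) hf (-(N - 1))]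
  refine Finset.sum_congr rfl fun n hn => ?_
  congr 1
  have := Finset.mem_range.1 hn
  omega

lemma geom_sum_root {x : ℂ} {N : ℕ} (hx : x ^ N = 1) :
    ∑ j ∈ Finset.range N, x ^ j = if x = 1 then (N : ℂ) else 0 := by
  split_ifs with h
  · simp [h]
  · rw [geom_sum_eq h, hx, sub_self, zero_div]

variable (p : ℕ) [NeZero p]

lemma sum_qpow_half (s : ℤ) : ∑ j ∈ Finset.range (4 * p), qpow p (s * j / 2) =
    if (4 * p : ℤ) ∣ s then (4 * p : ℂ) else 0 := by
  have h : ∀ j : ℕ, qpow p (s * j / 2) = qpow p (s / 2) ^ j := fun j => by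
    rw [qpow_pow]; congr 1; ring
  simp_rw [h, ← qpow_half_eq_one_iff]
  rw [geom_sum_root]
  · push_cast; rfl
  · rw [← h]
    have := qpow_two_p_int p s
    rw [← this]; congr 1; push_cast; ring

lemma sum_qpow (s : ℤ) : ∑ j ∈ Finset.range (2 * p), qpow p (s * j) =
    if (2 * p : ℤ) ∣ s then (2 * p : ℂ) else 0 := by
  have h : ∀ j : ℕ, qpow p (s * j) = qpow p s ^ j := fun j => by
    rw [qpow_pow]; congr 1; ring
  simp_rw [h, ← qpow_eq_one_iff]
  rw [geom_sum_root]
  · push_cast; rfl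
  · rw [← h]
    have := qpow_two_p_int p s
    rw [← this]; congr 1; push_cast; ring

end periodic

/-! ### Moving one generator past powers of the other. -/

section commutation

variable {R : Type*} [Ring R] [Algebra ℂ R] (p : ℕ) [NeZero p]

omit [NeZero p] in
lemma qpow_natCast (n : ℕ) : qpow p n = qpow p 1 ^ n := by rw [qpow_pow, mul_one]

omit [NeZero p] in
lemma qpow_two : qpow p 2 = qpow p 1 ^ 2 := by rw [qpow_pow]; norm_num

/-- The scalar induction step of `e_mul_f_pow`: it collects the coefficient of `L` after one more
factor `f` is passed; the primed version does the same for `L'`. -/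
lemma qInt_succ_add (hp : 2 ≤ p) (m : ℕ) :
    1 + qInt p (m + 1 : ℕ) * qpow p (-m) * qpow p (-2) =
      qInt p (m + 1 + 1 : ℕ) * qpow p (-(m + 1 : ℕ)) := by
  have hq := qdiff_ne_zero p hp
  apply mul_right_cancel₀ hq
  have h1 := qInt_mul p hp (m + 1)
  have h2 := qInt_mul p hp (m + 1 + 1)
  have hx := qpow_ne_zero p 1
  calc _ = (qpow p 1 - qpow p (-1)) + (qInt p (m + 1 : ℕ) * (qpow p 1 - qpow p (-1))) *
      qpow p (-m) * qpow p (-2) := by ring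
    _ = (qInt p (m + 1 + 1 : ℕ) * (qpow p 1 - qpow p (-1))) * qpow p (-(m + 1 : ℕ)) := by
      rw [h1, h2]
      simp only [qpow_neg, qpow_natCast, qpow_two]
      field_simp
      ring
    _ = _ := by ring

lemma qInt_succ_add' (hp : 2 ≤ p) (m : ℕ) :
    1 + qInt p (m + 1 : ℕ) * qpow p m * qpow p 2 =
      qInt p (m + 1 + 1 : ℕ) * qpow p (m + 1 : ℕ) := by
  have hq := qdiff_ne_zero p hp
  apply mul_right_cancel₀ hq
  have h1 := qInt_mul p hp (m + 1)
  have h2 := qInt_mul p hp (m + 1 + 1)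
  have hx := qpow_ne_zero p 1
  calc _ = (qpow p 1 - qpow p (-1)) + (qInt p (m + 1 : ℕ) * (qpow p 1 - qpow p (-1))) *
      qpow p m * qpow p 2 := by ring
    _ = (qInt p (m + 1 + 1 : ℕ) * (qpow p 1 - qpow p (-1))) * qpow p (m + 1 : ℕ) := by
      rw [h1, h2]
      simp only [qpow_neg, qpow_natCast, qpow_two]
      field_simp
      ring
    _ = _ := by ring

/-- Commuting `e` past powers of `f` when `[e, f] = d (L - L')`. -/
lemma e_mul_f_pow (hp : 2 ≤ p) {e f L L' : R} {d : ℂ} (h : e * f - f * e = d • (L - L'))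
    (hL : L * f = qpow p (-2) • (f * L)) (hL' : L' * f = qpow p 2 • (f * L')) (m : ℕ) :
    e * f ^ (m + 1) = f ^ (m + 1) * e +
      (d * qInt p (m + 1 : ℕ)) • (f ^ m * (qpow p (-m) • L - qpow p m • L')) := by
  have hq := qdiff_ne_zero p hp
  have hef : e * f = f * e + d • (L - L') := by rw [← h]; abel
  induction m with
  | zero =>
    have : qInt p 1 = 1 := by
      rw [qInt]; push_cast; exact div_self hq
    simp [hef, this, qpow_zero]
  | succ m ih =>
    rw [pow_succ f (m + 1), ← mul_assoc, ih, add_mul, mul_assoc, hef, mul_add, ← mul_assoc,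
      smul_mul_assoc, mul_assoc (f ^ m), sub_mul, smul_mul_assoc, smul_mul_assoc, hL, hL', add_assoc]
    congr 1
    simp only [mul_sub, mul_smul_comm, ← mul_assoc, ← pow_succ]
    have h1 := qInt_succ_add p hp m
    have h2 := qInt_succ_add' p hp m
    push_cast at h1 h2
    match_scalars
    · linear_combination d * h1
    · linear_combination -d * h2

end commutation

/-! ### The quadratic Gauss sum, from theta series. -/

section Gauss

open Filter Topology Complex

lemma summable_exp_neg_mul_sq {T : ℝ} (hT : 0 < T) :
    Summable fun n : ℤ => Real.exp (-Real.pi * T * (n : ℝ) ^ 2) := by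
  have h := summable_jacobiTheta₂_term_iff 0 (Complex.I * T)
  have h' := (h.2 (by simpa using hT)).norm
  refine h'.congr fun n => ?_
  rw [norm_jacobiTheta₂_term]
  simp
  ring_nf

/-- Theta series with bounded coefficients tend to their constant term. -/
lemma tendsto_theta_series (c : ℤ → ℂ) (hc : ∀ n, ‖c n‖ ≤ 1) (h0 : c 0 = 1) :
    Tendsto (fun T : ℝ => ∑' n : ℤ, (Real.exp (-Real.pi * T * (n : ℝ) ^ 2) : ℂ) * c n)
      atTop (𝓝 1) := by
  have key := tendsto_tsum_of_dominated_convergence (𝓕 := atTop)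
    (f := fun (T : ℝ) (n : ℤ) => (Real.exp (-Real.pi * T * (n : ℝ) ^ 2) : ℂ) * c n)
    (g := fun n : ℤ => if n = 0 then (1 : ℂ) else 0)
    (bound := fun n : ℤ => Real.exp (-Real.pi * 1 * (n : ℝ) ^ 2))
    (summable_exp_neg_mul_sq one_pos) ?_ ?_
  · simpa using key
  · intro n
    rcases eq_or_ne n 0 with rfl | hn
    · simp [h0]
    · simp only [if_neg hn]
      have hpos : 0 < Real.pi * (n : ℝ) ^ 2 := by positivity
      have h1 : Tendsto (fun T : ℝ => Real.exp (-Real.pi * T * (n : ℝ) ^ 2)) atTop (𝓝 0) := by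
        refine Real.tendsto_exp_atBot.comp ?_
        have := (tendsto_id (α := ℝ) (x := atTop)).const_mul_atTop hpos
        refine (tendsto_neg_atTop_atBot.comp this).congr fun T => ?_
        simp only [Function.comp, id]
        ring
      have h2 : Tendsto (fun T : ℝ => ((Real.exp (-Real.pi * T * (n : ℝ) ^ 2) : ℝ) : ℂ)) atTop
          (𝓝 ((0 : ℝ) : ℂ)) := (Complex.continuous_ofReal.tendsto _).comp h1
      simpa using h2.mul_const (c n)
  · filter_upwards [eventually_ge_atTop (1 : ℝ)] with T hT n
    rw [norm_mul, Complex.norm_real, Real.norm_eq_abs, Real.abs_exp]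
    have h3 : Real.exp (-Real.pi * T * (n : ℝ) ^ 2) ≤ Real.exp (-Real.pi * 1 * (n : ℝ) ^ 2) := by
      apply Real.exp_le_exp.2
      have : 0 ≤ Real.pi * (n : ℝ) ^ 2 := by positivity
      nlinarith
    calc _ ≤ Real.exp (-Real.pi * T * (n : ℝ) ^ 2) * 1 :=
          mul_le_mul_of_nonneg_left (hc n) (Real.exp_nonneg _)
      _ ≤ _ := by simpa using h3

/-- Sums over `ℤ` by residue classes. -/
lemma tsum_int_eq_sum_residues {N : ℕ} [NeZero N] {f : ℤ → ℂ} (hf : Summable f) :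
    ∑' n : ℤ, f n = ∑ r ∈ Finset.range N, ∑' k : ℤ, f (k * N + r) := by
  let e : Fin N × ℤ ≃ ℤ := (Equiv.prodComm _ _).trans (Int.divModEquiv N).symm
  have he : ∀ x, e x = x.2 * N + (x.1 : ℕ) := fun x => by simp [e]
  rw [← e.tsum_eq f, Summable.tsum_prod (f := fun x => f (e x)) (e.summable_iff.2 hf), tsum_fintype,
    ← Fin.sum_univ_eq_sum_range (fun r => ∑' k : ℤ, f (k * N + r))]
  exact Finset.sum_congr rfl fun r _ => tsum_congr fun k => by rw [he]

lemma ofReal_mul_cpow {r : ℝ} (hr : 0 < r) {x : ℂ} (hx : x ≠ 0) (s : ℂ) :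
    ((r : ℂ) * x) ^ s = (r : ℂ) ^ s * x ^ s := by
  have hr' : (r : ℂ) ≠ 0 := Complex.ofReal_ne_zero.2 hr.ne'
  rw [Complex.cpow_def_of_ne_zero (mul_ne_zero hr' hx), Complex.cpow_def_of_ne_zero hr',
    Complex.cpow_def_of_ne_zero hx, ← Complex.exp_add, Complex.log_ofReal_mul hr hx,
    Complex.ofReal_log hr.le, add_mul]

lemma exp_int_mul_two_pi (n : ℤ) {x : ℂ} (h : x = n * (2 * Real.pi * Complex.I)) :
    Complex.exp x = 1 := Complex.exp_eq_one_iff.2 ⟨n, h⟩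

/-- The series Σ exp(-π a n²) at a = 1/(4p²T) - i/(2p) is computed in two ways: by splitting n into
residue classes mod 2p and applying Poisson summation to each class, and by inverting a,
translating, and inverting back. As T → ∞ the point a tends to the rational point -i/(2p), where the
theta series exhibits the Gauss sum. -/
lemma theta_reciprocity (p : ℕ) [NeZero p] {T : ℝ} (hT : 0 < T) :
    ∑ r ∈ Finset.range (2 * p), Complex.exp (Real.pi * Complex.I * r ^ 2 / (2 * p)) *
        ∑' n : ℤ, (Real.exp (-Real.pi * T * (n : ℝ) ^ 2) : ℂ) *
          Complex.exp (Real.pi * Complex.I * n * r / p) =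
      1 / ((1 / (4 * p ^ 2 * T) - Complex.I / (2 * p) : ℂ)) ^ (1 / 2 : ℂ) *
        ((1 + Complex.I / (2 * p * T) : ℂ) ^ (1 / 2 : ℂ) *
        ∑' n : ℤ, (Real.exp (-Real.pi * T * (n : ℝ) ^ 2) : ℂ) *
          Complex.exp (-Real.pi * Complex.I * n ^ 2 / (2 * p))) := by
  have hp : (p : ℂ) ≠ 0 := Nat.cast_ne_zero.2 (NeZero.ne p)
  have hpr : (0 : ℝ) < p := Nat.cast_pos.2 (NeZero.pos p)
  have hTc : (T : ℂ) ≠ 0 := Complex.ofReal_ne_zero.2 hT.ne'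
  set a : ℂ := 1 / (4 * p ^ 2 * T) - Complex.I / (2 * p) with ha
  have hare : 0 < a.re := by
    have : a = ((1 / (4 * p ^ 2 * T) : ℝ) : ℂ) - ((1 / (2 * p) : ℝ) : ℂ) * Complex.I := by
      rw [ha]; push_cast; ring
    rw [this]
    simp only [Complex.sub_re, Complex.ofReal_re, Complex.re_ofReal_mul, Complex.I_re, mul_zero,
      sub_zero]
    positivity
  have ha0 : a ≠ 0 := fun h => by simp [h] at hare
  set b : ℂ := T + Complex.I / (2 * p) with hb
  have hbre : b.re = T := by
    have : b = (T : ℂ) + ((1 / (2 * p) : ℝ) : ℂ) * Complex.I := by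
      rw [hb]; push_cast; ring
    rw [this]
    simp only [Complex.add_re, Complex.ofReal_re, Complex.re_ofReal_mul, Complex.I_re, mul_zero,
      add_zero]
  have hb0 : b ≠ 0 := fun h => by rw [h] at hbre; exact hT.ne hbre
  -- This is the reason for the choice of `a` and `b`: the inverses of the two differ by 2pi, and
  -- exp(-π · 2pi · n²) = 1 for integral n.
  have hab : 1 / a = 2 * p * Complex.I + 1 / b := by
    have h1 : a * (4 * p ^ 2 * T) = 1 - 2 * p * T * Complex.I := by
      rw [ha]; field_simp; ring
    have h2 : b * (2 * p) = 2 * p * T + Complex.I := by rw [hb]; field_simp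
    have h3 : a * (4 * p ^ 2 * T) = - Complex.I * (b * (2 * p)) := by
      rw [h1, h2]; linear_combination Complex.I_mul_I
    have h4 : a * (2 * p * T) = -Complex.I * b := by
      apply mul_right_cancel₀ (mul_ne_zero two_ne_zero hp)
      linear_combination h3
    rw [div_eq_iff ha0]
    have h5 : 2 * p * Complex.I + 1 / b = (2 * p * T * Complex.I) / b := by
      rw [eq_div_iff hb0, add_mul, one_div, inv_mul_cancel₀ hb0]
      linear_combination Complex.I * h2 + Complex.I_mul_I
    rw [h5, div_mul_eq_mul_div, eq_div_iff hb0]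
    linear_combination -Complex.I * h4 + b * Complex.I_mul_I
  -- the theta series at `a`, transformed
  have hR : ∑' n : ℤ, Complex.exp (-Real.pi * a * (n : ℂ) ^ 2) =
      1 / a ^ (1 / 2 : ℂ) * (b ^ (1 / 2 : ℂ) *
        ∑' n : ℤ, (Real.exp (-Real.pi * T * (n : ℝ) ^ 2) : ℂ) *
          Complex.exp (-Real.pi * Complex.I * n ^ 2 / (2 * p))) := by
    rw [Complex.tsum_exp_neg_mul_int_sq hare]
    congr 1
    have h1 : ∀ n : ℤ, Complex.exp (-Real.pi / a * (n : ℂ) ^ 2) =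
        Complex.exp (-Real.pi / b * (n : ℂ) ^ 2) := by
      intro n
      have : (-Real.pi / a * (n : ℂ) ^ 2 : ℂ) = -Real.pi / b * (n : ℂ) ^ 2 +
          (-(p * n ^ 2) : ℤ) * (2 * Real.pi * Complex.I) := by
        rw [div_eq_mul_one_div, hab]; push_cast; ring
      rw [this, Complex.exp_add, exp_int_mul_two_pi _ rfl, mul_one]
    have h2 : ∀ n : ℤ, (Real.exp (-Real.pi * T * (n : ℝ) ^ 2) : ℂ) *
          Complex.exp (-Real.pi * Complex.I * n ^ 2 / (2 * p)) =
        Complex.exp (-Real.pi * b * (n : ℂ) ^ 2) := by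
      intro n
      rw [Complex.ofReal_exp, ← Complex.exp_add, hb]
      congr 1
      push_cast
      ring
    rw [tsum_congr h1, tsum_congr h2, Complex.tsum_exp_neg_mul_int_sq (by rw [hbre]; exact hT),
      ← mul_assoc, mul_one_div, div_self, one_mul]
    rw [Ne, Complex.cpow_eq_zero_iff, not_and_or]
    exact Or.inl hb0
  -- and decomposed into residue classes
  have hs : Summable fun n : ℤ => Complex.exp (-Real.pi * a * (n : ℂ) ^ 2) := by
    have h := (summable_jacobiTheta₂_term_iff 0 (Complex.I * a)).2 (by simpa using hare)
    refine h.congr fun n => ?_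
    rw [jacobiTheta₂_term]
    congr 1
    linear_combination (Real.pi : ℂ) * n ^ 2 * a * Complex.I_mul_I
  have hL : ∑' n : ℤ, Complex.exp (-Real.pi * a * (n : ℂ) ^ 2) =
      (T : ℂ) ^ (1 / 2 : ℂ) * ∑ r ∈ Finset.range (2 * p),
        Complex.exp (Real.pi * Complex.I * r ^ 2 / (2 * p)) *
        ∑' n : ℤ, (Real.exp (-Real.pi * T * (n : ℝ) ^ 2) : ℂ) *
          Complex.exp (Real.pi * Complex.I * n * r / p) := by
    have : NeZero (2 * p) := ⟨mul_ne_zero two_ne_zero (NeZero.ne p)⟩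
    rw [tsum_int_eq_sum_residues (N := 2 * p) hs, Finset.mul_sum]
    refine Finset.sum_congr rfl fun r _ => ?_
    -- In the square of 2pk + r, the imaginary part of `a` multiplies k-dependent terms only into
    -- the integer multiple p k² + k r of 2πi, so the phase depends on r alone.
    have h1 : ∀ k : ℤ, Complex.exp (-Real.pi * a * ((k * (2 * p : ℕ) + r : ℤ) : ℂ) ^ 2) =
        Complex.exp (Real.pi * Complex.I * r ^ 2 / (2 * p) - Real.pi * r ^ 2 / (4 * p ^ 2 * T)) *
        Complex.exp (-Real.pi * (1 / T : ℝ) * k ^ 2 + 2 * Real.pi * (-(r / (2 * p * T))) * k) := by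
      intro k
      have : (-Real.pi * a * ((k * (2 * p : ℕ) + r : ℤ) : ℂ) ^ 2) =
          (Real.pi * Complex.I * r ^ 2 / (2 * p) - Real.pi * r ^ 2 / (4 * p ^ 2 * T)) +
          (-Real.pi * (1 / T : ℝ) * k ^ 2 + 2 * Real.pi * (-(r / (2 * p * T))) * k) +
          (p * k ^ 2 + k * r : ℤ) * (2 * Real.pi * Complex.I) := by
        rw [ha]; push_cast; field_simp; ring
      rw [this, Complex.exp_add, exp_int_mul_two_pi _ rfl, mul_one, Complex.exp_add]
    rw [tsum_congr h1, tsum_mul_left, Complex.tsum_exp_neg_quadratic (by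
      rw [Complex.ofReal_re]; positivity), sub_eq_add_neg, Complex.exp_add]
    have h2 : ∀ n : ℤ, Complex.exp (-Real.pi / (1 / T : ℝ) *
          (n + Complex.I * (-(r / (2 * p * T)))) ^ 2) =
        Complex.exp (Real.pi * r ^ 2 / (4 * p ^ 2 * T)) *
          ((Real.exp (-Real.pi * T * (n : ℝ) ^ 2) : ℂ) *
          Complex.exp (Real.pi * Complex.I * n * r / p)) := by
      intro n
      rw [Complex.ofReal_exp, ← Complex.exp_add, ← Complex.exp_add]
      congr 1
      push_cast
      field_simp
      linear_combination (-4 * (r : ℂ) ^ 2) * Complex.I_sq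
    have h3 : 1 / (((1 / T : ℝ) : ℂ)) ^ (1 / 2 : ℂ) = (T : ℂ) ^ (1 / 2 : ℂ) := by
      have h4 := ofReal_mul_cpow (r := 1 / T) (x := (T : ℂ)) (by positivity) hTc (1 / 2)
      have h5 : ((1 / T : ℝ) : ℂ) * T = 1 := by push_cast; field_simp
      rw [h5, Complex.one_cpow] at h4
      exact (eq_one_div_of_mul_eq_one_right h4.symm).symm
    rw [tsum_congr h2, tsum_mul_left, h3]
    have h6 : Complex.exp (-(Real.pi * r ^ 2 / (4 * p ^ 2 * T))) *
        Complex.exp (Real.pi * r ^ 2 / (4 * p ^ 2 * T)) = 1 := by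
      rw [← Complex.exp_add, neg_add_cancel, Complex.exp_zero]
    linear_combination (Complex.exp (Real.pi * Complex.I * r ^ 2 / (2 * p)) *
      (T : ℂ) ^ (1 / 2 : ℂ) * ∑' n : ℤ, (Real.exp (-Real.pi * T * (n : ℝ) ^ 2) : ℂ) *
          Complex.exp (Real.pi * Complex.I * n * r / p)) * h6
  have hbT : b ^ (1 / 2 : ℂ) = (T : ℂ) ^ (1 / 2 : ℂ) *
      (1 + Complex.I / (2 * p * T)) ^ (1 / 2 : ℂ) := by
    have h1 : b = (T : ℂ) * (1 + Complex.I / (2 * p * T)) := by rw [hb]; field_simp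
    have h2 : (1 + Complex.I / (2 * p * T) : ℂ) ≠ 0 := by
      rintro h; rw [h, mul_zero] at h1; exact hb0 h1
    rw [h1, ofReal_mul_cpow hT h2]
  rw [hR, hbT] at hL
  have hT2 : (T : ℂ) ^ (1 / 2 : ℂ) ≠ 0 := by
    rw [Ne, Complex.cpow_eq_zero_iff, not_and_or]
    exact Or.inl hTc
  apply mul_left_cancel₀ hT2
  rw [← hL]
  ring

/-- The limit T → ∞ of `theta_reciprocity`: each theta series tends to its n = 0 term, which is 1.
-/
lemma gauss_sum_inv (p : ℕ) [NeZero p] :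
    ∑ r ∈ Finset.range (2 * p), Complex.exp (Real.pi * Complex.I * r ^ 2 / (2 * p)) =
      1 / (-Complex.I / (2 * p) : ℂ) ^ (1 / 2 : ℂ) := by
  have hp : (p : ℂ) ≠ 0 := Nat.cast_ne_zero.2 (NeZero.ne p)
  have hpr : (0 : ℝ) < p := Nat.cast_pos.2 (NeZero.pos p)
  have unit : ∀ x : ℝ, ‖Complex.exp (x * Complex.I)‖ ≤ 1 := fun x =>
    (Complex.norm_exp_ofReal_mul_I x).le
  have hL : Tendsto (fun T : ℝ => ∑ r ∈ Finset.range (2 * p),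
      Complex.exp (Real.pi * Complex.I * r ^ 2 / (2 * p)) *
        ∑' n : ℤ, (Real.exp (-Real.pi * T * (n : ℝ) ^ 2) : ℂ) *
          Complex.exp (Real.pi * Complex.I * n * r / p)) atTop
      (𝓝 (∑ r ∈ Finset.range (2 * p),
        Complex.exp (Real.pi * Complex.I * r ^ 2 / (2 * p)) * 1)) := by
    refine tendsto_finsetSum _ fun r _ => (tendsto_theta_series _ (fun n => ?_) ?_).const_mul _
    · convert unit (Real.pi * n * r / p) using 3
      push_cast; ring
    · simp
  have hR1 := tendsto_theta_series
    (fun n : ℤ => Complex.exp (-Real.pi * Complex.I * n ^ 2 / (2 * p))) (fun n => by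
      convert unit (-Real.pi * n ^ 2 / (2 * p)) using 3
      push_cast; ring) (by simp)
  have hinv : Tendsto (fun T : ℝ => (T : ℂ)⁻¹) atTop (𝓝 0) := by
    have := (Complex.continuous_ofReal.tendsto 0).comp tendsto_inv_atTop_zero
    simpa [Function.comp_def] using this
  have hz : (-Complex.I / (2 * p) : ℂ) = ((-(1 / (2 * p)) : ℝ) : ℂ) * Complex.I := by
    push_cast; ring
  have hslit : (-Complex.I / (2 * p) : ℂ) ∈ Complex.slitPlane := by
    refine Or.inr ?_
    rw [hz, Complex.im_ofReal_mul, Complex.I_im, mul_one]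
    have : 0 < 1 / (2 * (p : ℝ)) := by positivity
    linarith
  have hA : Tendsto (fun T : ℝ => (1 / (4 * p ^ 2 * T) - Complex.I / (2 * p) : ℂ) ^ (1 / 2 : ℂ))
      atTop (𝓝 ((-Complex.I / (2 * p) : ℂ) ^ (1 / 2 : ℂ))) := by
    refine ((continuousAt_cpow_const hslit).tendsto).comp ?_
    have := (hinv.const_mul (1 / (4 * p ^ 2) : ℂ)).sub_const (Complex.I / (2 * p))
    refine (this.congr fun T => ?_).trans (by rw [mul_zero, zero_sub, neg_div])
    rw [one_div, one_div, mul_inv, mul_inv, mul_inv]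
  have hB : Tendsto (fun T : ℝ => (1 + Complex.I / (2 * p * T) : ℂ) ^ (1 / 2 : ℂ))
      atTop (𝓝 ((1 : ℂ) ^ (1 / 2 : ℂ))) := by
    refine ((continuousAt_cpow_const (by simp)).tendsto).comp ?_
    have := (hinv.const_mul (Complex.I / (2 * p) : ℂ)).const_add 1
    refine (this.congr fun T => ?_).trans (by rw [mul_zero, add_zero])
    rw [div_mul_eq_div_div_swap, div_eq_mul_inv, div_eq_mul_inv, div_eq_mul_inv]; ring
  have hA0 : (-Complex.I / (2 * p) : ℂ) ^ (1 / 2 : ℂ) ≠ 0 := by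
    rw [Ne, Complex.cpow_eq_zero_iff, not_and_or]
    exact Or.inl (Complex.slitPlane_ne_zero hslit)
  have hR := ((tendsto_const_nhds (x := (1 : ℂ))).div hA hA0).mul (hB.mul hR1)
  have := tendsto_nhds_unique_of_eventuallyEq hL hR (by
    filter_upwards [eventually_gt_atTop (0 : ℝ)] with T hT using theta_reciprocity p hT)
  simpa using this

/-- The quadratic Gauss sum. -/
lemma quadratic_gauss_sum (p : ℕ) [NeZero p] :
    ∑ r ∈ Finset.range (2 * p), Complex.exp (Real.pi * Complex.I * r ^ 2 / (2 * p)) =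
      (√(p : ℝ) : ℝ) * (1 + Complex.I) := by
  have hpr : (0 : ℝ) < p := Nat.cast_pos.2 (NeZero.pos p)
  have hs : 0 < √(p : ℝ) := Real.sqrt_pos.2 hpr
  have hsc : ((√(p : ℝ) : ℝ) : ℂ) ≠ 0 := Complex.ofReal_ne_zero.2 hs.ne'
  have hsq : ((√(p : ℝ) : ℝ) : ℂ) ^ 2 = p := by
    rw [← Complex.ofReal_pow, Real.sq_sqrt hpr.le, Complex.ofReal_natCast]
  -- The square root of -i/(2p) with positive real part, that is, the value of the principal branch.
  set x : ℂ := ((1 / (2 * √(p : ℝ)) : ℝ) : ℂ) * (1 - Complex.I) with hx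
  have hx2 : (-Complex.I / (2 * p) : ℂ) = x ^ 2 := by
    rw [hx, ← hsq]
    push_cast
    field_simp
    linear_combination (-1 : ℂ) * Complex.I_sq
  have hre : 0 < x.re := by
    rw [hx, Complex.re_ofReal_mul]
    simp only [Complex.sub_re, Complex.one_re, Complex.I_re, sub_zero, mul_one]
    positivity
  rw [gauss_sum_inv, hx2, one_div 2, Complex.sq_cpow_two_inv hre, hx, one_div,
    inv_eq_of_mul_eq_one_left]
  push_cast
  field_simp
  linear_combination (-1 : ℂ) * Complex.I_sq
end Gauss

/-! ### Powers of k, weight projectors, and the Cartan part of the R-matrix. -/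

section torus

variable {A : Type*} [Ring A]

/-- Integer powers of a unit, as elements of the ring. -/
def zp (k : Aˣ) (n : ℤ) : A := ((k ^ n : Aˣ) : A)

lemma zp_add (k : Aˣ) (m n : ℤ) : zp k (m + n) = zp k m * zp k n := by
  simp [zp, zpow_add]

lemma zp_zero (k : Aˣ) : zp k 0 = 1 := by simp [zp]

lemma zp_natCast (k : Aˣ) (n : ℕ) : zp k n = (k : A) ^ n := by simp [zp]

lemma zp_one (k : Aˣ) : zp k 1 = k := by simp [zp]

lemma zp_pow (k : Aˣ) (n : ℤ) (m : ℕ) : zp k n ^ m = zp k (n * m) := by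
  simp [zp, zpow_mul]

lemma zp_mul_neg (k : Aˣ) (n : ℤ) : zp k n * zp k (-n) = 1 := by
  rw [← zp_add, add_neg_cancel, zp_zero]

lemma zp_neg_mul (k : Aˣ) (n : ℤ) : zp k (-n) * zp k n = 1 := by
  rw [← zp_add, neg_add_cancel, zp_zero]

lemma zp_comm (k : Aˣ) (m n : ℤ) : zp k m * zp k n = zp k n * zp k m := by
  rw [← zp_add, ← zp_add, add_comm]

variable [Algebra ℂ A] {p : ℕ} {k : Aˣ}

omit [Algebra ℂ A] in
lemma zp_add_period {N : ℕ} (hk : (k : A) ^ N = 1) (n : ℤ) : zp k (n + N) = zp k n := by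
  rw [zp_add, zp_natCast, hk, mul_one]

lemma zp_mul_of_comm {a : ℂ} {x : A} (h : (k : A) * x = qpow p a • (x * k)) (n : ℤ) :
    zp k n * x = qpow p (a * n) • (x * zp k n) := by
  induction n using Int.induction_on with
  | zero => simp [zp_zero, qpow_zero]
  | succ n ih =>
    rw [zp_add, zp_one, mul_assoc, h, mul_smul_comm, ← mul_assoc, ih, smul_mul_assoc, smul_smul,
      ← qpow_add, mul_assoc]
    congr 2
    push_cast; ring
  | pred n ih =>
    have h1 : zp k (-1) * x = qpow p (-a) • (x * zp k (-1)) := by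
      have e : zp k (-1) * ((k : A) * x) * zp k (-1) = x * zp k (-1) := by
        rw [← mul_assoc, ← zp_one k, zp_neg_mul, one_mul]
      rw [h, mul_smul_comm, smul_mul_assoc, mul_assoc, mul_assoc, ← zp_one k, zp_mul_neg,
        mul_one] at e
      rw [← e, smul_smul, ← qpow_add, neg_add_cancel, qpow_zero, one_smul]
    rw [sub_eq_add_neg, zp_add, mul_assoc, h1, mul_smul_comm, ← mul_assoc, ih, smul_mul_assoc,
      smul_smul, ← qpow_add, mul_assoc]
    congr 2
    push_cast; ring

variable [NeZero p]

/-- The projector on the subspace where `k` acts by `q ^ (s / 2)`. -/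
def idem (p : ℕ) (k : Aˣ) (s : ℤ) : A :=
  (1 / (4 * p) : ℂ) • ∑ j ∈ Finset.range (4 * p), qpow p (-(s * j) / 2) • zp k j

lemma qpow_half_periodic (p : ℕ) [NeZero p] (s n : ℤ) :
    qpow p (s * ((n + (4 * p : ℕ) : ℤ) : ℂ) / 2) = qpow p (s * n / 2) := by
  rw [← mul_one (qpow p (s * n / 2)), ← qpow_two_p_int p s, ← qpow_add]
  congr 1; push_cast; ring

/-- Multiplication by a power of `k` translates the Fourier sum, whose summand has period `4 * p`;
only a phase comes out. -/
lemma zp_mul_idem (hk : (k : A) ^ (4 * p) = 1) (s n : ℤ) :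
    zp k n * idem p k s = qpow p (s * n / 2) • idem p k s := by
  rw [idem, mul_smul_comm, Finset.mul_sum, smul_comm]
  congr 1
  have hf : ∀ j : ℤ, qpow p ((-s : ℤ) * (j + (4 * p : ℕ) : ℤ) / 2) • zp k (j + (4 * p : ℕ)) =
      qpow p ((-s : ℤ) * j / 2) • zp k j := fun j => by
    rw [qpow_half_periodic, zp_add_period hk]
  have h := sum_range_shift (f := fun j : ℤ => qpow p ((-s : ℤ) * j / 2) • zp k j) hf n
  rw [Finset.smul_sum]
  have e : ∀ j ∈ Finset.range (4 * p), qpow p (-(s * j) / 2) • zp k j =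
    qpow p ((-s : ℤ) * (j : ℤ) / 2) • zp k j := fun j _ => by
      congr 2; push_cast; ring
  rw [← Finset.smul_sum, Finset.sum_congr rfl e, ← h, Finset.smul_sum]
  refine Finset.sum_congr rfl fun j _ => ?_
  rw [mul_smul_comm, ← zp_add, smul_smul, ← qpow_add, add_comm n]
  congr 2
  push_cast; ring

/-- Summing the characters over `s` kills every power of `k` except the zeroth. -/
lemma idem_sum (p : ℕ) [NeZero p] (k : Aˣ) : ∑ s ∈ Finset.range (4 * p), idem p k s = 1 := by
  have hp := cast_ne p
  have e : ∀ j ∈ Finset.range (4 * p), ∑ s ∈ Finset.range (4 * p),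
      qpow p (-(((s : ℤ) : ℂ) * j) / 2) • zp k j = if j = 0 then (4 * p : ℂ) • (1 : A) else 0 := by
    intro j hj
    have h := sum_qpow_half p (-j)
    rw [← Finset.sum_smul]
    have h2 : ∀ s ∈ Finset.range (4 * p), qpow p (-(((s : ℤ) : ℂ) * j) / 2) =
      qpow p ((-j : ℤ) * s / 2) := fun s _ => by
        congr 1; push_cast; ring
    rw [Finset.sum_congr rfl h2, h]
    have h3 : (4 * p : ℤ) ∣ -(j : ℤ) ↔ j = 0 := by
      rw [dvd_neg]
      constructor
      · intro hd
        by_contra h0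
        have := Int.le_of_dvd (by omega) hd
        have := Finset.mem_range.1 hj
        omega
      · rintro rfl; simp
    simp only [h3]
    split_ifs with h0
    · rw [h0]; simp [zp_zero]
    · simp
  simp only [idem]
  rw [← Finset.smul_sum, Finset.sum_comm, Finset.sum_congr rfl e]
  rw [Finset.sum_ite_eq', if_pos (by simp [NeZero.pos p]), smul_smul]
  rw [one_div, inv_mul_cancel₀ (by simpa using hp), one_smul]

lemma idem_mul_idem (hk : (k : A) ^ (4 * p) = 1) (t s : ℤ) :
    idem p k t * idem p k s = if (4 * p : ℤ) ∣ s - t then idem p k s else 0 := by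
  have hp := cast_ne p
  conv_lhs => rw [idem]
  rw [smul_mul_assoc, Finset.sum_mul]
  have e : ∀ j ∈ Finset.range (4 * p), qpow p (-(t * j) / 2) • zp k j * idem p k s =
      qpow p ((s - t : ℤ) * j / 2) • idem p k s := fun j _ => by
    rw [smul_mul_assoc, zp_mul_idem hk, smul_smul, ← qpow_add]
    congr 2; push_cast; ring
  rw [Finset.sum_congr rfl e, ← Finset.sum_smul, sum_qpow_half]
  split_ifs
  · rw [smul_smul, one_div, inv_mul_cancel₀ (by simpa using hp), one_smul]
  · simp

lemma idem_mul_idem_range (hk : (k : A) ^ (4 * p) = 1) {t s : ℕ} (ht : t < 4 * p) (hs : s < 4 * p) :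
    idem p k t * idem p k s = if t = s then idem p k s else 0 := by
  rw [idem_mul_idem hk]
  have : (4 * p : ℤ) ∣ s - t ↔ t = s := by
    constructor
    · intro h
      have h2 := (Int.natCast_modEq_iff (a := t) (b := s) (n := 4 * p)).1
        ((Int.modEq_iff_dvd).2 (by exact_mod_cast h))
      exact Nat.ModEq.eq_of_lt_of_lt h2 ht hs
    · rintro rfl; simp
  simp only [this]

lemma idem_periodic (p : ℕ) [NeZero p] (k : Aˣ) (s : ℤ) :
    idem p k (s + (4 * p : ℕ)) = idem p k s := by
  rw [idem, idem]
  congr 1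
  refine Finset.sum_congr rfl fun j _ => ?_
  congr 1
  have := qpow_half_periodic p (-j) s
  refine Eq.trans ?_ (this.trans ?_) <;> congr 1 <;> push_cast <;> ring

omit [NeZero p] in
-- The label `s` stands for the eigenvalue q^(s/2), so an element that rescales this eigenvalue by
-- q^a moves the label by 2a.
lemma idem_mul_of_comm {a : ℤ} {x : A} (h : (k : A) * x = qpow p a • (x * k)) (s : ℤ) :
    idem p k s * x = x * idem p k (s - 2 * a) := by
  rw [idem, idem, smul_mul_assoc, mul_smul_comm, Finset.sum_mul, Finset.mul_sum]
  congr 1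
  refine Finset.sum_congr rfl fun j _ => ?_
  rw [smul_mul_assoc, zp_mul_of_comm h, mul_smul_comm, smul_smul, ← qpow_add]
  congr 2
  push_cast; ring

/-- The Cartan part of the `R`-matrix. -/
def cartan (p : ℕ) (k : Aˣ) : A ⊗[ℂ] A := ∑ n ∈ Finset.range (4 * p), zp k n ⊗ₜ[ℂ] idem p k n

/-- The double sum is symmetric in the two legs, which allows the projectors to be placed in either
leg. -/
lemma cartan_eq (p : ℕ) (k : Aˣ) : cartan p k = (1 / (4 * p) : ℂ) •
    ∑ n ∈ Finset.range (4 * p), ∑ j ∈ Finset.range (4 * p),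
      qpow p (-((n : ℂ) * j) / 2) • (zp k n ⊗ₜ[ℂ] zp k j) := by
  rw [cartan, Finset.smul_sum]
  refine Finset.sum_congr rfl fun n _ => ?_
  simp only [idem, TensorProduct.tmul_smul, TensorProduct.tmul_sum, Int.cast_natCast]

lemma cartan_eq' (p : ℕ) (k : Aˣ) :
    cartan p k = ∑ n ∈ Finset.range (4 * p), idem p k n ⊗ₜ[ℂ] zp k n := by
  rw [cartan_eq, Finset.sum_comm, Finset.smul_sum]
  refine Finset.sum_congr rfl fun n _ => ?_
  simp only [idem, ← TensorProduct.smul_tmul', TensorProduct.sum_tmul, Int.cast_natCast]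
  congr 1
  refine Finset.sum_congr rfl fun j _ => ?_
  rw [mul_comm]

/-- The inverse of the Cartan part. -/
def cartanInv (p : ℕ) (k : Aˣ) : A ⊗[ℂ] A :=
  ∑ n ∈ Finset.range (4 * p), zp k (-n) ⊗ₜ[ℂ] idem p k n

/-- Orthogonality of the projectors makes multiplication termwise. Invertibility, coproduct and
square of the Cartan part all come from this. -/
lemma sum_tmul_idem_mul {B : Type*} [Ring B] [Algebra ℂ B] (hk : (k : A) ^ (4 * p) = 1) (x y : ℕ → B) :
    (∑ n ∈ Finset.range (4 * p), x n ⊗ₜ[ℂ] idem p k n) *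
      (∑ n ∈ Finset.range (4 * p), y n ⊗ₜ[ℂ] idem p k n) =
    ∑ n ∈ Finset.range (4 * p), (x n * y n) ⊗ₜ[ℂ] idem p k n := by
  rw [Finset.sum_mul]
  refine Finset.sum_congr rfl fun n hn => ?_
  rw [Finset.mul_sum, Finset.sum_eq_single_of_mem n hn]
  · rw [Algebra.TensorProduct.tmul_mul_tmul, idem_mul_idem_range hk (Finset.mem_range.1 hn)
      (Finset.mem_range.1 hn), if_pos rfl]
  · intro m hm hmn
    rw [Algebra.TensorProduct.tmul_mul_tmul, idem_mul_idem_range hk (Finset.mem_range.1 hn)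
      (Finset.mem_range.1 hm), if_neg (Ne.symm hmn), TensorProduct.tmul_zero]

lemma cartan_mul_inv (hk : (k : A) ^ (4 * p) = 1) : cartan p k * cartanInv p k = 1 := by
  rw [cartan, cartanInv, sum_tmul_idem_mul hk]
  simp only [zp_mul_neg]
  rw [← TensorProduct.tmul_sum, idem_sum, Algebra.TensorProduct.one_def]

lemma cartanInv_mul (hk : (k : A) ^ (4 * p) = 1) : cartanInv p k * cartan p k = 1 := by
  rw [cartan, cartanInv, sum_tmul_idem_mul hk]
  simp only [zp_neg_mul]
  rw [← TensorProduct.tmul_sum, idem_sum, Algebra.TensorProduct.one_def]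

lemma idem_tmul_periodic (hk : (k : A) ^ (4 * p) = 1) (n : ℤ) :
    zp k (n + (4 * p : ℕ)) ⊗ₜ[ℂ] idem p k (n + (4 * p : ℕ)) = zp k n ⊗ₜ[ℂ] idem p k n := by
  rw [zp_add_period hk, idem_periodic]

/-- The element `x` moves the weight in the second leg by `2 * a`; reindexing the sum shifts the
power of `k` in the first leg by the same amount. -/
lemma cartan_mul_right (hk : (k : A) ^ (4 * p) = 1) {a : ℤ} {x : A}
    (h : (k : A) * x = qpow p a • (x * k)) :
    cartan p k * (1 ⊗ₜ[ℂ] x) = (zp k (2 * a) ⊗ₜ[ℂ] x) * cartan p k := by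
  have hs := sum_range_shift (f := fun n => zp k n ⊗ₜ[ℂ] idem p k n) (idem_tmul_periodic hk) (-(2 * a))
  nth_rewrite 2 [cartan]
  rw [← hs, cartan, Finset.sum_mul, Finset.mul_sum]
  refine Finset.sum_congr rfl fun n _ => ?_
  rw [Algebra.TensorProduct.tmul_mul_tmul, Algebra.TensorProduct.tmul_mul_tmul, mul_one,
    idem_mul_of_comm h, ← zp_add]
  congr 2
  ring

lemma cartan_mul_left (hk : (k : A) ^ (4 * p) = 1) {a : ℤ} {x : A}
    (h : (k : A) * x = qpow p a • (x * k)) :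
    cartan p k * (x ⊗ₜ[ℂ] 1) = (x ⊗ₜ[ℂ] zp k (2 * a)) * cartan p k := by
  have hs := sum_range_shift (f := fun n => idem p k n ⊗ₜ[ℂ] zp k n) (N := 4 * p)
    (fun n => by simp only [zp_add_period hk, idem_periodic]) (-(2 * a))
  rw [cartan_eq']
  nth_rewrite 2 [← hs]
  rw [Finset.sum_mul, Finset.mul_sum]
  refine Finset.sum_congr rfl fun n _ => ?_
  simp only [Algebra.TensorProduct.tmul_mul_tmul, mul_one]
  rw [idem_mul_of_comm h, ← zp_add]
  congr 2
  ring

end torus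

/-! ### The truncated q-exponential. -/

section qexp

variable (p : ℕ) [NeZero p]

/-- The coefficients `(q - q⁻¹)^m q^(m(m-1)/2) / [m]!` of the `q`-exponential. -/
def rc (m : ℕ) : ℂ :=
  (qpow p 1 - qpow p (-1)) ^ m / qFactorial p m * qpow p ((m : ℂ) * (m - 1) / 2)

omit [NeZero p] in
lemma rc_zero : rc p 0 = 1 := by simp [rc, qFactorial_zero, qpow_zero]

lemma rc_succ (hp : 2 ≤ p) {m : ℕ} (hm : m + 1 < p) :
    rc p (m + 1) * qInt p (m + 1 : ℕ) = rc p m * (qpow p 1 - qpow p (-1)) * qpow p m := by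
  have h1 := qInt_ne_zero p hp (m := m + 1) (by omega) hm
  have h2 := qFactorial_ne_zero p hp (m := m) (by omega)
  have e : qpow p (((m + 1 : ℕ) : ℂ) * ((m + 1 : ℕ) - 1) / 2) =
      qpow p ((m : ℂ) * (m - 1) / 2) * qpow p m := by
    rw [← qpow_add]; congr 1; push_cast; ring
  rw [rc, rc, qFactorial_succ, e, pow_succ]
  field_simp

lemma one_sub_qpow (hp : 2 ≤ p) (m : ℕ) :
    1 - qpow p (-2) ^ m = qpow p (-m) * (qInt p m * (qpow p 1 - qpow p (-1))) := by
  rw [qInt_mul p hp, mul_sub, ← qpow_add, ← qpow_add, qpow_pow, neg_add_cancel, qpow_zero]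
  congr 2
  ring

/-- Up to normalization `rc` is an inverse q-factorial. The identity is the coefficient form of the
functional equation of the q-exponential, and follows by induction from the absorption identity for
Gaussian binomials. -/
lemma gaussBinom_mul_rc (hp : 2 ≤ p) (l : ℕ) : ∀ k, k + l < p →
    gaussBinom (qpow p (-2)) (k + l) k * rc p (k + l) = rc p k * rc p l := by
  intro k
  induction k with
  | zero => intro _; simp [gaussBinom_zero_right, rc_zero]
  | succ k ih =>
    intro h
    have ih := ih (by omega)
    have h1 := gaussBinom_absorb (qpow p (-2)) (k + l) k
    have h2 := rc_succ p hp (m := k + l) (by omega)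
    have h3 := rc_succ p hp (m := k) (by omega)
    have n1 := qInt_ne_zero p hp (m := k + 1) (by omega) (by omega)
    have n2 := qInt_ne_zero p hp (m := k + l + 1) (by omega) (by omega)
    have hq := qdiff_ne_zero p hp
    rw [one_sub_qpow p hp, one_sub_qpow p hp] at h1
    rw [show k + 1 + l = k + l + 1 by ring]
    have e1 : qpow p (-(k + 1 : ℕ)) = qpow p (-k) * qpow p (-1) := by
      rw [← qpow_add]; congr 1; push_cast; ring
    have e2 : qpow p (-(k + l + 1 : ℕ)) = qpow p (-(k + l : ℕ)) * qpow p (-1) := by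
      rw [← qpow_add]; congr 1; push_cast; ring
    rw [e1, e2] at h1
    generalize qpow p (-2) = w at h1 ih ⊢
    simp only [qpow_neg] at h1 h2 h3 hq
    have z1 := qpow_ne_zero p 1
    have z2 := qpow_ne_zero p k
    have z3 := qpow_ne_zero p (k + l : ℕ)
    set Q := qpow p 1 - (qpow p 1)⁻¹
    apply mul_right_cancel₀ (mul_ne_zero n1 n2)
    have h4 : qInt p (k + 1 : ℕ) * gaussBinom w (k + l + 1) (k + 1) *
        qpow p (k + l : ℕ) = qInt p (k + l + 1 : ℕ) * gaussBinom w (k + l) k *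
          qpow p k := by
      field_simp at h1
      linear_combination h1
    calc _ = qInt p (k + 1 : ℕ) * gaussBinom w (k + l + 1) (k + 1) *
          (rc p (k + l + 1) * qInt p (k + l + 1 : ℕ)) := by ring
      _ = (qInt p (k + 1 : ℕ) * gaussBinom w (k + l + 1) (k + 1) *
          qpow p (k + l : ℕ)) * rc p (k + l) * Q := by rw [h2]; ring
      _ = (gaussBinom w (k + l) k * rc p (k + l)) * qInt p (k + l + 1 : ℕ) *
          qpow p k * Q := by rw [h4]; ring
      _ = (rc p k * Q * qpow p k) * rc p l * qInt p (k + l + 1 : ℕ) := by rw [ih]; ring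
      _ = _ := by rw [← h3]; ring

variable {T : Type*} [Ring T] [Algebra ℂ T] {T' : Type*} [Ring T'] [Algebra ℂ T']

/-- The truncated `q`-exponential. -/
def qexp (z : T) : T := ∑ m ∈ Finset.range p, rc p m • z ^ m

omit [NeZero p] in
lemma map_qexp (f : T →ₐ[ℂ] T') (z : T) : f (qexp p z) = qexp p (f z) := by
  simp [qexp]

omit [NeZero p] in
lemma qexp_semiconj {z c x : T} (h : z * c = c * x) : qexp p z * c = c * qexp p x := by
  have h' : SemiconjBy c x z := h.symm
  rw [qexp, qexp, Finset.sum_mul, Finset.mul_sum]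
  refine Finset.sum_congr rfl fun m _ => ?_
  rw [smul_mul_assoc, mul_smul_comm, ← (h'.pow_right m).eq]

/-- The q-binomial theorem turns the left side into a sum over total degree below `p`; the right
side has in addition the terms with a + b ≥ p, and these vanish by `h0`. -/
lemma qexp_add (hp : 2 ≤ p) {x y : T} (h : y * x = qpow p (-2) • (x * y))
    (h0 : ∀ a b, p ≤ a + b → x ^ a * y ^ b = 0) : qexp p (x + y) = qexp p x * qexp p y := by
  have e1 : qexp p (x + y) = ∑ n ∈ Finset.range p, ∑ k ∈ Finset.range (n + 1),
      (rc p k * rc p (n - k)) • (x ^ k * y ^ (n - k)) := by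
    refine Finset.sum_congr rfl fun n hn => ?_
    rw [q_binomial h, Finset.smul_sum]
    refine Finset.sum_congr rfl fun k hk => ?_
    have hn := Finset.mem_range.1 hn
    have hk := Finset.mem_range.1 hk
    have := gaussBinom_mul_rc p hp (n - k) k (by omega)
    rw [show k + (n - k) = n by omega] at this
    rw [smul_smul, ← this, mul_comm]
  rw [e1, Finset.sum_range_diag_flip p (fun k l => (rc p k * rc p l) • (x ^ k * y ^ l)), qexp,
    Finset.sum_mul]
  refine Finset.sum_congr rfl fun a ha => ?_
  rw [qexp, Finset.mul_sum]
  have hsub : Finset.range (p - a) ⊆ Finset.range p := Finset.range_subset_range.2 (by omega)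
  rw [← Finset.sum_subset hsub]
  · refine Finset.sum_congr rfl fun b _ => ?_
    rw [smul_mul_smul_comm]
  · intro b _ hb
    have hb : ¬ b < p - a := fun h => hb (Finset.mem_range.2 h)
    rw [smul_mul_smul_comm, h0 a b (by omega), smul_zero]

omit [NeZero p] in
-- The constant term is 1 and the rest is a multiple of the nilpotent `z` by an element commuting
-- with it. For p = 0 the hypothesis reads 1 = 0 and the ring is trivial.
lemma isUnit_qexp {z : T} (hz : z ^ p = 0) : IsUnit (qexp p z) := by
  cases p with
  | zero =>
    rw [pow_zero] at hz
    have := subsingleton_of_zero_eq_one hz.symm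
    exact isUnit_of_subsingleton _
  | succ P =>
    rw [qexp, Finset.sum_range_succ', rc_zero, pow_zero, one_smul, add_comm]
    refine IsNilpotent.isUnit_one_add ⟨P + 1, ?_⟩
    have : ∑ k ∈ Finset.range P, rc (P + 1) (k + 1) • z ^ (k + 1) =
        z * ∑ k ∈ Finset.range P, rc (P + 1) (k + 1) • z ^ k := by
      rw [Finset.mul_sum]
      refine Finset.sum_congr rfl fun k _ => ?_
      rw [mul_smul_comm, pow_succ']
    rw [this, Commute.mul_pow, hz, zero_mul]
    exact Commute.sum_right _ _ _ fun k _ => ((Commute.refl z).pow_right k).smul_right _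

end qexp

section more_cartan

variable {A : Type*} [Ring A] [Algebra ℂ A] {p : ℕ} {k : Aˣ} [NeZero p]

lemma cartan_mul_tmul (hk : (k : A) ^ (4 * p) = 1) {a b : ℤ} {x y : A}
    (hx : (k : A) * x = qpow p a • (x * k)) (hy : (k : A) * y = qpow p b • (y * k)) :
    cartan p k * (x ⊗ₜ[ℂ] y) = ((x * zp k (2 * b)) ⊗ₜ[ℂ] (zp k (2 * a) * y)) * cartan p k := by
  have e : x ⊗ₜ[ℂ] y = (x ⊗ₜ[ℂ] 1) * (1 ⊗ₜ[ℂ] y) := by simp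
  rw [e, ← mul_assoc, cartan_mul_left hk hx, mul_assoc, cartan_mul_right hk hy, ← mul_assoc]
  simp

lemma sum_idem_tmul_mul {B : Type*} [Ring B] [Algebra ℂ B] (hk : (k : A) ^ (4 * p) = 1) (x y : ℕ → B) :
    (∑ n ∈ Finset.range (4 * p), idem p k n ⊗ₜ[ℂ] x n) *
      (∑ n ∈ Finset.range (4 * p), idem p k n ⊗ₜ[ℂ] y n) =
    ∑ n ∈ Finset.range (4 * p), idem p k n ⊗ₜ[ℂ] (x n * y n) := by
  rw [Finset.sum_mul]
  refine Finset.sum_congr rfl fun n hn => ?_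
  rw [Finset.mul_sum, Finset.sum_eq_single_of_mem n hn]
  · rw [Algebra.TensorProduct.tmul_mul_tmul, idem_mul_idem_range hk (Finset.mem_range.1 hn)
      (Finset.mem_range.1 hn), if_pos rfl]
  · intro m hm hmn
    rw [Algebra.TensorProduct.tmul_mul_tmul, idem_mul_idem_range hk (Finset.mem_range.1 hn)
      (Finset.mem_range.1 hm), if_neg (Ne.symm hmn), TensorProduct.zero_tmul]

end more_cartan

/-! ### The unit k of `DBar` and the factorization of the R-matrix. -/

namespace DBar

variable {p : ℕ} [NeZero p]

/-- The generator `K` as a unit. -/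
def Ku (p : ℕ) [NeZero p] : (DBar p)ˣ where
  val := K p
  inv := K p ^ (4 * p - 1)
  val_inv := (rel p).kinv' (by simpa using NeZero.ne p)
  inv_val := (rel p).kinv (by simpa using NeZero.ne p)

lemma Ku_val : ((Ku p : (DBar p)ˣ) : DBar p) = K p := rfl

lemma Ku_pow : ((Ku p : (DBar p)ˣ) : DBar p) ^ (4 * p) = 1 := (rel p).k_pow

lemma Ku_E : ((Ku p : (DBar p)ˣ) : DBar p) * E p = qpow p ((1 : ℤ) : ℂ) • (E p * (Ku p : (DBar p)ˣ)) := by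
  rw [Int.cast_one]; exact (rel p).ke

lemma Ku_F : ((Ku p : (DBar p)ˣ) : DBar p) * F p = qpow p ((-1 : ℤ) : ℂ) • (F p * (Ku p : (DBar p)ˣ)) := by
  rw [Int.cast_neg, Int.cast_one]; exact (rel p).kf

lemma Ku_zp (n : ℤ) : ((Ku p : (DBar p)ˣ) : DBar p) * zp (Ku p) n =
    qpow p ((0 : ℤ) : ℂ) • (zp (Ku p) n * (Ku p : (DBar p)ˣ)) := by
  rw [Int.cast_zero, qpow_zero, one_smul, ← zp_one, zp_comm]

lemma K_pow_eq (n : ℕ) : K p ^ n = zp (Ku p) n := by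
  rw [zp_natCast, Ku_val]

lemma K_sq : K p ^ 2 = zp (Ku p) 2 := K_pow_eq 2

lemma zp_Ku_add (n : ℤ) : zp (Ku p) (n + (4 * p : ℕ)) = zp (Ku p) n := zp_add_period Ku_pow n

lemma K_pow_sub (a : ℕ) (h : a ≤ 4 * p) : K p ^ (4 * p - a) = zp (Ku p) (-a) := by
  rw [K_pow_eq, ← zp_Ku_add (-(a : ℤ)), Nat.cast_sub h, neg_add_eq_sub]

lemma four_p_ge : 4 ≤ 4 * p := by
  have := NeZero.one_le (n := p)
  omega

lemma K_inv_sq : K p ^ (4 * p - 2) = zp (Ku p) (-2) := K_pow_sub 2 (by have := four_p_ge (p := p); omega)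

lemma K_inv : K p ^ (4 * p - 1) = zp (Ku p) (-1) := K_pow_sub 1 (by have := four_p_ge (p := p); omega)

lemma EF : E p * F p - F p * E p =
    (qpow p 1 - qpow p (-1))⁻¹ • (zp (Ku p) 2 - zp (Ku p) (-2)) := by
  have := (rel p).ef
  rw [K_sq] at this
  rw [this, ← K_inv_sq]

lemma comul_E' : Coalgebra.comul (R := ℂ) (E p) = 1 ⊗ₜ[ℂ] E p + E p ⊗ₜ[ℂ] zp (Ku p) 2 := by
  rw [comul_E, K_sq]

lemma comul_F' : Coalgebra.comul (R := ℂ) (F p) = zp (Ku p) (-2) ⊗ₜ[ℂ] F p + F p ⊗ₜ[ℂ] 1 := by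
  rw [comul_F, K_inv_sq]

lemma exists_nat_zp (n : ℤ) : ∃ m : ℕ, zp (Ku p) n = K p ^ m := by
  have h4 := four_p_ge (p := p)
  refine ⟨(n % (4 * p : ℕ)).toNat, ?_⟩
  rw [K_pow_eq, Int.toNat_of_nonneg (Int.emod_nonneg _ (by omega))]
  have : n = n % (4 * p : ℕ) + (4 * p : ℕ) * (n / (4 * p : ℕ)) := (Int.emod_add_mul_ediv n _).symm
  conv_lhs => rw [this, zp_add]
  have h1 : zp (Ku p) ((4 * p : ℕ) * (n / (4 * p : ℕ))) = 1 := by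
    have : (Ku p) ^ (4 * p) = 1 := Units.ext (by rw [Units.val_pow_eq_pow_val, Ku_pow]; rfl)
    rw [zp, zpow_mul, zpow_natCast, this, one_zpow]; rfl
  rw [h1, mul_one]

lemma comul_zp (n : ℤ) : Coalgebra.comul (R := ℂ) (zp (Ku p) n) =
    zp (Ku p) n ⊗ₜ[ℂ] zp (Ku p) n := by
  obtain ⟨m, hm⟩ := exists_nat_zp (p := p) n
  rw [hm, Bialgebra.comul_pow, comul_K, Algebra.TensorProduct.tmul_pow]

lemma counit_zp (n : ℤ) : Coalgebra.counit (R := ℂ) (zp (Ku p) n) = 1 := by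
  obtain ⟨m, hm⟩ := exists_nat_zp (p := p) n
  rw [hm, Bialgebra.counit_pow, counit_K, one_pow]

lemma zp_E (n : ℤ) : zp (Ku p) n * E p = qpow p n • (E p * zp (Ku p) n) := by
  rw [zp_mul_of_comm Ku_E]; simp

lemma zp_F (n : ℤ) : zp (Ku p) n * F p = qpow p (-n) • (F p * zp (Ku p) n) := by
  rw [zp_mul_of_comm Ku_F]; simp

lemma zp_E_pow (n : ℤ) (m : ℕ) : zp (Ku p) n * E p ^ m = qpow p (n * m) • (E p ^ m * zp (Ku p) n) := by
  rw [qcomm_pow (zp_E n), qpow_pow, mul_comm (m : ℂ)]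

lemma zp_F_pow (n : ℤ) (m : ℕ) :
    zp (Ku p) n * F p ^ m = qpow p (-(n * m)) • (F p ^ m * zp (Ku p) n) := by
  rw [qcomm_pow (zp_F n), qpow_pow]
  congr 2; ring

/-- Moving K^n ⊗ K^j to the right of E^m ⊗ F^m costs q^(m(n-j)), which is the mixed term in the
exponent of the explicit formula. -/
lemma Rbar_eq (p : ℕ) [NeZero p] : Rbar p = cartan p (Ku p) * qexp p (E p ⊗ₜ[ℂ] F p) := by
  rw [cartan_eq, smul_mul_assoc, Rbar, qexp, Finset.mul_sum]
  congr 1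
  refine Finset.sum_congr rfl fun m _ => ?_
  rw [Finset.sum_mul]
  refine Finset.sum_congr rfl fun n _ => ?_
  rw [Finset.sum_mul]
  refine Finset.sum_congr rfl fun j _ => ?_
  rw [Algebra.TensorProduct.tmul_pow, smul_mul_smul_comm, Algebra.TensorProduct.tmul_mul_tmul,
    zp_E_pow, zp_F_pow, TensorProduct.smul_tmul_smul, smul_smul, K_pow_eq, K_pow_eq, rc]
  congr 1
  have : qpow p ((m : ℂ) * (m - 1) / 2 + m * ((n : ℂ) - j) - (n : ℂ) * j / 2) =
      qpow p ((m : ℂ) * (m - 1) / 2) * qpow p (-((n : ℂ) * j) / 2) *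
        (qpow p ((n : ℤ) * m) * qpow p (-((j : ℤ) * m))) := by
    rw [← qpow_add, ← qpow_add, ← qpow_add]; congr 1; push_cast; ring
  rw [this]; ring

end DBar

section

variable (p : ℕ) [NeZero p] {A : Type*} [Ring A] [Algebra ℂ A]

/-- Reindexing for commutators with the truncated `q`-exponential. -/
lemma sum_rc_telescope {T : Type*} [AddCommGroup T] [Module ℂ T] (hp : 2 ≤ p) {U V : ℕ → T}
    (hU : U 0 = 0) (hV : V (p - 1) = 0)
    (h : ∀ m, m + 1 < p → rc p (m + 1) • U (m + 1) = rc p m • V m) :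
    ∑ m ∈ Finset.range p, rc p m • U m = ∑ m ∈ Finset.range p, rc p m • V m := by
  obtain ⟨P, rfl⟩ : ∃ P, p = P + 1 := ⟨p - 1, by omega⟩
  rw [Finset.sum_range_succ', Finset.sum_range_succ (fun m => rc (P + 1) m • V m), hU]
  rw [Nat.add_sub_cancel] at hV
  rw [hV, smul_zero, smul_zero, add_zero, add_zero]
  refine Finset.sum_congr rfl fun m hm => h m ?_
  have := Finset.mem_range.1 hm
  omega

end

/-! ### Quasitriangularity of `DBar`. -/

namespace DBar

variable {p : ℕ} [NeZero p]

lemma E_F_pow (hp : 2 ≤ p) (m : ℕ) : E p * F p ^ (m + 1) - F p ^ (m + 1) * E p =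
    ((qpow p 1 - qpow p (-1))⁻¹ * qInt p (m + 1 : ℕ)) •
      (F p ^ m * (qpow p (-m) • zp (Ku p) 2 - qpow p m • zp (Ku p) (-2))) := by
  rw [e_mul_f_pow p hp (EF (p := p))]
  · abel
  · rw [zp_F]; norm_num
  · rw [zp_F]; norm_num

lemma F_E_pow (hp : 2 ≤ p) (m : ℕ) : F p * E p ^ (m + 1) - E p ^ (m + 1) * F p =
    ((qpow p 1 - qpow p (-1))⁻¹ * qInt p (m + 1 : ℕ)) •
      (E p ^ m * (qpow p (-m) • zp (Ku p) (-2) - qpow p m • zp (Ku p) 2)) := by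
  have h : F p * E p - E p * F p =
    (qpow p 1 - qpow p (-1))⁻¹ • (zp (Ku p) (-2) - zp (Ku p) 2) := by
    rw [← neg_sub (E p * F p), EF, ← smul_neg, neg_sub]
  rw [e_mul_f_pow p hp h]
  · abel
  · rw [zp_E]; norm_num
  · rw [zp_E]; norm_num

/-- The `q`-exponential part of the `R`-matrix. -/
def theta (p : ℕ) : DBar p ⊗[ℂ] DBar p := qexp p (E p ⊗ₜ[ℂ] F p)

omit [NeZero p] in
lemma E_pow_p : E p ^ p = 0 := (rel p).e_pow
omit [NeZero p] in
lemma F_pow_p : F p ^ p = 0 := (rel p).f_pow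

/-- The commutator of `E` with F^(m+1) in the second leg lowers the degree by one, and the recursion
`rc_succ` matches it with the degree m terms containing K^2 and K^(-2). The boundary terms vanish:
the commutator is zero for m = 0, and E^p = 0 at the top. -/
lemma comm_theta_E (hp : 2 ≤ p) :
    (E p ⊗ₜ[ℂ] zp (Ku p) (-2) + 1 ⊗ₜ[ℂ] E p) * theta p =
      theta p * (1 ⊗ₜ[ℂ] E p + E p ⊗ₜ[ℂ] zp (Ku p) 2) := by
  have hq := qdiff_ne_zero p hp
  have key := sum_rc_telescope p hp
    (U := fun m => (E p ^ m) ⊗ₜ[ℂ] (E p * F p ^ m - F p ^ m * E p))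
    (V := fun m => (E p ^ (m + 1)) ⊗ₜ[ℂ] (F p ^ m * zp (Ku p) 2 - zp (Ku p) (-2) * F p ^ m))
    (by simp)
    (by simp only [Nat.sub_add_cancel (show 1 ≤ p by omega), E_pow_p, TensorProduct.zero_tmul])
    (fun m hm => by
      have h := rc_succ p hp hm
      rw [E_F_pow hp, TensorProduct.tmul_smul, smul_smul, zp_F_pow, ← TensorProduct.tmul_smul,
        ← TensorProduct.tmul_smul]
      congr 1
      have e : qpow p (-(((-2 : ℤ) : ℂ) * m)) = qpow p m * qpow p m := by
        rw [← qpow_add]; congr 1; push_cast; ring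
      have e' : qpow p (-m) * qpow p m = 1 := by rw [← qpow_add, neg_add_cancel, qpow_zero]
      rw [e]
      simp only [mul_sub, mul_smul_comm]
      match_scalars
      · field_simp
        linear_combination (qpow p (-m)) * h + rc p m * (qpow p 1 - qpow p (-1)) * e'
      · field_simp
        linear_combination -(qpow p m) * h)
  simp only [theta, qexp, Finset.mul_sum, Finset.sum_mul, mul_smul_comm, smul_mul_assoc,
    Algebra.TensorProduct.tmul_pow, add_mul, mul_add, Algebra.TensorProduct.tmul_mul_tmul, one_mul,
    mul_one, smul_add, Finset.sum_add_distrib]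
  simp only [TensorProduct.tmul_sub, smul_sub, Finset.sum_sub_distrib] at key
  simp only [← pow_succ, ← pow_succ'] at key ⊢
  rw [← sub_eq_zero] at key ⊢
  rw [← key]
  abel

lemma comm_theta_F (hp : 2 ≤ p) :
    (F p ⊗ₜ[ℂ] 1 + zp (Ku p) 2 ⊗ₜ[ℂ] F p) * theta p =
      theta p * (zp (Ku p) (-2) ⊗ₜ[ℂ] F p + F p ⊗ₜ[ℂ] 1) := by
  have hq := qdiff_ne_zero p hp
  have key := sum_rc_telescope p hp
    (U := fun m => (F p * E p ^ m - E p ^ m * F p) ⊗ₜ[ℂ] (F p ^ m))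
    (V := fun m => (E p ^ m * zp (Ku p) (-2) - zp (Ku p) 2 * E p ^ m) ⊗ₜ[ℂ] (F p ^ (m + 1)))
    (by simp)
    (by simp only [Nat.sub_add_cancel (show 1 ≤ p by omega), F_pow_p, TensorProduct.tmul_zero])
    (fun m hm => by
      have h := rc_succ p hp hm
      rw [F_E_pow hp, ← TensorProduct.smul_tmul', smul_smul, zp_E_pow, TensorProduct.smul_tmul',
        TensorProduct.smul_tmul']
      congr 1
      have e : qpow p (((2 : ℤ) : ℂ) * m) = qpow p m * qpow p m := by
        rw [← qpow_add]; congr 1; push_cast; ring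
      have e' : qpow p (-m) * qpow p m = 1 := by rw [← qpow_add, neg_add_cancel, qpow_zero]
      rw [e]
      simp only [mul_sub, mul_smul_comm]
      match_scalars
      · field_simp
        linear_combination (qpow p (-m)) * h + rc p m * (qpow p 1 - qpow p (-1)) * e'
      · field_simp
        linear_combination -(qpow p m) * h)
  simp only [theta, qexp, Finset.mul_sum, Finset.sum_mul, mul_smul_comm, smul_mul_assoc,
    Algebra.TensorProduct.tmul_pow, add_mul, mul_add, Algebra.TensorProduct.tmul_mul_tmul, one_mul,
    mul_one, smul_add, Finset.sum_add_distrib]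
  simp only [TensorProduct.sub_tmul, smul_sub, Finset.sum_sub_distrib] at key
  simp only [← pow_succ, ← pow_succ'] at key ⊢
  rw [← sub_eq_zero] at key ⊢
  rw [← key]
  abel

lemma Rbar_eq' (p : ℕ) [NeZero p] : Rbar p = cartan p (Ku p) * theta p := Rbar_eq p

lemma flip21_tmul (a b : DBar p) : flip21 (a ⊗ₜ[ℂ] b) = b ⊗ₜ[ℂ] a := rfl

/-- Passing Δ^op(E) through the Cartan part replaces it by E ⊗ K^(-2) + 1 ⊗ E, which is what the
q-exponential intertwines with Δ(E). -/
lemma op_comul_E (hp : 2 ≤ p) : flip21 (Coalgebra.comul (R := ℂ) (E p)) * Rbar p =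
    Rbar p * Coalgebra.comul (R := ℂ) (E p) := by
  have h1 : (E p ⊗ₜ[ℂ] 1) * cartan p (Ku p) =
      cartan p (Ku p) * (E p ⊗ₜ[ℂ] zp (Ku p) (-2)) := by
    rw [cartan_mul_tmul Ku_pow Ku_E (Ku_zp (-2))]
    simp [zp_zero, zp_mul_neg]
  have h2 : (zp (Ku p) 2 ⊗ₜ[ℂ] E p) * cartan p (Ku p) = cartan p (Ku p) * (1 ⊗ₜ[ℂ] E p) :=
    (cartan_mul_right Ku_pow Ku_E).symm
  rw [Rbar_eq', comul_E', map_add, flip21_tmul, flip21_tmul, ← mul_assoc, add_mul, h1, h2, ← mul_add,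
    mul_assoc, mul_assoc, ← comm_theta_E hp, add_comm (E p ⊗ₜ[ℂ] zp (Ku p) (-2))]

lemma op_comul_F (hp : 2 ≤ p) : flip21 (Coalgebra.comul (R := ℂ) (F p)) * Rbar p =
    Rbar p * Coalgebra.comul (R := ℂ) (F p) := by
  have h1 : (F p ⊗ₜ[ℂ] zp (Ku p) (-2)) * cartan p (Ku p) = cartan p (Ku p) * (F p ⊗ₜ[ℂ] 1) :=
    (cartan_mul_left Ku_pow Ku_F).symm
  have h2 : (1 ⊗ₜ[ℂ] F p) * cartan p (Ku p) = cartan p (Ku p) * (zp (Ku p) 2 ⊗ₜ[ℂ] F p) := by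
    rw [cartan_mul_tmul Ku_pow (Ku_zp 2) Ku_F]
    simp [zp_zero, zp_mul_neg]
  rw [Rbar_eq', comul_F', map_add, flip21_tmul, flip21_tmul, ← mul_assoc, add_mul, h1, h2, ← mul_add,
    mul_assoc, mul_assoc, ← comm_theta_F hp, add_comm (F p ⊗ₜ[ℂ] 1)]

lemma op_comul_K : flip21 (Coalgebra.comul (R := ℂ) (K p)) * Rbar p =
    Rbar p * Coalgebra.comul (R := ℂ) (K p) := by
  have h1 : (K p ⊗ₜ[ℂ] K p) * cartan p (Ku p) = cartan p (Ku p) * (K p ⊗ₜ[ℂ] K p) := by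
    have := Ku_zp (p := p) 1
    rw [zp_one] at this
    rw [← Ku_val, cartan_mul_tmul Ku_pow this this]
    simp [zp_zero]
  have h2 : (K p ⊗ₜ[ℂ] K p) * theta p = theta p * (K p ⊗ₜ[ℂ] K p) := by
    refine (qexp_semiconj p ?_).symm
    rw [Algebra.TensorProduct.tmul_mul_tmul, Algebra.TensorProduct.tmul_mul_tmul, (rel p).ke,
      (rel p).kf, TensorProduct.smul_tmul_smul, ← qpow_add, add_neg_cancel, qpow_zero, one_smul]
  rw [Rbar_eq', comul_K, flip21_tmul, ← mul_assoc, h1, mul_assoc, mul_assoc, h2]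

lemma op_comul_Rbar (hp : 2 ≤ p) (x : DBar p) : flip21 (Coalgebra.comul (R := ℂ) x) * Rbar p =
    Rbar p * Coalgebra.comul (R := ℂ) x := by
  have hx : x ∈ Algebra.adjoin ℂ {E p, F p, K p} := by rw [adjoin]; exact Algebra.mem_top
  induction hx using Algebra.adjoin_induction with
  | mem x hx =>
    rcases hx with rfl | rfl | rfl
    · exact op_comul_E hp
    · exact op_comul_F hp
    · exact op_comul_K
  | algebraMap r =>
    rw [Bialgebra.comul_algebraMap, AlgHom.commutes]
    exact Algebra.commutes _ _
  | add x y _ _ hx hy => rw [map_add, map_add, add_mul, mul_add, hx, hy]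
  | mul x y _ _ hx hy => rw [Bialgebra.comul_mul, map_mul, mul_assoc, hy, ← mul_assoc, hx, mul_assoc]

/-- `Δ ⊗ id` as an algebra homomorphism. -/
def comulId (p : ℕ) [NeZero p] : DBar p ⊗[ℂ] DBar p →ₐ[ℂ] DBar p ⊗[ℂ] (DBar p ⊗[ℂ] DBar p) :=
  (Algebra.TensorProduct.assoc ℂ ℂ ℂ (DBar p) (DBar p) (DBar p)).toAlgHom.comp
    (Algebra.TensorProduct.map (Bialgebra.comulAlgHom ℂ (DBar p)) (AlgHom.id ℂ (DBar p)))

lemma comulId_tmul (a b : DBar p) : comulId p (a ⊗ₜ[ℂ] b) =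
    Algebra.TensorProduct.assoc ℂ ℂ ℂ (DBar p) (DBar p) (DBar p)
      (Coalgebra.comul (R := ℂ) a ⊗ₜ[ℂ] b) := rfl

/-- `id ⊗ Δ` as an algebra homomorphism. -/
def idComul (p : ℕ) [NeZero p] : DBar p ⊗[ℂ] DBar p →ₐ[ℂ] DBar p ⊗[ℂ] (DBar p ⊗[ℂ] DBar p) :=
  Algebra.TensorProduct.map (AlgHom.id ℂ (DBar p)) (Bialgebra.comulAlgHom ℂ (DBar p))

lemma idComul_tmul (a b : DBar p) : idComul p (a ⊗ₜ[ℂ] b) =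
    a ⊗ₜ[ℂ] Coalgebra.comul (R := ℂ) b := rfl

lemma leg12_tmul (a b : DBar p) : leg12 (a ⊗ₜ[ℂ] b) = a ⊗ₜ[ℂ] (b ⊗ₜ[ℂ] 1) := rfl
lemma leg13_tmul (a b : DBar p) : leg13 (a ⊗ₜ[ℂ] b) = a ⊗ₜ[ℂ] (1 ⊗ₜ[ℂ] b) := rfl
lemma leg23_tmul (a b : DBar p) : leg23 (a ⊗ₜ[ℂ] b) = 1 ⊗ₜ[ℂ] (a ⊗ₜ[ℂ] b) := rfl

lemma comulId_cartan : comulId p (cartan p (Ku p)) =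
    leg13 (cartan p (Ku p)) * leg23 (cartan p (Ku p)) := by
  let a := Algebra.TensorProduct.assoc ℂ ℂ ℂ (DBar p) (DBar p) (DBar p)
  have h1 : leg13 (cartan p (Ku p)) =
      a (∑ n ∈ Finset.range (4 * p), (zp (Ku p) n ⊗ₜ[ℂ] (1 : DBar p)) ⊗ₜ[ℂ] idem p (Ku p) n) := by
    simp only [cartan, map_sum, leg13_tmul]; rfl
  have h2 : leg23 (cartan p (Ku p)) =
      a (∑ n ∈ Finset.range (4 * p), ((1 : DBar p) ⊗ₜ[ℂ] zp (Ku p) n) ⊗ₜ[ℂ] idem p (Ku p) n) := by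
    simp only [cartan, map_sum, leg23_tmul]; rfl
  have h3 : comulId p (cartan p (Ku p)) =
      a (∑ n ∈ Finset.range (4 * p), (zp (Ku p) n ⊗ₜ[ℂ] zp (Ku p) n) ⊗ₜ[ℂ] idem p (Ku p) n) := by
    simp only [cartan, map_sum, comulId_tmul, comul_zp]; rfl
  rw [h1, h2, h3, ← map_mul, sum_tmul_idem_mul Ku_pow]
  simp only [Algebra.TensorProduct.tmul_mul_tmul, one_mul, mul_one]

lemma idComul_cartan : idComul p (cartan p (Ku p)) =
    leg13 (cartan p (Ku p)) * leg12 (cartan p (Ku p)) := by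
  simp only [cartan_eq', map_sum, leg13_tmul, leg12_tmul, idComul_tmul, comul_zp]
  rw [sum_idem_tmul_mul Ku_pow]
  simp only [Algebra.TensorProduct.tmul_mul_tmul, one_mul, mul_one]

omit [NeZero p] in
lemma F_pow_add {a b : ℕ} (h : p ≤ a + b) : F p ^ a * F p ^ b = 0 := by
  rw [← pow_add]
  exact pow_eq_zero_of_le h F_pow_p

omit [NeZero p] in
lemma E_pow_add {a b : ℕ} (h : p ≤ a + b) : E p ^ a * E p ^ b = 0 := by
  rw [← pow_add]
  exact pow_eq_zero_of_le h E_pow_p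

/-- Moving the Cartan part in legs 2, 3 to the left of the q-exponential in legs 1, 3 turns the
argument E ⊗ 1 ⊗ F into E ⊗ K^2 ⊗ F. This and 1 ⊗ E ⊗ F are the two summands of (Δ ⊗ id)(E ⊗ F);
they commute up to q^(-2), so the two exponentials combine. Terms of total degree at least p die
because of F in the last leg. -/
lemma comulId_Rbar (hp : 2 ≤ p) : comulId p (Rbar p) = leg13 (Rbar p) * leg23 (Rbar p) := by
  have h1 : comulId p (E p ⊗ₜ[ℂ] F p) =
      E p ⊗ₜ[ℂ] (zp (Ku p) 2 ⊗ₜ[ℂ] F p) + 1 ⊗ₜ[ℂ] (E p ⊗ₜ[ℂ] F p) := by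
    rw [comulId_tmul, comul_E', TensorProduct.add_tmul, map_add, add_comm]; rfl
  have h2 : (leg13 (E p ⊗ₜ[ℂ] F p)) * leg23 (cartan p (Ku p)) =
      leg23 (cartan p (Ku p)) * (E p ⊗ₜ[ℂ] (zp (Ku p) 2 ⊗ₜ[ℂ] F p)) := by
    have h : (1 ⊗ₜ[ℂ] F p) * cartan p (Ku p) = cartan p (Ku p) * (zp (Ku p) 2 ⊗ₜ[ℂ] F p) := by
      rw [cartan_mul_tmul Ku_pow (Ku_zp 2) Ku_F]
      simp [zp_zero, zp_mul_neg]
    have e : leg23 (cartan p (Ku p)) = 1 ⊗ₜ[ℂ] cartan p (Ku p) := rfl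
    rw [leg13_tmul, e, Algebra.TensorProduct.tmul_mul_tmul, Algebra.TensorProduct.tmul_mul_tmul, h,
      one_mul, mul_one]
  have h3 : qexp p (leg13 (E p ⊗ₜ[ℂ] F p)) * leg23 (cartan p (Ku p)) = _ := qexp_semiconj p h2
  rw [Rbar_eq', map_mul, map_mul, map_mul, comulId_cartan, theta, map_qexp, map_qexp, map_qexp, h1,
    qexp_add p hp, mul_assoc, mul_assoc, ← mul_assoc (qexp p _), h3, leg23_tmul, mul_assoc]
  · simp only [Algebra.TensorProduct.tmul_mul_tmul, one_mul, mul_one, zp_E]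
    simp only [← TensorProduct.smul_tmul', TensorProduct.tmul_smul, smul_smul, ← qpow_add]
    norm_num [qpow_zero]
  · intro a b hab
    simp only [Algebra.TensorProduct.tmul_pow, Algebra.TensorProduct.tmul_mul_tmul, F_pow_add hab,
      TensorProduct.tmul_zero]

lemma idComul_Rbar (hp : 2 ≤ p) : idComul p (Rbar p) = leg13 (Rbar p) * leg12 (Rbar p) := by
  have h1 : idComul p (E p ⊗ₜ[ℂ] F p) =
      E p ⊗ₜ[ℂ] (zp (Ku p) (-2) ⊗ₜ[ℂ] F p) + E p ⊗ₜ[ℂ] (F p ⊗ₜ[ℂ] 1) := by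
    rw [idComul_tmul, comul_F', TensorProduct.tmul_add]
  have h2 : (leg13 (E p ⊗ₜ[ℂ] F p)) * leg12 (cartan p (Ku p)) =
      leg12 (cartan p (Ku p)) * (E p ⊗ₜ[ℂ] (zp (Ku p) (-2) ⊗ₜ[ℂ] F p)) := by
    have h : (E p ⊗ₜ[ℂ] 1) * cartan p (Ku p) = cartan p (Ku p) * (E p ⊗ₜ[ℂ] zp (Ku p) (-2)) := by
      rw [cartan_mul_tmul Ku_pow Ku_E (Ku_zp (-2))]
      simp [zp_zero, zp_mul_neg]
    -- The Cartan part lives in legs 1 and 2, so the factor `F` in leg 3 is split off and commutes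
    -- with it.
    have e1 : leg13 (E p ⊗ₜ[ℂ] F p) = leg12 (E p ⊗ₜ[ℂ] 1) * (1 ⊗ₜ[ℂ] (1 ⊗ₜ[ℂ] F p)) := by
      rw [leg12_tmul, leg13_tmul]; simp
    have e2 : E p ⊗ₜ[ℂ] (zp (Ku p) (-2) ⊗ₜ[ℂ] F p) =
        leg12 (E p ⊗ₜ[ℂ] zp (Ku p) (-2)) * (1 ⊗ₜ[ℂ] (1 ⊗ₜ[ℂ] F p)) := by
      rw [leg12_tmul]; simp
    have e3 : (1 ⊗ₜ[ℂ] (1 ⊗ₜ[ℂ] F p)) * leg12 (cartan p (Ku p)) =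
        leg12 (cartan p (Ku p)) * (1 ⊗ₜ[ℂ] (1 ⊗ₜ[ℂ] F p)) := by
      rw [cartan, map_sum, Finset.sum_mul, Finset.mul_sum]
      refine Finset.sum_congr rfl fun n _ => ?_
      rw [leg12_tmul]; simp
    rw [e1, e2, mul_assoc, e3, ← mul_assoc, ← map_mul, h, map_mul, mul_assoc]
  have h3 : qexp p (leg13 (E p ⊗ₜ[ℂ] F p)) * leg12 (cartan p (Ku p)) = _ := qexp_semiconj p h2
  rw [Rbar_eq', map_mul, map_mul, map_mul, idComul_cartan, theta, map_qexp, map_qexp, map_qexp, h1,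
    qexp_add p hp, mul_assoc, mul_assoc, ← mul_assoc (qexp p _), h3, leg12_tmul, mul_assoc]
  · simp only [Algebra.TensorProduct.tmul_mul_tmul, one_mul, mul_one, zp_F]
    simp only [← TensorProduct.smul_tmul', TensorProduct.tmul_smul, smul_smul, ← qpow_add]
    norm_num [qpow_zero]
  · intro a b hab
    simp only [Algebra.TensorProduct.tmul_pow, Algebra.TensorProduct.tmul_mul_tmul, E_pow_add hab,
      TensorProduct.zero_tmul]

lemma isUnit_cartan : IsUnit (cartan p (Ku p)) :=
  ⟨⟨_, _, cartan_mul_inv Ku_pow, cartanInv_mul Ku_pow⟩, rfl⟩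

theorem isUniversalRMatrix (hp : 2 ≤ p) : IsUniversalRMatrix (Rbar p) where
  isUnit := by
    rw [Rbar_eq']
    refine isUnit_cartan.mul (isUnit_qexp p ?_)
    rw [Algebra.TensorProduct.tmul_pow, E_pow_p, TensorProduct.zero_tmul]
  op_comul := op_comul_Rbar hp
  comul_id := comulId_Rbar hp
  id_comul := idComul_Rbar hp

end DBar

/-! ### Reordering of nested finite sums. -/

section sums

variable {ι M : Type*} [AddCommMonoid M] {s : Finset ι}

lemma sum_out_two (f : ι → ι → ι → M) : ∑ i ∈ s, ∑ j ∈ s, ∑ k ∈ s, f i j k =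
    ∑ k ∈ s, ∑ i ∈ s, ∑ j ∈ s, f i j k :=
  (Finset.sum_congr rfl fun _ _ => Finset.sum_comm).trans Finset.sum_comm

lemma sum_out_three (f : ι → ι → ι → ι → M) : ∑ i ∈ s, ∑ j ∈ s, ∑ k ∈ s, ∑ l ∈ s, f i j k l =
    ∑ l ∈ s, ∑ i ∈ s, ∑ j ∈ s, ∑ k ∈ s, f i j k l :=
  (Finset.sum_congr rfl fun i _ => sum_out_two (f i)).trans Finset.sum_comm

lemma sum_out_four (f : ι → ι → ι → ι → ι → M) :
    ∑ i ∈ s, ∑ j ∈ s, ∑ k ∈ s, ∑ l ∈ s, ∑ m ∈ s, f i j k l m =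
    ∑ m ∈ s, ∑ i ∈ s, ∑ j ∈ s, ∑ k ∈ s, ∑ l ∈ s, f i j k l m :=
  (Finset.sum_congr rfl fun i _ => sum_out_three (f i)).trans Finset.sum_comm

lemma sum_comm_pairs (f : ι → ι → ι → ι → M) : ∑ i ∈ s, ∑ j ∈ s, ∑ k ∈ s, ∑ l ∈ s, f i j k l =
    ∑ k ∈ s, ∑ l ∈ s, ∑ i ∈ s, ∑ j ∈ s, f i j k l :=
  (sum_out_two fun i j k => ∑ l ∈ s, f i j k l).trans
    (Finset.sum_congr rfl fun k _ => sum_out_two fun i j l => f i j k l)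

end sums

/-! ### General quasitriangular Hopf algebras: Yang–Baxter and the coproduct of u. -/

section quasitriangular

variable {A : Type*} [Ring A] [HopfAlgebra ℂ A] {R : A ⊗[ℂ] A} {ι : Type*} {s : Finset ι}
  {a b : ι → A}

open HopfAlgebra Coalgebra

lemma leg12_sum (h : R = ∑ i ∈ s, a i ⊗ₜ[ℂ] b i) :
    leg12 R = ∑ i ∈ s, a i ⊗ₜ[ℂ] (b i ⊗ₜ[ℂ] (1 : A)) := by rw [h, map_sum]; rfl

lemma leg13_sum (h : R = ∑ i ∈ s, a i ⊗ₜ[ℂ] b i) :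
    leg13 R = ∑ i ∈ s, a i ⊗ₜ[ℂ] ((1 : A) ⊗ₜ[ℂ] b i) := by rw [h, map_sum]; rfl

lemma leg23_sum (h : R = ∑ i ∈ s, a i ⊗ₜ[ℂ] b i) :
    leg23 R = ∑ i ∈ s, (1 : A) ⊗ₜ[ℂ] (a i ⊗ₜ[ℂ] b i) := by rw [h, map_sum]; rfl

lemma flip21_sum (h : R = ∑ i ∈ s, a i ⊗ₜ[ℂ] b i) :
    flip21 R = ∑ i ∈ s, b i ⊗ₜ[ℂ] a i := by rw [h, map_sum]; rfl

lemma canonicalElement_sum (h : R = ∑ i ∈ s, a i ⊗ₜ[ℂ] b i) :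
    canonicalElement R = ∑ i ∈ s, antipode ℂ (b i) * a i := by
  rw [canonicalElement, flip21_sum h, map_sum, map_sum]
  simp

namespace IsUniversalRMatrix

variable (hR : IsUniversalRMatrix R) (h : R = ∑ i ∈ s, a i ⊗ₜ[ℂ] b i)

include hR h

lemma comul_id_sum : ∑ i ∈ s, comul (R := ℂ) (a i) ⊗ₜ[ℂ] b i =
    ∑ i ∈ s, ∑ j ∈ s, (a i ⊗ₜ[ℂ] a j) ⊗ₜ[ℂ] (b i * b j) := by
  apply (TensorProduct.assoc ℂ A A A).injective
  have := hR.comul_id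
  rw [leg13_sum h, leg23_sum h, h, map_sum, map_sum] at this
  simp only [Finset.sum_mul_sum, Algebra.TensorProduct.tmul_mul_tmul, one_mul, mul_one,
    LinearMap.rTensor_tmul] at this
  simpa only [map_sum, TensorProduct.assoc_tmul] using this

lemma id_comul_sum : ∑ i ∈ s, a i ⊗ₜ[ℂ] comul (R := ℂ) (b i) =
    ∑ i ∈ s, ∑ j ∈ s, (a i * a j) ⊗ₜ[ℂ] (b j ⊗ₜ[ℂ] b i) := by
  have := hR.id_comul
  rw [leg13_sum h, leg12_sum h, h, map_sum] at this
  simpa only [Finset.sum_mul_sum, Algebra.TensorProduct.tmul_mul_tmul, one_mul, mul_one,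
    LinearMap.lTensor_tmul] using this

/-- Applying ε to the last leg of (id ⊗ Δ)(R) = R₁₃R₁₂ gives R = (x ⊗ 1) R, where x is the left side
of the claim; then R is cancelled. -/
lemma counit_right : ∑ i ∈ s, counit (R := ℂ) (b i) • a i = 1 := by
  have h1 := congrArg ((TensorProduct.map LinearMap.id
    ((TensorProduct.rid ℂ A).toLinearMap ∘ₗ (counit (R := ℂ) (A := A)).lTensor A)) :
      A ⊗[ℂ] (A ⊗[ℂ] A) →ₗ[ℂ] A ⊗[ℂ] A) (hR.id_comul_sum h)
  have h2 : (1 ⊗ₜ[ℂ] (1 : A)) * R = ((∑ i ∈ s, counit (R := ℂ) (b i) • a i) ⊗ₜ[ℂ] 1) * R := by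
    rw [← Algebra.TensorProduct.one_def, one_mul]
    nth_rewrite 2 [h]
    rw [TensorProduct.sum_tmul, Finset.sum_mul_sum]
    simp only [map_sum, TensorProduct.map_tmul, LinearMap.id_apply, LinearMap.comp_apply,
      LinearEquiv.coe_coe, LinearMap.lTensor_tmul, TensorProduct.rid_tmul,
      Coalgebra.lTensor_counit_comul, one_smul] at h1
    rw [h, h1]
    simp only [Algebra.TensorProduct.tmul_mul_tmul, one_mul, smul_mul_assoc,
      TensorProduct.tmul_smul, TensorProduct.smul_tmul']
  have h3 := hR.isUnit.mul_right_cancel h2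
  have h4 := congrArg ((TensorProduct.rid ℂ A).toLinearMap ∘ₗ (counit (R := ℂ) (A := A)).lTensor A) h3
  simpa using h4.symm

/-- `∑ aᵢ aⱼ ⊗ S(bⱼ) bᵢ = 1 ⊗ 1`. -/
lemma sum_mul_antipode : ∑ i ∈ s, ∑ j ∈ s, (a i * a j) ⊗ₜ[ℂ] (antipode ℂ (b j) * b i) = 1 := by
  have h1 := congrArg ((TensorProduct.map LinearMap.id
    (LinearMap.mul' ℂ A ∘ₗ (antipode ℂ (A := A)).rTensor A)) :
      A ⊗[ℂ] (A ⊗[ℂ] A) →ₗ[ℂ] A ⊗[ℂ] A) (hR.id_comul_sum h)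
  simp only [map_sum, TensorProduct.map_tmul, LinearMap.id_apply, LinearMap.comp_apply,
    LinearMap.rTensor_tmul, LinearMap.mul'_apply] at h1
  rw [← h1]
  have h2 := hR.counit_right h
  have h3 : (1 : A ⊗[ℂ] A) = (∑ i ∈ s, counit (R := ℂ) (b i) • a i) ⊗ₜ[ℂ] (1 : A) := by
    rw [h2, Algebra.TensorProduct.one_def]
  rw [h3, TensorProduct.sum_tmul]
  refine Finset.sum_congr rfl fun i _ => ?_
  rw [HopfAlgebra.mul_antipode_rTensor_comul_apply, Algebra.algebraMap_eq_smul_one,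
    TensorProduct.tmul_smul, TensorProduct.smul_tmul']

/-- The Yang–Baxter equation. -/
lemma yang_baxter : ∑ i ∈ s, ∑ j ∈ s, ∑ k ∈ s,
      (a i * a j) ⊗ₜ[ℂ] ((b i * a k) ⊗ₜ[ℂ] (b j * b k)) =
    ∑ i ∈ s, ∑ j ∈ s, ∑ k ∈ s, (a j * a i) ⊗ₜ[ℂ] ((a k * b i) ⊗ₜ[ℂ] (b k * b j)) := by
  have h1 := hR.comul_id_sum h
  have e : ∀ x : A, R * comul (R := ℂ) x = flip21 (comul (R := ℂ) x) * R := fun x =>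
    (hR.op_comul x).symm
  -- R intertwines Δ and Δ^op in the first two legs of (Δ ⊗ id)(R); expanding both sides by the
  -- hexagon identity gives R₁₂R₁₃R₂₃ = R₂₃R₁₃R₁₂.
  have h2 : (R ⊗ₜ[ℂ] (1 : A)) * ∑ i ∈ s, comul (R := ℂ) (a i) ⊗ₜ[ℂ] b i =
      (∑ i ∈ s, flip21 (comul (R := ℂ) (a i)) ⊗ₜ[ℂ] b i) * (R ⊗ₜ[ℂ] (1 : A)) := by
    rw [Finset.mul_sum, Finset.sum_mul]
    refine Finset.sum_congr rfl fun i _ => ?_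
    simp only [Algebra.TensorProduct.tmul_mul_tmul, one_mul, mul_one, e]
  have h3 : ∑ i ∈ s, flip21 (comul (R := ℂ) (a i)) ⊗ₜ[ℂ] b i =
      ∑ i ∈ s, ∑ j ∈ s, (a j ⊗ₜ[ℂ] a i) ⊗ₜ[ℂ] (b i * b j) := by
    have := congrArg ((flip21 (A := A)).toLinearMap.rTensor A) h1
    simp only [map_sum, LinearMap.rTensor_tmul] at this
    exact this
  rw [h1, h3] at h2
  have h4 := congrArg (TensorProduct.assoc ℂ A A A) h2
  rw [h, TensorProduct.sum_tmul, Finset.sum_mul, Finset.mul_sum] at h4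
  simp only [Finset.mul_sum, Finset.sum_mul, Algebra.TensorProduct.tmul_mul_tmul, one_mul, mul_one,
    map_sum, TensorProduct.assoc_tmul] at h4
  rw [h4]
  refine Finset.sum_congr rfl fun i _ => ?_
  rw [Finset.sum_comm]

omit h in
-- R₁₂ carries Δ to Δ^op and R₂₁ carries it back.
lemma mMatrix_comm (x : A) : mMatrix R * comul (R := ℂ) x = comul (R := ℂ) x * mMatrix R := by
  have h1 := hR.op_comul x
  have h2 := congrArg (flip21 (A := A)) h1
  have h3 : ∀ t : A ⊗[ℂ] A, flip21 (flip21 t) = t := fun t =>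
    (TensorProduct.comm ℂ A A).symm_apply_apply t
  rw [map_mul, map_mul, h3] at h2
  rw [mMatrix, mul_assoc, ← h1, ← mul_assoc, ← h2, mul_assoc]

/-- Both hexagon identities applied to one copy of R express it through four copies. The opposite
coproduct in the second leg is the form needed for Δ(S(b)) in the coproduct of the canonical
element. -/
lemma comul_comul_op_sum : ∑ i ∈ s, comul (R := ℂ) (a i) ⊗ₜ[ℂ] flip21 (comul (R := ℂ) (b i)) =
    ∑ i ∈ s, ∑ j ∈ s, ∑ k ∈ s, ∑ l ∈ s,
      ((a i * a j) ⊗ₜ[ℂ] (a k * a l)) ⊗ₜ[ℂ] ((b i * b k) ⊗ₜ[ℂ] (b j * b l)) := by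
  let c : A →ₐ[ℂ] A ⊗[ℂ] A := (flip21 (A := A)).comp (Bialgebra.comulAlgHom ℂ A)
  have hc : ∀ x, c x = flip21 (comul (R := ℂ) x) := fun _ => rfl
  have h1 := congrArg ((c.toLinearMap).lTensor (A ⊗[ℂ] A)) (hR.comul_id_sum h)
  simp only [map_sum, LinearMap.lTensor_tmul, AlgHom.toLinearMap_apply, map_mul] at h1
  have h2 : ∑ i ∈ s, a i ⊗ₜ[ℂ] c (b i) =
      ∑ i ∈ s, ∑ j ∈ s, (a i * a j) ⊗ₜ[ℂ] (b i ⊗ₜ[ℂ] b j) := by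
    have := congrArg ((flip21 (A := A)).toLinearMap.lTensor A) (hR.id_comul_sum h)
    simp only [map_sum, LinearMap.lTensor_tmul] at this
    exact this
  simp only [hc] at h1 h2
  rw [h1]
  -- multiply the two expansions in the third and fourth legs
  let Φ : A ⊗[ℂ] (A ⊗[ℂ] A) →ₗ[ℂ] A ⊗[ℂ] (A ⊗[ℂ] A) →ₗ[ℂ] (A ⊗[ℂ] A) ⊗[ℂ] (A ⊗[ℂ] A) :=
    TensorProduct.curry ((TensorProduct.map LinearMap.id (LinearMap.mul' ℂ (A ⊗[ℂ] A))) ∘ₗ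
      (TensorProduct.tensorTensorTensorComm ℂ A (A ⊗[ℂ] A) A (A ⊗[ℂ] A)).toLinearMap)
  have hΦ : ∀ x y u v, Φ (x ⊗ₜ[ℂ] u) (y ⊗ₜ[ℂ] v) = (x ⊗ₜ[ℂ] y) ⊗ₜ[ℂ] (u * v) := fun _ _ _ _ => by
    simp [Φ]
  have h3 : ∑ i ∈ s, ∑ j ∈ s, (a i ⊗ₜ[ℂ] a j) ⊗ₜ[ℂ]
      (flip21 (comul (R := ℂ) (b i)) * flip21 (comul (R := ℂ) (b j))) =
      Φ (∑ i ∈ s, a i ⊗ₜ[ℂ] flip21 (comul (R := ℂ) (b i)))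
        (∑ i ∈ s, a i ⊗ₜ[ℂ] flip21 (comul (R := ℂ) (b i))) := by
    simp only [map_sum, LinearMap.sum_apply, hΦ]
    rw [Finset.sum_comm]
  rw [h3, h2]
  simp only [map_sum, LinearMap.sum_apply, hΦ, Algebra.TensorProduct.tmul_mul_tmul]
  exact sum_comm_pairs fun k l i j =>
    ((a i * a j) ⊗ₜ[ℂ] (a k * a l)) ⊗ₜ[ℂ] ((b i * b k) ⊗ₜ[ℂ] (b j * b l))

/-- `Δ(u) = M⁻¹ (u ⊗ u)`. -/
lemma mMatrix_mul_comul_canonicalElement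
    (hS : ∀ x : A, comul (R := ℂ) (antipode ℂ x) =
      TensorProduct.map (antipode ℂ) (antipode ℂ) (flip21 (comul (R := ℂ) x))) :
    mMatrix R * comul (R := ℂ) (canonicalElement R) = canonicalElement R ⊗ₜ[ℂ] canonicalElement R := by
  have hanti : ∀ x y : A, antipode ℂ (x * y) = antipode ℂ y * antipode ℂ x :=
    HopfAlgebra.antipode_mul_antidistrib
  let Ξ : (A ⊗[ℂ] A) ⊗[ℂ] (A ⊗[ℂ] A) →ₗ[ℂ] A ⊗[ℂ] A :=
    LinearMap.mul' ℂ (A ⊗[ℂ] A) ∘ₗ (TensorProduct.comm ℂ _ _).toLinearMap ∘ₗ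
      TensorProduct.map (LinearMap.mulLeft ℂ (mMatrix R))
        (TensorProduct.map (antipode ℂ) (antipode ℂ))
  have hΞ : ∀ x y, Ξ (x ⊗ₜ[ℂ] y) =
      TensorProduct.map (antipode ℂ) (antipode ℂ) y * (mMatrix R * x) := fun x y => by simp [Ξ]
  have hM : mMatrix R = ∑ o ∈ s, ∑ r ∈ s, (b o * a r) ⊗ₜ[ℂ] (a o * b r) := by
    rw [mMatrix, flip21_sum h]
    nth_rewrite 1 [h]
    rw [Finset.sum_mul_sum]
    simp only [Algebra.TensorProduct.tmul_mul_tmul]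
  -- Since M commutes with every Δ(x), it can be placed between Δ(S(bᵢ)) and Δ(aᵢ). Two copies of R
  -- from M and four from (Δ ⊗ Δ^op)(R) give the sixfold sum.
  have e1 : mMatrix R * comul (R := ℂ) (canonicalElement R) =
      ∑ i ∈ s, ∑ j ∈ s, ∑ k ∈ s, ∑ l ∈ s, ∑ o ∈ s, ∑ r ∈ s,
        (antipode ℂ (b i * b k) * (b o * a r * (a i * a j))) ⊗ₜ[ℂ]
          (antipode ℂ (b j * b l) * (a o * b r * (a k * a l))) := by
    calc _ = Ξ (∑ i ∈ s, comul (R := ℂ) (a i) ⊗ₜ[ℂ] flip21 (comul (R := ℂ) (b i))) := by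
          rw [canonicalElement_sum h, map_sum, Finset.mul_sum, map_sum]
          refine Finset.sum_congr rfl fun i _ => ?_
          rw [hΞ, hR.mMatrix_comm, Bialgebra.comul_mul, hS, mul_assoc, hR.mMatrix_comm]
      _ = _ := by
          rw [hR.comul_comul_op_sum h]
          simp only [map_sum, hΞ]
          rw [hM]
          simp only [TensorProduct.map_tmul, Finset.sum_mul, Finset.mul_sum,
            Algebra.TensorProduct.tmul_mul_tmul]
  -- The linear maps `f`, `g`, `g'` insert a tensor into the sixfold sum, so that Yang–Baxter and Σ
  -- aᵢaⱼ ⊗ S(bⱼ)bᵢ = 1 can be substituted under the remaining summations.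
  let f : ι → ι → ι → A ⊗[ℂ] (A ⊗[ℂ] A) →ₗ[ℂ] A ⊗[ℂ] A := fun j l o =>
    TensorProduct.map
      (LinearMap.mul' ℂ A ∘ₗ TensorProduct.map (antipode ℂ)
        (LinearMap.mulLeft ℂ (b o) ∘ₗ LinearMap.mulRight ℂ (a j)))
      (LinearMap.mulLeft ℂ (antipode ℂ (b j * b l)) ∘ₗ LinearMap.mulLeft ℂ (a o) ∘ₗ
        LinearMap.mulRight ℂ (a l)) ∘ₗ
    (TensorProduct.assoc ℂ A A A).symm.toLinearMap ∘ₗ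
    (TensorProduct.comm ℂ _ _).toLinearMap ∘ₗ (TensorProduct.assoc ℂ A A A).symm.toLinearMap
  have hf : ∀ j l o x y z, f j l o (x ⊗ₜ[ℂ] (y ⊗ₜ[ℂ] z)) =
      (antipode ℂ z * (b o * (x * a j))) ⊗ₜ[ℂ] (antipode ℂ (b j * b l) * (a o * (y * a l))) := by
    intros; simp [f]
  let g : ι → ι → ι → ι → A ⊗[ℂ] A →ₗ[ℂ] A ⊗[ℂ] A := fun j l r i =>
    TensorProduct.map
      (LinearMap.mulLeft ℂ (antipode ℂ (b i)) ∘ₗ LinearMap.mulRight ℂ (a i * a r * a j))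
      (LinearMap.mulLeft ℂ (antipode ℂ (b j * b l)) ∘ₗ LinearMap.mulRight ℂ (b r * a l)) ∘ₗ
    (TensorProduct.comm ℂ _ _).toLinearMap
  have hg : ∀ j l r i x y, g j l r i (x ⊗ₜ[ℂ] y) =
      (antipode ℂ (b i) * (y * (a i * a r * a j))) ⊗ₜ[ℂ]
        (antipode ℂ (b j * b l) * (x * (b r * a l))) := by
    intros; simp [g, mul_assoc]
  let g' : ι → ι → A ⊗[ℂ] A →ₗ[ℂ] A ⊗[ℂ] A := fun l i =>
    TensorProduct.map (LinearMap.mulLeft ℂ (antipode ℂ (b i) * a i))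
      (LinearMap.mulLeft ℂ (antipode ℂ (b l)) ∘ₗ LinearMap.mulRight ℂ (a l))
  have hg' : ∀ l i x y, g' l i (x ⊗ₜ[ℂ] y) =
      (antipode ℂ (b i) * a i * x) ⊗ₜ[ℂ] (antipode ℂ (b l) * (y * a l)) := by
    intros; simp [g', mul_assoc]
  have ybe := hR.yang_baxter h
  have hL := hR.sum_mul_antipode h
  calc _ = ∑ o ∈ s, ∑ j ∈ s, ∑ l ∈ s, f j l o (∑ r ∈ s, ∑ i ∈ s, ∑ k ∈ s,
        (a r * a i) ⊗ₜ[ℂ] ((b r * a k) ⊗ₜ[ℂ] (b i * b k))) := by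
        rw [e1, sum_out_four fun i j k l o => ∑ r ∈ s,
          (antipode ℂ (b i * b k) * (b o * a r * (a i * a j))) ⊗ₜ[ℂ]
          (antipode ℂ (b j * b l) * (a o * b r * (a k * a l)))]
        refine Finset.sum_congr rfl fun o _ => ?_
        simp only [map_sum, hf]
        rw [Finset.sum_comm]
        refine Finset.sum_congr rfl fun j _ => ?_
        rw [sum_out_two fun i k l => ∑ r ∈ s,
          (antipode ℂ (b i * b k) * (b o * a r * (a i * a j))) ⊗ₜ[ℂ]
          (antipode ℂ (b j * b l) * (a o * b r * (a k * a l)))]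
        refine Finset.sum_congr rfl fun l _ => ?_
        rw [sum_out_two]
        simp only [mul_assoc]
    -- Yang–Baxter in the indices r, i, k makes S(b_k) and b_o adjacent in one leg and a_o, a_k
    -- adjacent in the other, so the sum over o, k collapses to 1 ⊗ 1.
    _ = ∑ o ∈ s, ∑ j ∈ s, ∑ l ∈ s, ∑ r ∈ s, ∑ i ∈ s, ∑ k ∈ s,
        g j l r i ((a o * a k) ⊗ₜ[ℂ] (antipode ℂ (b k) * b o)) := by
        rw [ybe]
        simp only [map_sum, hf, hg, hanti, mul_assoc]
    _ = ∑ j ∈ s, ∑ l ∈ s, ∑ r ∈ s, ∑ i ∈ s, g j l r i (∑ o ∈ s, ∑ k ∈ s,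
        (a o * a k) ⊗ₜ[ℂ] (antipode ℂ (b k) * b o)) := by
        rw [← sum_out_four]
        simp only [map_sum]
    -- After this collapse r and j form a second pair of the same shape; removing it leaves one copy
    -- of u in each leg.
    _ = ∑ l ∈ s, ∑ i ∈ s, ∑ r ∈ s, ∑ j ∈ s,
        g' l i ((a r * a j) ⊗ₜ[ℂ] (antipode ℂ (b j) * b r)) := by
        rw [hL, Finset.sum_comm]
        refine Finset.sum_congr rfl fun l _ => ?_
        rw [sum_out_two]
        refine Finset.sum_congr rfl fun i _ => ?_
        rw [Finset.sum_comm]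
        simp only [Algebra.TensorProduct.one_def, hg, hg', hanti, mul_assoc, one_mul]
    _ = _ := by
        simp only [← map_sum]
        rw [hL, canonicalElement_sum h]
        simp only [Algebra.TensorProduct.one_def, hg', mul_one, one_mul]
        rw [TensorProduct.sum_tmul]
        simp only [TensorProduct.tmul_sum]
        rw [Finset.sum_comm]

end IsUniversalRMatrix

end quasitriangular

/-! ### The canonical element as a linear functional of the R-matrix. -/

section quasitriangular

variable {A : Type*} [Ring A] [HopfAlgebra ℂ A] {R : A ⊗[ℂ] A}

open HopfAlgebra Coalgebra

lemma canonicalElement_tmul (x y : A) : canonicalElement (x ⊗ₜ[ℂ] y) = antipode ℂ y * x := by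
  have : flip21 (x ⊗ₜ[ℂ] y) = y ⊗ₜ[ℂ] x := rfl
  rw [canonicalElement, this]
  simp

lemma canonicalElement_zero : canonicalElement (0 : A ⊗[ℂ] A) = 0 := by
  simp [canonicalElement]

lemma canonicalElement_add (s t : A ⊗[ℂ] A) :
    canonicalElement (s + t) = canonicalElement s + canonicalElement t := by
  simp [canonicalElement]

lemma canonicalElement_mul_tmul (t : A ⊗[ℂ] A) (x y : A) :
    canonicalElement (t * (x ⊗ₜ[ℂ] y)) = antipode ℂ y * canonicalElement t * x := by
  induction t with
  | zero => simp [canonicalElement_zero]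
  | add s t hs ht => simp only [add_mul, mul_add, canonicalElement_add, hs, ht]
  | tmul a b =>
    rw [Algebra.TensorProduct.tmul_mul_tmul, canonicalElement_tmul, canonicalElement_tmul,
      HopfAlgebra.antipode_mul_antidistrib]
    simp only [mul_assoc]

/-- The factor Δ^op(x) ends up in the middle of the product as Σ S(x')x'' = ε(x). -/
lemma canonicalElement_op_comul_mul (x : A) (t : A ⊗[ℂ] A) :
    canonicalElement (flip21 (comul (R := ℂ) x) * t) = counit (R := ℂ) x • canonicalElement t := by
  induction t with
  | zero => simp [canonicalElement_zero]
  | add s t hs ht => simp only [mul_add, canonicalElement_add, hs, ht, smul_add]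
  | tmul a b =>
    have key : ∀ s : A ⊗[ℂ] A, canonicalElement (flip21 s * (a ⊗ₜ[ℂ] b)) =
        antipode ℂ b * LinearMap.mul' ℂ A ((antipode ℂ).rTensor A s) * a := by
      intro s
      induction s with
      | zero => simp [canonicalElement_zero]
      | add s t hs ht => simp only [map_add, add_mul, mul_add, canonicalElement_add, hs, ht]
      | tmul c d =>
        have : flip21 (c ⊗ₜ[ℂ] d) = d ⊗ₜ[ℂ] c := rfl
        rw [this, Algebra.TensorProduct.tmul_mul_tmul, canonicalElement_tmul,
          HopfAlgebra.antipode_mul_antidistrib]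
        simp [mul_assoc]
    rw [key, mul_antipode_rTensor_comul_apply, canonicalElement_tmul,
      Algebra.algebraMap_eq_smul_one, mul_smul_comm, mul_one, smul_mul_assoc]

/-- Writing out the right side for x = e, φ, k gives the commutation relations of u with the
generators. -/
lemma IsUniversalRMatrix.counit_smul_canonicalElement (hR : IsUniversalRMatrix R) (x : A) :
    counit (R := ℂ) x • canonicalElement R =
      canonicalElement (R * comul (R := ℂ) x) := by
  rw [← canonicalElement_op_comul_mul, hR.op_comul]

end quasitriangular

/-! ### The Drinfeld element of `DBar` and the central element derived from it. -/

namespace DBar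

open HopfAlgebra Coalgebra

variable {p : ℕ} [NeZero p]

lemma antipode_mul (x y : DBar p) : antipode ℂ (x * y) = antipode ℂ y * antipode ℂ x :=
  HopfAlgebra.antipode_mul_antidistrib x y

lemma antipode_pow (x : DBar p) (n : ℕ) : antipode ℂ (x ^ n) = antipode ℂ x ^ n := by
  induction n with
  | zero => simp
  | succ n ih => rw [pow_succ, antipode_mul, ih, pow_succ']

lemma antipode_zp (n : ℤ) : antipode ℂ (zp (Ku p) n) = zp (Ku p) (-n) := by
  obtain ⟨m, hm⟩ := exists_nat_zp (p := p) n
  have h1 : antipode ℂ (zp (Ku p) n) * zp (Ku p) n = 1 := by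
    have := mul_antipode_rTensor_comul_apply (R := ℂ) (zp (Ku p) n)
    rw [comul_zp, counit_zp] at this
    simpa using this
  exact left_inv_eq_right_inv h1 (zp_mul_neg _ _)

lemma antipode_E' : antipode ℂ (E p) = -(E p * zp (Ku p) (-2)) := by rw [antipode_E, K_inv_sq]
lemma antipode_F' : antipode ℂ (F p) = -(zp (Ku p) 2 * F p) := by rw [antipode_F, K_sq]
lemma antipode_K' : antipode ℂ (K p) = zp (Ku p) (-1) := by rw [antipode_K, K_inv]

lemma map_antipode_mul (s t : DBar p ⊗[ℂ] DBar p) :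
    TensorProduct.map (antipode ℂ) (antipode ℂ) (s * t) =
      TensorProduct.map (antipode ℂ) (antipode ℂ) t *
        TensorProduct.map (antipode ℂ) (antipode ℂ) s := by
  induction s with
  | zero => simp
  | add s s' hs hs' => simp only [add_mul, mul_add, map_add, hs, hs']
  | tmul a b =>
    induction t with
    | zero => simp
    | add s s' hs hs' => simp only [add_mul, mul_add, map_add, hs, hs']
    | tmul c d => simp [antipode_mul]

/-- Both sides are anti-multiplicative in `x`, so generators suffice. This is the hypothesis under
which the coproduct of the canonical element was computed. -/
lemma comul_antipode (x : DBar p) : comul (R := ℂ) (antipode ℂ x) =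
    TensorProduct.map (antipode ℂ) (antipode ℂ) (flip21 (comul (R := ℂ) x)) := by
  have hx : x ∈ Algebra.adjoin ℂ {E p, F p, K p} := by rw [adjoin]; exact Algebra.mem_top
  induction hx using Algebra.adjoin_induction with
  | mem x hx =>
    rcases hx with rfl | rfl | rfl
    · rw [antipode_E', map_neg, Bialgebra.comul_mul, comul_zp, comul_E', map_add, flip21_tmul,
        flip21_tmul]
      simp only [map_add, TensorProduct.map_tmul, antipode_E', antipode_zp, antipode_one, add_mul,
        Algebra.TensorProduct.tmul_mul_tmul, one_mul, zp_mul_neg, TensorProduct.neg_tmul,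
        TensorProduct.tmul_neg]
      abel
    · rw [antipode_F', map_neg, Bialgebra.comul_mul, comul_zp, comul_F', map_add, flip21_tmul,
        flip21_tmul]
      simp only [map_add, TensorProduct.map_tmul, antipode_F', antipode_zp, antipode_one, mul_add,
        Algebra.TensorProduct.tmul_mul_tmul, mul_one, zp_mul_neg, TensorProduct.neg_tmul,
        TensorProduct.tmul_neg, neg_neg]
      abel
    · rw [antipode_K', comul_zp, comul_K, flip21_tmul, TensorProduct.map_tmul, antipode_K']
  | algebraMap r => 
    simp [Algebra.algebraMap_eq_smul_one, Algebra.TensorProduct.one_def, flip21_tmul]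
  | add x y _ _ hx hy => simp only [map_add, hx, hy]
  | mul x y _ _ hx hy =>
    rw [antipode_mul, Bialgebra.comul_mul, Bialgebra.comul_mul, map_mul, map_antipode_mul, hx, hy]

/-- The Drinfeld element. -/
def u (p : ℕ) [NeZero p] : DBar p := canonicalElement (Rbar p)

/-- The expansion of 0 = ε(E)u is -E K^(-2) u + K^(-2) u E. -/
lemma u_mul_E (hp : 2 ≤ p) : u p * E p = zp (Ku p) 2 * E p * zp (Ku p) (-2) * u p := by
  have h := (isUniversalRMatrix hp).counit_smul_canonicalElement (E p)
  rw [counit_E, zero_smul, comul_E', mul_add, canonicalElement_add, canonicalElement_mul_tmul,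
    canonicalElement_mul_tmul, antipode_E', antipode_zp, mul_one] at h
  have h2 := congrArg (fun x => zp (Ku p) 2 * x) h
  simp only [mul_zero, mul_add, neg_mul, mul_neg, ← mul_assoc, zp_mul_neg, one_mul] at h2
  have h3 := eq_neg_of_add_eq_zero_right h2.symm
  rw [neg_neg] at h3
  exact h3

lemma u_mul_F (hp : 2 ≤ p) : u p * F p = zp (Ku p) 2 * F p * u p * zp (Ku p) (-2) := by
  have h := (isUniversalRMatrix hp).counit_smul_canonicalElement (F p)
  rw [counit_F, zero_smul, comul_F', mul_add, canonicalElement_add, canonicalElement_mul_tmul,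
    canonicalElement_mul_tmul, antipode_F', antipode_one, one_mul] at h
  have h3 := eq_neg_of_add_eq_zero_right h.symm
  simp only [neg_mul, neg_neg] at h3
  exact h3

lemma u_mul_zp (hp : 2 ≤ p) (n : ℤ) : u p * zp (Ku p) n = zp (Ku p) n * u p := by
  have h := (isUniversalRMatrix hp).counit_smul_canonicalElement (zp (Ku p) n)
  rw [counit_zp, one_smul, comul_zp, canonicalElement_mul_tmul, antipode_zp] at h
  have h2 := congrArg (fun x => zp (Ku p) n * x) h
  simp only [← mul_assoc, zp_mul_neg, one_mul] at h2
  exact h2.symm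

/-- The quotient of the Drinfeld element by the balancing group-like element. -/
def vElt (p : ℕ) [NeZero p] : DBar p := zp (Ku p) (-2 * p - 2) * u p

/-- Conjugation by K^(2p) rescales `E` by q^(2p) = 1. Hence the factor K^(-2p) in `vElt` does not
affect centrality; it accounts for the p in the exponent (j + p + 1)²/2 of the ribbon element. -/
lemma zp_two_p_E : zp (Ku p) (-2 * p) * E p = E p * zp (Ku p) (-2 * p) := by
  have := qpow_two_p_int p (-1)
  rw [zp_E]
  push_cast at this ⊢
  rw [show (-2 * p : ℂ) = 2 * p * -1 by ring, this, one_smul]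

lemma zp_two_p_F : zp (Ku p) (-2 * p) * F p = F p * zp (Ku p) (-2 * p) := by
  have := qpow_two_p_int p 1
  rw [zp_F]
  push_cast at this ⊢
  rw [show (-(-2 * p) : ℂ) = 2 * p * 1 by ring, this, one_smul]

lemma vElt_mul_E (hp : 2 ≤ p) : vElt p * E p = E p * vElt p := by
  have e : zp (Ku p) (-2 * p - 2) = zp (Ku p) (-2 * p) * zp (Ku p) (-2) := by
    rw [← zp_add, sub_eq_add_neg]
  have h : zp (Ku p) (-2) * (u p * E p) = E p * zp (Ku p) (-2) * u p := by
    rw [u_mul_E hp]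
    simp only [← mul_assoc, zp_neg_mul, one_mul]
  rw [vElt, e, mul_assoc, mul_assoc, h, mul_assoc, ← mul_assoc _ (E p), zp_two_p_E]
  simp only [mul_assoc]

lemma vElt_mul_F (hp : 2 ≤ p) : vElt p * F p = F p * vElt p := by
  have e : zp (Ku p) (-2 * p - 2) = zp (Ku p) (-2 * p) * zp (Ku p) (-2) := by
    rw [← zp_add, sub_eq_add_neg]
  have h : zp (Ku p) (-2) * (u p * F p) = F p * zp (Ku p) (-2) * u p := by
    rw [u_mul_F hp, mul_assoc _ (u p), u_mul_zp hp]
    simp only [← mul_assoc, zp_neg_mul, one_mul]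
  rw [vElt, e, mul_assoc, mul_assoc, h, mul_assoc, ← mul_assoc _ (F p), zp_two_p_F]
  simp only [mul_assoc]

lemma vElt_mul_zp (hp : 2 ≤ p) (n : ℤ) : vElt p * zp (Ku p) n = zp (Ku p) n * vElt p := by
  rw [vElt, mul_assoc, u_mul_zp hp, ← mul_assoc, zp_comm, mul_assoc]

omit [NeZero p] in
lemma mem_center_of_commute {z : DBar p} (hE : z * E p = E p * z) (hF : z * F p = F p * z)
    (hK : z * K p = K p * z) : z ∈ Subalgebra.center ℂ (DBar p) := by
  rw [Subalgebra.mem_center_iff]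
  intro x
  have hx : x ∈ Algebra.adjoin ℂ {E p, F p, K p} := by rw [adjoin]; exact Algebra.mem_top
  induction hx using Algebra.adjoin_induction with
  | mem x hx =>
    rcases hx with rfl | rfl | rfl
    · exact hE.symm
    · exact hF.symm
    · exact hK.symm
  | algebraMap r => exact Algebra.commutes _ _
  | add x y _ _ hx hy => rw [add_mul, mul_add, hx, hy]
  | mul x y _ _ hx hy => rw [mul_assoc, hy, ← mul_assoc, hx, mul_assoc]

lemma vElt_mem_center (hp : 2 ≤ p) : vElt p ∈ Subalgebra.center ℂ (DBar p) := by
  refine mem_center_of_commute (vElt_mul_E hp) (vElt_mul_F hp) ?_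
  have := vElt_mul_zp hp 1
  rwa [zp_one, Ku_val] at this

/-- The factor K^(-2p-2) is group-like and M commutes with its coproduct, so the formula for Δ(u)
passes to v. -/
lemma comul_vElt (hp : 2 ≤ p) : mMatrix (Rbar p) * comul (R := ℂ) (vElt p) =
    vElt p ⊗ₜ[ℂ] vElt p := by
  obtain ⟨s, hs⟩ := TensorProduct.exists_finset (Rbar p)
  have h := (isUniversalRMatrix hp).mMatrix_mul_comul_canonicalElement
    (a := Prod.fst) (b := Prod.snd) hs comul_antipode
  have hc := (isUniversalRMatrix hp).mMatrix_comm (zp (Ku p) (-2 * p - 2))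
  have hu : canonicalElement (Rbar p) = u p := rfl
  rw [hu] at h
  rw [vElt, Bialgebra.comul_mul, ← mul_assoc, hc, mul_assoc, h, comul_zp,
    Algebra.TensorProduct.tmul_mul_tmul]

lemma isUnit_mMatrix (hp : 2 ≤ p) : IsUnit (mMatrix (Rbar p)) :=
  ((isUniversalRMatrix hp).isUnit.map flip21).mul (isUniversalRMatrix hp).isUnit

lemma u_eq : u p = zp (Ku p) (2 * p + 2) * vElt p := by
  rw [vElt, ← mul_assoc, ← zp_add]
  ring_nf
  rw [zp_zero, one_mul]

lemma vElt_comm (hp : 2 ≤ p) (x : DBar p) : x * vElt p = vElt p * x :=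
  Subalgebra.mem_center_iff.1 (vElt_mem_center hp) x

/-- Because v is central, the canonical element of `Rbar p * t` is a left multiple of v for every t.
Taking t = R⁻¹ gives 1. -/
lemma isUnit_vElt (hp : 2 ≤ p) : IsUnit (vElt p) := by
  have key : ∀ t : DBar p ⊗[ℂ] DBar p, ∃ w, canonicalElement (Rbar p * t) = w * vElt p := by
    intro t
    induction t with
    | zero => exact ⟨0, by simp [canonicalElement_zero]⟩
    | add s t hs ht =>
      obtain ⟨a, ha⟩ := hs
      obtain ⟨b, hb⟩ := ht
      exact ⟨a + b, by rw [mul_add, canonicalElement_add, ha, hb, add_mul]⟩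
    | tmul c d =>
      refine ⟨antipode ℂ d * zp (Ku p) (2 * p + 2) * c, ?_⟩
      have hu : canonicalElement (Rbar p) = u p := rfl
      rw [canonicalElement_mul_tmul, hu, u_eq, mul_assoc, mul_assoc, mul_assoc, mul_assoc,
        vElt_comm hp c]
  obtain ⟨r, hr⟩ := (isUniversalRMatrix hp).isUnit.exists_right_inv
  obtain ⟨w, hw⟩ := key r
  rw [hr, Algebra.TensorProduct.one_def, canonicalElement_tmul, antipode_one, one_mul] at hw
  exact ⟨⟨vElt p, w, by rw [← vElt_comm hp, ← hw], hw.symm⟩, rfl⟩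

end DBar

/-! ### Signs and Gauss sums expressed by powers of q. -/

lemma qpow_int_mul_p (p : ℕ) [NeZero p] (m : ℤ) : qpow p (p * m) = (-1) ^ m := by
  have hp := cast_ne p
  have h : qpow p p = -1 := by
    rw [qpow, ← Complex.exp_pi_mul_I]
    congr 1
    field_simp
  have h2 : ∀ n : ℕ, qpow p (p * n) = (-1) ^ n := fun n => by rw [← h, qpow_pow, mul_comm]
  obtain ⟨n, rfl | rfl⟩ := m.eq_nat_or_neg
  · exact_mod_cast h2 n
  · rw [Int.cast_neg, mul_neg, qpow_neg, zpow_neg]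
    exact_mod_cast congrArg (·⁻¹) (h2 n)

lemma qpow_four_p_int (p : ℕ) [NeZero p] (m : ℤ) : qpow p (4 * p * m) = 1 := by
  rw [← qpow_two_p_int p (2 * m)]
  congr 1; push_cast; ring

/-- On integers q^(x²/2) has period 2p, so the Gauss sum may be started anywhere. -/
lemma gauss_sum_shift (p : ℕ) [NeZero p] (n : ℤ) :
    ∑ j ∈ Finset.range (2 * p), qpow p (((j : ℂ) + n) ^ 2 / 2) =
      ((√(p : ℝ) : ℝ) : ℂ) * (1 + Complex.I) := by
  have hp := cast_ne p
  have h := sum_range_shift (f := fun j : ℤ => qpow p ((j : ℂ) ^ 2 / 2)) (N := 2 * p) (fun j => by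
    have := qpow_two_p_int p (j + p)
    rw [show (((j + (2 * p : ℕ) : ℤ) : ℂ) ^ 2 / 2) = (j : ℂ) ^ 2 / 2 + 2 * p * (j + p : ℤ) by
      push_cast; ring, qpow_add, this, mul_one]) n
  rw [← quadratic_gauss_sum p]
  simp only [Int.cast_add, Int.cast_natCast] at h
  rw [h]
  refine Finset.sum_congr rfl fun j _ => ?_
  rw [qpow]
  congr 1
  field_simp

/-! ### The interpolating polynomials -/

section newton

open Polynomial

variable (p : ℕ)

/-- The value of the Casimir element on a highest weight vector. -/
def casVal (x : ℂ) : ℂ := (qpow p x + qpow p (-x)) / (qpow p 1 - qpow p (-1)) ^ 2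

/-- The value of the ribbon element on a highest weight vector. -/
def ribVal (x : ℂ) : ℂ := qpow p (-(x * (p + 1)) - x ^ 2 / 2)

/-- The coefficients of the ribbon element. -/
def ribCoeff (m : ℕ) : ℂ :=
  (qpow p 1 - qpow p (-1)) ^ m / qFactorial p m * qpow p (-(m : ℂ) / 2)

/-- The Newton basis polynomials for the values of the Casimir element. -/
def casPoly (s : ℂ) (m : ℕ) : ℂ[X] := ∏ r ∈ Finset.range m, (X - C (casVal p (s + 1 + 2 * r)))

/-- The polynomial in the Casimir element by which the ribbon element acts on a weight space. -/
def ribPoly (s : ℂ) : ℂ[X] :=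
  ∑ m ∈ Finset.range p, C (ribCoeff p m * ribVal p (s + m)) * casPoly p s m

lemma casPoly_succ (s : ℂ) (m : ℕ) :
    casPoly p s (m + 1) = (X - C (casVal p (s + 1 + 2 * m))) * casPoly p s m := by
  rw [casPoly, Finset.prod_range_succ, mul_comm, casPoly]

lemma casPoly_succ' (s : ℂ) (m : ℕ) :
    casPoly p s (m + 1) = (X - C (casVal p (s + 1))) * casPoly p (s + 2) m := by
  rw [casPoly, Finset.prod_range_succ', mul_comm, casPoly]
  congr 1
  · simp
  · refine Finset.prod_congr rfl fun r _ => ?_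
    congr 3; push_cast; ring

/-- The two products share all roots but one, so their difference is a constant times the product of
the common factors. -/
lemma casPoly_shift (s : ℂ) (m : ℕ) : casPoly p s (m + 1) = casPoly p (s + 2) (m + 1) +
    C (casVal p (s + 1 + 2 * (m + 1)) - casVal p (s + 1)) * casPoly p (s + 2) m := by
  rw [casPoly_succ', casPoly_succ, show s + 2 + 1 + 2 * (m : ℂ) = s + 1 + 2 * (m + 1) by ring,
    C_sub]
  ring

lemma ribVal_one [NeZero p] (t : ℂ) : ribVal p (t + 1) * qpow p (t + 3 / 2) = - ribVal p t := by
  have h := qpow_int_mul_p p (-1)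
  rw [ribVal, ribVal, ← qpow_add, show -((t + 1) * (p + 1)) - (t + 1) ^ 2 / 2 + (t + 3 / 2) =
    p * ((-1 : ℤ) : ℂ) + (-(t * (p + 1)) - t ^ 2 / 2) by push_cast; ring, qpow_add, h]
  simp

lemma ribVal_sub [NeZero p] (t : ℂ) : ribVal p t - ribVal p (t + 2) =
    -(ribVal p (t + 1) * qpow p (-1 / 2) * (qpow p (t + 2) - qpow p (-(t + 2)))) := by
  have h1 := ribVal_one p t
  have h2 := ribVal_one p (t + 1)
  have h3 : ribVal p (t + 2) = - (ribVal p (t + 1) * qpow p (-(t + 5 / 2))) := by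
    rw [← neg_eq_iff_eq_neg.2 h2, show t + 1 + 1 = t + 2 by ring]
    rw [neg_mul, neg_neg, mul_assoc, ← qpow_add]
    ring_nf
    rw [qpow_zero, mul_one]
  have e1 : qpow p (-1 / 2) * qpow p (t + 2) = qpow p (t + 3 / 2) := by
    rw [← qpow_add]; congr 1; ring
  have e2 : qpow p (-1 / 2) * qpow p (-(t + 2)) = qpow p (-(t + 5 / 2)) := by
    rw [← qpow_add]; congr 1; ring
  rw [h3, mul_assoc, mul_sub, e1, e2]
  linear_combination h1

lemma casVal_sub (x y : ℂ) : casVal p (x + y) - casVal p (x - y) =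
    (qpow p x - qpow p (-x)) * (qpow p y - qpow p (-y)) / (qpow p 1 - qpow p (-1)) ^ 2 := by
  rw [casVal, casVal, ← sub_div, sub_mul, mul_sub, mul_sub]
  simp only [← qpow_add]
  congr 1
  rw [show -(x + y) = -x + -y by ring, show x - y = x + -y by ring,
    show -(x + -y) = -x + y by ring]
  ring

variable [NeZero p]

lemma ribCoeff_succ (hp : 2 ≤ p) {m : ℕ} (hm : m + 1 < p) :
    ribCoeff p (m + 1) * qInt p (m + 1 : ℕ) =
      ribCoeff p m * (qpow p 1 - qpow p (-1)) * qpow p (-1 / 2) := by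
  have h1 := qInt_ne_zero p hp (m := m + 1) (by omega) hm
  have h2 := qFactorial_ne_zero p hp (m := m) (by omega)
  have e : qpow p (-((m + 1 : ℕ) : ℂ) / 2) = qpow p (-(m : ℂ) / 2) * qpow p (-1 / 2) := by
    rw [← qpow_add]; congr 1; push_cast; ring
  rw [ribCoeff, ribCoeff, qFactorial_succ, e]
  field_simp
  ring

/-- The two contributions at `casPoly p (s + 2) m` to the difference of consecutive interpolating
polynomials: one from the change of value, one from exchanging a root in degree m + 1. Their
cancellation makes the difference telescope. -/
lemma ribPoly_coeff_cancel (hp : 2 ≤ p) (s : ℂ) {m : ℕ} (hm : m + 1 < p) :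
    ribCoeff p m * (ribVal p (s + m) - ribVal p (s + m + 2)) +
      ribCoeff p (m + 1) * ribVal p (s + m + 1) *
        (casVal p (s + 1 + 2 * (m + 1)) - casVal p (s + 1)) = 0 := by
  have hd := qdiff_ne_zero (p := p) hp
  have h1 := ribCoeff_succ p hp hm
  have h2 := casVal_sub p (s + m + 2) (m + 1)
  rw [show s + m + 2 + (m + 1) = s + 1 + 2 * (m + 1 : ℂ) by ring,
    show s + m + 2 - (m + 1) = s + 1 by ring] at h2
  rw [h2, ribVal_sub]
  have h3 : qpow p (m + 1) - qpow p (-(m + 1)) =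
      qInt p (m + 1 : ℕ) * (qpow p 1 - qpow p (-1)) := by
    rw [qInt]; push_cast; field_simp
  rw [h3]
  generalize qpow p (-1 / 2) = c at h1 ⊢
  field_simp
  linear_combination (ribVal p (s + m + 1) * (qpow p (s + m + 2) - qpow p (-(s + m + 2)))) * h1

/-- The leading coefficient of the difference of consecutive interpolating polynomials. -/
def ribLead (s : ℂ) : ℂ := ribCoeff p (p - 1) *
  (ribVal p (s + (p - 1 : ℕ)) - ribVal p (s + (p - 1 : ℕ) + 2))

/-- The partial sums are shown to leave only the top term of degree n; at n = p - 1 there is no next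
term left to cancel it. -/
lemma ribPoly_sub (hp : 2 ≤ p) (s : ℂ) : ribPoly p s - ribPoly p (s + 2) =
    C (ribLead p s) * casPoly p (s + 2) (p - 1) := by
  have key : ∀ n, n + 1 ≤ p →
      ∑ m ∈ Finset.range (n + 1), C (ribCoeff p m * ribVal p (s + m)) * casPoly p s m -
      ∑ m ∈ Finset.range (n + 1), C (ribCoeff p m * ribVal p (s + 2 + m)) * casPoly p (s + 2) m =
      C (ribCoeff p n * (ribVal p (s + n) - ribVal p (s + n + 2))) * casPoly p (s + 2) n := by
    intro n
    induction n with
    | zero =>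
      intro _
      simp [casPoly, mul_sub]
    | succ n ih =>
      intro hn
      rw [Finset.sum_range_succ, Finset.sum_range_succ _ (n + 1), add_sub_add_comm,
        ih (by omega), casPoly_shift]
      have h := congrArg C (ribPoly_coeff_cancel p hp s (m := n) (by omega))
      simp only [C_add, C_mul, C_sub, C_0] at h ⊢
      rw [show s + 2 + ((n + 1 : ℕ) : ℂ) = s + (n + 1 : ℕ) + 2 by ring,
        show s + ((n + 1 : ℕ) : ℂ) = s + n + 1 by push_cast; ring]
      linear_combination casPoly p (s + 2) n * h
  have h := key (p - 1) (by omega)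
  rw [Nat.sub_add_cancel (by omega)] at h
  exact h

lemma casVal_neg (p : ℕ) (x : ℂ) : casVal p (-x) = casVal p x := by
  rw [casVal, casVal, neg_neg, add_comm]

lemma casVal_add_period (x : ℂ) : casVal p (x + 2 * p) = casVal p x := by
  have h1 := qpow_two_p_int p 1
  have h2 := qpow_two_p_int p (-1)
  rw [Int.cast_one, mul_one] at h1
  rw [Int.cast_neg, Int.cast_one, mul_neg, mul_one] at h2
  rw [casVal, casVal, neg_add, qpow_add, qpow_add p (-x), h1, h2, mul_one, mul_one]

/-- The Casimir values are even and 2p-periodic, so reversing the order of the roots identifies the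
two products. -/
lemma casPoly_reflect (s : ℂ) : casPoly p (-s) (p - 1) = casPoly p (s + 2) (p - 1) := by
  rw [casPoly, casPoly, ← Finset.prod_range_reflect]
  refine Finset.prod_congr rfl fun r hr => ?_
  have hr := Finset.mem_range.1 hr
  congr 2
  rw [← casVal_neg, ← casVal_add_period, Nat.sub_sub, Nat.sub_sub, Nat.cast_sub (by omega)]
  congr 1
  push_cast
  ring

lemma ribLead_reflect (s : ℤ) : ribLead p (-s - 2) = -ribLead p s := by
  have hp1 : ((p - 1 : ℕ) : ℂ) = p - 1 := by rw [Nat.cast_sub NeZero.one_le, Nat.cast_one]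
  rw [ribLead, ribLead, ribVal_sub, ribVal_sub, hp1]
  have e1 : ribVal p (-s - 2 + (p - 1) + 1) = ribVal p (s + (p - 1) + 1) := by
    have h := qpow_four_p_int p (s + 1)
    rw [ribVal, ribVal, show (-((-s - 2 + (p - 1) + 1) * (p + 1)) -
      (-s - 2 + (p - 1) + 1) ^ 2 / 2 : ℂ) = -((s + (p - 1) + 1) * (p + 1)) -
      (s + (p - 1) + 1) ^ 2 / 2 + 4 * p * (s + 1 : ℤ) by push_cast; ring, qpow_add, h, mul_one]
  have e2 : qpow p (-s - 2 + (p - 1) + 2) = - qpow p (-(s + 1)) := by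
    have h := qpow_int_mul_p p 1
    rw [show (-s - 2 + (p - 1) + 2 : ℂ) = p * ((1 : ℤ) : ℂ) + -(s + 1) by push_cast; ring, qpow_add,
      h]; simp
  have e3 : qpow p (-(-s - 2 + (p - 1) + 2)) = - qpow p (s + 1) := by
    have h := qpow_int_mul_p p (-1)
    rw [show (-(-s - 2 + (p - 1) + 2) : ℂ) = p * ((-1 : ℤ) : ℂ) + (s + 1) by push_cast; ring,
      qpow_add, h]; simp
  have e4 : qpow p (s + (p - 1) + 2) = - qpow p (s + 1) := by
    have h := qpow_int_mul_p p 1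
    rw [show (s + (p - 1) + 2 : ℂ) = p * ((1 : ℤ) : ℂ) + (s + 1) by push_cast; ring, qpow_add,
      h]; simp
  have e5 : qpow p (-(s + (p - 1) + 2)) = - qpow p (-(s + 1)) := by
    have h := qpow_int_mul_p p (-1)
    rw [show (-(s + (p - 1) + 2) : ℂ) = p * ((-1 : ℤ) : ℂ) + -(s + 1) by push_cast; ring,
      qpow_add, h]; simp
  rw [e1, e2, e3, e4, e5]
  ring

/-- By the reflection lemmas the function s ↦ `ribPoly p s - ribPoly p (-s)` is invariant under s ↦
s + 2. It is also odd. Comparing its values at -|s| and |s|, which differ by an even shift, shows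
that it is zero. -/
lemma ribPoly_neg (hp : 2 ≤ p) (s : ℤ) : ribPoly p (-s) = ribPoly p s := by
  have step : ∀ s : ℤ, ribPoly p s - ribPoly p (-s) =
      ribPoly p ((s + 2 : ℤ) : ℂ) - ribPoly p (-((s + 2 : ℤ) : ℂ)) := by
    intro s
    have h1 := ribPoly_sub p hp s
    have h2 := ribPoly_sub p hp (-s - 2)
    rw [ribLead_reflect, show (-s - 2 + 2 : ℂ) = -s by ring, casPoly_reflect, C_neg] at h2
    push_cast
    rw [show (-(s + 2) : ℂ) = -s - 2 by ring]
    linear_combination h1 + h2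
  have hnat : ∀ n : ℕ, ∀ s : ℤ, ribPoly p s - ribPoly p (-s) =
      ribPoly p ((s + 2 * n : ℤ) : ℂ) - ribPoly p (-((s + 2 * n : ℤ) : ℂ)) := by
    intro n
    induction n with
    | zero => intro s; simp
    | succ n ih =>
      intro s
      rw [ih s, step]
      congr 3 <;> (push_cast; ring)
  have h := hnat s.natAbs (-s.natAbs)
  have h1 : (-(s.natAbs : ℤ) + 2 * (s.natAbs : ℤ)) = s.natAbs := by ring
  rw [h1] at h
  have h3 : (2 : ℂ[X]) * (ribPoly p (-(s.natAbs : ℤ) : ℤ) - ribPoly p (s.natAbs : ℤ)) = 0 := by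
    rw [Int.cast_neg, neg_neg] at h
    rw [Int.cast_neg]
    linear_combination h
  have h4 := (mul_eq_zero.1 h3).resolve_left two_ne_zero
  rw [Int.cast_neg] at h4
  rcases Int.natAbs_eq s with h5 | h5
  · rw [h5]; exact sub_eq_zero.1 h4
  · rw [h5, Int.cast_neg, neg_neg]; exact (sub_eq_zero.1 h4).symm

end newton

/-! ### Weight projectors and the Casimir element. -/

namespace DBar

open HopfAlgebra Coalgebra

variable {p : ℕ} [NeZero p]

lemma zp_idem (s n : ℤ) : zp (Ku p) n * idem p (Ku p) s = qpow p (s * n / 2) • idem p (Ku p) s :=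
  zp_mul_idem Ku_pow s n

lemma idem_zp (s n : ℤ) : idem p (Ku p) s * zp (Ku p) n = qpow p (s * n / 2) • idem p (Ku p) s := by
  have h := idem_mul_of_comm (p := p) (a := 0) (Ku_zp n) s
  rw [h, mul_zero, sub_zero, zp_idem]

lemma E_idem (s : ℤ) : E p * idem p (Ku p) s = idem p (Ku p) (s + 2) * E p := by
  have h := idem_mul_of_comm (p := p) (a := 1) Ku_E (s + 2)
  rw [h]; congr 2; ring

lemma F_idem (s : ℤ) : F p * idem p (Ku p) s = idem p (Ku p) (s - 2) * F p := by
  have h := idem_mul_of_comm (p := p) (a := -1) Ku_F (s - 2)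
  rw [h]; congr 2; ring

lemma E_pow_idem (m : ℕ) (s : ℤ) :
    E p ^ m * idem p (Ku p) s = idem p (Ku p) (s + 2 * m) * E p ^ m := by
  induction m with
  | zero => simp
  | succ m ih =>
    rw [pow_succ', mul_assoc, ih, ← mul_assoc, E_idem, mul_assoc]
    congr 2; push_cast; ring

lemma F_pow_idem (m : ℕ) (s : ℤ) :
    F p ^ m * idem p (Ku p) s = idem p (Ku p) (s - 2 * m) * F p ^ m := by
  induction m with
  | zero => simp
  | succ m ih =>
    rw [pow_succ', mul_assoc, ih, ← mul_assoc, F_idem, mul_assoc]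
    congr 2; push_cast; ring

/-- The Casimir element. -/
def casimir (p : ℕ) [NeZero p] : DBar p := F p * E p +
  (((qpow p 1 - qpow p (-1)) ^ 2)⁻¹ : ℂ) • (qpow p 1 • zp (Ku p) 2 + qpow p (-1) • zp (Ku p) (-2))

lemma casimir_eq (hp : 2 ≤ p) : casimir p = E p * F p + (((qpow p 1 - qpow p (-1)) ^ 2)⁻¹ : ℂ) •
    (qpow p (-1) • zp (Ku p) 2 + qpow p 1 • zp (Ku p) (-2)) := by
  have hd := qdiff_ne_zero (p := p) hp
  have h : E p * F p = F p * E p +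
    (qpow p 1 - qpow p (-1))⁻¹ • (zp (Ku p) 2 - zp (Ku p) (-2)) := by rw [← EF]; abel
  rw [casimir, h, add_assoc]
  congr 1
  match_scalars
  · field_simp; ring
  · field_simp; ring

/-- The antipode sends FE to EF and exchanges K^2 with K^(-2), hence interchanges the two
expressions of the Casimir element. -/
lemma antipode_casimir (hp : 2 ≤ p) : antipode ℂ (casimir p) = casimir p := by
  have h : E p * zp (Ku p) (-2) * (zp (Ku p) 2 * F p) = E p * F p := by
    rw [mul_assoc, ← mul_assoc (zp (Ku p) (-2)), zp_neg_mul, one_mul]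
  rw [casimir_eq hp]
  conv_lhs => rw [← casimir_eq hp, casimir]
  simp only [map_add, map_smul, antipode_mul, antipode_E', antipode_F', antipode_zp, neg_mul_neg,
    neg_neg]
  rw [h, add_comm (qpow p 1 • _)]

lemma F_mul_E_idem (s : ℤ) : F p * E p * idem p (Ku p) s =
    casimir p * idem p (Ku p) s - casVal p (s + 1) • idem p (Ku p) s := by
  have e1 : qpow p 1 * qpow p ((s : ℂ) * (2 : ℤ) / 2) = qpow p (s + 1) := by
    rw [← qpow_add]; congr 1; push_cast; ring
  have e2 : qpow p (-1) * qpow p ((s : ℂ) * (-2 : ℤ) / 2) = qpow p (-(s + 1)) := by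
    rw [← qpow_add]; congr 1; push_cast; ring
  rw [casimir, add_mul, add_sub_assoc, left_eq_add, smul_mul_assoc, add_mul, smul_mul_assoc,
    smul_mul_assoc, zp_idem, zp_idem, smul_smul, smul_smul, e1, e2, ← add_smul,
    smul_smul, ← sub_smul, casVal, div_eq_inv_mul, sub_self, zero_smul]

lemma casimir_mul_F (hp : 2 ≤ p) : casimir p * F p = F p * casimir p := by
  have e1 : qpow p 1 * qpow p (-(2 : ℤ)) = qpow p (-1) := by
    rw [← qpow_add]; congr 1; push_cast; ring
  have e2 : qpow p (-1) * qpow p (-(-2 : ℤ)) = qpow p 1 := by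
    rw [← qpow_add]; congr 1; push_cast; ring
  conv_rhs => rw [casimir_eq hp]
  rw [casimir]
  simp only [add_mul, mul_add, smul_mul_assoc, mul_smul_comm, zp_F, smul_smul, mul_assoc, e1, e2]

lemma casimir_mul_idem (s : ℤ) : casimir p * idem p (Ku p) s = idem p (Ku p) s * casimir p := by
  have h2 : F p * E p * idem p (Ku p) s = idem p (Ku p) s * (F p * E p) := by
    rw [mul_assoc, E_idem, ← mul_assoc, F_idem, add_sub_cancel_right, mul_assoc]
  rw [casimir, add_mul, mul_add, h2]
  congr 1
  simp only [smul_mul_assoc, mul_smul_comm, add_mul, mul_add, zp_idem, idem_zp]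

open Polynomial

lemma aeval_casimir_comm {x : DBar p} (h : casimir p * x = x * casimir p) (f : ℂ[X]) :
    aeval (casimir p) f * x = x * aeval (casimir p) f := by
  induction f using Polynomial.induction_on' with
  | add f g hf hg => rw [map_add, add_mul, mul_add, hf, hg]
  | monomial n a =>
    have h' : Commute (casimir p) x := h
    rw [aeval_monomial, mul_assoc, (h'.pow_left n).eq, ← mul_assoc, Algebra.commutes, mul_assoc]

/-- Peeling off the outer pair F … E leaves the same expression at weight s + 2, which by induction
is a polynomial in the Casimir element and commutes with `F`; the outer pair then contributes the
root at s + 1. -/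
lemma F_pow_E_pow_idem (hp : 2 ≤ p) (m : ℕ) (s : ℤ) : F p ^ m * E p ^ m * idem p (Ku p) s =
    aeval (casimir p) (casPoly p s m) * idem p (Ku p) s := by
  induction m generalizing s with
  | zero => simp [casPoly]
  | succ m ih =>
    have h := ih (s + 2)
    have h1 : F p ^ (m + 1) * E p ^ (m + 1) * idem p (Ku p) s =
        F p * (F p ^ m * E p ^ m * idem p (Ku p) (s + 2)) * E p := by
      rw [pow_succ' (F p), pow_succ (E p)]
      simp only [mul_assoc]
      rw [E_idem]
    have h2 := aeval_casimir_comm (casimir_mul_F hp) (casPoly p (s + 2) m)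
    have h3 := aeval_casimir_comm (p := p) rfl (casPoly p (s + 2) m)
    push_cast at h
    rw [h1, h, casPoly_succ', map_mul, map_sub, aeval_X, aeval_C]
    generalize aeval (casimir p) (casPoly p (s + 2) m) = x at h2 h3 ⊢
    rw [← mul_assoc, ← h2, mul_assoc, mul_assoc, ← E_idem, ← mul_assoc (F p), F_mul_E_idem, mul_sub,
      ← mul_assoc, h3, sub_mul, sub_mul, mul_smul_comm, Algebra.algebraMap_eq_smul_one,
      smul_mul_assoc, one_mul, smul_mul_assoc]

lemma antipode_aeval_casimir (hp : 2 ≤ p) (f : ℂ[X]) :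
    antipode ℂ (aeval (casimir p) f) = aeval (casimir p) f := by
  induction f using Polynomial.induction_on' with
  | add f g hf hg => rw [map_add, map_add, hf, hg]
  | monomial n a =>
    rw [aeval_monomial, Algebra.algebraMap_eq_smul_one, smul_mul_assoc, one_mul, map_smul,
      antipode_pow, antipode_casimir hp]

lemma antipode_idem (s : ℤ) : antipode ℂ (idem p (Ku p) s) = idem p (Ku p) (-s) := by
  have hs := sum_range_neg (f := fun j : ℤ => qpow p (-(((-s : ℤ) : ℂ) * j) / 2) • zp (Ku p) j)
    (N := 4 * p) (fun j => by
      have := qpow_half_periodic p s j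
      rw [zp_Ku_add]
      push_cast at this ⊢
      simp only [neg_mul, neg_neg]
      rw [this])
  rw [idem, idem, map_smul, map_sum]
  congr 1
  refine Eq.trans (Finset.sum_congr rfl fun j _ => ?_) hs
  rw [map_smul, antipode_zp]
  congr 2
  push_cast
  ring

/-! ### The ribbon element -/

/-- On the weight projector K^(2j) becomes a phase. Completing the square in j turns the inner sum
into a shifted Gauss sum equal to √p(1 + i), which the prefactor (1 - i)/(2√p) cancels. -/
lemma ribbonElement_mul_idem (hp : 2 ≤ p) (s : ℤ) : ribbonElement p * idem p (Ku p) s =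
    aeval (casimir p) (ribPoly p s) * idem p (Ku p) s := by
  have hsq : ((√(p : ℝ) : ℝ) : ℂ) ≠ 0 := by
    rw [Complex.ofReal_ne_zero, Real.sqrt_ne_zero']
    exact_mod_cast NeZero.pos p
  rw [ribbonElement, ribPoly, map_sum, smul_mul_assoc, Finset.sum_mul, Finset.sum_mul,
    Finset.smul_sum]
  refine Finset.sum_congr rfl fun m _ => ?_
  rw [map_mul, aeval_C, mul_assoc, ← F_pow_E_pow_idem hp, Algebra.algebraMap_eq_smul_one,
    smul_mul_assoc, one_mul, Finset.sum_mul]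
  have key : ∀ j ∈ Finset.range (2 * p),
      ((qpow p 1 - qpow p (-1)) ^ m / qFactorial p m *
        qpow p (-(m : ℂ) / 2 + (m : ℂ) * j + ((j : ℂ) + p + 1) ^ 2 / 2)) •
      (F p ^ m * E p ^ m * K p ^ (2 * j)) * idem p (Ku p) s =
      qpow p (((j : ℂ) + ((p + 1 + m + s : ℤ) : ℂ)) ^ 2 / 2) •
        ((ribCoeff p m * ribVal p (s + m)) • (F p ^ m * E p ^ m * idem p (Ku p) s)) := by
    intro j _
    rw [K_pow_eq, smul_mul_assoc, mul_assoc, zp_idem, mul_smul_comm, smul_smul, smul_smul, ribCoeff,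
      ribVal, mul_assoc, mul_assoc, mul_left_comm (qpow p (_ ^ 2 / 2)), ← qpow_add, ← qpow_add,
      mul_assoc, ← qpow_add]
    congr 3
    push_cast
    ring
  rw [Finset.sum_congr rfl key, ← Finset.sum_smul, gauss_sum_shift, smul_smul]
  convert one_smul ℂ _
  field_simp
  ring_nf
  simp [one_add_one_eq_two]

/-- For representatives of `s` in [0, 4p) this is orthogonality of the projectors; both sides depend
on `s` only modulo 4p. -/
lemma cartan_mul_idem_tmul (s : ℤ) : cartan p (Ku p) * (idem p (Ku p) s ⊗ₜ[ℂ] 1) =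
    idem p (Ku p) s ⊗ₜ[ℂ] zp (Ku p) s := by
  have h4 := four_p_ge (p := p)
  have red : ∀ r : ℕ, r < 4 * p → cartan p (Ku p) * (idem p (Ku p) r ⊗ₜ[ℂ] 1) =
      idem p (Ku p) r ⊗ₜ[ℂ] zp (Ku p) r := by
    intro r hr
    rw [cartan_eq', Finset.sum_mul, Finset.sum_eq_single r]
    · rw [Algebra.TensorProduct.tmul_mul_tmul, idem_mul_idem_range Ku_pow hr hr, if_pos rfl, mul_one]
    · intro n hn hne
      rw [Algebra.TensorProduct.tmul_mul_tmul,
        idem_mul_idem_range Ku_pow (Finset.mem_range.1 hn) hr, if_neg hne, TensorProduct.zero_tmul]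
    · exact fun h => absurd (Finset.mem_range.2 hr) h
  have per : ∀ (s : ℤ) (n : ℕ), idem p (Ku p) (s + (4 * p : ℕ) * n) = idem p (Ku p) s ∧
      zp (Ku p) (s + (4 * p : ℕ) * n) = zp (Ku p) s := by
    intro s n
    induction n with
    | zero => simp
    | succ n ih =>
      rw [Nat.cast_succ, mul_add, mul_one, ← add_assoc, idem_periodic, zp_Ku_add]
      exact ih
  obtain ⟨r, hr, n, h | h⟩ : ∃ r : ℕ, r < 4 * p ∧ ∃ n : ℕ, s = r + (4 * p : ℕ) * n ∨
      (r : ℤ) = s + (4 * p : ℕ) * n := by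
    have h0 := Int.emod_nonneg s (b := (4 * p : ℕ)) (by omega)
    have h1 := Int.emod_lt_of_pos s (b := (4 * p : ℕ)) (by omega)
    have h2 := Int.emod_add_mul_ediv s (4 * p : ℕ)
    refine ⟨(s % (4 * p : ℕ)).toNat, by omega, (s / (4 * p : ℕ)).natAbs, ?_⟩
    rw [Int.toNat_of_nonneg h0]
    rcases Int.natAbs_eq (s / (4 * p : ℕ)) with h3 | h3
    · left; rw [← h3]; exact h2.symm
    · right
      have h4 : ((4 * p : ℕ) : ℤ) * (s / (4 * p : ℕ)) =
          -((4 * p : ℕ) * ((s / (4 * p : ℕ)).natAbs : ℤ)) := by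
        conv_lhs => rw [h3]
        ring
      linarith
  · rw [h, (per r n).1, (per r n).2, red r hr]
  · have := red r hr
    rwa [h, (per s n).1, (per s n).2] at this

/-- The sign (-1)^m from the antipode is recorded as q^(pm), so that all scalars stay powers of q.
-/
lemma antipode_F_pow_mul_idem (m : ℕ) (t : ℤ) : antipode ℂ (F p) ^ m * idem p (Ku p) t =
    qpow p (p * m + m * t - m * (m + 1)) • (F p ^ m * idem p (Ku p) t) := by
  have hp1 := qpow_int_mul_p p 1
  induction m with
  | zero => simp [qpow_zero]
  | succ m ih =>
    have h1 : zp (Ku p) 2 * F p * (F p ^ m * idem p (Ku p) t) =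
        qpow p (t - 2 * m - 2) • (F p ^ (m + 1) * idem p (Ku p) t) := by
      rw [mul_assoc, ← mul_assoc (F p), ← pow_succ', F_pow_idem, ← mul_assoc, zp_idem,
        smul_mul_assoc]
      congr 2; push_cast; ring
    have h2 : -qpow p (t - 2 * m - 2) = qpow p (p + (t - 2 * m - 2)) := by
      rw [Int.cast_one, mul_one, zpow_one] at hp1
      rw [qpow_add, hp1, neg_one_mul]
    rw [pow_succ', mul_assoc, ih, mul_smul_comm, antipode_F', neg_mul, h1, ← neg_smul, h2, smul_smul,
      ← qpow_add]
    congr 2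
    push_cast
    ring

/-- Restricting the first leg of R to a weight makes the Cartan part a single power of K, so u
becomes a sum of multiples of F^m E^m on the projector, each a polynomial in the Casimir element. -/
lemma vElt_mul_idem (hp : 2 ≤ p) (s : ℤ) : vElt p * idem p (Ku p) s =
    aeval (casimir p) (ribPoly p s) * idem p (Ku p) s := by
  have h1 : u p * idem p (Ku p) s =
      canonicalElement (Rbar p * (idem p (Ku p) s ⊗ₜ[ℂ] 1)) := by
    rw [canonicalElement_mul_tmul, antipode_one, one_mul]; rfl
  have h2 : ∀ t : Finset ℕ, ∀ f : ℕ → DBar p ⊗[ℂ] DBar p,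
      canonicalElement (∑ m ∈ t, f m) = ∑ m ∈ t, canonicalElement (f m) := by
    intro t f; simp [canonicalElement]
  have h3 : ∀ m : ℕ, canonicalElement (cartan p (Ku p) * ((E p ⊗ₜ[ℂ] F p) ^ m *
      (idem p (Ku p) s ⊗ₜ[ℂ] 1))) = antipode ℂ (F p) ^ m * zp (Ku p) (-(s + 2 * m)) *
        (idem p (Ku p) (s + 2 * m) * E p ^ m) := by
    intro m
    have : (E p ⊗ₜ[ℂ] F p) ^ m * (idem p (Ku p) s ⊗ₜ[ℂ] 1) =
        (idem p (Ku p) (s + 2 * m) ⊗ₜ[ℂ] 1) * ((E p ^ m) ⊗ₜ[ℂ] (F p ^ m)) := by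
      rw [Algebra.TensorProduct.tmul_pow, Algebra.TensorProduct.tmul_mul_tmul,
        Algebra.TensorProduct.tmul_mul_tmul, E_pow_idem, mul_one, one_mul]
    rw [this, ← mul_assoc, cartan_mul_idem_tmul, Algebra.TensorProduct.tmul_mul_tmul,
      canonicalElement_tmul, antipode_mul, antipode_zp, antipode_pow]
  have h4 : ∀ m : ℕ, canonicalElement (rc p m • (cartan p (Ku p) * ((E p ⊗ₜ[ℂ] F p) ^ m *
      (idem p (Ku p) s ⊗ₜ[ℂ] 1)))) = rc p m • (antipode ℂ (F p) ^ m * zp (Ku p) (-(s + 2 * m)) *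
        (idem p (Ku p) (s + 2 * m) * E p ^ m)) := by
    intro m
    rw [← h3]; simp [canonicalElement]
  rw [vElt, mul_assoc, h1, Rbar_eq, qexp, mul_assoc, Finset.sum_mul, Finset.mul_sum, h2, ribPoly,
    map_sum, Finset.sum_mul, Finset.mul_sum]
  refine Finset.sum_congr rfl fun m _ => ?_
  have h5 : antipode ℂ (F p) ^ m * zp (Ku p) (-(s + 2 * m)) * (idem p (Ku p) (s + 2 * m) * E p ^ m) =
      qpow p (-((s + 2 * m) ^ 2 / 2) + (p * m + m * (s + 2 * m) - m * (m + 1))) •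
        (F p ^ m * E p ^ m * idem p (Ku p) s) := by
    rw [mul_assoc, ← mul_assoc (zp _ _), zp_idem, smul_mul_assoc, mul_smul_comm, ← mul_assoc,
      antipode_F_pow_mul_idem, smul_mul_assoc, mul_assoc, ← E_pow_idem, smul_smul, ← qpow_add,
      ← mul_assoc]
    congr 2
    push_cast
    ring
  have h6 : F p ^ m * E p ^ m * idem p (Ku p) s = idem p (Ku p) s * (F p ^ m * E p ^ m) := by
    rw [mul_assoc, E_pow_idem, ← mul_assoc, F_pow_idem, mul_assoc, add_sub_cancel_right]
  have h7 : zp (Ku p) (-2 * p - 2) * (F p ^ m * E p ^ m * idem p (Ku p) s) =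
      qpow p (-(s * (p + 1))) • (F p ^ m * E p ^ m * idem p (Ku p) s) := by
    rw [h6, ← mul_assoc, zp_idem, smul_mul_assoc]
    congr 2
    push_cast
    ring
  -- The exponents on the two sides agree only up to 2pm.
  have h8 : ∀ x, qpow p x = qpow p (x + 2 * p * (m : ℤ)) := fun x => by
    rw [qpow_add, qpow_two_p_int, mul_one]
  rw [map_mul, aeval_C, mul_assoc (algebraMap _ _ _ : DBar p), ← F_pow_E_pow_idem hp,
    Algebra.algebraMap_eq_smul_one, smul_mul_assoc, smul_mul_assoc, one_mul, mul_smul_comm, h4, h5,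
    smul_smul, mul_smul_comm, h7, smul_smul, rc, ribCoeff, ribVal, mul_assoc, mul_assoc, mul_assoc,
    ← qpow_add, ← qpow_add, mul_assoc, ← qpow_add,
    h8 (-(m : ℂ) / 2 + _)]
  congr 3
  push_cast
  ring

lemma ribbonElement_eq (hp : 2 ≤ p) : ribbonElement p = vElt p := by
  rw [← mul_one (ribbonElement p), ← mul_one (vElt p), ← idem_sum p (Ku p), Finset.mul_sum,
    Finset.mul_sum]
  refine Finset.sum_congr rfl fun s _ => ?_
  rw [ribbonElement_mul_idem hp, vElt_mul_idem hp]

/-- The antipode fixes polynomials in the Casimir element and maps the projector of weight s to that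
of weight -s, so the claim is the evenness `ribPoly_neg`. -/
lemma antipode_vElt (hp : 2 ≤ p) : antipode ℂ (vElt p) = vElt p := by
  have hs := sum_range_neg (f := fun s : ℤ => antipode ℂ (vElt p * idem p (Ku p) s)) (N := 4 * p)
    (fun s => by rw [idem_periodic])
  rw [← mul_one (vElt p), ← idem_sum p (Ku p), Finset.mul_sum, map_sum, ← hs]
  refine Finset.sum_congr rfl fun s _ => ?_
  rw [vElt_mul_idem hp, vElt_mul_idem hp, antipode_mul, antipode_aeval_casimir hp, antipode_idem,
    neg_neg, Int.cast_neg, ribPoly_neg p hp, aeval_casimir_comm (casimir_mul_idem s)]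

/-- The counit of the weight zero projector is 1, so v may be evaluated there; every term with m > 0
contains ε(F) = 0. -/
lemma counit_vElt (hp : 2 ≤ p) : counit (R := ℂ) (vElt p) = 1 := by
  have hc := cast_ne p
  have h0 : counit (R := ℂ) (idem p (Ku p) 0) = 1 := by
    rw [idem, map_smul, map_sum]
    simp only [counit_zp, Int.cast_zero, zero_mul, neg_zero, zero_div, qpow_zero, one_smul,
      Finset.sum_const, Finset.card_range, smul_eq_mul, nsmul_eq_mul, mul_one]
    push_cast
    field_simp
  have h := congrArg (counit (R := ℂ)) (vElt_mul_idem hp 0)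
  rw [Bialgebra.counit_mul, h0, mul_one, ribPoly, map_sum, Finset.sum_mul, map_sum] at h
  rw [h, Finset.sum_eq_single 0]
  · simp [casPoly, h0, ribCoeff, ribVal, qFactorial_zero, qpow_zero]
  · intro m _ hm
    rw [map_mul (aeval _), mul_assoc, ← F_pow_E_pow_idem hp, Bialgebra.counit_mul, Bialgebra.counit_mul,
      Bialgebra.counit_mul, Bialgebra.counit_pow, counit_F, zero_pow hm]
    simp
  · intro h
    exact absurd (Finset.mem_range.2 (NeZero.pos p)) h

theorem isRibbonElement (hp : 2 ≤ p) : IsRibbonElement (Rbar p) (ribbonElement p) := by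
  rw [ribbonElement_eq hp]
  refine ⟨isUnit_vElt hp, vElt_mem_center hp, ?_, antipode_vElt hp, counit_vElt hp, ?_⟩
  -- Here u = g v with g group-like and v central and fixed by S, so u S(u) = g v v g⁻¹ = v².
  · change _ = u p * antipode ℂ (u p)
    rw [u_eq, antipode_mul, antipode_zp, antipode_vElt hp, ← vElt_comm hp (zp _ (-_)),
      mul_assoc, ← mul_assoc (vElt p), ← vElt_comm hp, mul_assoc, ← mul_assoc, zp_mul_neg, one_mul,
      sq]
  · rw [← comul_vElt hp, ← mul_assoc, Ring.inverse_mul_cancel _ (isUnit_mMatrix hp), one_mul]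

end DBar

/-! ### Relations of the double and the universal highest weight module -/

/-- The relations satisfied by the generators of the Drinfeld double of `B`. -/
structure DoubleRel {A : Type*} [Ring A] [Algebra ℂ A] (p : ℕ) (e f k c : A) : Prop where
  borel : BorelRel p 2 1 e k
  borel' : BorelRel p 2 1 f c
  kf : k * f = qpow p (-1) • (f * k)
  ce : c * e = qpow p (-1) • (e * c)
  kc : k * c = c * k
  ef : e * f - f * e = (qpow p 1 - qpow p (-1))⁻¹ • (k ^ 2 - c ^ 2)

namespace Verma

variable {R : Type*} [CommRing R] {p : ℕ}

/-- The vector `F ^ m E ^ n v`, where `v` is the generating vector. -/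
def vec (R : Type*) [CommRing R] (p m n : ℕ) : Fin p × Fin p → R :=
  if h : m < p ∧ n < p then Pi.single (⟨m, h.1⟩, ⟨n, h.2⟩) 1 else 0

lemma vec_of_le_left {m n : ℕ} (h : p ≤ m) : vec R p m n = 0 := by
  rw [vec, dif_neg]; omega

lemma vec_of_le_right {m n : ℕ} (h : p ≤ n) : vec R p m n = 0 := by
  rw [vec, dif_neg]; omega

/-- The operator with prescribed values on the vectors `F ^ m E ^ n v`. -/
def op (g : ℕ → ℕ → Fin p × Fin p → R) : Module.End R (Fin p × Fin p → R) :=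
  (Pi.basisFun R (Fin p × Fin p)).constr R fun i => g i.1 i.2

/-- Vectors with an index out of range are zero, so the prescription must vanish there for the
formula to hold without bounds on m and n. -/
lemma op_vec {g : ℕ → ℕ → Fin p × Fin p → R} {m n : ℕ} (h : ¬ (m < p ∧ n < p) → g m n = 0) :
    op g (vec R p m n) = g m n := by
  by_cases h' : m < p ∧ n < p
  · have : vec R p m n = Pi.basisFun R (Fin p × Fin p) (⟨m, h'.1⟩, ⟨n, h'.2⟩) := by
      rw [vec, dif_pos h', Pi.basisFun_apply]
    rw [this, op, Module.Basis.constr_basis]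
  · rw [h h', vec, dif_neg h', map_zero]

lemma end_ext {f g : Module.End R (Fin p × Fin p → R)}
    (h : ∀ m n, f (vec R p m n) = g (vec R p m n)) : f = g := by
  refine (Pi.basisFun R (Fin p × Fin p)).ext fun i => ?_
  have : vec R p i.1 i.2 = Pi.basisFun R (Fin p × Fin p) i := by
    rw [vec, dif_pos ⟨i.1.2, i.2.2⟩, Pi.basisFun_apply]
  rw [← this, h]

variable [Algebra ℂ R]

/-- The diagonal operator of weight `b`. -/
def opK (p : ℕ) (b : ℂ) (l : R) : Module.End R (Fin p × Fin p → R) :=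
  op fun m n => (qpow p (b * (n - m)) • l) • vec R p m n

/-- The lowering operator. -/
def opF (R : Type*) [CommRing R] [Algebra ℂ R] (p : ℕ) : Module.End R (Fin p × Fin p → R) :=
  op fun m n => vec R p (m + 1) n

/-- The structure constants of the raising operator. -/
def coeffE (p : ℕ) (l c : R) (m n : ℕ) : R :=
  ((qpow p 1 - qpow p (-1))⁻¹ * qInt p m) •
    (qpow p (2 * n - m + 1) • l ^ 2 - qpow p (-(2 * n - m + 1)) • c ^ 2)

/-- The raising operator. -/
def opE (p : ℕ) (l c : R) : Module.End R (Fin p × Fin p → R) :=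
  op fun m n => vec R p m (n + 1) + coeffE p l c m n • vec R p (m - 1) n

variable (l c : R)

lemma opK_vec (b : ℂ) (m n : ℕ) :
    opK p b l (vec R p m n) = (qpow p (b * (n - m)) • l) • vec R p m n := by
  refine op_vec fun h => ?_
  rw [vec, dif_neg h, smul_zero]

lemma opF_vec (m n : ℕ) : opF R p (vec R p m n) = vec R p (m + 1) n := by
  refine op_vec fun h => ?_
  rw [vec, dif_neg]; omega

variable [NeZero p]

omit [NeZero p] in
lemma coeffE_zero (n : ℕ) : coeffE p l c 0 n = 0 := by
  rw [coeffE, qInt_zero, mul_zero, zero_smul]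

lemma coeffE_self (n : ℕ) : coeffE p l c p n = 0 := by
  rw [coeffE, qInt_self, mul_zero, zero_smul]

/-- The critical index is m = p: the source vector is zero while the target with index p - 1 is not,
and the formula survives because its coefficient contains [p] = 0. -/
lemma opE_vec (m n : ℕ) :
    opE p l c (vec R p m n) = vec R p m (n + 1) + coeffE p l c m n • vec R p (m - 1) n := by
  refine op_vec fun h => ?_
  by_cases hn : p ≤ n
  · rw [vec_of_le_right hn, vec_of_le_right (by omega), smul_zero, add_zero]
  · rw [vec_of_le_left (by omega)]
    rcases (show p ≤ m by omega).eq_or_lt with rfl | hm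
    · rw [coeffE_self, zero_smul, add_zero]
    · rw [vec_of_le_left (by omega), smul_zero, add_zero]

/-- This difference is the eigenvalue of [E, F] on F^m E^n v. -/
lemma coeffE_succ (hp : 2 ≤ p) (m n : ℕ) : coeffE p l c (m + 1) n - coeffE p l c m n =
    (qpow p 1 - qpow p (-1))⁻¹ •
      (qpow p (2 * (n - m)) • l ^ 2 - qpow p (-(2 * (n - m))) • c ^ 2) := by
  have hd := qdiff_ne_zero (p := p) hp
  have h1 := qInt_mul p hp m
  have h2 := qInt_mul p hp (m + 1 : ℕ)
  have e1 : (qpow p 1 - qpow p (-1))⁻¹ * qInt p (m + 1 : ℕ) * qpow p (2 * n - (m + 1 : ℕ) + 1) -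
      (qpow p 1 - qpow p (-1))⁻¹ * qInt p m * qpow p (2 * n - m + 1) =
      (qpow p 1 - qpow p (-1))⁻¹ * qpow p (2 * (n - m)) := by
    refine mul_right_cancel₀ hd ?_
    calc _ = (qpow p 1 - qpow p (-1))⁻¹ * ((qInt p (m + 1 : ℕ) * (qpow p 1 - qpow p (-1))) *
        qpow p (2 * n - (m + 1 : ℕ) + 1) - (qInt p m * (qpow p 1 - qpow p (-1))) *
        qpow p (2 * n - m + 1)) := by ring
      _ = _ := by
        rw [h1, h2, mul_assoc, sub_mul, sub_mul, mul_sub (qpow p (2 * (n - m)))]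
        simp only [← qpow_add]
        push_cast
        ring_nf
  have e2 : (qpow p 1 - qpow p (-1))⁻¹ * qInt p (m + 1 : ℕ) * qpow p (-(2 * n - (m + 1 : ℕ) + 1)) -
      (qpow p 1 - qpow p (-1))⁻¹ * qInt p m * qpow p (-(2 * n - m + 1)) =
      (qpow p 1 - qpow p (-1))⁻¹ * qpow p (-(2 * (n - m))) := by
    refine mul_right_cancel₀ hd ?_
    calc _ = (qpow p 1 - qpow p (-1))⁻¹ * ((qInt p (m + 1 : ℕ) * (qpow p 1 - qpow p (-1))) *
        qpow p (-(2 * n - (m + 1 : ℕ) + 1)) - (qInt p m * (qpow p 1 - qpow p (-1))) *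
        qpow p (-(2 * n - m + 1))) := by ring
      _ = _ := by
        rw [h1, h2, mul_assoc, sub_mul, sub_mul, mul_sub (qpow p (-(2 * (n - m))))]
        simp only [← qpow_add]
        push_cast
        ring_nf
  rw [coeffE, coeffE, smul_sub, smul_sub, smul_sub, smul_smul, smul_smul, smul_smul, smul_smul,
    smul_smul, smul_smul, ← e1, ← e2, sub_smul, sub_smul]
  abel

omit [NeZero p] in
lemma opK_pow_vec (b : ℂ) (j m n : ℕ) :
    (opK p b l ^ j) (vec R p m n) = (qpow p (b * j * (n - m)) • l ^ j) • vec R p m n := by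
  induction j with
  | zero => simp [qpow_zero]
  | succ j ih =>
    rw [pow_succ', Module.End.mul_apply, ih, map_smul, opK_vec, smul_smul, smul_mul_smul_comm,
      ← qpow_add, ← pow_succ]
    congr 3; push_cast; ring

omit [NeZero p] in
lemma opF_pow_vec (j m n : ℕ) : (opF R p ^ j) (vec R p m n) = vec R p (m + j) n := by
  induction j with
  | zero => simp
  | succ j ih => rw [pow_succ', Module.End.mul_apply, ih, opF_vec, add_assoc]

lemma opE_pow_vec (j n : ℕ) : (opE p l c ^ j) (vec R p 0 n) = vec R p 0 (n + j) := by
  induction j with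
  | zero => simp
  | succ j ih =>
    rw [pow_succ', Module.End.mul_apply, ih, opE_vec, coeffE_zero, zero_smul, add_zero, add_assoc]

lemma opK_mul_opE (b : ℂ) (x : R) :
    opK p b x * opE p l c = qpow p b • (opE p l c * opK p b x) := by
  refine end_ext fun m n => ?_
  have e1 : (qpow p (b * ((n + 1 : ℕ) - m)) • x) = qpow p b • qpow p (b * (n - m)) • x := by
    rw [smul_smul, ← qpow_add]; congr 2; push_cast; ring
  have e2 : coeffE p l c m n • (qpow p (b * (n - (m - 1 : ℕ))) • x) • vec R p (m - 1) n =
      coeffE p l c m n • (qpow p b • qpow p (b * (n - m)) • x) • vec R p (m - 1) n := by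
    cases m with
    | zero => rw [Nat.cast_zero, coeffE_zero, zero_smul, zero_smul]
    | succ m =>
      rw [smul_smul (qpow p b), ← qpow_add, Nat.add_sub_cancel]
      congr 4; push_cast; ring
  rw [LinearMap.smul_apply, Module.End.mul_apply, Module.End.mul_apply, opE_vec, opK_vec, map_add,
    map_smul, map_smul, opK_vec, opK_vec, opE_vec, e1, e2, smul_add, smul_add, smul_assoc,
    smul_comm (coeffE p l c m n), smul_assoc (qpow p b)]

omit [NeZero p] in
lemma opK_mul_opF (b : ℂ) (x : R) :
    opK p b x * opF R p = qpow p (-b) • (opF R p * opK p b x) := by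
  refine end_ext fun m n => ?_
  rw [LinearMap.smul_apply, Module.End.mul_apply, Module.End.mul_apply, opF_vec, opK_vec, opK_vec,
    map_smul, opF_vec, ← smul_assoc, smul_smul, ← qpow_add]
  congr 3; push_cast; ring

omit [NeZero p] in
lemma opK_comm (b b' : ℂ) : opK p b l * opK p b' c = opK p b' c * opK p b l := by
  refine end_ext fun m n => ?_
  rw [Module.End.mul_apply, Module.End.mul_apply, opK_vec, opK_vec, map_smul, map_smul, opK_vec,
    opK_vec, smul_comm]

lemma opK_pow_order {l : R} (hl : l ^ (4 * p) = 1) (b : ℤ) : opK p b l ^ (2 * 2 * p) = 1 := by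
  refine end_ext fun m n => ?_
  have h := qpow_four_p_int p (b * (n - m))
  rw [opK_pow_vec, hl, show (b * ((2 * 2 * p : ℕ) : ℂ) * (n - m)) =
    4 * p * ((b * (n - m) : ℤ) : ℂ) by push_cast; ring, h, one_smul, one_smul, Module.End.one_apply]

omit [NeZero p] in
lemma opF_pow_self : opF R p ^ p = 0 := by
  refine end_ext fun m n => ?_
  rw [opF_pow_vec, vec_of_le_left (by omega), LinearMap.zero_apply]

lemma opE_opF (hp : 2 ≤ p) : opE p l c * opF R p - opF R p * opE p l c =
    (qpow p 1 - qpow p (-1))⁻¹ • (opK p 1 l ^ 2 - opK p (-1) c ^ 2) := by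
  refine end_ext fun m n => ?_
  have h := coeffE_succ l c hp m n
  have e : coeffE p l c m n • vec R p (m - 1 + 1) n = coeffE p l c m n • vec R p m n := by
    cases m with
    | zero => rw [coeffE_zero, zero_smul, zero_smul]
    | succ m => rfl
  rw [LinearMap.sub_apply, Module.End.mul_apply, Module.End.mul_apply, opF_vec, opE_vec, opE_vec,
    map_add, map_smul, opF_vec, opF_vec, e, add_sub_add_left_eq_sub, Nat.add_sub_cancel, ← sub_smul,
    h, LinearMap.smul_apply, LinearMap.sub_apply, opK_pow_vec, opK_pow_vec, smul_assoc, sub_smul]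
  congr 4
  · congr 2; push_cast; ring
  · congr 2; push_cast; ring

/-- Since [p] = 0, E^p commutes with `F`. It kills the vectors E^n v, and every basis vector is a
power of `F` applied to one of these. -/
lemma opE_pow_self (hp : 2 ≤ p) : opE p l c ^ p = 0 := by
  have h := e_mul_f_pow p hp (e := opF R p) (f := opE p l c)
    (d := (qpow p 1 - qpow p (-1))⁻¹) (L := opK p (-1) c ^ 2) (L' := opK p 1 l ^ 2)
    (by rw [← neg_sub, opE_opF l c hp]; module)
    (by rw [qcomm_pow_left (opK_mul_opE l c _ _), qpow_pow]; norm_num)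
    (by rw [qcomm_pow_left (opK_mul_opE l c _ _), qpow_pow]; norm_num) (p - 1)
  rw [Nat.sub_add_cancel (by omega), qInt_self, mul_zero, zero_smul, add_zero] at h
  have hc : Commute (opE p l c ^ p) (opF R p) := h.symm
  refine end_ext fun m n => ?_
  have e : vec R p m n = (opF R p ^ m) (vec R p 0 n) := by rw [opF_pow_vec, zero_add]
  rw [e, ← Module.End.mul_apply, (hc.pow_right m).eq, Module.End.mul_apply, opE_pow_vec,
    vec_of_le_right (by omega), map_zero, LinearMap.zero_apply]

/-- The operators on the universal highest weight module satisfy the relations of the double. -/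
lemma doubleRel (hp : 2 ≤ p) {l c : R} (hl : l ^ (4 * p) = 1) (hc : c ^ (4 * p) = 1) :
    DoubleRel p (opE p l c) (opF R p) (opK p 1 l) (opK p (-1) c) where
  borel := ⟨opK_mul_opE l c 1 l, opE_pow_self l c hp, by exact_mod_cast opK_pow_order hl 1⟩
  borel' := ⟨by simpa using opK_mul_opF (p := p) (-1) c, opF_pow_self,
    by exact_mod_cast opK_pow_order hc (-1)⟩
  kf := opK_mul_opF 1 l
  ce := opK_mul_opE l c (-1) c
  kc := opK_comm l c 1 (-1)
  ef := opE_opF l c hp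

/-- With l and c elements of a group algebra, distinct PBW monomials give distinct pairs of basis
vector and group element. All linear independence statements rest on this formula. -/
lemma monomial_apply (m n a b : ℕ) :
    (opF R p ^ m * opK p (-1) c ^ a * (opE p l c ^ n * opK p 1 l ^ b)) (vec R p 0 0) =
      (qpow p (-(a * n)) • (c ^ a * l ^ b)) • vec R p m n := by
  simp only [Module.End.mul_apply, opK_pow_vec, map_smul, opE_pow_vec, opF_pow_vec, zero_add,
    Nat.cast_zero, sub_zero, mul_zero, qpow_zero, one_smul]
  rw [smul_smul, mul_comm, smul_mul_assoc]
  congr 3; ring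

/-- The coefficient functional of a basis vector of the highest weight module over a group ring. -/
def coeffAt {G : Type*} [AddCommGroup G] (i : Fin p × Fin p) (x : G) :
    Module.End (AddMonoidAlgebra ℂ G) (Fin p × Fin p → AddMonoidAlgebra ℂ G) →ₗ[ℂ] ℂ where
  toFun T := (T (vec _ p 0 0) i).coeff x
  map_add' _ _ := rfl
  map_smul' _ _ := rfl

omit [NeZero p] in
lemma coeffAt_apply {G : Type*} [AddCommGroup G] (i : Fin p × Fin p) (x : G)
    (T : Module.End (AddMonoidAlgebra ℂ G) (Fin p × Fin p → AddMonoidAlgebra ℂ G)) :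
    coeffAt i x T = (T (vec _ p 0 0) i).coeff x := rfl

lemma coeffAt_monomial {G : Type*} [AddCommGroup G] [DecidableEq G] (g h x : G)
    (i : Fin p × Fin p) {m n : ℕ}
    (hm : m < p) (hn : n < p) (a b : ℕ) : coeffAt i x
      (opF (AddMonoidAlgebra ℂ G) p ^ m * opK p (-1) (.single h 1) ^ a *
        (opE p (.single g 1) (.single h 1) ^ n * opK p 1 (.single g 1) ^ b)) =
      if (i.1 : ℕ) = m ∧ (i.2 : ℕ) = n ∧ a • h + b • g = x then qpow p (-(a * n)) else 0 := by
  rw [coeffAt_apply, monomial_apply, AddMonoidAlgebra.single_pow, AddMonoidAlgebra.single_pow,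
    AddMonoidAlgebra.single_mul_single, Pi.smul_apply, vec, dif_pos ⟨hm, hn⟩, one_pow, one_pow,
    one_mul, AddMonoidAlgebra.smul_single, smul_eq_mul, smul_eq_mul, mul_one (qpow p _),
    Pi.single_apply, mul_ite, mul_one, mul_zero]
  by_cases h1 : i = (⟨m, hm⟩, ⟨n, hn⟩)
  · rw [if_pos h1, AddMonoidAlgebra.coeff_single, Finsupp.single_apply]
    simp [h1]
  · rw [if_neg h1, if_neg]
    · rfl
    · rintro ⟨h2, h3, -⟩
      exact h1 (Prod.ext (Fin.ext h2) (Fin.ext h3))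

end Verma

/-! ### Criteria for independence and spanning, and specializations of the relations. -/

lemma linearIndependent_of_dual {ι M : Type*} [Fintype ι] [AddCommGroup M] [Module ℂ M]
    {v : ι → M} (f : ι → M →ₗ[ℂ] ℂ) (h0 : ∀ i j, i ≠ j → f i (v j) = 0) (h1 : ∀ i, f i (v i) ≠ 0) :
    LinearIndependent ℂ v := by
  rw [Fintype.linearIndependent_iff]
  intro c hc i
  have h := congrArg (f i) hc
  rw [map_sum, map_zero, Finset.sum_eq_single i] at h
  · rw [map_smul, smul_eq_mul] at h
    exact (mul_eq_zero.1 h).resolve_right (h1 i)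
  · intro j _ hj
    rw [map_smul, h0 i j hj.symm, smul_zero]
  · exact fun h => absurd (Finset.mem_univ i) h

/-- Stability under generators makes `S` a left ideal, and it contains 1. -/
lemma span_eq_top_of_mul_mem {A : Type*} [Ring A] [Algebra ℂ A] {G : Set A}
    (hG : Algebra.adjoin ℂ G = ⊤) (S : Submodule ℂ A) (h1 : 1 ∈ S)
    (h : ∀ g ∈ G, ∀ s ∈ S, g * s ∈ S) : S = ⊤ := by
  have key : ∀ x : A, ∀ s ∈ S, x * s ∈ S := by
    intro x
    have hx : x ∈ Algebra.adjoin ℂ G := hG ▸ Algebra.mem_top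
    induction hx using Algebra.adjoin_induction with
    | mem x hx => exact h x hx
    | algebraMap r =>
      intro s hs
      rw [← Algebra.smul_def]
      exact S.smul_mem r hs
    | add x y _ _ hx hy =>
      intro s hs
      rw [add_mul]
      exact S.add_mem (hx s hs) (hy s hs)
    | mul x y _ _ hx hy =>
      intro s hs
      rw [mul_assoc]
      exact hx _ (hy s hs)
  rw [eq_top_iff]
  intro x _
  simpa using key x 1 h1

namespace DoubleRel

variable {A : Type*} [Ring A] [Algebra ℂ A] {p : ℕ} {e f k c : A}

lemma toSl2 [NeZero p] (h : DoubleRel p e f k c) (hkc : c * k = 1) : Sl2Rel p 2 1 e f k where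
  toBorelRel := h.borel
  kf := h.kf
  ef := by
    have hN : 2 * 2 * p ≠ 0 := by simpa using NeZero.ne p
    have : c = k ^ (2 * 2 * p - 1) := left_inv_eq_right_inv hkc (h.borel.kinv' hN)
    rw [h.ef, this, h.borel.kinv_pow_base hN]
  f_pow := h.borel'.e_pow

end DoubleRel

lemma Sl2Rel.sq {A : Type*} [Ring A] [Algebra ℂ A] {p : ℕ} [NeZero p] {e f k : A}
    (h : Sl2Rel p 2 1 e f k) : Sl2Rel p 1 2 e f (k ^ 2) where
  ke := h.toBorelRel.Le (by norm_num)
  e_pow := h.e_pow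
  k_pow := by rw [← pow_mul, ← h.k_pow]; congr 1; ring
  kf := h.Lf (by norm_num)
  ef := by
    rw [h.ef, pow_one, ← pow_mul]
    congr 3
    omega
  f_pow := h.f_pow

/-! ### PBW monomials span the restricted quantum group. -/

namespace Uq

variable {p : ℕ} [NeZero p]

/-- The PBW monomials. -/
def mon (p m n j : ℕ) : Uq p := F p ^ m * E p ^ n * K p ^ j

omit [NeZero p] in
lemma K_pow_add_mul (j l : ℕ) : K p ^ (j + 2 * p * l) = K p ^ j := by
  have h : K p ^ (2 * p) = 1 := by simpa using (rel p).k_pow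
  rw [pow_add, pow_mul, h, one_pow, mul_one]

lemma mon_mem_span (m n j : ℕ) : mon p m n j ∈
    Submodule.span ℂ (Set.range fun i : Fin p × Fin p × Fin (2 * p) => mon p i.1 i.2.1 i.2.2) := by
  by_cases hm : m < p
  · by_cases hn : n < p
    · have hj : j % (2 * p) < 2 * p := Nat.mod_lt _ (by have := NeZero.pos p; omega)
      have : mon p m n j = mon p m n (j % (2 * p)) := by
        rw [mon, mon, ← K_pow_add_mul (j % (2 * p)) (j / (2 * p)), Nat.mod_add_div]
      rw [this]
      exact Submodule.subset_span ⟨(⟨m, hm⟩, ⟨n, hn⟩, ⟨_, hj⟩), rfl⟩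
    · rw [mon, ← Nat.sub_add_cancel (not_lt.1 hn), pow_add, (rel p).e_pow]
      simp
  · rw [mon, ← Nat.sub_add_cancel (not_lt.1 hm), pow_add, (rel p).f_pow]
    simp

omit [NeZero p] in
lemma K_mul_mon (m n j : ℕ) : K p * mon p m n j = qpow p (2 * n - 2 * m) • mon p m n (j + 1) := by
  rw [mon, mul_assoc, ← mul_assoc, qcomm_pow (rel p).kf, smul_mul_assoc, mul_assoc, ← mul_assoc (K p),
    qcomm_pow (rel p).ke, smul_mul_assoc, mul_smul_comm, smul_smul, mul_assoc, ← pow_succ', mon,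
    mul_assoc, qpow_pow, qpow_pow, ← qpow_add]
  congr 2; ring

/-- The only nontrivial straightening: left multiplication by `F` or `K` visibly preserves the span
of the monomials. The inverse of K appears as K^(2p-1). -/
lemma E_mul_mon_succ (hp : 2 ≤ p) (m n j : ℕ) : E p * mon p (m + 1) n j = mon p (m + 1) (n + 1) j +
    ((qpow p 1 - qpow p (-1))⁻¹ * qInt p (m + 1 : ℕ)) •
      (qpow p (2 * n - m) • mon p m n (j + 1) - qpow p (m - 2 * n) • mon p m n (j + (2 * p - 1))) := by
  have h1 : (2 * 1 * p - 1) = 2 * p - 1 := by omega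
  have hef := (rel p).ef
  rw [pow_one, h1] at hef
  have h := e_mul_f_pow p hp hef (rel p).kf
    (by have := (rel p).Lf' (by norm_num); rwa [h1] at this) m
  have hE : K p ^ (2 * p - 1) * E p ^ n = qpow p (-(2 * n)) • (E p ^ n * K p ^ (2 * p - 1)) := by
    have := (rel p).toBorelRel.Le' (by norm_num)
    rw [h1] at this
    rw [qcomm_pow this, qpow_pow]; congr 2; ring
  have e1 : K p * (E p ^ n * K p ^ j) = qpow p (2 * n) • (E p ^ n * K p ^ (j + 1)) := by
    rw [← mul_assoc, qcomm_pow (rel p).ke, qpow_pow, smul_mul_assoc, mul_assoc, ← pow_succ',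
      mul_comm 2]
  have e2 : K p ^ (2 * p - 1) * (E p ^ n * K p ^ j) =
      qpow p (-(2 * n)) • (E p ^ n * K p ^ (j + (2 * p - 1))) := by
    rw [← mul_assoc, hE, smul_mul_assoc, mul_assoc, ← pow_add, add_comm j]
  rw [mon, mul_assoc, ← mul_assoc, h, add_mul, mul_assoc, ← mul_assoc (E p), ← pow_succ',
    smul_mul_assoc, mul_assoc (F p ^ m), sub_mul, smul_mul_assoc, smul_mul_assoc, e1, e2, smul_smul,
    smul_smul, ← qpow_add, ← qpow_add, mul_sub, mul_smul_comm, mul_smul_comm, mon, mon, mon,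
    mul_assoc, mul_assoc, mul_assoc]
  congr 4
  · congr 1; ring

lemma span_mon (hp : 2 ≤ p) : Submodule.span ℂ
    (Set.range fun i : Fin p × Fin p × Fin (2 * p) => mon p i.1 i.2.1 i.2.2) = ⊤ := by
  refine span_eq_top_of_mul_mem (adjoin p) _ ?_ ?_
  · have := mon_mem_span (p := p) 0 0 0
    simpa [mon] using this
  · intro g hg s hs
    induction hs using Submodule.span_induction with
    | mem x hx =>
      obtain ⟨⟨m, n, j⟩, rfl⟩ := hx
      dsimp only
      rcases hg with rfl | rfl | rfl
      · rcases Nat.eq_zero_or_pos (m : ℕ) with h | h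
        · have := mon_mem_span (p := p) 0 (n + 1) j
          rw [h]
          rw [mon, pow_zero, one_mul] at this ⊢
          rwa [← mul_assoc, ← pow_succ']
        · obtain ⟨m', hm'⟩ := Nat.exists_eq_add_of_le' h
          rw [hm', E_mul_mon_succ hp]
          exact Submodule.add_mem _ (mon_mem_span _ _ _) (Submodule.smul_mem _ _ (Submodule.sub_mem _
            (Submodule.smul_mem _ _ (mon_mem_span _ _ _))
            (Submodule.smul_mem _ _ (mon_mem_span _ _ _))))
      · have := mon_mem_span (p := p) (m + 1) n j
        rwa [mon, pow_succ', mul_assoc, mul_assoc, ← mul_assoc (F p ^ _)] at this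
      · rw [K_mul_mon]
        exact Submodule.smul_mem _ _ (mon_mem_span _ _ _)
    | zero => rw [mul_zero]; exact Submodule.zero_mem _
    | add x y _ _ hx hy => rw [mul_add]; exact Submodule.add_mem _ hx hy
    | smul a x _ hx => rw [mul_smul_comm]; exact Submodule.smul_mem _ _ hx

end Uq

/-! ### The highest weight module of `DBar` and the embedding of the restricted quantum group. -/

section highestWeight

open Verma

variable (p : ℕ) [NeZero p]

/-- The coefficient ring of the highest weight module of `DBar`. -/
abbrev CycRing : Type := AddMonoidAlgebra ℂ (ZMod (4 * p))

omit [NeZero p] in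
lemma cyc_single_pow (a : ZMod (4 * p)) : (.single a 1 : CycRing p) ^ (4 * p) = 1 := by
  rw [AddMonoidAlgebra.single_pow, one_pow, nsmul_eq_mul, ZMod.natCast_self, zero_mul]
  rfl

/-- Specializing the two parameters to inverse elements of the cyclic group makes the operators of κ
and k mutually inverse. -/
lemma verma_sl2Rel (hp : 2 ≤ p) : Sl2Rel p 2 1 (opE p (.single 1 1 : CycRing p) (.single (-1) 1))
    (opF (CycRing p) p) (opK p 1 (.single 1 1)) := by
  refine (Verma.doubleRel hp (cyc_single_pow p 1) (cyc_single_pow p (-1))).toSl2 ?_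
  refine end_ext fun m n => ?_
  rw [Module.End.mul_apply, opK_vec, map_smul, opK_vec, smul_smul, smul_mul_smul_comm, ← qpow_add,
    AddMonoidAlgebra.single_mul_single, add_neg_cancel, mul_one, Module.End.one_apply, one_mul,
    neg_one_mul, add_neg_cancel, qpow_zero, one_smul]
  exact one_smul (CycRing p) _

/-- The action of `DBar` on the universal highest weight module. -/
def DBar.toVerma (hp : 2 ≤ p) :
    DBar p →ₐ[ℂ] Module.End (CycRing p) (Fin p × Fin p → CycRing p) :=
  DBar.lift (verma_sl2Rel p hp)

/-- The inclusion of the restricted quantum group, as an algebra homomorphism. -/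
def Uq.toDBarAlgHom : Uq p →ₐ[ℂ] DBar p := Uq.lift (DBar.rel p).sq

/-- The inclusion of the restricted quantum group. -/
def Uq.toDBar : Uq p →ₐc[ℂ] DBar p :=
  .ofAlgHom (Uq.toDBarAlgHom p)
    (Uq.hom_ext (by simp [Uq.toDBarAlgHom, DBar.counit_E, Uq.counit_E])
      (by simp [Uq.toDBarAlgHom, DBar.counit_F, Uq.counit_F])
      (by simp [Uq.toDBarAlgHom, DBar.counit_K, Uq.counit_K]))
    (Uq.hom_ext (by simp [Uq.toDBarAlgHom, DBar.comul_E, Uq.comul_E])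
      (by
        simp [Uq.toDBarAlgHom, DBar.comul_F, Uq.comul_F, ← pow_mul]
        congr 3
        omega)
      (by simp [Uq.toDBarAlgHom, DBar.comul_K, Uq.comul_K, Algebra.TensorProduct.tmul_pow]))

lemma Uq.toDBar_E : Uq.toDBar p (Uq.E p) = DBar.E p := Uq.lift_E _
lemma Uq.toDBar_F : Uq.toDBar p (Uq.F p) = DBar.F p := Uq.lift_F _
lemma Uq.toDBar_K : Uq.toDBar p (Uq.K p) = DBar.K p ^ 2 := Uq.lift_K _

/-- K^j acts through the group element 2j, and the numbers 2j with j < 2p are distinct modulo 4p; so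
coefficients of the generating vector's image separate the monomials. -/
lemma Uq.linearIndependent_toDBar_mon (hp : 2 ≤ p) : LinearIndependent ℂ
    ((Uq.toDBarAlgHom p).toLinearMap ∘
      fun i : Fin p × Fin p × Fin (2 * p) => Uq.mon p i.1 i.2.1 i.2.2) := by
  refine LinearIndependent.of_comp (DBar.toVerma p hp).toLinearMap ?_
  have key : ∀ i j : Fin p × Fin p × Fin (2 * p),
      coeffAt (i.1, i.2.1) ((2 * (i.2.2 : ℕ) : ℕ) : ZMod (4 * p)) (DBar.toVerma p hp
        (Uq.toDBarAlgHom p (Uq.mon p j.1 j.2.1 j.2.2))) = if i = j then 1 else 0 := by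
    rintro ⟨i, i', i''⟩ ⟨j, j', j''⟩
    have h : DBar.toVerma p hp (Uq.toDBarAlgHom p (Uq.mon p j j' j'')) =
        opF (CycRing p) p ^ (j : ℕ) * opK p (-1) (.single (-1) 1) ^ 0 *
          (opE p (.single 1 1) (.single (-1) 1) ^ (j' : ℕ) *
            opK p 1 (.single 1 1) ^ (2 * (j'' : ℕ))) := by
      simp [Uq.mon, Uq.toDBarAlgHom, DBar.toVerma, pow_mul, mul_assoc]
    rw [h, coeffAt_monomial _ _ _ _ j.2 j'.2]
    simp only [Nat.cast_zero, zero_mul, neg_zero, qpow_zero, zero_smul, zero_add, nsmul_one,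
      Prod.mk.injEq, Fin.ext_iff]
    congr 1
    rw [eq_comm (b := ((2 * (i'' : ℕ) : ℕ) : ZMod (4 * p))), ZMod.natCast_eq_natCast_iff',
      Nat.mod_eq_of_lt (by omega), Nat.mod_eq_of_lt (by omega), Nat.mul_right_inj two_ne_zero]
  refine linearIndependent_of_dual (fun i => coeffAt (i.1, i.2.1) ((2 * (i.2.2 : ℕ) : ℕ) : ZMod (4 * p))) ?_ ?_
  · intro i j hij
    exact (key i j).trans (if_neg hij)
  · intro i
    refine ((key i i).trans (if_pos rfl)).trans_ne one_ne_zero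

lemma Uq.toDBar_injective (hp : 2 ≤ p) : Function.Injective (Uq.toDBar p) :=
  LinearMap.injective_of_linearIndependent (Uq.span_mon hp) (Uq.linearIndependent_toDBar_mon p hp)

end highestWeight

/-! ### The `M`-matrix -/

namespace DBar

variable {p : ℕ} [NeZero p]

lemma zp_two_mul_period (n l : ℤ) : zp (Ku p) (2 * (n + 2 * p * l)) = zp (Ku p) (2 * n) := by
  obtain ⟨l, rfl | rfl⟩ := l.eq_nat_or_neg
  · induction l with
    | zero => simp
    | succ l ih =>
      rw [← ih, ← zp_Ku_add (2 * (n + 2 * p * l))]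
      congr 1; push_cast; ring
  · induction l with
    | zero => simp
    | succ l ih =>
      rw [← ih, ← zp_Ku_add]
      congr 1; push_cast; ring

/-- The square is the sum of K^(2n) ⊗ (projector of weight n). The first leg depends only on n
modulo 2p, and a Fourier expansion over ℤ/2p in the second leg then involves only even powers of K.
-/
lemma cartan_sq : cartan p (Ku p) * cartan p (Ku p) = (1 / (2 * p) : ℂ) •
    ∑ i ∈ Finset.range (2 * p), ∑ j ∈ Finset.range (2 * p),
      qpow p (-((i : ℂ) * j)) • (zp (Ku p) (2 * j) ⊗ₜ[ℂ] zp (Ku p) (2 * i)) := by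
  have hc := cast_ne p
  have h0 : 0 < 2 * p := by have := NeZero.pos p; omega
  rw [cartan, sum_tmul_idem_mul Ku_pow]
  have h1 : ∀ i j : ℕ, zp (Ku p) (2 * j) ⊗ₜ[ℂ] zp (Ku p) (2 * i) =
      ∑ t ∈ Finset.range (4 * p), qpow p ((t : ℂ) * i) •
        (zp (Ku p) (2 * j) ⊗ₜ[ℂ] idem p (Ku p) t) := by
    intro i j
    rw [← mul_one (zp (Ku p) (2 * (i : ℤ))), ← idem_sum p (Ku p), Finset.mul_sum,
      TensorProduct.tmul_sum]
    refine Finset.sum_congr rfl fun t _ => ?_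
    rw [zp_idem, TensorProduct.tmul_smul]
    congr 2; push_cast; ring
  simp only [h1, Finset.smul_sum, smul_smul]
  rw [Finset.sum_comm]
  rw [Finset.sum_congr rfl fun j _ => Finset.sum_comm]
  rw [Finset.sum_comm]
  refine Finset.sum_congr rfl fun t _ => ?_
  simp only [← Finset.sum_smul]
  have h2 : ∀ j : ℕ, ∑ i ∈ Finset.range (2 * p),
      (1 / (2 * p) : ℂ) * (qpow p (-((i : ℂ) * j)) * qpow p ((t : ℂ) * i)) =
      if (2 * p : ℤ) ∣ t - j then 1 else 0 := by
    intro j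
    have h := sum_qpow p ((t : ℤ) - j)
    rw [← Finset.mul_sum, Finset.sum_congr rfl (g := fun i : ℕ => qpow p ((((t : ℤ) - j : ℤ) : ℂ) * i))
      fun i _ => by rw [← qpow_add]; congr 1; push_cast; ring, h]
    split_ifs
    · field_simp
    · rw [mul_zero]
  simp only [h2, ite_smul, one_smul, zero_smul]
  rw [Finset.sum_eq_single (t % (2 * p))]
  · have h3 := Nat.mod_add_div t (2 * p)
    have h4 : zp (Ku p) (2 * t) = zp (Ku p) (2 * (t % (2 * p) : ℕ)) := by
      rw [← zp_two_mul_period ((t % (2 * p) : ℕ) : ℤ) ((t / (2 * p) : ℕ) : ℤ)]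
      conv_lhs => rw [← h3]
      push_cast
      rfl
    rw [if_pos, ← zp_add, ← two_mul, h4]
    · exact ⟨(t / (2 * p) : ℕ), by zify at h3; push_cast at h3 ⊢; linarith⟩
  · intro j hj hne
    rw [if_neg]
    intro hl
    apply hne
    have h3 : (j : ℤ) % (2 * p) = (t : ℤ) % (2 * p) := Int.modEq_iff_dvd.2 hl
    have h4 : j % (2 * p) = t % (2 * p) := by exact_mod_cast h3
    rw [← Nat.mod_eq_of_lt (Finset.mem_range.1 hj), h4]
  · exact fun h => absurd (Finset.mem_range.2 (Nat.mod_lt _ h0)) h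

lemma flip21_cartan : flip21 (cartan p (Ku p)) = cartan p (Ku p) := by
  conv_lhs => rw [cartan]
  rw [cartan_eq', map_sum]
  rfl

/-- The Cartan part is symmetric under the flip, so in R₂₁R₁₂ the two copies meet after the flipped
q-exponential is moved past the second one. -/
lemma mMatrix_Rbar : mMatrix (Rbar p) = cartan p (Ku p) * cartan p (Ku p) *
    (qexp p ((F p * zp (Ku p) (-2)) ⊗ₜ[ℂ] (zp (Ku p) 2 * E p)) * qexp p (E p ⊗ₜ[ℂ] F p)) := by
  have h : (F p ⊗ₜ[ℂ] E p) * cartan p (Ku p) =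
      cartan p (Ku p) * ((F p * zp (Ku p) (-2)) ⊗ₜ[ℂ] (zp (Ku p) 2 * E p)) := by
    have hx : ((Ku p : (DBar p)ˣ) : DBar p) * (F p * zp (Ku p) (-2)) =
        qpow p ((-1 : ℤ) : ℂ) • (F p * zp (Ku p) (-2) * (Ku p : (DBar p)ˣ)) := by
      rw [← mul_assoc, Ku_F, smul_mul_assoc, mul_assoc, mul_assoc, ← zp_one, zp_comm]
    have hy : ((Ku p : (DBar p)ˣ) : DBar p) * (zp (Ku p) 2 * E p) =
        qpow p ((1 : ℤ) : ℂ) • (zp (Ku p) 2 * E p * (Ku p : (DBar p)ˣ)) := by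
      rw [← mul_assoc, ← zp_one, zp_comm, mul_assoc, zp_one, Ku_E, mul_smul_comm, mul_assoc]
    rw [cartan_mul_tmul Ku_pow hx hy]
    congr 2
    · rw [mul_assoc, ← zp_add]; norm_num [zp_zero]
    · rw [← mul_assoc, ← zp_add]; norm_num [zp_zero]
  rw [mMatrix, Rbar_eq, map_mul, flip21_cartan, map_qexp, flip21_tmul, mul_assoc, ← mul_assoc (qexp p _),
    qexp_semiconj p h]
  simp only [mul_assoc]

lemma map_mon (m n j : ℕ) : Uq.toDBar p (Uq.F p ^ m * Uq.E p ^ n * Uq.K p ^ j) =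
    F p ^ m * E p ^ n * zp (Ku p) (2 * j) := by
  rw [map_mul, map_mul, map_pow, map_pow, map_pow, Uq.toDBar_E, Uq.toDBar_F, Uq.toDBar_K, K_sq,
    zp_pow]

lemma map_mon' (m n j : ℕ) : Uq.toDBar p (Uq.E p ^ m * Uq.F p ^ n * Uq.K p ^ j) =
    E p ^ m * F p ^ n * zp (Ku p) (2 * j) := by
  rw [map_mul, map_mul, map_pow, map_pow, map_pow, Uq.toDBar_E, Uq.toDBar_F, Uq.toDBar_K, K_sq,
    zp_pow]

lemma F_zp_pow (m : ℕ) : (F p * zp (Ku p) (-2)) ^ m =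
    qpow p (m * (m - 1)) • (F p ^ m * zp (Ku p) (-2 * m)) := by
  induction m with
  | zero => simp [qpow_zero, zp_zero]
  | succ m ih =>
    rw [pow_succ, ih, smul_mul_assoc, mul_assoc, ← mul_assoc (zp _ _), zp_F, smul_mul_assoc,
      mul_smul_comm, smul_smul, ← qpow_add, mul_assoc (F p), ← zp_add, ← mul_assoc, ← pow_succ]
    congr 2
    · push_cast; ring
    · congr 1; push_cast; ring

lemma zp_E_mul_pow (m : ℕ) : (zp (Ku p) 2 * E p) ^ m =
    qpow p (m * (m + 1)) • (E p ^ m * zp (Ku p) (2 * m)) := by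
  induction m with
  | zero => simp [qpow_zero, zp_zero]
  | succ m ih =>
    rw [pow_succ, ih, smul_mul_assoc, mul_assoc, ← mul_assoc (zp _ _), ← zp_add, zp_E,
      mul_smul_comm, smul_smul, ← qpow_add, ← mul_assoc, ← pow_succ]
    congr 2
    · push_cast; ring

/-- The summands of the `M`-matrix, indexed by integers. -/
def mTerm (p : ℕ) [NeZero p] (m n : ℕ) (i j : ℤ) : DBar p ⊗[ℂ] DBar p :=
  qpow p (-(m : ℂ) ^ 2 - (m : ℂ) * j + 2 * (n : ℂ) * j - 2 * (n : ℂ) * i - (i : ℂ) * j +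
    (m : ℂ) * i) • ((F p ^ m * E p ^ n * zp (Ku p) (2 * j)) ⊗ₜ[ℂ]
      (E p ^ m * F p ^ n * zp (Ku p) (2 * i)))

lemma mTerm_period_left (m n : ℕ) (i j : ℤ) :
    mTerm p m n (i + (2 * p : ℕ)) j = mTerm p m n i j := by
  have h := qpow_two_p_int p (m - j - 2 * n)
  have h2 := zp_two_mul_period (p := p) i 1
  rw [mul_one] at h2
  rw [mTerm, mTerm, Nat.cast_mul, Nat.cast_two, h2]
  congr 1
  rw [← mul_one (qpow p (_ + (m : ℂ) * i)), ← h, ← qpow_add]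
  congr 1; push_cast; ring

lemma mTerm_period_right (m n : ℕ) (i j : ℤ) :
    mTerm p m n i (j + (2 * p : ℕ)) = mTerm p m n i j := by
  have h := qpow_two_p_int p (m + i - 2 * n)
  have h2 := zp_two_mul_period (p := p) j 1
  rw [mul_one] at h2
  rw [mTerm, mTerm, Nat.cast_mul, Nat.cast_two, h2]
  congr 1
  rw [← mul_one (qpow p (_ + (m : ℂ) * i)), ← h, ← qpow_add]
  congr 1; push_cast; ring

/-- Moving all torus elements to the right adds the powers K^(-2m) and K^(2m) from the first
q-exponential; this is the shift of j by -m and of i by m. -/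
lemma mTerm_eq (m n : ℕ) (i j : ℤ) : qpow p (-((i : ℂ) * j)) •
    ((zp (Ku p) (2 * j) ⊗ₜ[ℂ] zp (Ku p) (2 * i)) *
      (((F p * zp (Ku p) (-2)) ⊗ₜ[ℂ] (zp (Ku p) 2 * E p)) ^ m * (E p ⊗ₜ[ℂ] F p) ^ n)) =
    mTerm p m n (i + m) (j + (-m : ℤ)) := by
  have e1 : zp (Ku p) (2 * j) * ((F p * zp (Ku p) (-2)) ^ m * E p ^ n) =
      qpow p (m * (m - 1) - 2 * j * m + (2 * j - 2 * m) * n) •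
        (F p ^ m * E p ^ n * zp (Ku p) (2 * (j + (-m : ℤ)))) := by
    rw [F_zp_pow, smul_mul_assoc, mul_smul_comm, ← mul_assoc, ← mul_assoc, zp_F_pow, smul_mul_assoc,
      smul_mul_assoc, mul_assoc (F p ^ m), ← zp_add, mul_assoc, zp_E_pow, mul_smul_comm, smul_smul,
      smul_smul, ← qpow_add, ← qpow_add, ← mul_assoc]
    congr 2
    · push_cast; ring
    · congr 1; ring
  have e2 : zp (Ku p) (2 * i) * ((zp (Ku p) 2 * E p) ^ m * F p ^ n) =
      qpow p (m * (m + 1) + 2 * i * m - (2 * i + 2 * m) * n) •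
        (E p ^ m * F p ^ n * zp (Ku p) (2 * (i + m))) := by
    rw [zp_E_mul_pow, smul_mul_assoc, mul_smul_comm, ← mul_assoc, ← mul_assoc, zp_E_pow,
      smul_mul_assoc, smul_mul_assoc, mul_assoc (E p ^ m), ← zp_add, mul_assoc, zp_F_pow,
      mul_smul_comm, smul_smul, smul_smul, ← qpow_add, ← qpow_add, ← mul_assoc]
    congr 2
    · push_cast; ring
    · congr 1; ring
  rw [Algebra.TensorProduct.tmul_pow, Algebra.TensorProduct.tmul_pow,
    Algebra.TensorProduct.tmul_mul_tmul, Algebra.TensorProduct.tmul_mul_tmul, e1, e2,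
    TensorProduct.tmul_smul, ← TensorProduct.smul_tmul', smul_smul, smul_smul, ← qpow_add, ← qpow_add,
    mTerm]
  congr 2
  push_cast; ring

theorem map_Mbar : TensorProduct.map (Uq.toDBar p : Uq p →ₗ[ℂ] DBar p)
    (Uq.toDBar p : Uq p →ₗ[ℂ] DBar p) (Mbar p) = mMatrix (Rbar p) := by
  rw [mMatrix_Rbar, cartan_sq, Mbar, map_smul, smul_mul_assoc]
  congr 1
  simp only [map_sum, map_smul, TensorProduct.map_tmul]
  rw [qexp, qexp, Finset.sum_mul_sum, Finset.mul_sum]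
  refine Finset.sum_congr rfl fun m _ => ?_
  rw [Finset.mul_sum]
  refine Finset.sum_congr rfl fun n _ => ?_
  have hL : ∀ i j : ℕ, ((qpow p 1 - qpow p (-1)) ^ (m + n) / (qFactorial p m * qFactorial p n) *
        qpow p ((m : ℂ) * (m - 1) / 2 + (n : ℂ) * (n - 1) / 2) *
        qpow p (-(m : ℂ) ^ 2 - (m : ℂ) * j + 2 * (n : ℂ) * j - 2 * (n : ℂ) * i - (i : ℂ) * j +
          (m : ℂ) * i)) • ((Uq.toDBar p : Uq p →ₗ[ℂ] DBar p) (Uq.F p ^ m * Uq.E p ^ n * Uq.K p ^ j) ⊗ₜ[ℂ]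
          (Uq.toDBar p : Uq p →ₗ[ℂ] DBar p) (Uq.E p ^ m * Uq.F p ^ n * Uq.K p ^ i)) =
      (rc p m * rc p n) • mTerm p m n i j := by
    intro i j
    have e1 : (Uq.toDBar p : Uq p →ₗ[ℂ] DBar p) (Uq.F p ^ m * Uq.E p ^ n * Uq.K p ^ j) =
      F p ^ m * E p ^ n * zp (Ku p) (2 * j) := map_mon m n j
    have e2 : (Uq.toDBar p : Uq p →ₗ[ℂ] DBar p) (Uq.E p ^ m * Uq.F p ^ n * Uq.K p ^ i) =
      E p ^ m * F p ^ n * zp (Ku p) (2 * i) := map_mon' m n i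
    rw [e1, e2, mTerm, smul_smul]
    congr 1
    rw [rc, rc, qpow_add, pow_add]
    simp only [Int.cast_natCast]
    ring
  simp only [hL, ← Finset.smul_sum]
  rw [smul_mul_smul_comm, mul_smul_comm]
  congr 1
  rw [Finset.sum_mul]
  -- The summands are 2p-periodic in both indices, so the shifts by m and -m do not change the sum.
  rw [← sum_range_shift (f := fun i => ∑ j ∈ Finset.range (2 * p), mTerm p m n i j)
    (fun i => by simp only [mTerm_period_left]) m]
  refine Finset.sum_congr rfl fun i _ => ?_
  rw [Finset.sum_mul, ← sum_range_shift (f := fun j => mTerm p m n (i + m) j)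
    (mTerm_period_right _ _ _) (-m)]
  refine Finset.sum_congr rfl fun j _ => ?_
  rw [← mTerm_eq, smul_mul_assoc]
  simp only [Int.cast_natCast]

end DBar

/-! ### The bases of the restricted quantum group -/

namespace Uq

variable {p : ℕ} [NeZero p]

/-- The PBW basis. -/
def pbw (hp : 2 ≤ p) : Module.Basis (Fin p × Fin p × Fin (2 * p)) ℂ (Uq p) :=
  .mk (v := fun i => mon p i.1 i.2.1 i.2.2)
    (LinearIndependent.of_comp _ (linearIndependent_toDBar_mon p hp)) (span_mon hp).ge

lemma pbw_apply (hp : 2 ≤ p) (i : Fin p × Fin p × Fin (2 * p)) :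
    pbw hp i = F p ^ (i.1 : ℕ) * E p ^ (i.2.1 : ℕ) * K p ^ (i.2.2 : ℕ) := by
  rw [pbw, Module.Basis.mk_apply, mon]

omit [NeZero p] in
lemma K_pow_two_p : K p ^ (2 * p) = 1 := by simpa using (rel p).k_pow

lemma chevalley_rel (p : ℕ) [NeZero p] : Sl2Rel p 1 2 (F p) (E p) (K p ^ (2 * p - 1)) := by
  have hN : 2 * 1 * p ≠ 0 := by simpa using NeZero.ne p
  have h1 : 2 * 1 * p - 1 = 2 * p - 1 := by rw [mul_one]
  have h2 := (rel p).kinv_pow_compl hN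
  have h3 := (rel p).Lf' (by norm_num)
  have h4 := (rel p).toBorelRel.Le' (by norm_num)
  have h5 := (rel p).ef
  rw [h1] at h2 h3 h4 h5
  refine ⟨⟨h3, (rel p).f_pow, ?_⟩, h4, ?_, (rel p).e_pow⟩
  · rw [mul_one, ← pow_mul, mul_comm, pow_mul, K_pow_two_p, one_pow]
  · rw [h1, h2, pow_one, ← neg_sub, h5]
    module

/-- The Chevalley involution. -/
def chevalley (p : ℕ) [NeZero p] : Uq p →ₐ[ℂ] Uq p := lift (chevalley_rel p)

lemma chevalley_comp (p : ℕ) [NeZero p] :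
    (chevalley p).comp (chevalley p) = AlgHom.id ℂ (Uq p) := by
  have hN : 2 * 1 * p ≠ 0 := by simpa using NeZero.ne p
  have h2 := (rel p).kinv_pow_compl hN
  rw [mul_one] at h2
  refine hom_ext ?_ ?_ ?_ <;> simp [chevalley]
  simpa using h2

/-- The Chevalley involution carries the PBW monomials F^m E^n K^j to E^m F^n K^(-j). -/
lemma E_F_K_mem_span (S : Submodule ℂ (Uq p))
    (hS : ∀ m < p, ∀ n < p, ∀ j : ℕ, E p ^ m * F p ^ n * K p ^ j ∈ S) (hp : 2 ≤ p) : S = ⊤ := by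
  rw [eq_top_iff]
  intro x _
  have hx : chevalley p x ∈ Submodule.span ℂ
      (Set.range fun i : Fin p × Fin p × Fin (2 * p) => mon p i.1 i.2.1 i.2.2) := by
    rw [span_mon hp]; trivial
  have h2 : ∀ y ∈ Submodule.span ℂ
      (Set.range fun i : Fin p × Fin p × Fin (2 * p) => mon p i.1 i.2.1 i.2.2), chevalley p y ∈ S := by
    intro y hy
    induction hy using Submodule.span_induction with
    | mem y hy =>
      obtain ⟨⟨m, n, j⟩, rfl⟩ := hy
      have := hS m m.2 n n.2 ((2 * p - 1) * j)
      simpa [mon, chevalley, pow_mul] using this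
    | zero => rw [map_zero]; exact S.zero_mem
    | add x y _ _ hx hy => rw [map_add]; exact S.add_mem hx hy
    | smul a x _ hx => rw [map_smul]; exact S.smul_mem a hx
  have h3 := h2 _ hx
  rwa [← AlgHom.comp_apply, chevalley_comp] at h3

/-- The second tensor factors of the `M`-matrix, up to scalars. -/
def mDual (p m n j : ℕ) : Uq p := ∑ i ∈ Finset.range (2 * p),
  qpow p (((m : ℂ) - 2 * n - j) * i) • (E p ^ m * F p ^ n * K p ^ i)

/-- Fourier inversion on ℤ/2p: the second tensor factors determine the monomials E^m F^n K^l. -/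
lemma sum_mDual (m n : ℕ) {l : ℕ} (hl : l < 2 * p) :
    ∑ j ∈ Finset.range (2 * p), qpow p ((l : ℂ) * j) • mDual p m n j =
      (2 * p * qpow p (((m : ℂ) - 2 * n) * l)) • (E p ^ m * F p ^ n * K p ^ l) := by
  simp only [mDual, Finset.smul_sum, smul_smul, ← qpow_add]
  rw [Finset.sum_comm, Finset.sum_eq_single l]
  · rw [← Finset.sum_smul]
    congr 1
    rw [Finset.sum_congr rfl (g := fun _ => qpow p (((m : ℂ) - 2 * n) * l))
      fun j _ => by congr 1; ring]
    simp
  · intro i hi hne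
    rw [← Finset.sum_smul]
    have h := sum_qpow p ((l : ℤ) - i)
    rw [if_neg] at h
    · rw [Finset.sum_congr rfl (g := fun j : ℕ => qpow p (((m : ℂ) - 2 * n) * i) *
        qpow p ((((l : ℤ) - i : ℤ) : ℂ) * j)) fun j _ => by
          rw [← qpow_add]; congr 1; push_cast; ring, ← Finset.mul_sum, h, mul_zero, zero_smul]
    · rintro ⟨c, hc⟩
      have hi := Finset.mem_range.1 hi
      have h1 : (2 * p : ℤ) * c < 2 * p * 1 := by rw [← hc]; omega
      have h2 : (2 * p : ℤ) * (-1) < 2 * p * c := by rw [← hc]; omega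
      have hp : (0 : ℤ) < 2 * p := by omega
      have h3 := lt_of_mul_lt_mul_left h1 hp.le
      have h4 := lt_of_mul_lt_mul_left h2 hp.le
      obtain rfl : c = 0 := by omega
      omega
  · exact fun h => absurd (Finset.mem_range.2 hl) h

/-- The coefficients of the second tensor factors of the `M`-matrix. -/
def mCoeff (p m n j : ℕ) : ℂ := 1 / (2 * p) *
  ((qpow p 1 - qpow p (-1)) ^ (m + n) / (qFactorial p m * qFactorial p n) *
    qpow p ((m : ℂ) * (m - 1) / 2 + (n : ℂ) * (n - 1) / 2) *
    qpow p (-(m : ℂ) ^ 2 - (m : ℂ) * j + 2 * (n : ℂ) * j))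

lemma mCoeff_ne_zero (hp : 2 ≤ p) {m n : ℕ} (hm : m < p) (hn : n < p) (j : ℕ) :
    mCoeff p m n j ≠ 0 := by
  have hc := cast_ne p
  exact mul_ne_zero (by simp [hc]) (mul_ne_zero (mul_ne_zero (div_ne_zero
    (pow_ne_zero _ (qdiff_ne_zero p hp))
    (mul_ne_zero (qFactorial_ne_zero p hp hm) (qFactorial_ne_zero p hp hn)))
    (qpow_ne_zero _ _)) (qpow_ne_zero _ _))

lemma span_mDual (hp : 2 ≤ p) : ⊤ ≤ Submodule.span ℂ
    (Set.range fun i : Fin p × Fin p × Fin (2 * p) =>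
      mCoeff p i.1 i.2.1 i.2.2 • mDual p i.1 i.2.1 i.2.2) := by
  have hc := cast_ne p
  refine (E_F_K_mem_span _ ?_ hp).ge
  intro m hm n hn l
  have h0 : l % (2 * p) < 2 * p := Nat.mod_lt _ (by omega)
  rw [← Nat.mod_add_div l (2 * p), K_pow_add_mul]
  have h := sum_mDual (p := p) m n h0
  rw [← inv_smul_smul₀ (show (2 * p * qpow p (((m : ℂ) - 2 * n) * (l % (2 * p) : ℕ)) : ℂ) ≠ 0 from
    mul_ne_zero (by simp [hc]) (qpow_ne_zero _ _)) (E p ^ m * F p ^ n * K p ^ (l % (2 * p))), ← h]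
  refine Submodule.smul_mem _ _ (Submodule.sum_mem _ fun j hj => Submodule.smul_mem _ _ ?_)
  rw [← inv_smul_smul₀ (mCoeff_ne_zero hp hm hn j) (mDual p m n j)]
  exact Submodule.smul_mem _ _ (Submodule.subset_span
    ⟨(⟨m, hm⟩, ⟨n, hn⟩, ⟨j, Finset.mem_range.1 hj⟩), rfl⟩)

/-- The basis formed by the second tensor factors of the `M`-matrix. -/
def mBasis (hp : 2 ≤ p) : Module.Basis (Fin p × Fin p × Fin (2 * p)) ℂ (Uq p) :=
  basisOfTopLeSpanOfCardEqFinrank _ (span_mDual hp)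
    (Module.finrank_eq_card_basis (pbw hp)).symm

/-- The sum over i is absorbed into the second factor. Of the scalar, the part independent of i goes
into `mCoeff` and the rest is the Fourier kernel of `mDual`. -/
lemma Mbar_eq_sum (hp : 2 ≤ p) : Mbar p = ∑ i, pbw hp i ⊗ₜ[ℂ] mBasis hp i := by
  simp only [mBasis, coe_basisOfTopLeSpanOfCardEqFinrank, pbw_apply, Fintype.sum_prod_type]
  rw [Mbar, Finset.smul_sum, Finset.sum_range]
  refine Finset.sum_congr rfl fun m _ => ?_
  rw [Finset.smul_sum, Finset.sum_range]
  refine Finset.sum_congr rfl fun n _ => ?_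
  rw [Finset.sum_comm, Finset.smul_sum, Finset.sum_range]
  refine Finset.sum_congr rfl fun j _ => ?_
  rw [mDual, Finset.smul_sum, Finset.smul_sum, TensorProduct.tmul_sum]
  refine Finset.sum_congr rfl fun i _ => ?_
  rw [TensorProduct.tmul_smul, TensorProduct.tmul_smul, smul_smul, smul_smul, mCoeff]
  congr 1
  rw [show (-((m : ℕ) : ℂ) ^ 2 - ((m : ℕ) : ℂ) * (j : ℕ) + 2 * ((n : ℕ) : ℂ) * (j : ℕ) -
    2 * ((n : ℕ) : ℂ) * i - (i : ℂ) * (j : ℕ) + ((m : ℕ) : ℂ) * i) =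
    (-((m : ℕ) : ℂ) ^ 2 - ((m : ℕ) : ℂ) * (j : ℕ) + 2 * ((n : ℕ) : ℂ) * (j : ℕ)) +
    (((m : ℕ) : ℂ) - 2 * (n : ℕ) - (j : ℕ)) * i by ring, qpow_add _ (_ + _) (_ * (i : ℂ))]
  ring

end Uq

/-! ### The Hopf pairing of `B` with itself -/

namespace B

open Coalgebra HopfAlgebra WithConv

variable {p : ℕ} [NeZero p]

/-- The monomials `E ^ n K ^ j`. -/
def mon (p n j : ℕ) : B p := E p ^ n * K p ^ j

omit [NeZero p] in
lemma K_pow : K p ^ (4 * p) = 1 := by simpa using (rel p).k_pow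

omit [NeZero p] in
lemma K_pow_add_mul (j l : ℕ) : K p ^ (j + 4 * p * l) = K p ^ j := by
  rw [pow_add, pow_mul, K_pow, one_pow, mul_one]

omit [NeZero p] in
lemma mon_eq_zero {n : ℕ} (hn : p ≤ n) (j : ℕ) : mon p n j = 0 := by
  rw [mon, ← Nat.sub_add_cancel hn, pow_add, (rel p).e_pow, mul_zero, zero_mul]

omit [NeZero p] in
lemma K_mul_mon (n j : ℕ) : K p * mon p n j = qpow p n • mon p n (j + 1) := by
  rw [mon, ← mul_assoc, qcomm_pow (rel p).ke, smul_mul_assoc, mul_assoc, ← pow_succ', qpow_pow,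
    mul_one, mon]

omit [NeZero p] in
lemma E_mul_mon (n j : ℕ) : E p * mon p n j = mon p (n + 1) j := by
  rw [mon, ← mul_assoc, ← pow_succ', mon]

omit [NeZero p] in
lemma mon_mul_K (n j : ℕ) : mon p n j * K p = mon p n (j + 1) := by
  rw [mon, mul_assoc, ← pow_succ, mon]

omit [NeZero p] in
lemma mon_mul_E (n j : ℕ) : mon p n j * E p = qpow p j • mon p (n + 1) j := by
  rw [mon, mul_assoc, qcomm_pow_left (rel p).ke, mul_smul_comm, ← mul_assoc, ← pow_succ, qpow_pow,
    mul_one, mon]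

omit [NeZero p] in
lemma mon_mod (n j : ℕ) : mon p n j = mon p n (j % (4 * p)) := by
  rw [mon, mon, ← K_pow_add_mul (j % (4 * p)) (j / (4 * p)), Nat.mod_add_div]

lemma mon_mem_span (n j : ℕ) : mon p n j ∈
    Submodule.span ℂ (Set.range fun i : Fin p × Fin (4 * p) => mon p i.1 i.2) := by
  by_cases hn : n < p
  · have hj : j % (4 * p) < 4 * p := Nat.mod_lt _ (by have := NeZero.pos p; omega)
    rw [mon_mod]
    exact Submodule.subset_span ⟨(⟨n, hn⟩, ⟨_, hj⟩), rfl⟩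
  · rw [mon_eq_zero (not_lt.1 hn)]
    exact Submodule.zero_mem _

lemma span_mon (p : ℕ) [NeZero p] : Submodule.span ℂ
    (Set.range fun i : Fin p × Fin (4 * p) => mon p i.1 i.2) = ⊤ := by
  refine span_eq_top_of_mul_mem (adjoin p) _ ?_ ?_
  · have := mon_mem_span (p := p) 0 0
    simpa [mon] using this
  · intro g hg s hs
    induction hs using Submodule.span_induction with
    | mem x hx =>
      obtain ⟨⟨n, j⟩, rfl⟩ := hx
      dsimp only
      rcases hg with rfl | rfl
      · rw [E_mul_mon]
        exact mon_mem_span _ _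
      · rw [K_mul_mon]
        exact Submodule.smul_mem _ _ (mon_mem_span _ _)
    | zero => rw [mul_zero]; exact Submodule.zero_mem _
    | add x y _ _ hx hy => rw [mul_add]; exact Submodule.add_mem _ hx hy
    | smul a x _ hx => rw [mul_smul_comm]; exact Submodule.smul_mem _ _ hx

open Verma in
lemma linearIndependent_mon (hp : 2 ≤ p) :
    LinearIndependent ℂ fun i : Fin p × Fin (4 * p) => mon p i.1 i.2 := by
  refine LinearIndependent.of_comp (lift (verma_sl2Rel p hp).toBorelRel).toLinearMap ?_
  have key : ∀ i j : Fin p × Fin (4 * p), coeffAt ((⟨0, NeZero.pos p⟩ : Fin p), i.1)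
      ((i.2 : ℕ) : ZMod (4 * p)) (lift (verma_sl2Rel p hp).toBorelRel (mon p j.1 j.2)) =
        if i = j then 1 else 0 := by
    rintro ⟨i, i'⟩ ⟨j, j'⟩
    have h : lift (verma_sl2Rel p hp).toBorelRel (mon p j j') =
        opF (CycRing p) p ^ 0 * opK p (-1) (.single (-1) 1) ^ 0 *
          (opE p (.single 1 1) (.single (-1) 1) ^ (j : ℕ) * opK p 1 (.single 1 1) ^ (j' : ℕ)) := by
      simp [mon]
    rw [h, coeffAt_monomial _ _ _ _ (NeZero.pos p) j.2]
    simp only [Nat.cast_zero, zero_mul, neg_zero, qpow_zero, zero_smul, zero_add, nsmul_one,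
      Prod.mk.injEq, Fin.ext_iff, true_and]
    congr 1
    rw [eq_comm (b := ((i' : ℕ) : ZMod (4 * p))), ZMod.natCast_eq_natCast_iff',
      Nat.mod_eq_of_lt i'.2, Nat.mod_eq_of_lt j'.2]
  refine linearIndependent_of_dual (fun i => coeffAt ((⟨0, NeZero.pos p⟩ : Fin p), i.1)
      ((i.2 : ℕ) : ZMod (4 * p))) ?_ ?_
  · intro i j hij
    exact (key i j).trans (if_neg hij)
  · intro i
    refine ((key i i).trans (if_pos rfl)).trans_ne one_ne_zero

/-- The PBW basis of `B`. -/
def pbw (hp : 2 ≤ p) : Module.Basis (Fin p × Fin (4 * p)) ℂ (B p) :=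
  .mk (linearIndependent_mon hp) (span_mon p).ge

lemma pbw_apply (hp : 2 ≤ p) (i : Fin p × Fin (4 * p)) : pbw hp i = mon p i.1 i.2 := by
  rw [pbw, Module.Basis.mk_apply]

lemma linearMap_ext {M : Type*} [AddCommGroup M] [Module ℂ M] {f g : B p →ₗ[ℂ] M}
    (h : ∀ n j, f (mon p n j) = g (mon p n j)) : f = g := by
  refine LinearMap.ext_on_range (span_mon p) fun i => h _ _

/-- The functional with prescribed values on the PBW basis. -/
def functional (hp : 2 ≤ p) (g : ℕ → ℕ → ℂ) : Module.Dual ℂ (B p) :=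
  (pbw hp).constr ℂ fun i => g i.1 i.2

/-- The hypotheses on `g` allow evaluation on monomials with unreduced exponents, as they arise from
products and coproducts. -/
lemma functional_mon (hp : 2 ≤ p) {g : ℕ → ℕ → ℂ} (h0 : ∀ n j, p ≤ n → g n j = 0)
    (h1 : ∀ n j, g n (j + 4 * p) = g n j) (n j : ℕ) : functional hp g (mon p n j) = g n j := by
  have h2 : ∀ l j, g n (j + 4 * p * l) = g n j := by
    intro l
    induction l with
    | zero => simp
    | succ l ih => intro j; rw [mul_add, mul_one, ← add_assoc, h1, ih]
  by_cases hn : n < p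
  · have hj : j % (4 * p) < 4 * p := Nat.mod_lt _ (by omega)
    rw [mon_mod]
    have := (pbw hp).constr_basis ℂ (fun i => g i.1 i.2) (⟨n, hn⟩, ⟨_, hj⟩)
    rw [pbw_apply] at this
    rw [functional, this]
    dsimp only
    rw [← h2 (j / (4 * p)), Nat.mod_add_div]
  · rw [mon_eq_zero (not_lt.1 hn), map_zero, h0 n j (not_lt.1 hn)]

lemma qpow_period (x : ℕ) (j : ℕ) : qpow p (-(x * ((j + 4 * p : ℕ) : ℂ)) / 2) =
    qpow p (-(x * (j : ℂ)) / 2) := by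
  have h := qpow_two_p_int p (-x)
  rw [← mul_one (qpow p (-(x * (j : ℂ)) / 2)), ← h, ← qpow_add]
  congr 1; push_cast; ring

/-- The functional `κ`. -/
def kappa (hp : 2 ≤ p) : Module.Dual ℂ (B p) :=
  functional hp fun n j => if n = 0 then qpow p (-(j : ℂ) / 2) else 0

/-- The functional `φ`. -/
def phi (hp : 2 ≤ p) : Module.Dual ℂ (B p) :=
  functional hp fun n j => if n = 1 then qpow p (-(j : ℂ)) / (qpow p 1 - qpow p (-1)) else 0

lemma kappa_mon (hp : 2 ≤ p) (n j : ℕ) :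
    kappa hp (mon p n j) = if n = 0 then qpow p (-(j : ℂ) / 2) else 0 := by
  refine functional_mon hp (fun n j hn => if_neg (by omega)) (fun n j => ?_) n j
  have := qpow_period (p := p) 1 j
  simp only [Nat.cast_one, one_mul] at this
  rw [this]

lemma phi_mon (hp : 2 ≤ p) (n j : ℕ) : phi hp (mon p n j) =
    if n = 1 then qpow p (-(j : ℂ)) / (qpow p 1 - qpow p (-1)) else 0 := by
  refine functional_mon hp (fun n j hn => if_neg (by omega)) (fun n j => ?_) n j
  have := qpow_period (p := p) 2 j
  have e : ∀ x : ℂ, -(((2 : ℕ) : ℂ) * x) / 2 = -x := fun x => by push_cast; ring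
  rw [e, e] at this
  rw [this]

lemma comul_mon (m j : ℕ) : comul (R := ℂ) (mon p m j) = ∑ k ∈ Finset.range (m + 1),
    gaussBinom (qpow p 2) m k • (mon p (m - k) j ⊗ₜ[ℂ] mon p k (2 * (m - k) + j)) := by
  have h : (E p ⊗ₜ[ℂ] (K p ^ 2)) * ((1 : B p) ⊗ₜ[ℂ] E p) =
      qpow p 2 • (((1 : B p) ⊗ₜ[ℂ] E p) * (E p ⊗ₜ[ℂ] (K p ^ 2))) := by
    rw [Algebra.TensorProduct.tmul_mul_tmul, Algebra.TensorProduct.tmul_mul_tmul,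
      (rel p).Le (by norm_num), TensorProduct.tmul_smul, one_mul, mul_one]
  rw [mon, Bialgebra.comul_mul, Bialgebra.comul_pow, Bialgebra.comul_pow, comul_E, comul_K,
    q_binomial h, Finset.sum_mul]
  refine Finset.sum_congr rfl fun k _ => ?_
  simp only [smul_mul_assoc, Algebra.TensorProduct.tmul_pow, Algebra.TensorProduct.tmul_mul_tmul,
    one_pow, one_mul, mon, mul_assoc, ← pow_mul, ← pow_add]

lemma conv_mon (f g : WithConv (Module.Dual ℂ (B p))) (m j : ℕ) : (f * g).ofConv (mon p m j) =
    ∑ k ∈ Finset.range (m + 1), gaussBinom (qpow p 2) m k *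
      (f.ofConv (mon p (m - k) j) * g.ofConv (mon p k (2 * (m - k) + j))) := by
  rw [LinearMap.convMul_def]
  simp [comul_mon]

end B

lemma gaussBinom_one {p : ℕ} [NeZero p] (hp : 2 ≤ p) (n : ℕ) :
    gaussBinom (qpow p 2) (n + 1) 1 = qInt p (n + 1 : ℕ) * qpow p n := by
  have h := gaussBinom_absorb (qpow p 2) n 0
  have hq := qdiff_ne_zero p hp
  have h1 := qInt_mul p hp (n + 1)
  rw [zero_add, pow_one, gaussBinom_zero_right, mul_one] at h
  have hw : 1 - qpow p 2 ≠ 0 := fun h0 => hq <| by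
    have : qpow p 1 - qpow p (-1) = - (1 - qpow p 2) * qpow p (-1) := by
      rw [neg_sub, sub_mul, ← qpow_add, one_mul]; norm_num
    rw [this, h0, neg_zero, zero_mul]
  refine mul_left_cancel₀ hw (h.trans ?_)
  have e : 1 - qpow p 2 = - qpow p 1 * (qpow p 1 - qpow p (-1)) := by
    rw [mul_sub, neg_mul, neg_mul, ← qpow_add, ← qpow_add, add_neg_cancel, qpow_zero]; norm_num; ring
  calc _ = - qpow p 1 * (qpow p (n + 1 : ℕ) - qpow p (-(n + 1 : ℕ))) * qpow p n := by
        rw [mul_sub, sub_mul, neg_mul, neg_mul, neg_mul, neg_mul, ← qpow_add, ← qpow_add,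
          ← qpow_add, ← qpow_add, qpow_pow]
        have : (1 : ℂ) + -((n + 1 : ℕ) : ℂ) + n = 0 := by push_cast; ring
        rw [this, qpow_zero, neg_sub_neg]
        congr 2; push_cast; ring
    _ = _ := by rw [← h1, e]; ring

lemma injective_of_linearIndependent_comp {ι M N : Type*} [AddCommGroup M] [Module ℂ M]
    [AddCommGroup N] [Module ℂ N] (b : Module.Basis ι ℂ M) {f : M →ₗ[ℂ] N}
    (h : LinearIndependent ℂ (f ∘ b)) : Function.Injective f := by
  have := b.injective_constr_of_linearIndependent (R₂ := ℕ) h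
  rwa [show b.constr ℕ (f ∘ b) = f from b.ext fun i => b.constr_basis ℕ _ i] at this

namespace B

open Coalgebra HopfAlgebra WithConv

variable {p : ℕ} [NeZero p]

/-- A functional concentrated in one degree of E selects a single term of the coproduct. -/
lemma conv_mon_of_graded {f g : WithConv (Module.Dual ℂ (B p))} {a b : ℕ}
    (hf : ∀ m j, m ≠ a → f.ofConv (mon p m j) = 0) (hg : ∀ m j, m ≠ b → g.ofConv (mon p m j) = 0)
    (m j : ℕ) : (f * g).ofConv (mon p m j) = if m = a + b then gaussBinom (qpow p 2) (a + b) b *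
      (f.ofConv (mon p a j) * g.ofConv (mon p b (2 * a + j))) else 0 := by
  rw [conv_mon]
  split_ifs with h
  · subst h
    rw [Finset.sum_eq_single b]
    · rw [Nat.add_sub_cancel]
    · intro k _ hk
      rw [hg k _ hk, mul_zero, mul_zero]
    · intro hb
      exact absurd (Finset.mem_range.2 (by omega)) hb
  · refine Finset.sum_eq_zero fun k hk => ?_
    have := Finset.mem_range.1 hk
    by_cases hkb : k = b
    · rw [hf (m - k) _ (by omega), zero_mul, mul_zero]
    · rw [hg k _ hkb, mul_zero, mul_zero]

/-- The coefficients of the powers of `φ`. -/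
def phiCoeff (p : ℕ) : ℕ → ℂ
  | 0 => 1
  | n + 1 => phiCoeff p n * ((qpow p 1 - qpow p (-1))⁻¹ * (qInt p (n + 1 : ℕ) * qpow p (-n)))

lemma phiCoeff_ne_zero (hp : 2 ≤ p) : ∀ {n : ℕ}, n < p → phiCoeff p n ≠ 0
  | 0, _ => one_ne_zero
  | n + 1, h => mul_ne_zero (phiCoeff_ne_zero hp (by omega)) <|
      mul_ne_zero (inv_ne_zero (qdiff_ne_zero p hp)) <|
        mul_ne_zero (qInt_ne_zero p hp (by omega) h) (qpow_ne_zero _ _)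

lemma phi_pow_mon (hp : 2 ≤ p) (n m j : ℕ) : (toConv (phi hp) ^ n).ofConv (mon p m j) =
    if m = n then phiCoeff p n * qpow p (-(n * j)) else 0 := by
  induction n generalizing m j with
  | zero =>
    rw [pow_zero, LinearMap.convOne_def, mon]
    simp only [LinearMap.comp_apply, Algebra.linearMap_apply]
    rw [Bialgebra.counit_mul, Bialgebra.counit_pow, Bialgebra.counit_pow, counit_E, counit_K]
    by_cases h : m = 0 <;> simp [h, phiCoeff, qpow_zero]
  | succ n ih =>
    rw [pow_succ, conv_mon_of_graded (a := n) (b := 1)]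
    · by_cases h : m = n + 1
      · rw [if_pos h, if_pos h, ih, if_pos rfl, gaussBinom_one hp]
        change _ * (_ * phi hp _) = _
        rw [phi_mon, if_pos rfl, phiCoeff, div_eq_mul_inv]
        have e : qpow p (-((n + 1 : ℕ) * j)) * qpow p (-n) =
            qpow p n * qpow p (-(n * j)) * qpow p (-(2 * n + j : ℕ)) := by
          simp only [← qpow_add]; congr 1; push_cast; ring
        linear_combination (-(qInt p (n + 1 : ℕ) * phiCoeff p n *
          (qpow p 1 - qpow p (-1))⁻¹)) * e
      · rw [if_neg h, if_neg h]
    · intro m j h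
      rw [ih, if_neg h]
    · intro m j h
      change phi hp _ = _
      rw [phi_mon, if_neg h]

lemma kappa_pow_mon (hp : 2 ≤ p) (n m j : ℕ) : (toConv (kappa hp) ^ n).ofConv (mon p m j) =
    if m = 0 then qpow p (-(n * j) / 2) else 0 := by
  induction n generalizing m j with
  | zero =>
    rw [pow_zero, LinearMap.convOne_def, mon]
    simp only [LinearMap.comp_apply, Algebra.linearMap_apply]
    rw [Bialgebra.counit_mul, Bialgebra.counit_pow, Bialgebra.counit_pow, counit_E, counit_K]
    by_cases h : m = 0 <;> simp [h, qpow_zero]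
  | succ n ih =>
    rw [pow_succ, conv_mon_of_graded (a := 0) (b := 0)]
    · by_cases h : m = 0
      · rw [if_pos h, if_pos h, ih, if_pos rfl, gaussBinom_zero_right]
        change _ * (_ * kappa hp _) = _
        rw [kappa_mon, if_pos rfl, one_mul, ← qpow_add]
        congr 1; push_cast; ring
      · rw [if_neg h, if_neg h]
    · intro m j h
      rw [ih, if_neg h]
    · intro m j h
      change kappa hp _ = _
      rw [kappa_mon, if_neg h]

lemma conv_ext {f g : WithConv (Module.Dual ℂ (B p))}
    (h : ∀ m j, f.ofConv (mon p m j) = g.ofConv (mon p m j)) : f = g :=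
  congrArg toConv (linearMap_ext h)

lemma borelRel_dual (hp : 2 ≤ p) : BorelRel p 2 1 (toConv (phi hp)) (toConv (kappa hp)) where
  ke := by
    have hk : ∀ m j, m ≠ 0 → (toConv (kappa hp)).ofConv (mon p m j) = 0 := fun m j h => by
      rw [ofConv_toConv, kappa_mon, if_neg h]
    have hf : ∀ m j, m ≠ 1 → (toConv (phi hp)).ofConv (mon p m j) = 0 := fun m j h => by
      rw [ofConv_toConv, phi_mon, if_neg h]
    refine conv_ext fun m j => ?_
    rw [ofConv_smul, LinearMap.smul_apply, conv_mon_of_graded hk hf, conv_mon_of_graded hf hk]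
    by_cases h : m = 1
    · rw [if_pos (by omega), if_pos (by omega)]
      dsimp only
      rw [kappa_mon, if_pos rfl, kappa_mon, if_pos rfl, phi_mon, if_pos rfl, phi_mon, if_pos rfl,
        zero_add, gaussBinom_self, gaussBinom_zero_right, smul_eq_mul]
      have e : qpow p (-(j : ℂ) / 2) * qpow p (-((2 * 0 + j : ℕ) : ℂ)) =
          qpow p 1 * (qpow p (-(j : ℂ)) * qpow p (-((2 * 1 + j : ℕ) : ℂ) / 2)) := by
        simp only [← qpow_add]; congr 1; push_cast; ring
      linear_combination (qpow p 1 - qpow p (-1))⁻¹ * e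
    · rw [if_neg (by omega), if_neg (by omega), smul_zero]
  e_pow := conv_ext fun m j => by
    rw [phi_pow_mon, ofConv_zero, LinearMap.zero_apply]
    by_cases h : m = p
    · obtain ⟨n, rfl⟩ := Nat.exists_eq_succ_of_ne_zero (NeZero.ne p)
      rw [if_pos h, phiCoeff, ← Nat.succ_eq_add_one, qInt_self]
      simp
    · rw [if_neg h]
  k_pow := conv_ext fun m j => by
    have h0 := phi_pow_mon hp 0 m j
    rw [pow_zero] at h0
    rw [kappa_pow_mon, h0]
    by_cases h : m = 0
    · rw [if_pos h, if_pos h, phiCoeff, one_mul, Nat.cast_zero, zero_mul, neg_zero, qpow_zero,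
        ← qpow_two_p_int p (-j)]
      congr 1; push_cast; ring
    · rw [if_neg h, if_neg h]

/-- The homomorphism from `B` to its dual with `E ↦ φ` and `K ↦ κ`. -/
def toDual (hp : 2 ≤ p) : B p →ₐ[ℂ] WithConv (Module.Dual ℂ (B p)) := lift (borelRel_dual hp)

lemma toDual_E (hp : 2 ≤ p) : (toDual hp (E p)).ofConv = phi hp := by rw [toDual, lift_E]

lemma toDual_K (hp : 2 ≤ p) : (toDual hp (K p)).ofConv = kappa hp := by rw [toDual, lift_K]

lemma toDual_mon (hp : 2 ≤ p) (n i m j : ℕ) : (toDual hp (mon p n i)).ofConv (mon p m j) =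
    if m = n then phiCoeff p n * qpow p (-(n * j) - n * i - i * j / 2) else 0 := by
  rw [mon, map_mul, map_pow, map_pow, toDual, lift_E, lift_K, conv_mon_of_graded (a := n) (b := 0)]
  · by_cases h : m = n
    · rw [if_pos (by omega), if_pos h, phi_pow_mon, kappa_pow_mon, if_pos rfl, if_pos rfl,
        gaussBinom_zero_right, one_mul, mul_assoc, ← qpow_add]
      congr 2; push_cast; ring
    · rw [if_neg (by omega), if_neg h]
  · intro m j h
    rw [phi_pow_mon, if_neg h]
  · intro m j h
    rw [kappa_pow_mon, if_neg h]

/-- `toDual` as a linear map. -/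
def toDualLin (hp : 2 ≤ p) : B p →ₗ[ℂ] Module.Dual ℂ (B p) :=
  (WithConv.linearEquiv ℂ _).toLinearMap ∘ₗ (toDual hp).toLinearMap

lemma toDualLin_apply (hp : 2 ≤ p) (x : B p) : toDualLin hp x = (toDual hp x).ofConv := rfl

lemma toDualLin_mon (hp : 2 ≤ p) (n i m j : ℕ) : toDualLin hp (mon p n i) (mon p m j) =
    if m = n then phiCoeff p n * qpow p (-(n * j) - n * i - i * j / 2) else 0 :=
  toDual_mon hp n i m j

/-- The explicit value on monomials is symmetric in i and j. Thanks to this symmetry, the coproduct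
and counit of the dual can be read off from those of `B`. -/
lemma toDualLin_comm (hp : 2 ≤ p) (x y : B p) : toDualLin hp x y = toDualLin hp y x := by
  have : toDualLin hp = (toDualLin hp).flip := by
    refine linearMap_ext fun n i => linearMap_ext fun m j => ?_
    rw [LinearMap.flip_apply, toDualLin_mon, toDualLin_mon]
    by_cases h : m = n
    · subst h
      rw [if_pos rfl, if_pos rfl]
      congr 2; ring
    · rw [if_neg h, if_neg (Ne.symm h)]
  conv_lhs => rw [this]
  rfl

lemma toDualLin_mul (hp : 2 ≤ p) (x y z : B p) : toDualLin hp (x * y) z =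
    LinearMap.mul' ℂ ℂ (TensorProduct.map (toDualLin hp x) (toDualLin hp y)
      (comul (R := ℂ) z)) := by
  rw [toDualLin_apply, map_mul]; rfl

lemma toDualLin_one (hp : 2 ≤ p) : toDualLin hp 1 = counit (R := ℂ) (A := B p) := by
  rw [toDualLin_apply, map_one]; rfl

/-- Inverse Fourier transform in the torus exponent; it provides functionals dual, up to nonzero
scalars, to the images of the PBW basis. -/
lemma sum_toDualLin_mon (hp : 2 ≤ p) (i j : Fin p × Fin (4 * p)) :
    ∑ l ∈ Finset.range (4 * p), qpow p (((i.1 : ℕ) : ℂ) * l + ((i.2 : ℕ) : ℂ) * l / 2) *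
      toDualLin hp (mon p j.1 j.2) (mon p i.1 l) =
    if i = j then 4 * p * (phiCoeff p i.1 * qpow p (-((i.1 : ℕ) * (i.2 : ℕ)))) else 0 := by
  obtain ⟨n, i⟩ := i
  obtain ⟨m, j⟩ := j
  simp only [toDualLin_mon]
  by_cases h : n = m
  · subst h
    have h1 : ∀ l ∈ Finset.range (4 * p), qpow p (((n : ℕ) : ℂ) * l + ((i : ℕ) : ℂ) * l / 2) *
        (if (n : ℕ) = n then phiCoeff p n * qpow p (-((n : ℕ) * l) - (n : ℕ) * (j : ℕ) -
          (j : ℕ) * l / 2) else 0) = qpow p ((((i : ℕ) : ℤ) - ((j : ℕ) : ℤ) : ℤ) * l / 2) *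
          (phiCoeff p n * qpow p (-((n : ℕ) * (j : ℕ)))) := fun l _ => by
      rw [if_pos rfl, mul_left_comm, ← qpow_add, mul_left_comm, ← qpow_add]
      congr 2; push_cast; ring
    rw [Finset.sum_congr rfl h1, ← Finset.sum_mul, sum_qpow_half]
    by_cases hij : i = j
    · subst hij
      rw [if_pos rfl, sub_self, if_pos (dvd_zero _)]
    · rw [if_neg (fun h' => hij (congrArg Prod.snd h')), if_neg, zero_mul]
      intro hd
      refine hij (Fin.ext ?_)
      have hi := i.2
      have hj := j.2
      have h2 := Int.eq_zero_of_abs_lt_dvd hd (by rw [abs_lt]; omega)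
      omega
  · rw [if_neg fun h' => h (congrArg Prod.fst h')]
    refine Finset.sum_eq_zero fun l _ => ?_
    rw [if_neg fun h' => h (Fin.ext h'), mul_zero]

lemma toDualLin_injective (hp : 2 ≤ p) : Function.Injective (toDualLin hp) := by
  have h : LinearIndependent ℂ (toDualLin hp ∘ pbw hp) := by
    have key := sum_toDualLin_mon (p := p) hp
    refine linearIndependent_of_dual (fun (i : Fin p × Fin (4 * p)) =>
      (∑ l ∈ Finset.range (4 * p), qpow p (((i.1 : ℕ) : ℂ) * l + ((i.2 : ℕ) : ℂ) * l / 2) •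
        LinearMap.applyₗ (mon p i.1 l) : Module.Dual ℂ (B p) →ₗ[ℂ] ℂ)) ?_ ?_
    · intro i j hij
      rw [LinearMap.sum_apply, Function.comp_apply, pbw_apply]
      exact (key i j).trans (if_neg hij)
    · intro i
      rw [LinearMap.sum_apply, Function.comp_apply, pbw_apply]
      refine ((key i i).trans (if_pos rfl)).trans_ne ?_
      exact mul_ne_zero (mul_ne_zero (by norm_num) (cast_ne p))
        (mul_ne_zero (phiCoeff_ne_zero hp i.1.2) (qpow_ne_zero _ _))
  exact injective_of_linearIndependent_comp (pbw hp) h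

/-- The isomorphism of `B` with its dual. -/
def dualEquiv (hp : 2 ≤ p) : B p ≃ₗ[ℂ] Module.Dual ℂ (B p) :=
  haveI : Module.Finite ℂ (B p) := Module.Finite.of_basis (pbw hp)
  LinearEquiv.ofInjectiveOfFinrankEq (toDualLin hp) (toDualLin_injective hp)
    Subspace.dual_finrank_eq.symm

lemma dualEquiv_apply (hp : 2 ≤ p) (x : B p) : dualEquiv hp x = toDualLin hp x := rfl

end B

/-! ### The double of `B` by generators and relations -/

namespace DoubleRel

variable {A : Type*} [Ring A] [Algebra ℂ A] {p : ℕ} {e f k c : A}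

lemma qcomm_inv {x x' y : A} {w : ℂ} (h : x * y = w • (y * x)) (h1 : x * x' = 1) (h2 : x' * x = 1) :
    y * x' = w • (x' * y) := by
  calc y * x' = x' * (x * y) * x' := by rw [← mul_assoc, h2, one_mul]
    _ = w • (x' * (y * (x * x'))) := by rw [h]; simp only [mul_smul_comm, smul_mul_assoc, mul_assoc]
    _ = _ := by rw [h1, mul_one]

lemma Kf (h : DoubleRel p e f k c) : k ^ 2 * f = qpow p (-2) • (f * k ^ 2) := by
  rw [qcomm_pow_left h.kf, qpow_pow]; norm_num

lemma Ce (h : DoubleRel p e f k c) : c ^ 2 * e = qpow p (-2) • (e * c ^ 2) := by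
  rw [qcomm_pow_left h.ce, qpow_pow]; norm_num

lemma counit (p : ℕ) [NeZero p] : DoubleRel p (0 : ℂ) (0 : ℂ) (1 : ℂ) (1 : ℂ) where
  borel := BorelRel.counit p 2 1
  borel' := BorelRel.counit p 2 1
  kf := by simp
  ce := by simp
  kc := by simp
  ef := by simp

/-- The relations hold for the coproducts of the generators. -/
lemma comul [NeZero p] (h : DoubleRel p e f k c) :
    DoubleRel p ((1 : A) ⊗ₜ[ℂ] e + e ⊗ₜ[ℂ] (k ^ 2)) ((c ^ 2) ⊗ₜ[ℂ] f + f ⊗ₜ[ℂ] (1 : A))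
      (k ⊗ₜ[ℂ] k) (c ⊗ₜ[ℂ] c) where
  borel := h.borel.comul (by norm_num)
  borel' := by
    refine ⟨?_, ?_, ?_⟩
    · simp only [mul_add, add_mul, Algebra.TensorProduct.tmul_mul_tmul, one_mul, mul_one,
        h.borel'.ke, TensorProduct.tmul_smul, ← TensorProduct.smul_tmul', smul_add]
      rw [← pow_succ, ← pow_succ']
    · have hp : IsPrimitiveRoot (qpow p (-2)) p := by
        rw [qpow_neg]
        exact (qpow_two_primitive p).inv
      refine comul_pow_F ?_ (NeZero.ne p) hp h.borel'.e_pow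
      rw [h.borel'.Le (by norm_num), smul_smul, ← qpow_add, neg_add_cancel, qpow_zero, one_smul]
    · rw [Algebra.TensorProduct.tmul_pow, h.borel'.k_pow, Algebra.TensorProduct.one_def]
  kf := by
    have hkc : k * c ^ 2 = c ^ 2 * k := (show Commute k c from h.kc).pow_right 2
    simp only [mul_add, add_mul, Algebra.TensorProduct.tmul_mul_tmul, one_mul, mul_one, h.kf,
      TensorProduct.tmul_smul, ← TensorProduct.smul_tmul', smul_add, hkc]
  ce := by
    have hkc : c * k ^ 2 = k ^ 2 * c := (show Commute c k from h.kc.symm).pow_right 2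
    simp only [mul_add, add_mul, Algebra.TensorProduct.tmul_mul_tmul, one_mul, mul_one, h.ce,
      TensorProduct.tmul_smul, ← TensorProduct.smul_tmul', smul_add, hkc]
  kc := by simp only [Algebra.TensorProduct.tmul_mul_tmul, h.kc]
  ef := by
    rw [comul_EF h.Kf h.Ce h.ef, Algebra.TensorProduct.tmul_pow, Algebra.TensorProduct.tmul_pow]

/-- The relations hold for the antipodes of the generators in the opposite algebra. -/
lemma antipode [NeZero p] (h : DoubleRel p e f k c) :
    DoubleRel p (MulOpposite.op (-(e * k ^ (4 * p - 2)))) (MulOpposite.op (-(c ^ (4 * p - 2) * f)))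
      (MulOpposite.op (k ^ (4 * p - 1))) (MulOpposite.op (c ^ (4 * p - 1))) := by
  have hN : 2 * 2 * p ≠ 0 := by simpa using NeZero.ne p
  have hk1 := h.borel.kinv' hN
  have hk2 := h.borel.kinv hN
  have hc1 := h.borel'.kinv' hN
  have hc2 := h.borel'.kinv hN
  have hK1 := h.borel.kL
  have hK2 := h.borel.Lk
  have hC1 := h.borel'.kL
  have hC2 := h.borel'.Lk
  have hk3 := h.borel.kinv_pow_base hN
  have hc3 := h.borel'.kinv_pow_base hN
  have b := h.borel.antipode (by norm_num) hN
  simp only [show 2 * 2 * p = 4 * p by ring] at *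
  have hkc : Commute k c := h.kc
  refine ⟨b, ⟨?_, ?_, ?_⟩, ?_, ?_, ?_, ?_⟩
  · rw [← MulOpposite.op_mul, ← MulOpposite.op_mul, ← MulOpposite.op_smul]
    congr 1
    rw [neg_mul, mul_neg, mul_assoc, qcomm_inv h.borel'.ke hc1 hc2, mul_smul_comm, smul_neg,
      ← mul_assoc, ← mul_assoc, ← pow_add, ← pow_add, add_comm]
  · rw [← MulOpposite.op_pow, neg_pow, mul_pow_eq_zero
      (qcomm_inv (h.borel'.Le (by norm_num)) hC1 hC2) (by rw [h.borel'.e_pow, mul_zero]), mul_zero,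
      MulOpposite.op_zero]
  · rw [← MulOpposite.op_pow, ← pow_mul, mul_comm, pow_mul, h.borel'.k_pow, one_pow,
      MulOpposite.op_one]
  · rw [← MulOpposite.op_mul, ← MulOpposite.op_mul, ← MulOpposite.op_smul]
    congr 1
    rw [neg_mul, mul_neg, mul_assoc, qcomm_inv h.kf hk1 hk2, mul_smul_comm, smul_neg,
      ← mul_assoc, ← mul_assoc, (hkc.pow_pow _ _).eq]
  · rw [← MulOpposite.op_mul, ← MulOpposite.op_mul, ← MulOpposite.op_smul]
    congr 1
    rw [neg_mul, mul_neg, mul_assoc, (hkc.pow_pow _ _).eq, ← mul_assoc, qcomm_inv h.ce hc1 hc2,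
      smul_mul_assoc, smul_neg, mul_assoc]
  · rw [← MulOpposite.op_mul, ← MulOpposite.op_mul, (hkc.pow_pow _ _).eq]
  · rw [← MulOpposite.op_mul, ← MulOpposite.op_mul, ← MulOpposite.op_pow, ← MulOpposite.op_pow,
      ← MulOpposite.op_sub, ← MulOpposite.op_sub, ← MulOpposite.op_smul, hk3, hc3]
    congr 1
    set L := k ^ (4 * p - 2)
    set M := c ^ (4 * p - 2)
    have hLM : L * M = M * L := hkc.pow_pow _ _
    have f1 : f * L = qpow p (-2) • (L * f) := qcomm_inv h.Kf hK1 hK2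
    have f2 : f * M = qpow p 2 • (M * f) := qcomm_inv (h.borel'.Le (by norm_num)) hC1 hC2
    have f3 : e * M = qpow p (-2) • (M * e) := qcomm_inv h.Ce hC1 hC2
    have e1 : M * f * (e * L) = f * e * (M * L) := by
      calc _ = (qpow p 2 * qpow p (-2)) • (M * f * (e * L)) := by
            rw [← qpow_add, add_neg_cancel, qpow_zero, one_smul]
        _ = qpow p (-2) • (f * M * e * L) := by
            rw [f2, smul_mul_assoc, smul_mul_assoc, smul_smul, mul_comm (qpow p 2), mul_assoc (M * f)]
        _ = f * (e * M) * L := by rw [f3, mul_smul_comm, smul_mul_assoc, ← mul_assoc]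
        _ = _ := by simp only [mul_assoc]
    have e2 : e * L * (M * f) = e * f * (M * L) := by
      calc _ = (qpow p 2 * qpow p (-2)) • (e * M * L * f) := by
            rw [← qpow_add, add_neg_cancel, qpow_zero, one_smul, mul_assoc, ← mul_assoc L, hLM]
            simp only [mul_assoc]
        _ = qpow p 2 • (e * M * (f * L)) := by
            rw [f1, mul_smul_comm, smul_smul]; simp only [mul_assoc]
        _ = e * (f * M) * L := by
            rw [f2, mul_smul_comm, smul_mul_assoc]; simp only [mul_assoc]
        _ = _ := by simp only [mul_assoc]
    have e3 : (k ^ 2 - c ^ 2) * (M * L) = M - L := by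
      rw [sub_mul, ← hLM, ← mul_assoc, hK1, one_mul, hLM, ← mul_assoc, hC1, one_mul]
    rw [neg_mul_neg, neg_mul_neg, e1, e2, ← sub_mul, ← neg_sub (e * f), h.ef, neg_mul,
      smul_mul_assoc, e3, ← smul_neg, neg_sub]

end DoubleRel

/-- Generators of the double. -/
inductive DGen
  | E
  | F
  | K
  | C

open FreeAlgebra in
/-- Defining relations of the double of `B`; `F` and `C` are the functionals `φ` and `κ`. -/
inductive DoublePres (p : ℕ) : FreeAlgebra ℂ DGen → FreeAlgebra ℂ DGen → Prop
  | ke : DoublePres p (ι ℂ .K * ι ℂ .E) (qpow p 1 • (ι ℂ .E * ι ℂ .K))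
  | e_pow : DoublePres p (ι ℂ .E ^ p) 0
  | k_pow : DoublePres p (ι ℂ .K ^ (4 * p)) 1
  | cf : DoublePres p (ι ℂ .C * ι ℂ .F) (qpow p 1 • (ι ℂ .F * ι ℂ .C))
  | f_pow : DoublePres p (ι ℂ .F ^ p) 0
  | c_pow : DoublePres p (ι ℂ .C ^ (4 * p)) 1
  | kf : DoublePres p (ι ℂ .K * ι ℂ .F) (qpow p (-1) • (ι ℂ .F * ι ℂ .K))
  | ce : DoublePres p (ι ℂ .C * ι ℂ .E) (qpow p (-1) • (ι ℂ .E * ι ℂ .C))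
  | kc : DoublePres p (ι ℂ .K * ι ℂ .C) (ι ℂ .C * ι ℂ .K)
  | ef : DoublePres p (ι ℂ .E * ι ℂ .F - ι ℂ .F * ι ℂ .E)
      ((qpow p 1 - qpow p (-1))⁻¹ • (ι ℂ .K ^ 2 - ι ℂ .C ^ 2))

/-- The double of `B`, presented by generators and relations. -/
def Double (p : ℕ) : Type := RingQuot (DoublePres p)

namespace Double

instance (p : ℕ) : Ring (Double p) := inferInstanceAs (Ring (RingQuot (DoublePres p)))
instance (p : ℕ) : Algebra ℂ (Double p) := inferInstanceAs (Algebra ℂ (RingQuot (DoublePres p)))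

/-- The quotient map from the free algebra. -/
def mk (p : ℕ) : FreeAlgebra ℂ DGen →ₐ[ℂ] Double p := RingQuot.mkAlgHom ℂ (DoublePres p)

/-- The generator `E`. -/
def E (p : ℕ) : Double p := mk p (FreeAlgebra.ι ℂ .E)
/-- The generator `F`. -/
def F (p : ℕ) : Double p := mk p (FreeAlgebra.ι ℂ .F)
/-- The generator `K`. -/
def K (p : ℕ) : Double p := mk p (FreeAlgebra.ι ℂ .K)
/-- The generator `C`. -/
def C (p : ℕ) : Double p := mk p (FreeAlgebra.ι ℂ .C)

section

variable {p : ℕ} {A : Type*} [Ring A] [Algebra ℂ A]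

lemma mk_rel {x y : FreeAlgebra ℂ DGen} (h : DoublePres p x y) : mk p x = mk p y :=
  RingQuot.mkAlgHom_rel ℂ h

lemma rel (p : ℕ) : DoubleRel p (E p) (F p) (K p) (C p) where
  borel := ⟨by simpa [E, K] using mk_rel (DoublePres.ke (p := p)),
    by simpa [E] using mk_rel (DoublePres.e_pow (p := p)),
    by simpa [K] using mk_rel (DoublePres.k_pow (p := p))⟩
  borel' := ⟨by simpa [F, C] using mk_rel (DoublePres.cf (p := p)),
    by simpa [F] using mk_rel (DoublePres.f_pow (p := p)),
    by simpa [C] using mk_rel (DoublePres.c_pow (p := p))⟩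
  kf := by simpa [F, K] using mk_rel (DoublePres.kf (p := p))
  ce := by simpa [E, C] using mk_rel (DoublePres.ce (p := p))
  kc := by simpa [C, K] using mk_rel (DoublePres.kc (p := p))
  ef := by simpa [E, F, K, C] using mk_rel (DoublePres.ef (p := p))

/-- The universal property of the presentation. -/
def lift {e f k c : A} (h : DoubleRel p e f k c) : Double p →ₐ[ℂ] A :=
  RingQuot.liftAlgHom ℂ ⟨FreeAlgebra.lift ℂ fun | .E => e | .F => f | .K => k | .C => c, by
    rintro _ _ (_ | _ | _ | _ | _ | _ | _ | _ | _ | _)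
    · simpa using h.borel.ke
    · simpa using h.borel.e_pow
    · simpa using h.borel.k_pow
    · simpa using h.borel'.ke
    · simpa using h.borel'.e_pow
    · simpa using h.borel'.k_pow
    · simpa using h.kf
    · simpa using h.ce
    · simpa using h.kc
    · simpa using h.ef⟩

variable {e f k c : A} (h : DoubleRel p e f k c)

@[simp] lemma lift_E : lift h (E p) = e :=
  (RingQuot.liftAlgHom_mkAlgHom_apply ..).trans (FreeAlgebra.lift_ι_apply ..)

@[simp] lemma lift_F : lift h (F p) = f :=
  (RingQuot.liftAlgHom_mkAlgHom_apply ..).trans (FreeAlgebra.lift_ι_apply ..)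

@[simp] lemma lift_K : lift h (K p) = k :=
  (RingQuot.liftAlgHom_mkAlgHom_apply ..).trans (FreeAlgebra.lift_ι_apply ..)

@[simp] lemma lift_C : lift h (C p) = c :=
  (RingQuot.liftAlgHom_mkAlgHom_apply ..).trans (FreeAlgebra.lift_ι_apply ..)

lemma hom_ext {φ ψ : Double p →ₐ[ℂ] A} (hE : φ (E p) = ψ (E p)) (hF : φ (F p) = ψ (F p))
    (hK : φ (K p) = ψ (K p)) (hC : φ (C p) = ψ (C p)) : φ = ψ := by
  apply RingQuot.ringQuot_ext'
  ext (_ | _ | _ | _)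
  · exact hE
  · exact hF
  · exact hK
  · exact hC

end

lemma adjoin (p : ℕ) : Algebra.adjoin ℂ {E p, F p, K p, C p} = ⊤ := by
  set s := Algebra.adjoin ℂ {E p, F p, K p, C p}
  have h : DoubleRel p (⟨E p, Algebra.subset_adjoin (by simp)⟩ : s)
      (⟨F p, Algebra.subset_adjoin (by simp)⟩ : s)
      (⟨K p, Algebra.subset_adjoin (by simp)⟩ : s)
      (⟨C p, Algebra.subset_adjoin (by simp)⟩ : s) :=
    ⟨⟨Subtype.ext (rel p).borel.ke, Subtype.ext (rel p).borel.e_pow,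
        Subtype.ext (rel p).borel.k_pow⟩,
      ⟨Subtype.ext (rel p).borel'.ke, Subtype.ext (rel p).borel'.e_pow,
        Subtype.ext (rel p).borel'.k_pow⟩,
      Subtype.ext (rel p).kf, Subtype.ext (rel p).ce, Subtype.ext (rel p).kc,
      Subtype.ext (rel p).ef⟩
  have e : s.val.comp (lift h) = AlgHom.id ℂ (Double p) :=
    hom_ext (by simp) (by simp) (by simp) (by simp)
  rw [eq_top_iff]
  intro x _
  have := DFunLike.congr_fun e x
  simp only [AlgHom.comp_apply, AlgHom.id_apply] at this
  rw [← this]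
  exact (lift h x).2

variable {p : ℕ} [NeZero p]

/-- The coproduct of the double. -/
def comulHom (p : ℕ) [NeZero p] : Double p →ₐ[ℂ] Double p ⊗[ℂ] Double p := lift (rel p).comul

/-- The counit of the double. -/
def counitHom (p : ℕ) [NeZero p] : Double p →ₐ[ℂ] ℂ := lift (DoubleRel.counit p)

/-- The antipode of the double. -/
def antipodeHom (p : ℕ) [NeZero p] : Double p →ₐ[ℂ] (Double p)ᵐᵒᵖ := lift (rel p).antipode

instance : Bialgebra ℂ (Double p) :=
  Bialgebra.ofAlgHom (comulHom p) (counitHom p)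
    (hom_ext
      (by simp [comulHom, Algebra.TensorProduct.one_def, TensorProduct.tmul_add, add_assoc,
            TensorProduct.add_tmul, Algebra.TensorProduct.tmul_pow])
      (by simp [comulHom, Algebra.TensorProduct.one_def, TensorProduct.tmul_add, add_assoc,
            TensorProduct.add_tmul, Algebra.TensorProduct.tmul_pow])
      (by simp [comulHom]) (by simp [comulHom]))
    (hom_ext (by simp [comulHom, counitHom]) (by simp [comulHom, counitHom])
      (by simp [comulHom, counitHom]) (by simp [comulHom, counitHom]))
    (hom_ext (by simp [comulHom, counitHom]) (by simp [comulHom, counitHom])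
      (by simp [comulHom, counitHom]) (by simp [comulHom, counitHom]))

lemma comul_E : Coalgebra.comul (R := ℂ) (E p) = 1 ⊗ₜ[ℂ] E p + E p ⊗ₜ[ℂ] (K p ^ 2) := lift_E _
lemma comul_F : Coalgebra.comul (R := ℂ) (F p) = (C p ^ 2) ⊗ₜ[ℂ] F p + F p ⊗ₜ[ℂ] 1 := lift_F _
lemma comul_K : Coalgebra.comul (R := ℂ) (K p) = K p ⊗ₜ[ℂ] K p := lift_K _
lemma comul_C : Coalgebra.comul (R := ℂ) (C p) = C p ⊗ₜ[ℂ] C p := lift_C _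
lemma counit_E : Coalgebra.counit (R := ℂ) (E p) = 0 := lift_E _
lemma counit_F : Coalgebra.counit (R := ℂ) (F p) = 0 := lift_F _
lemma counit_K : Coalgebra.counit (R := ℂ) (K p) = 1 := lift_K _
lemma counit_C : Coalgebra.counit (R := ℂ) (C p) = 1 := lift_C _

instance : HopfAlgebra ℂ (Double p) :=
  hopfOfGenerators (antipodeHom p) {E p, F p, K p, C p} (adjoin p)
    (by
      have hN : 2 * 2 * p ≠ 0 := by simpa using NeZero.ne p
      have hL : K p ^ (4 * p - 2) * (K p ^ 2) = 1 := by simpa using (rel p).borel.Lk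
      have hC : (C p ^ (4 * p - 1)) ^ 2 = C p ^ (4 * p - 2) := by
        simpa using (rel p).borel'.kinv_pow_base hN
      rintro _ (rfl | rfl | rfl | rfl)
      · simp [comul_E, counit_E, antiLin_apply, antipodeHom, mul_assoc]
        rw [hL, mul_one, add_neg_cancel]
      · simp [comul_F, counit_F, antiLin_apply, antipodeHom]
        rw [hC, add_neg_cancel]
      · simp [comul_K, counit_K, antiLin_apply, antipodeHom]
        exact (rel p).borel.kinv hN
      · simp [comul_C, counit_C, antiLin_apply, antipodeHom]
        exact (rel p).borel'.kinv hN)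
    (by
      have hN : 2 * 2 * p ≠ 0 := by simpa using NeZero.ne p
      have hC : C p ^ 2 * C p ^ (4 * p - 2) = 1 := by simpa using (rel p).borel'.kL
      have hK : (K p ^ (4 * p - 1)) ^ 2 = K p ^ (4 * p - 2) := by
        simpa using (rel p).borel.kinv_pow_base hN
      rintro _ (rfl | rfl | rfl | rfl)
      · simp [comul_E, counit_E, antiLin_apply, antipodeHom]
        rw [hK, neg_add_cancel]
      · simp [comul_F, counit_F, antiLin_apply, antipodeHom, ← mul_assoc]
        rw [hC, one_mul, neg_add_cancel]
      · simp [comul_K, counit_K, antiLin_apply, antipodeHom]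
        exact (rel p).borel.kinv' hN
      · simp [comul_C, counit_C, antiLin_apply, antipodeHom]
        exact (rel p).borel'.kinv' hN)

lemma antipode_mul (x y : Double p) : HopfAlgebra.antipode ℂ (x * y) =
    HopfAlgebra.antipode ℂ y * HopfAlgebra.antipode ℂ x := antiLin_mul _ _ _
lemma antipode_F : HopfAlgebra.antipode ℂ (F p) = -(C p ^ (4 * p - 2) * F p) :=
  congrArg MulOpposite.unop (lift_F _)
lemma antipode_C : HopfAlgebra.antipode ℂ (C p) = C p ^ (4 * p - 1) :=
  congrArg MulOpposite.unop (lift_C _)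

omit [NeZero p] in
/-- The element `C K` is central. -/
lemma CK_mem_center : C p * K p ∈ Subalgebra.center ℂ (Double p) := by
  rw [Subalgebra.mem_center_iff]
  have hq : qpow p 1 * qpow p (-1) = 1 := by rw [← qpow_add, add_neg_cancel, qpow_zero]
  have hq' : qpow p (-1) * qpow p 1 = 1 := by rw [mul_comm, hq]
  have hkc := (rel p).kc
  intro x
  have hx : x ∈ Algebra.adjoin ℂ {E p, F p, K p, C p} := adjoin p ▸ Algebra.mem_top
  induction hx using Algebra.adjoin_induction with
  | mem x hx =>
    rcases hx with rfl | rfl | rfl | rfl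
    · symm
      rw [mul_assoc, (rel p).borel.ke, mul_smul_comm, ← mul_assoc, (rel p).ce, smul_mul_assoc,
        smul_smul, hq, one_smul, mul_assoc]
    · symm
      rw [mul_assoc, (rel p).kf, mul_smul_comm, ← mul_assoc, (rel p).borel'.ke, smul_mul_assoc,
        smul_smul, hq', one_smul, mul_assoc]
    · rw [← mul_assoc, hkc]
    · rw [mul_assoc, hkc]
  | algebraMap r => exact Algebra.commutes _ _
  | add x y _ _ hx hy => rw [add_mul, mul_add, hx, hy]
  | mul x y _ _ hx hy => rw [mul_assoc, hy, ← mul_assoc, hx, mul_assoc]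

end Double

lemma DBar.K_pow_mul_K (p : ℕ) [NeZero p] : K p ^ (4 * p - 1) * K p = 1 := by
  simpa using (rel p).kinv (by simpa using NeZero.ne p)

lemma DBar.doubleRel (p : ℕ) [NeZero p] :
    DoubleRel p (E p) (F p) (K p) (K p ^ (4 * p - 1)) := by
  have hN : 2 * 2 * p ≠ 0 := by simpa using NeZero.ne p
  have h1 := (rel p).kinv' hN
  have h2 := (rel p).kinv hN
  have h3 := (rel p).kinv_pow_base hN
  have h4 := (rel p).ef
  have h5 := (rel p).k_pow
  simp only [show 2 * 2 * p = 4 * p by ring] at *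
  refine ⟨(rel p).toBorelRel, ⟨?_, (rel p).f_pow, ?_⟩, (rel p).kf, ?_, ?_, ?_⟩
  · rw [DoubleRel.qcomm_inv (rel p).kf h1 h2, smul_smul, ← qpow_add, add_neg_cancel, qpow_zero,
      one_smul]
  · rw [← pow_mul, mul_comm, pow_mul, show 2 * 2 * p = 4 * p by ring, h5, one_pow]
  · rw [DoubleRel.qcomm_inv (rel p).ke h1 h2, smul_smul, ← qpow_add, neg_add_cancel, qpow_zero,
      one_smul]
  · rw [h1, h2]
  · rw [h4, h3]

lemma DoubleRel.map {A A' : Type*} [Ring A] [Algebra ℂ A] [Ring A'] [Algebra ℂ A'] {p : ℕ}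
    {e f k c : A} (h : DoubleRel p e f k c) (g : A →ₐ[ℂ] A') :
    DoubleRel p (g e) (g f) (g k) (g c) where
  borel := ⟨by simpa using congrArg g h.borel.ke, by simpa using congrArg g h.borel.e_pow,
    by simpa using congrArg g h.borel.k_pow⟩
  borel' := ⟨by simpa using congrArg g h.borel'.ke, by simpa using congrArg g h.borel'.e_pow,
    by simpa using congrArg g h.borel'.k_pow⟩
  kf := by simpa using congrArg g h.kf
  ce := by simpa using congrArg g h.ce
  kc := by simpa using congrArg g h.kc
  ef := by simpa using congrArg g h.ef

/-! ### The projection of the double onto `DBar` and its kernel. -/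

namespace Double

variable (p : ℕ) [NeZero p]

lemma C_pow_in_DBar : (DBar.K p ^ (4 * p - 1)) ^ 2 = DBar.K p ^ (4 * p - 2) := by
  simpa using (DBar.rel p).kinv_pow_base (by simpa using NeZero.ne p)

/-- The projection of the double onto `DBar`. -/
def toDBar : Double p →ₐc[ℂ] DBar p :=
  .ofAlgHom (lift (DBar.doubleRel p))
    (hom_ext (by simp [DBar.counit_E, counit_E]) (by simp [DBar.counit_F, counit_F])
      (by simp [DBar.counit_K, counit_K]) (by simp [DBar.counit_K, counit_C]))
    (hom_ext (by simp [DBar.comul_E, comul_E])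
      (by simp [DBar.comul_F, comul_F, C_pow_in_DBar]) (by simp [DBar.comul_K, comul_K])
      (by simp [DBar.comul_K, comul_C, Algebra.TensorProduct.tmul_pow]))

lemma toDBar_E : toDBar p (E p) = DBar.E p := lift_E _
lemma toDBar_F : toDBar p (F p) = DBar.F p := lift_F _
lemma toDBar_K : toDBar p (K p) = DBar.K p := lift_K _
lemma toDBar_C : toDBar p (C p) = DBar.K p ^ (4 * p - 1) := lift_C _

lemma toDBar_surjective : Function.Surjective (toDBar p) := by
  intro x
  have hx : x ∈ Algebra.adjoin ℂ {DBar.E p, DBar.F p, DBar.K p} := DBar.adjoin p ▸ Algebra.mem_top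
  induction hx using Algebra.adjoin_induction with
  | mem x hx =>
    rcases hx with rfl | rfl | rfl
    exacts [⟨_, toDBar_E p⟩, ⟨_, toDBar_F p⟩, ⟨_, toDBar_K p⟩]
  | algebraMap r => exact ⟨algebraMap ℂ _ r, AlgHomClass.commutes (toDBar p) r⟩
  | add x y _ _ hx hy =>
    obtain ⟨a, rfl⟩ := hx
    obtain ⟨b, rfl⟩ := hy
    exact ⟨a + b, map_add _ _ _⟩
  | mul x y _ _ hx hy =>
    obtain ⟨a, rfl⟩ := hx
    obtain ⟨b, rfl⟩ := hy
    exact ⟨a * b, map_mul _ _ _⟩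

/-- In the quotient by the ideal the images of `C` and `K` are mutually inverse, so the generators
satisfy the relations of `DBar` and the quotient map factors through the projection. -/
lemma toDBar_eq_zero_iff (d : Double p) :
    toDBar p d = 0 ↔ d ∈ TwoSidedIdeal.span {C p * K p - 1} := by
  set I := TwoSidedIdeal.span {C p * K p - 1} with hI
  constructor
  · intro h
    set g := I.ringCon.mkₐ (α := ℂ)
    have hg : ∀ x, g x = 0 ↔ x ∈ I := fun x => by
      have := TwoSidedIdeal.mem_ker I.ringCon.mk' (x := x)
      rw [TwoSidedIdeal.ker_ringCon_mk'] at this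
      exact this.symm
    have hCK : g (C p) * g (K p) = 1 := by
      have h0 : g (C p * K p - 1) = 0 := (hg _).2 (TwoSidedIdeal.subset_span rfl)
      rwa [map_sub, map_mul, map_one, sub_eq_zero] at h0
    have hrel := ((rel p).map g).toSl2 hCK
    have hc : g (C p) = g (K p) ^ (4 * p - 1) :=
      left_inv_eq_right_inv hCK (by
        simpa [show 2 * 2 * p = 4 * p by ring] using hrel.kinv' (by simpa using NeZero.ne p))
    have e : (DBar.lift hrel).comp (lift (DBar.doubleRel p)) = g :=
      hom_ext (by simp) (by simp) (by simp) (by simp [hc])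
    rw [← hg, ← e]
    exact (congrArg (DBar.lift hrel) h).trans (map_zero _)
  · intro h
    rw [← TwoSidedIdeal.mem_ker (toDBar p)]
    refine (TwoSidedIdeal.span_le.2 ?_) h
    rintro _ rfl
    rw [SetLike.mem_coe, TwoSidedIdeal.mem_ker, map_sub, map_mul, map_one, toDBar_C, toDBar_K,
      DBar.K_pow_mul_K, sub_self]

end Double

/-! ### The antipode of `B` and the pairing. -/

namespace B

open Coalgebra HopfAlgebra WithConv

variable {p : ℕ} [NeZero p]

instance : Module.Finite ℂ (B p) :=
  Module.finite_def.2 (span_mon p ▸ Submodule.fg_span (Set.finite_range _))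

lemma antipode_mul' (x y : B p) : antipode ℂ (x * y) = antipode ℂ y * antipode ℂ x :=
  antiLin_mul _ _ _

lemma antipode_pow (x : B p) (n : ℕ) : antipode ℂ (x ^ n) = antipode ℂ x ^ n := by
  induction n with
  | zero => rw [pow_zero, pow_zero, antipode_one]
  | succ n ih => rw [pow_succ, antipode_mul', ih, pow_succ']

/-- The scalar `s` is left unspecified: it depends on `n` only, and the pairing is diagonal in `n`,
so it cancels wherever this lemma is used. -/
lemma antipode_mon (n : ℕ) : ∃ s : ℂ, ∀ i, antipode ℂ (mon p n i) =
    (s * qpow p (-(n * i))) • mon p n ((4 * p - 1) * i + (4 * p - 2) * n) := by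
  have hc : ∀ n, ∃ s : ℂ, (-(E p * K p ^ (4 * p - 2))) ^ n = s • mon p n ((4 * p - 2) * n) := by
    intro n
    induction n with
    | zero => exact ⟨1, by simp [mon]⟩
    | succ n ih =>
      obtain ⟨s, hs⟩ := ih
      refine ⟨-(s * qpow p ((4 * p - 2) * n : ℕ)), ?_⟩
      rw [pow_succ, hs, smul_mul_assoc, mul_neg, ← mul_assoc, mon_mul_E, smul_mul_assoc, mon,
        mul_assoc, ← pow_add, neg_smul, smul_neg, smul_smul, mon]
      congr 4
  obtain ⟨s, hs⟩ := hc n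
  refine ⟨s, fun i => ?_⟩
  have hq : qpow p (((4 * p - 1) * i : ℕ) * n) = qpow p (-(n * i)) := by
    have h1 : 1 ≤ 4 * p := by have := NeZero.pos p; omega
    have h2 := qpow_two_p_int p (2 * i * n : ℕ)
    rw [← mul_one (qpow p (-(n * i))), ← h2, ← qpow_add]
    congr 1; push_cast [h1]; ring
  have hK : ∀ a : ℕ, K p ^ a * E p ^ n = qpow p (a * n) • (E p ^ n * K p ^ a) := by
    intro a
    have := qcomm_pow_left (qcomm_pow (rel p).ke n) a
    rw [this, qpow_pow, qpow_pow]; congr 2; ring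
  rw [mon, antipode_mul', antipode_pow, antipode_pow, antipode_E, antipode_K, hs, ← pow_mul,
    mul_smul_comm, mon, ← mul_assoc, hK, hq, smul_mul_assoc, mul_assoc, ← pow_add, smul_smul, mon]

lemma toDualLin_antipode (hp : 2 ≤ p) (x y : B p) :
    toDualLin hp (antipode ℂ x) y = toDualLin hp x (antipode ℂ y) := by
  have : toDualLin hp ∘ₗ antipode ℂ = (toDualLin hp).compl₂ (antipode ℂ) := by
    refine linearMap_ext fun n i => linearMap_ext fun m j => ?_
    obtain ⟨s, hs⟩ := antipode_mon (p := p) n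
    rw [LinearMap.comp_apply, LinearMap.compl₂_apply, hs, map_smul, LinearMap.smul_apply,
      toDualLin_mon]
    by_cases h : m = n
    · subst h
      have h1 : 1 ≤ 4 * p := by have := NeZero.pos p; omega
      have h2 : 2 ≤ 4 * p := by have := NeZero.pos p; omega
      have h3 := qpow_two_p_int p (m * (j - i))
      have e : qpow p (-(m * i)) * qpow p (-(m * j) - m * ((4 * p - 1) * i + (4 * p - 2) * m : ℕ) -
          ((4 * p - 1) * i + (4 * p - 2) * m : ℕ) * j / 2) =
          qpow p (-(m * j)) * qpow p (-(m * ((4 * p - 1) * j + (4 * p - 2) * m : ℕ)) - m * i -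
          i * ((4 * p - 1) * j + (4 * p - 2) * m : ℕ) / 2) := by
        rw [← qpow_add, ← qpow_add, ← mul_one (qpow p (_ + (_ - _ - i * _ / 2))), ← h3, ← qpow_add]
        congr 1; push_cast [h1, h2]; ring
      rw [hs, map_smul, toDualLin_mon, if_pos rfl, if_pos rfl, smul_eq_mul, smul_eq_mul]
      linear_combination (s * phiCoeff p m) * e
    · obtain ⟨s', hs'⟩ := antipode_mon (p := p) m
      rw [hs', map_smul, toDualLin_mon, if_neg h, if_neg h, smul_zero, smul_zero]
  exact LinearMap.congr_fun (LinearMap.congr_fun this x) y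

end B

/-! ### The two halves of the double and their Hopf structures. -/

namespace Double

open Coalgebra HopfAlgebra WithConv

variable (p : ℕ) [NeZero p]

/-- The inclusion of `B` in the double. -/
def inc : B p →ₐc[ℂ] Double p :=
  .ofAlgHom (B.lift (rel p).borel)
    (B.hom_ext (by simp [B.counit_E, counit_E]) (by simp [B.counit_K, counit_K]))
    (B.hom_ext (by simp [B.comul_E, comul_E]) (by simp [B.comul_K, comul_K]))

lemma inc_E : inc p (B.E p) = E p := B.lift_E _
lemma inc_K : inc p (B.K p) = K p := B.lift_K _

/-- The inclusion of the dual of `B` in the double, on `B` itself. -/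
def dualHom (p : ℕ) : B p →ₐ[ℂ] Double p := B.lift (rel p).borel'

omit [NeZero p] in
lemma dualHom_E : dualHom p (B.E p) = F p := B.lift_E _
omit [NeZero p] in
lemma dualHom_K : dualHom p (B.K p) = C p := B.lift_K _

variable {p}

/-- The inclusion of the dual of `B` in the double. -/
def dualInc (hp : 2 ≤ p) : Module.Dual ℂ (B p) →ₗ[ℂ] Double p :=
  (dualHom p).toLinearMap ∘ₗ (B.dualEquiv hp).symm.toLinearMap

lemma dualInc_toDualLin (hp : 2 ≤ p) (b : B p) : dualInc hp (B.toDualLin hp b) = dualHom p b := by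
  rw [dualInc, ← B.dualEquiv_apply]
  exact congrArg (dualHom p) ((B.dualEquiv hp).symm_apply_apply b)

lemma exists_toDualLin (hp : 2 ≤ p) (β : Module.Dual ℂ (B p)) : ∃ b, B.toDualLin hp b = β :=
  (B.dualEquiv hp).surjective β

lemma dualInc_counit (hp : 2 ≤ p) : dualInc hp (counit (R := ℂ) (A := B p)) = 1 := by
  rw [← B.toDualLin_one hp, dualInc_toDualLin, map_one]

lemma dualInc_mul (hp : 2 ≤ p) (β γ : Module.Dual ℂ (B p)) :
    dualInc hp (toConv β * toConv γ).ofConv = dualInc hp β * dualInc hp γ := by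
  obtain ⟨a, rfl⟩ := exists_toDualLin hp β
  obtain ⟨b, rfl⟩ := exists_toDualLin hp γ
  have : (toConv (B.toDualLin hp a) * toConv (B.toDualLin hp b)).ofConv =
      B.toDualLin hp (a * b) := by
    rw [B.toDualLin_apply, B.toDualLin_apply, B.toDualLin_apply, map_mul]
  rw [this, dualInc_toDualLin, dualInc_toDualLin, dualInc_toDualLin, map_mul]

lemma counit_dualInc (hp : 2 ≤ p) (β : Module.Dual ℂ (B p)) :
    counit (R := ℂ) (dualInc hp β) = β 1 := by
  obtain ⟨b, rfl⟩ := exists_toDualLin hp β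
  have : (Bialgebra.counitAlgHom ℂ (Double p)).comp (dualHom p) =
      Bialgebra.counitAlgHom ℂ (B p) :=
    B.hom_ext (by simp [dualHom_E, counit_F, B.counit_E]) (by simp [dualHom_K, counit_C, B.counit_K])
  rw [dualInc_toDualLin, B.toDualLin_comm, B.toDualLin_one]
  exact DFunLike.congr_fun this b

/-- Both sides are algebra maps in `b`, so generators suffice. The flip reflects the opposite
coproduct ⟨Δβ, x ⊗ y⟩ = ⟨β, yx⟩ on the dual. -/
lemma comul_dualHom (b : B p) : comul (R := ℂ) (dualHom p b) =
    TensorProduct.map (dualHom p).toLinearMap (dualHom p).toLinearMap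
      (TensorProduct.comm ℂ _ _ (comul (R := ℂ) b)) := by
  have : (Bialgebra.comulAlgHom ℂ (Double p)).comp (dualHom p) =
      (Algebra.TensorProduct.map (dualHom p) (dualHom p)).comp
        ((Algebra.TensorProduct.comm ℂ (B p) (B p)).toAlgHom.comp
          (Bialgebra.comulAlgHom ℂ (B p))) :=
    B.hom_ext
      (by simp [dualHom_E, dualHom_K, comul_F, B.comul_E, add_comm])
      (by simp [dualHom_K, comul_C, B.comul_K])
  exact DFunLike.congr_fun this b

/-- In finite dimension the condition on `t` determines it. For β paired from b, symmetry of the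
pairing shows that the flipped coproduct of b meets the condition. -/
lemma comul_dualInc (hp : 2 ≤ p) (β : Module.Dual ℂ (B p))
    (t : Module.Dual ℂ (B p) ⊗[ℂ] Module.Dual ℂ (B p))
    (ht : ∀ x y : B p, TensorProduct.dualDistrib ℂ (B p) (B p) t (x ⊗ₜ[ℂ] y) = β (y * x)) :
    comul (R := ℂ) (dualInc hp β) = TensorProduct.map (dualInc hp) (dualInc hp) t := by
  obtain ⟨b, rfl⟩ := exists_toDualLin hp β
  have key : t = TensorProduct.map (B.toDualLin hp) (B.toDualLin hp)
      (TensorProduct.comm ℂ _ _ (comul (R := ℂ) b)) := by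
    refine (TensorProduct.dualDistribEquiv ℂ (B p) (B p)).injective ?_
    refine TensorProduct.ext' fun x y => (ht x y).trans ?_
    rw [B.toDualLin_comm, B.toDualLin_mul]
    change _ = TensorProduct.dualDistrib ℂ (B p) (B p) _ _
    induction comul (R := ℂ) b with
    | zero => simp
    | add u v hu hv => simp only [map_add, hu, hv, LinearMap.add_apply]
    | tmul u v => simp [B.toDualLin_comm hp x, B.toDualLin_comm hp y, mul_comm]
  rw [key, dualInc_toDualLin, comul_dualHom]
  induction comul (R := ℂ) b with
  | zero => simp
  | add u v hu hv => simp only [map_add, hu, hv]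
  | tmul u v => simp [dualInc_toDualLin]

/-- On the dual half the antipode of the double is the inverse of that of `B`; stated without the
inverse, since bijectivity of the antipode is deduced from it. -/
lemma antipode_dualHom_antipode (b : B p) :
    antipode ℂ (dualHom p (antipode ℂ b)) = dualHom p b := by
  have hN : 2 * 2 * p ≠ 0 := by simpa using NeZero.ne p
  have hS : ∀ x : Double p, ∀ n, antipode ℂ (x ^ n) = antipode ℂ x ^ n := by
    intro x n
    induction n with
    | zero => rw [pow_zero, pow_zero, antipode_one]
    | succ n ih => rw [pow_succ, antipode_mul, ih, pow_succ']
  have hb : b ∈ Algebra.adjoin ℂ {B.E p, B.K p} := B.adjoin p ▸ Algebra.mem_top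
  induction hb using Algebra.adjoin_induction with
  | mem x hx =>
    rcases hx with rfl | rfl
    · have h1 := (rel p).borel'.kinv_pow_compl hN
      have h2 := (rel p).borel'.kL
      simp only [show 2 * 2 * p = 4 * p by ring] at h1 h2
      rw [B.antipode_E, map_neg, map_mul, map_pow, dualHom_E, dualHom_K, map_neg, antipode_mul, hS,
        antipode_F, antipode_C, h1, mul_neg, neg_neg, ← mul_assoc, h2, one_mul]
    · have h1 := (rel p).borel'.kinv_pow hN (4 * p - 1)
      have h3 := (rel p).borel'.k_pow
      simp only [show 2 * 2 * p = 4 * p by ring] at h1 h3 hN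
      rw [B.antipode_K, map_pow, dualHom_K, hS, antipode_C]
      exact left_inv_eq_right_inv h1 (by rw [← pow_succ, Nat.sub_add_cancel (by omega), h3])
  | algebraMap r =>
    rw [Algebra.algebraMap_eq_smul_one, map_smul, antipode_one, map_smul, map_one, map_smul,
      antipode_one]
  | add x y _ _ hx hy => rw [map_add, map_add, map_add, hx, hy, map_add]
  | mul x y _ _ hx hy => rw [B.antipode_mul', map_mul, antipode_mul, hx, hy, map_mul]

end Double

namespace Double

open Coalgebra HopfAlgebra WithConv

variable {p : ℕ} [NeZero p]

/-! ### The Poincaré–Birkhoff–Witt basis of the double -/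

/-- The canonical map from `B^* ⊗ B` to the double. -/
def pbwMap (hp : 2 ≤ p) : Module.Dual ℂ (B p) ⊗[ℂ] B p →ₗ[ℂ] Double p :=
  TensorProduct.lift ((LinearMap.mul ℂ (Double p)).compl₁₂ (dualInc hp) (inc p : B p →ₗ[ℂ] Double p))

lemma pbwMap_tmul (hp : 2 ≤ p) (β : Module.Dual ℂ (B p)) (x : B p) :
    pbwMap hp (β ⊗ₜ x) = dualInc hp β * inc p x := rfl

open Verma in
-- Over the group algebra of (ℤ/4p)² the weights of k and κ are independent, so the exponents of all
-- four generators can be recovered from the image of the generating vector.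
lemma pbwMap_injective (hp : 2 ≤ p) : Function.Injective (pbwMap hp) := by
  let G := ZMod (4 * p) × ZMod (4 * p)
  have hs : ∀ x : G, (AddMonoidAlgebra.single x (1 : ℂ)) ^ (4 * p) = 1 := fun x => by
    rw [AddMonoidAlgebra.single_pow, one_pow, AddMonoidAlgebra.one_def]
    congr 1
    refine Prod.ext ?_ ?_
    · rw [Prod.smul_fst, nsmul_eq_mul, ZMod.natCast_self, zero_mul]; rfl
    · rw [Prod.smul_snd, nsmul_eq_mul, ZMod.natCast_self, zero_mul]; rfl
  let V := lift (Verma.doubleRel (p := p) hp (hs (1, 0)) (hs (0, 1)))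
  let b := ((B.pbw (p := p) hp).map (B.dualEquiv hp)).tensorProduct (B.pbw (p := p) hp)
  refine injective_of_linearIndependent_comp b ?_
  refine LinearIndependent.of_comp V.toLinearMap ?_
  have key : ∀ i j : (Fin p × Fin (4 * p)) × (Fin p × Fin (4 * p)),
      coeffAt (i.1.1, i.2.1) ((((i.2.2 : ℕ) : ZMod (4 * p)), ((i.1.2 : ℕ) : ZMod (4 * p))) : G)
        (V (pbwMap hp (b j))) = if i = j then qpow p (-((i.1.2 : ℕ) * (i.2.1 : ℕ))) else 0 := by
    rintro ⟨⟨m, a⟩, ⟨n, c⟩⟩ ⟨⟨m', a'⟩, ⟨n', c'⟩⟩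
    have h : V (pbwMap hp (b ((m', a'), (n', c')))) =
        opF (AddMonoidAlgebra ℂ G) p ^ (m' : ℕ) * opK p (-1) (.single (0, 1) 1) ^ (a' : ℕ) *
          (opE p (.single (1, 0) 1) (.single (0, 1) 1) ^ (n' : ℕ) *
            opK p 1 (.single (1, 0) 1) ^ (c' : ℕ)) := by
      rw [Module.Basis.tensorProduct_apply, pbwMap_tmul, Module.Basis.map_apply, B.dualEquiv_apply,
        dualInc_toDualLin, B.pbw_apply, B.pbw_apply, B.mon, B.mon]
      simp [V, dualHom_E, dualHom_K, inc_E, inc_K]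
    rw [h, coeffAt_monomial _ _ _ _ m'.2 n'.2]
    by_cases hij : m = m' ∧ a = a' ∧ n = n' ∧ c = c'
    · obtain ⟨rfl, rfl, rfl, rfl⟩ := hij
      simp
    · rw [if_neg, if_neg]
      · simp only [Prod.mk.injEq]
        tauto
      · rintro ⟨h1, h2, h3⟩
        have h4 := congrArg Prod.fst h3
        have h5 := congrArg Prod.snd h3
        simp only [Prod.fst_add, Prod.smul_fst, smul_zero, zero_add, nsmul_one, Prod.snd_add,
          Prod.smul_snd, add_zero] at h4 h5
        rw [ZMod.natCast_eq_natCast_iff', Nat.mod_eq_of_lt c.2, Nat.mod_eq_of_lt c'.2] at h4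
        rw [ZMod.natCast_eq_natCast_iff', Nat.mod_eq_of_lt a.2, Nat.mod_eq_of_lt a'.2] at h5
        exact hij ⟨Fin.ext h1, Fin.ext h5.symm, Fin.ext h2, Fin.ext h4.symm⟩
  refine linearIndependent_of_dual (fun i =>
      coeffAt (i.1.1, i.2.1) ((((i.2.2 : ℕ) : ZMod (4 * p)), ((i.1.2 : ℕ) : ZMod (4 * p))) : G))
      ?_ ?_
  · intro i j hij
    exact (key i j).trans (if_neg hij)
  · intro i
    exact ((key i i).trans (if_pos rfl)).trans_ne (qpow_ne_zero _ _)

lemma dualHom_injective (hp : 2 ≤ p) : Function.Injective (dualHom p) := by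
  rw [injective_iff_map_eq_zero]
  intro b hb
  have h : pbwMap hp (B.toDualLin hp b ⊗ₜ 1) = 0 := by
    rw [pbwMap_tmul, dualInc_toDualLin, hb, zero_mul]
  have h1 := (map_eq_zero_iff _ (pbwMap_injective hp)).1 h
  have h2 := congrArg (TensorProduct.rid ℂ _) (congrArg
    ((counit (R := ℂ) (A := B p)).lTensor _) h1)
  rw [LinearMap.lTensor_tmul, TensorProduct.rid_tmul, Bialgebra.counit_one, one_smul, map_zero,
    map_zero] at h2
  exact (map_eq_zero_iff _ (B.toDualLin_injective hp)).1 h2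

end Double

namespace B

open HopfAlgebra

variable {p : ℕ} [NeZero p]

lemma antipode_injective (hp : 2 ≤ p) : Function.Injective (antipode ℂ : B p →ₗ[ℂ] B p) := by
  intro x y h
  apply Double.dualHom_injective hp
  rw [← Double.antipode_dualHom_antipode x, h, Double.antipode_dualHom_antipode]

/-- `antipodeInv` is a `Ring.inverse`, which is zero on non-units, so this is what makes it a
genuine inverse. In finite dimension injectivity suffices. -/
lemma isUnit_antipode (hp : 2 ≤ p) : IsUnit (antipode ℂ : Module.End ℂ (B p)) :=
  (LinearMap.isUnit_iff_ker_eq_bot _).2 (LinearMap.ker_eq_bot.2 (antipode_injective hp))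

lemma antipode_antipodeInv (hp : 2 ≤ p) (x : B p) : antipode ℂ (antipodeInv (B p) x) = x :=
  LinearMap.congr_fun (Ring.mul_inverse_cancel _ (isUnit_antipode hp)) x

lemma sum_antipodeInv_mul (hp : 2 ≤ p) (x : B p) : LinearMap.mul' ℂ (B p)
    ((antipodeInv (B p)).rTensor (B p) (TensorProduct.comm ℂ _ _ (Coalgebra.comul (R := ℂ) x))) =
      algebraMap ℂ (B p) (Coalgebra.counit (R := ℂ) x) := by
  apply antipode_injective hp
  rw [Algebra.algebraMap_eq_smul_one, map_smul, antipode_one, ← Algebra.algebraMap_eq_smul_one,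
    ← mul_antipode_rTensor_comul_apply]
  induction Coalgebra.comul (R := ℂ) x with
  | zero => simp
  | add u v hu hv => simp only [map_add, hu, hv]
  | tmul u v => simp [antipode_mul', antipode_antipodeInv hp]

end B

namespace Double

open Coalgebra HopfAlgebra WithConv

variable {p : ℕ} [NeZero p]

lemma antipode_dualInc (hp : 2 ≤ p) (β : Module.Dual ℂ (B p)) :
    antipode ℂ (dualInc hp β) = dualInc hp (β ∘ₗ antipodeInv (B p)) := by
  obtain ⟨b, rfl⟩ := exists_toDualLin hp β
  have h : B.toDualLin hp b ∘ₗ antipodeInv (B p) = B.toDualLin hp (antipodeInv (B p) b) := by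
    ext x
    conv_lhs => rw [← B.antipode_antipodeInv hp b]
    rw [LinearMap.comp_apply, B.toDualLin_antipode, B.antipode_antipodeInv hp]
  rw [h, dualInc_toDualLin, dualInc_toDualLin]
  conv_lhs => rw [← B.antipode_antipodeInv hp b]
  exact antipode_dualHom_antipode _

/-! ### The cross relation -/

/-- `a ⊗ b ↦ a β(b ?)`. -/
def leftForm (hp : 2 ≤ p) (β : Module.Dual ℂ (B p)) : B p ⊗[ℂ] B p →ₗ[ℂ] Double p :=
  LinearMap.mul' ℂ _ ∘ₗ TensorProduct.map (inc p : B p →ₗ[ℂ] Double p)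
    (dualInc hp ∘ₗ (LinearMap.mul ℂ (B p)).compr₂ β)

/-- `a ⊗ b ↦ β(? a) b`. -/
def rightForm (hp : 2 ≤ p) (β : Module.Dual ℂ (B p)) : B p ⊗[ℂ] B p →ₗ[ℂ] Double p :=
  LinearMap.mul' ℂ _ ∘ₗ TensorProduct.map (dualInc hp ∘ₗ (LinearMap.mul ℂ (B p)).flip.compr₂ β)
    (inc p : B p →ₗ[ℂ] Double p)

lemma leftForm_tmul (hp : 2 ≤ p) (β : Module.Dual ℂ (B p)) (a b : B p) :
    leftForm hp β (a ⊗ₜ b) = inc p a * dualInc hp (β ∘ₗ LinearMap.mulLeft ℂ b) := rfl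

lemma rightForm_tmul (hp : 2 ≤ p) (β : Module.Dual ℂ (B p)) (a b : B p) :
    rightForm hp β (a ⊗ₜ b) = dualInc hp (β ∘ₗ LinearMap.mulRight ℂ a) * inc p b := rfl

/-- The relation is multiplicative: for a product xy it is applied to y with β(x'' ?), then to x
with β(? y'), the left and right translations commuting with each other. -/
lemma leftForm_comul_mul (hp : 2 ≤ p) {x y : B p}
    (hx : ∀ β, leftForm hp β (comul (R := ℂ) x) = rightForm hp β (comul (R := ℂ) x))
    (hy : ∀ β, leftForm hp β (comul (R := ℂ) y) = rightForm hp β (comul (R := ℂ) y))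
    (β : Module.Dual ℂ (B p)) :
    leftForm hp β (comul (R := ℂ) (x * y)) = rightForm hp β (comul (R := ℂ) (x * y)) := by
  let r := Coalgebra.Repr.arbitrary ℂ x
  let s := Coalgebra.Repr.arbitrary ℂ y
  have hx' : ∀ β, ∑ k ∈ r.index, inc p (r.left k) * dualInc hp (β ∘ₗ LinearMap.mulLeft ℂ (r.right k))
      = ∑ k ∈ r.index, dualInc hp (β ∘ₗ LinearMap.mulRight ℂ (r.left k)) * inc p (r.right k) :=
    fun β => by
      have := hx β
      rwa [← r.eq, map_sum, map_sum] at this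
  have hy' : ∀ β, ∑ l ∈ s.index, inc p (s.left l) * dualInc hp (β ∘ₗ LinearMap.mulLeft ℂ (s.right l))
      = ∑ l ∈ s.index, dualInc hp (β ∘ₗ LinearMap.mulRight ℂ (s.left l)) * inc p (s.right l) :=
    fun β => by
      have := hy β
      rwa [← s.eq, map_sum, map_sum] at this
  have hxy : comul (R := ℂ) (x * y) = ∑ k ∈ r.index, ∑ l ∈ s.index,
      (r.left k * s.left l) ⊗ₜ[ℂ] (r.right k * s.right l) := by
    rw [Bialgebra.comul_mul, ← r.eq, ← s.eq, Finset.sum_mul_sum]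
    simp only [Algebra.TensorProduct.tmul_mul_tmul]
  have hc : ∀ a b : B p, LinearMap.mulLeft ℂ a ∘ₗ LinearMap.mulRight ℂ b =
      LinearMap.mulRight ℂ b ∘ₗ LinearMap.mulLeft ℂ a := fun a b =>
    (LinearMap.commute_mulLeft_right (R := ℂ) a b).eq
  simp only [hxy, map_sum, leftForm_tmul, rightForm_tmul, map_mul]
  calc _ = ∑ k ∈ r.index, inc p (r.left k) * ∑ l ∈ s.index, inc p (s.left l) *
        dualInc hp ((β ∘ₗ LinearMap.mulLeft ℂ (r.right k)) ∘ₗ LinearMap.mulLeft ℂ (s.right l)) := by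
        simp only [Finset.mul_sum, mul_assoc, LinearMap.mulLeft_mul, LinearMap.comp_assoc]
    _ = ∑ l ∈ s.index, (∑ k ∈ r.index, inc p (r.left k) * dualInc hp
          ((β ∘ₗ LinearMap.mulRight ℂ (s.left l)) ∘ₗ LinearMap.mulLeft ℂ (r.right k))) *
            inc p (s.right l) := by
        simp only [hy', Finset.mul_sum, Finset.sum_mul]
        rw [Finset.sum_comm]
        simp only [mul_assoc, LinearMap.comp_assoc, hc]
    _ = _ := by
        simp only [hx', Finset.sum_mul]
        rw [Finset.sum_comm]
        simp only [mul_assoc, LinearMap.mulRight_mul, LinearMap.comp_assoc]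

lemma dual_ext {f g : Module.Dual ℂ (B p) →ₗ[ℂ] Double p} (hp : 2 ≤ p)
    (h : ∀ n i, f (B.toDualLin hp (B.mon p n i)) = g (B.toDualLin hp (B.mon p n i))) : f = g := by
  have : f ∘ₗ B.toDualLin hp = g ∘ₗ B.toDualLin hp := B.linearMap_ext h
  ext β
  obtain ⟨b, rfl⟩ := exists_toDualLin hp β
  exact LinearMap.congr_fun this b

lemma toDualLin_mulLeft_K (hp : 2 ≤ p) (n i : ℕ) : B.toDualLin hp (B.mon p n i) ∘ₗ
    LinearMap.mulLeft ℂ (B.K p) = qpow p (-i / 2) • B.toDualLin hp (B.mon p n i) := by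
  refine B.linearMap_ext fun m j => ?_
  rw [LinearMap.comp_apply, LinearMap.mulLeft_apply, B.K_mul_mon, map_smul, LinearMap.smul_apply,
    B.toDualLin_mon, B.toDualLin_mon]
  by_cases h : m = n
  · subst h
    rw [if_pos rfl, if_pos rfl, smul_eq_mul, smul_eq_mul, mul_left_comm, ← qpow_add, mul_left_comm,
      ← qpow_add]
    congr 2; push_cast; ring
  · rw [if_neg h, if_neg h, smul_zero, smul_zero]

lemma toDualLin_mulRight_K (hp : 2 ≤ p) (n i : ℕ) : B.toDualLin hp (B.mon p n i) ∘ₗ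
    LinearMap.mulRight ℂ (B.K p) = qpow p (-n - i / 2) • B.toDualLin hp (B.mon p n i) := by
  refine B.linearMap_ext fun m j => ?_
  rw [LinearMap.comp_apply, LinearMap.mulRight_apply, B.mon_mul_K, LinearMap.smul_apply,
    B.toDualLin_mon, B.toDualLin_mon]
  by_cases h : m = n
  · subst h
    rw [if_pos rfl, if_pos rfl, smul_eq_mul, mul_left_comm, ← qpow_add]
    congr 2; push_cast; ring
  · rw [if_neg h, if_neg h, smul_zero]

lemma toDualLin_mulLeft_E_zero (hp : 2 ≤ p) (i : ℕ) :
    B.toDualLin hp (B.mon p 0 i) ∘ₗ LinearMap.mulLeft ℂ (B.E p) = 0 := by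
  refine B.linearMap_ext fun m j => ?_
  rw [LinearMap.comp_apply, LinearMap.mulLeft_apply, B.E_mul_mon, B.toDualLin_mon,
    if_neg (Nat.succ_ne_zero m), LinearMap.zero_apply]

lemma toDualLin_mulRight_E_zero (hp : 2 ≤ p) (i : ℕ) :
    B.toDualLin hp (B.mon p 0 i) ∘ₗ LinearMap.mulRight ℂ (B.E p) = 0 := by
  refine B.linearMap_ext fun m j => ?_
  rw [LinearMap.comp_apply, LinearMap.mulRight_apply, B.mon_mul_E, map_smul, B.toDualLin_mon,
    if_neg (Nat.succ_ne_zero m), LinearMap.zero_apply, smul_zero]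

lemma toDualLin_mulLeft_E (hp : 2 ≤ p) (n i : ℕ) :
    B.toDualLin hp (B.mon p (n + 1) i) ∘ₗ LinearMap.mulLeft ℂ (B.E p) =
      ((qpow p 1 - qpow p (-1))⁻¹ * qInt p (n + 1 : ℕ) * qpow p (n - i)) •
        B.toDualLin hp (B.mon p n (i + 2)) := by
  refine B.linearMap_ext fun m j => ?_
  rw [LinearMap.comp_apply, LinearMap.mulLeft_apply, B.E_mul_mon, LinearMap.smul_apply,
    B.toDualLin_mon, B.toDualLin_mon]
  by_cases h : m = n
  · subst h
    rw [if_pos rfl, if_pos rfl, smul_eq_mul, B.phiCoeff]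
    have e : qpow p (-m) * qpow p (-((m + 1 : ℕ) * j) - (m + 1 : ℕ) * i - i * j / 2) =
        qpow p (m - i) * qpow p (-(m * j) - m * (i + 2 : ℕ) - (i + 2 : ℕ) * j / 2) := by
      rw [← qpow_add, ← qpow_add]
      congr 1; push_cast; ring
    linear_combination (B.phiCoeff p m * (qpow p 1 - qpow p (-1))⁻¹ * qInt p (m + 1 : ℕ)) * e
  · rw [if_neg (by omega), if_neg h, smul_zero]

lemma toDualLin_mulRight_E (hp : 2 ≤ p) (n i : ℕ) :
    B.toDualLin hp (B.mon p (n + 1) i) ∘ₗ LinearMap.mulRight ℂ (B.E p) =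
      ((qpow p 1 - qpow p (-1))⁻¹ * qInt p (n + 1 : ℕ) * qpow p (-n - i)) •
        B.toDualLin hp (B.mon p n i) := by
  refine B.linearMap_ext fun m j => ?_
  rw [LinearMap.comp_apply, LinearMap.mulRight_apply, B.mon_mul_E, LinearMap.smul_apply, map_smul,
    B.toDualLin_mon, B.toDualLin_mon]
  by_cases h : m = n
  · subst h
    rw [if_pos rfl, if_pos rfl, smul_eq_mul, smul_eq_mul, B.phiCoeff]
    have e : qpow p j * qpow p (-m) * qpow p (-((m + 1 : ℕ) * j) - (m + 1 : ℕ) * i - i * j / 2) =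
        qpow p (-m - i) * qpow p (-(m * j) - m * i - i * j / 2) := by
      rw [← qpow_add, ← qpow_add, ← qpow_add]
      congr 1; push_cast; ring
    linear_combination (B.phiCoeff p m * (qpow p 1 - qpow p (-1))⁻¹ * qInt p (m + 1 : ℕ)) * e
  · rw [if_neg (by omega), if_neg h, smul_zero, smul_zero]

lemma dualInc_mon (hp : 2 ≤ p) (n i : ℕ) :
    dualInc hp (B.toDualLin hp (B.mon p n i)) = F p ^ n * C p ^ i := by
  rw [dualInc_toDualLin, B.mon, map_mul, map_pow, map_pow, dualHom_E, dualHom_K]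

lemma leftForm_comul_K (hp : 2 ≤ p) (β : Module.Dual ℂ (B p)) :
    leftForm hp β (comul (R := ℂ) (B.K p)) = rightForm hp β (comul (R := ℂ) (B.K p)) := by
  have : LinearMap.mulLeft ℂ (K p) ∘ₗ dualInc hp ∘ₗ (LinearMap.mulLeft ℂ (B.K p)).dualMap =
      LinearMap.mulRight ℂ (K p) ∘ₗ dualInc hp ∘ₗ (LinearMap.mulRight ℂ (B.K p)).dualMap := by
    refine dual_ext hp fun n i => ?_
    change K p * dualInc hp (B.toDualLin hp (B.mon p n i) ∘ₗ LinearMap.mulLeft ℂ (B.K p)) =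
      dualInc hp (B.toDualLin hp (B.mon p n i) ∘ₗ LinearMap.mulRight ℂ (B.K p)) * K p
    rw [toDualLin_mulLeft_K, toDualLin_mulRight_K, map_smul, map_smul, dualInc_mon, mul_smul_comm,
      ← mul_assoc, qcomm_pow (rel p).kf, smul_mul_assoc, smul_mul_assoc, smul_smul, mul_assoc,
      mul_assoc, qpow_pow, ← qpow_add, (show Commute (K p) (C p) from (rel p).kc).pow_right i]
    congr 2; ring
  rw [B.comul_K, leftForm_tmul, rightForm_tmul, inc_K]
  exact LinearMap.congr_fun this β

/-- On φ^n κ^i this is the commutator of e with φ^n: left and right translation by E supply its two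
Cartan terms. -/
lemma leftForm_comul_E (hp : 2 ≤ p) (β : Module.Dual ℂ (B p)) :
    leftForm hp β (comul (R := ℂ) (B.E p)) = rightForm hp β (comul (R := ℂ) (B.E p)) := by
  have : dualInc hp ∘ₗ (LinearMap.mulLeft ℂ (B.E p)).dualMap +
      LinearMap.mulLeft ℂ (E p) ∘ₗ dualInc hp ∘ₗ (LinearMap.mulLeft ℂ (B.K p ^ 2)).dualMap =
      LinearMap.mulRight ℂ (E p) ∘ₗ dualInc hp +
        LinearMap.mulRight ℂ (K p ^ 2) ∘ₗ dualInc hp ∘ₗ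
          (LinearMap.mulRight ℂ (B.E p)).dualMap := by
    refine dual_ext hp fun n i => ?_
    change dualInc hp (B.toDualLin hp (B.mon p n i) ∘ₗ LinearMap.mulLeft ℂ (B.E p)) +
        E p * dualInc hp (B.toDualLin hp (B.mon p n i) ∘ₗ LinearMap.mulLeft ℂ (B.K p ^ 2)) =
      dualInc hp (B.toDualLin hp (B.mon p n i)) * E p +
        dualInc hp (B.toDualLin hp (B.mon p n i) ∘ₗ LinearMap.mulRight ℂ (B.E p)) * K p ^ 2
    have hK : B.toDualLin hp (B.mon p n i) ∘ₗ LinearMap.mulLeft ℂ (B.K p ^ 2) =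
        qpow p (-i) • B.toDualLin hp (B.mon p n i) := by
      rw [pow_two, LinearMap.mulLeft_mul, ← LinearMap.comp_assoc, toDualLin_mulLeft_K,
        LinearMap.smul_comp, toDualLin_mulLeft_K, smul_smul, ← qpow_add]
      congr 2; ring
    have hC : C p ^ i * E p = qpow p (-i) • (E p * C p ^ i) := by
      rw [qcomm_pow_left (rel p).ce, qpow_pow]; congr 2; ring
    have hKC : C p ^ i * K p ^ 2 = K p ^ 2 * C p ^ i :=
      (show Commute (C p) (K p) from (rel p).kc.symm).pow_pow _ _
    rw [hK, map_smul, dualInc_mon]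
    cases n with
    | zero =>
      rw [toDualLin_mulLeft_E_zero, toDualLin_mulRight_E_zero, map_zero, zero_add, zero_mul,
        add_zero, pow_zero, one_mul, hC, mul_smul_comm]
    | succ n =>
      have hE := e_mul_f_pow p hp (rel p).ef (rel p).Kf ((rel p).borel'.Le (by norm_num)) n
      rw [toDualLin_mulLeft_E, toDualLin_mulRight_E, map_smul, map_smul, dualInc_mon, dualInc_mon,
        mul_smul_comm, ← mul_assoc, hE, mul_assoc (F p ^ (n + 1)), hC, smul_mul_assoc,
        mul_assoc _ (C p ^ i), hKC, add_comm i 2, pow_add]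
      simp only [add_mul, mul_sub, sub_mul, smul_add, smul_sub, mul_smul_comm, smul_mul_assoc,
        smul_smul, mul_assoc]
      have e1 : qpow p (-n - i) = qpow p (-n) * qpow p (-i) := by rw [← qpow_add]; congr 1
      have e2 : qpow p (n - i) = qpow p n * qpow p (-i) := by rw [← qpow_add]; congr 1
      rw [e1, e2]
      match_scalars <;> ring
  rw [B.comul_E, map_add, map_add, leftForm_tmul, rightForm_tmul, leftForm_tmul, rightForm_tmul,
    inc_E, map_pow, inc_K, map_one, one_mul, LinearMap.mulRight_one, LinearMap.comp_id]
  exact LinearMap.congr_fun this β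

lemma leftForm_comul (hp : 2 ≤ p) (x : B p) : ∀ β : Module.Dual ℂ (B p),
    leftForm hp β (comul (R := ℂ) x) = rightForm hp β (comul (R := ℂ) x) := by
  have hx : x ∈ Algebra.adjoin ℂ {B.E p, B.K p} := B.adjoin p ▸ Algebra.mem_top
  induction hx using Algebra.adjoin_induction with
  | mem x hx =>
    rcases hx with rfl | rfl
    exacts [leftForm_comul_E hp, leftForm_comul_K hp]
  | algebraMap r =>
    intro β
    rw [Algebra.algebraMap_eq_smul_one, map_smul, map_smul, map_smul, Bialgebra.comul_one,
      Algebra.TensorProduct.one_def, leftForm_tmul, rightForm_tmul, LinearMap.mulLeft_one,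
      LinearMap.mulRight_one, map_one, mul_one, one_mul]
  | add x y _ _ hx hy => intro β; rw [map_add, map_add, map_add, hx, hy]
  | mul x y _ _ hx hy => exact leftForm_comul_mul hp hx hy

/-- `a ⊗ (b ⊗ c) ↦ β(S⁻¹(c) ? a) b`. -/
def crossForm (hp : 2 ≤ p) (β : Module.Dual ℂ (B p)) :
    B p ⊗[ℂ] (B p ⊗[ℂ] B p) →ₗ[ℂ] Double p :=
  LinearMap.mul' ℂ _ ∘ₗ
    TensorProduct.map
      (dualInc hp ∘ₗ TensorProduct.lift (LinearMap.mk₂ ℂ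
        (fun a c => β ∘ₗ LinearMap.mulLeft ℂ (antipodeInv (B p) c) ∘ₗ LinearMap.mulRight ℂ a)
        (fun a a' c => by ext; simp [mul_add]) (fun r a c => by ext; simp)
        (fun a c c' => by ext; simp [add_mul]) (fun r a c => by ext; simp)))
      (inc p : B p →ₗ[ℂ] Double p) ∘ₗ
    (TensorProduct.comm ℂ (B p) (B p ⊗[ℂ] B p)).toLinearMap ∘ₗ
    (TensorProduct.leftComm ℂ (B p) (B p) (B p)).toLinearMap

lemma crossForm_tmul (hp : 2 ≤ p) (β : Module.Dual ℂ (B p)) (a b c : B p) :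
    crossForm hp β (a ⊗ₜ (b ⊗ₜ c)) = dualInc hp
      (β ∘ₗ LinearMap.mulLeft ℂ (antipodeInv (B p) c) ∘ₗ LinearMap.mulRight ℂ a) * inc p b := rfl

/-- `a ⊗ (b ⊗ c) ↦ a β(S⁻¹(c) b ?)`. -/
def crossForm' (hp : 2 ≤ p) (β : Module.Dual ℂ (B p)) :
    B p ⊗[ℂ] (B p ⊗[ℂ] B p) →ₗ[ℂ] Double p :=
  leftForm hp β ∘ₗ (LinearMap.lTensor (B p) (LinearMap.mul' ℂ (B p) ∘ₗ
    (antipodeInv (B p)).rTensor (B p) ∘ₗ (TensorProduct.comm ℂ (B p) (B p)).toLinearMap))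

lemma crossForm_assoc (hp : 2 ≤ p) (β : Module.Dual ℂ (B p)) (u : B p ⊗[ℂ] B p) (c : B p) :
    crossForm hp β (TensorProduct.assoc ℂ _ _ _ (u ⊗ₜ c)) =
      rightForm hp (β ∘ₗ LinearMap.mulLeft ℂ (antipodeInv (B p) c)) u := by
  induction u with
  | zero => simp
  | add u v hu hv => simp only [TensorProduct.add_tmul, map_add, hu, hv]
  | tmul a b => rw [TensorProduct.assoc_tmul, crossForm_tmul, rightForm_tmul, LinearMap.comp_assoc]

lemma crossForm'_assoc (hp : 2 ≤ p) (β : Module.Dual ℂ (B p)) (u : B p ⊗[ℂ] B p) (c : B p) :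
    crossForm' hp β (TensorProduct.assoc ℂ _ _ _ (u ⊗ₜ c)) =
      leftForm hp (β ∘ₗ LinearMap.mulLeft ℂ (antipodeInv (B p) c)) u := by
  induction u with
  | zero => simp
  | add u v hu hv => simp only [TensorProduct.add_tmul, map_add, hu, hv]
  | tmul a b =>
    rw [TensorProduct.assoc_tmul, leftForm_tmul, LinearMap.comp_assoc, ← LinearMap.mulLeft_mul]
    rfl

/-- By the inverse-free relation `leftForm_comul`, β(S⁻¹(x''') ? x') x'' becomes x' β(S⁻¹(x''') x''
?), and S⁻¹(x''') x'' contracts to the counit. -/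
lemma inc_mul_dualInc (hp : 2 ≤ p) (x : B p) (β : Module.Dual ℂ (B p)) :
    inc p x * dualInc hp β =
      crossForm hp β ((comul (R := ℂ) (A := B p)).lTensor (B p) (comul (R := ℂ) x)) := by
  have h1 : crossForm hp β ((comul (R := ℂ) (A := B p)).lTensor (B p) (comul (R := ℂ) x)) =
      crossForm' hp β ((comul (R := ℂ) (A := B p)).lTensor (B p) (comul (R := ℂ) x)) := by
    rw [← Coalgebra.coassoc_apply]
    induction comul (R := ℂ) x with
    | zero => simp
    | add u v hu hv => simp only [map_add, hu, hv]
    | tmul a c =>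
      rw [LinearMap.rTensor_tmul, crossForm_assoc, crossForm'_assoc, leftForm_comul]
  have h2 : ∀ u, crossForm' hp β ((comul (R := ℂ) (A := B p)).lTensor (B p) u) =
      leftForm hp β (LinearMap.lTensor (B p)
        (Algebra.linearMap ℂ (B p) ∘ₗ counit (R := ℂ) (A := B p)) u) := fun u => by
    induction u with
    | zero => simp
    | add u v hu hv => simp only [map_add, hu, hv]
    | tmul a c =>
      have := B.sum_antipodeInv_mul hp c
      simp only [crossForm', LinearMap.comp_apply, LinearMap.lTensor_tmul, LinearEquiv.coe_coe,
        this, Algebra.linearMap_apply]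
  rw [h1, h2, LinearMap.lTensor_comp, LinearMap.comp_apply, Coalgebra.lTensor_counit_comul,
    LinearMap.lTensor_tmul, Algebra.linearMap_apply, map_one, leftForm_tmul, LinearMap.mulLeft_one,
    LinearMap.comp_id]

/-- The range contains 1 and is a left ideal: the dual half multiplies into the first factor, and
`B` is moved past it by the cross relation. -/
lemma pbwMap_surjective (hp : 2 ≤ p) : Function.Surjective (pbwMap (p := p) hp) := by
  rw [← LinearMap.range_eq_top]
  have hinc : ∀ y : B p, ∀ s ∈ LinearMap.range (pbwMap (p := p) hp),
      inc p y * s ∈ LinearMap.range (pbwMap (p := p) hp) := by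
    rintro y _ ⟨t, rfl⟩
    induction t with
    | zero => simp
    | add u v hu hv => rw [map_add, mul_add]; exact Submodule.add_mem _ hu hv
    | tmul β x =>
      rw [pbwMap_tmul, ← mul_assoc, inc_mul_dualInc]
      induction (comul (R := ℂ) (A := B p)).lTensor (B p) (comul (R := ℂ) y) with
      | zero => simp
      | add u v hu hv => rw [map_add, add_mul]; exact Submodule.add_mem _ hu hv
      | tmul a w =>
        induction w with
        | zero => simp
        | add u v hu hv =>
          rw [TensorProduct.tmul_add, map_add, add_mul]; exact Submodule.add_mem _ hu hv
        | tmul b c =>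
          rw [crossForm_tmul, mul_assoc, ← map_mul]
          exact ⟨_ ⊗ₜ _, pbwMap_tmul hp _ _⟩
  have hdual : ∀ b : B p, ∀ s ∈ LinearMap.range (pbwMap (p := p) hp),
      dualHom p b * s ∈ LinearMap.range (pbwMap (p := p) hp) := by
    rintro b _ ⟨t, rfl⟩
    induction t with
    | zero => simp
    | add u v hu hv => rw [map_add, mul_add]; exact Submodule.add_mem _ hu hv
    | tmul β x =>
      obtain ⟨a, rfl⟩ := exists_toDualLin hp β
      rw [pbwMap_tmul, ← mul_assoc, dualInc_toDualLin, ← map_mul, ← dualInc_toDualLin hp]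
      exact ⟨_ ⊗ₜ _, pbwMap_tmul hp _ _⟩
  refine span_eq_top_of_mul_mem (adjoin p) _ ?_ ?_
  · refine ⟨counit (R := ℂ) (A := B p) ⊗ₜ 1, ?_⟩
    rw [pbwMap_tmul, dualInc_counit, map_one, mul_one]
  · rintro _ (rfl | rfl | rfl | rfl) s hs
    · rw [← inc_E]; exact hinc _ _ hs
    · rw [← dualHom_E]; exact hdual _ _ hs
    · rw [← inc_K]; exact hinc _ _ hs
    · rw [← dualHom_K]; exact hdual _ _ hs

lemma dualInc_kappa (hp : 2 ≤ p) : dualInc hp (B.kappa hp) = C p := by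
  rw [← B.toDual_K, ← B.toDualLin_apply, dualInc_toDualLin, dualHom_K]

lemma dualInc_phi (hp : 2 ≤ p) : dualInc hp (B.phi hp) = F p := by
  rw [← B.toDual_E, ← B.toDualLin_apply, dualInc_toDualLin, dualHom_E]

lemma isDrinfeldDouble (hp : 2 ≤ p) : IsDrinfeldDouble (inc p) (dualInc hp) where
  finite := inferInstance
  bijective := ⟨pbwMap_injective hp, pbwMap_surjective hp⟩
  map_one := dualInc_counit hp
  map_mul := dualInc_mul hp
  comul := comul_dualInc hp
  counit := counit_dualInc hp
  antipode := antipode_dualInc hp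
  cross x β s x₁ x₂ x₃ h := by
    rw [inc_mul_dualInc, h, map_sum]
    rfl

end Double

end QDouble

end

theorem mainTheorem7 (p : ℕ) [NeZero p] (hp : 2 ≤ p) :
    -- `DBar` is the quotient of the Drinfeld double of `B` by the ideal of `κ K - 1`
    (∃ (D : Type) (_ : Ring D) (_ : HopfAlgebra ℂ D)
      (i : B p →ₐc[ℂ] D) (j : Module.Dual ℂ (B p) →ₗ[ℂ] D)
      (κ φ : Module.Dual ℂ (B p)) (π : D →ₐc[ℂ] DBar p),
      IsDrinfeldDouble i j ∧
      (∀ m < p, ∀ n < 4 * p,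
        κ (B.E p ^ m * B.K p ^ n) = if m = 0 then qpow p (-(n : ℂ) / 2) else 0) ∧
      (∀ m < p, ∀ n < 4 * p, φ (B.E p ^ m * B.K p ^ n) =
        if m = 1 then qpow p (-(n : ℂ)) / (qpow p 1 - qpow p (-1)) else 0) ∧
      j κ * i (B.K p) ∈ Subalgebra.center ℂ D ∧
      Function.Surjective π ∧
      (∀ d : D, π d = 0 ↔ d ∈ TwoSidedIdeal.span {j κ * i (B.K p) - 1}) ∧
      π (i (B.E p)) = DBar.E p ∧ π (i (B.K p)) = DBar.K p ∧ π (j φ) = DBar.F p) ∧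
    -- the `R`-matrix and the ribbon element of `DBar`
    IsUniversalRMatrix (Rbar p) ∧
    IsRibbonElement (Rbar p) (ribbonElement p) ∧
    -- `U_q sl(2)` is a Hopf subalgebra of `DBar`, and the `M`-matrix lies in its tensor square
    (∃ ι : Uq p →ₐc[ℂ] DBar p, Function.Injective ι ∧
      ι (Uq.E p) = DBar.E p ∧ ι (Uq.F p) = DBar.F p ∧ ι (Uq.K p) = DBar.K p ^ 2 ∧
      TensorProduct.map (ι : Uq p →ₗ[ℂ] DBar p) (ι : Uq p →ₗ[ℂ] DBar p) (Mbar p) =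
        mMatrix (Rbar p)) ∧
    -- the two tensor factors of the `M`-matrix form bases of `U_q sl(2)`
    (∃ (I : Type) (_ : Fintype I) (m n : Module.Basis I ℂ (Uq p)),
      Mbar p = ∑ l : I, m l ⊗ₜ[ℂ] n l) := by
  refine ⟨⟨Double p, inferInstance, inferInstance, Double.inc p, Double.dualInc hp, B.kappa hp,
    B.phi hp, Double.toDBar p, Double.isDrinfeldDouble hp, fun m _ n _ => B.kappa_mon hp m n,
    fun m _ n _ => B.phi_mon hp m n, ?_, Double.toDBar_surjective p, fun d => ?_, ?_, ?_, ?_⟩,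
    DBar.isUniversalRMatrix hp, DBar.isRibbonElement hp,
    ⟨Uq.toDBar p, Uq.toDBar_injective p hp, Uq.toDBar_E p, Uq.toDBar_F p, Uq.toDBar_K p,
      DBar.map_Mbar⟩,
    ⟨_, inferInstance, Uq.pbw hp, Uq.mBasis hp, Uq.Mbar_eq_sum hp⟩⟩
  · rw [Double.dualInc_kappa, Double.inc_K]
    exact Double.CK_mem_center
  · rw [Double.dualInc_kappa, Double.inc_K]
    exact Double.toDBar_eq_zero_iff p d
  · rw [Double.inc_E, Double.toDBar_E]
  · rw [Double.inc_K, Double.toDBar_K]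
  · rw [Double.dualInc_phi, Double.toDBar_F]
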